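/- An undirected \emph{cactus} is a finite connected simple graph in which any two distinct simple cycles have at most one vertex in common. For vertices $u,v$ of an undirected graph $G$, the \emph{forwarding graph} $FG(u,v)$ is the directed graph formed by all edges of $G$ lying on shortest (fewest-edges) $u$--$v$ paths, oriented in the direction in which such paths traverse them; a unit of flow is sent from $u$ to $v$ along $FG(u,v)$ by dividing the flow entering each vertex evenly among its outgoing arcs. A \emph{segment path} $\langle s,w_1,\dots,w_\ell,t\rangle$ with waypoints $w_1,\dots,w_\ell\in V(G)$ sends one unit of flow successively along $FG(s,w_1),FG(w_1,w_2),\dots,FG(w_\ell,t)$; its load on an edge is the total flow that traverses the edge, in both directions and over all segments. \textsc{Unit Segment Routing}: given an undirected graph $G$ on $n$ vertices, a family of $d$ demands $(s_1,t_1),\dots,(s_d,t_d)\in V(G)^2$ and an integer $k\ge 0$, decide whether one can choose, for every $i$, a segment path from $s_i$ to $t_i$ with at most $k$ waypoints so that on every edge of $G$ the total load of the $d$ segment paths is at most $1$. \textbf{Theorem.} \textsc{Unit Segment Routing} on undirected cacti can be solved in $O(kdn)$ time. That is, there is a single program for a random access machine with words of $O(\log(n+d+k))$ bits and unit-cost word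 operations which, given $n$, $k$, a list of the edges of a cactus $G$ on $n$ vertices and a list of the $d$ demands, halts after at most $C\cdot\max(k,1)\cdot\max(d,1)\cdot n$ steps with the correct answer, where $C$ is an absolute constant. -/

import Mathlib

/-! ### Cacti -/

/-- A cactus: a connected graph in which any two distinct simple cycles (viewed as subgraphs)
have at most one vertex in common. -/
def IsCactus {V : Type*} (G : SimpleGraph V) : Prop :=
  G.Connected ∧
    ∀ (u v : V) (p : G.Walk u u) (q : G.Walk v v), p.IsCycle → q.IsCycle →
      p.toSubgraph ≠ q.toSubgraph →
        (p.toSubgraph.verts ∩ q.toSubgraph.verts).Subsingleton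

/-! ### Segment routing with unit weights, capacities and bandwidths -/

/-- `x → y` is an arc of the forwarding graph from `u` to `v`: the edge `xy` is traversed from `x`
to `y` by some shortest path from `u` to `v`. -/
def FwdArc {V : Type*} (G : SimpleGraph V) (u v x y : V) : Prop :=
  ∃ (h : G.Adj x y) (p : G.Walk u v),
    p.length = G.dist u v ∧ (⟨(x, y), h⟩ : G.Dart) ∈ p.darts

theorem exists_walks_of_mem_darts {V : Type*} {G : SimpleGraph V} {u v x y : V} (h : G.Adj x y)
    (p : G.Walk u v) (hp : (⟨(x, y), h⟩ : G.Dart) ∈ p.darts) :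
    ∃ (q : G.Walk u x) (r : G.Walk y v), p.length = q.length + 1 + r.length := by
  induction p with
  | nil => simp at hp
  | cons h' p' ih =>
    simp only [SimpleGraph.Walk.darts_cons, List.mem_cons] at hp
    rcases hp with hp | hp
    · simp only [SimpleGraph.Dart.mk.injEq, Prod.mk.injEq] at hp
      obtain ⟨rfl, rfl⟩ := hp
      exact ⟨.nil, p', by simp [add_comm]⟩
    · obtain ⟨q, r, hqr⟩ := ih hp
      exact ⟨.cons h' q, r, by simp only [SimpleGraph.Walk.length_cons]; omega⟩

/-- Forwarding graphs are acyclic: their arcs lead away from the source. -/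
theorem FwdArc.dist_lt {V : Type*} {G : SimpleGraph V} {u v x y : V} (h : FwdArc G u v x y) :
    G.dist u x < G.dist u y := by
  obtain ⟨hxy, p, hp, hd⟩ := h
  obtain ⟨q, r, hqr⟩ := exists_walks_of_mem_darts hxy p hd
  obtain ⟨s, hs⟩ := (q.reachable.trans hxy.reachable).exists_walk_length_eq_dist
  have h1 := SimpleGraph.dist_le (s.append r)
  have h2 := SimpleGraph.dist_le q
  rw [SimpleGraph.Walk.length_append] at h1
  omega

open Classical in
/-- The number of outgoing arcs of `x` in the forwarding graph from `u` to `v`. -/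
noncomputable def fwdOutDeg {V : Type*} [Fintype V] (G : SimpleGraph V) (u v x : V) : ℕ :=
  (Finset.univ.filter fun y => FwdArc G u v x y).card

open Classical in
/-- The amount of flow entering `x` when one unit of flow is sent from `u` to `v` along the
forwarding graph and every vertex divides its incoming flow evenly between its outgoing arcs. -/
noncomputable def inflow {V : Type*} [Fintype V] (G : SimpleGraph V) (u v x : V) : ℚ :=
  if x = u then 1
  else ∑ y : V, if _h : FwdArc G u v y x then inflow G u v y / (fwdOutDeg G u v y : ℚ) else 0
termination_by G.dist u x
decreasing_by exact _h.dist_lt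

open Classical in
/-- The flow on the arc `x → y` when one unit of flow is sent from `u` to `v`. -/
noncomputable def arcFlow {V : Type*} [Fintype V] (G : SimpleGraph V) (u v x y : V) : ℚ :=
  if FwdArc G u v x y then inflow G u v x / (fwdOutDeg G u v x : ℚ) else 0

/-- The load put on the undirected edge `xy` by one unit of flow sent along the segment path
`⟨s, w₁, …, w_ℓ, t⟩`; traversals in both directions count. -/
noncomputable def segmentLoad {V : Type*} [Fintype V] (G : SimpleGraph V) (x y : V) :
    V → List V → V → ℚ
  | s, [], t => arcFlow G s t x y + arcFlow G s t y x
  | s, w :: ws, t => arcFlow G s w x y + arcFlow G s w y x + segmentLoad G x y w ws t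

/-- The question of Unit Segment Routing: can one assign to every demand `(s, t)` of the family
`D` a sequence of at most `k` waypoints so that the total load of every edge is at most `1`? -/
def UnitSegmentRouting {V : Type*} [Fintype V] (G : SimpleGraph V) (D : List (V × V)) (k : ℕ) :
    Prop :=
  ∃ W : Fin D.length → List V,
    (∀ i, (W i).length ≤ k) ∧
      ∀ x y, G.Adj x y → ∑ i, segmentLoad G x y (D.get i).1 (W i) (D.get i).2 ≤ 1

/-! ### Random access machine with words of `w` bits

Programs are structured programs over finitely many registers and finitely many arrays of words,
with unit cost for every arithmetic operation, comparison, memory access and test. -/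

/-- Operations on words. -/
inductive WordOp
  | add | sub | mul | div | mod | lt | eq

/-- Results are reduced modulo `2 ^ w`; subtraction is truncated at `0`, and comparisons return
`0` or `1`. -/
def WordOp.eval (w : ℕ) : WordOp → ℕ → ℕ → ℕ
  | .add, a, b => (a + b) % 2 ^ w
  | .sub, a, b => (a - b) % 2 ^ w
  | .mul, a, b => (a * b) % 2 ^ w
  | .div, a, b => (a / b) % 2 ^ w
  | .mod, a, b => (a % b) % 2 ^ w
  | .lt, a, b => (if a < b then 1 else 0) % 2 ^ w
  | .eq, a, b => (if a = b then 1 else 0) % 2 ^ w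

/-- Expressions: constants, registers, the entry of array `a` at a computed index, operations. -/
inductive WordExpr
  | lit (c : ℕ)
  | reg (r : ℕ)
  | load (a : ℕ) (i : WordExpr)
  | op (o : WordOp) (e₁ e₂ : WordExpr)

/-- Memory contents: `reg r` is register `r`, and `arr a i` is the entry of array `a` at `i`. -/
structure RamState where
  reg : ℕ → ℕ
  arr : ℕ → ℕ → ℕ

def WordExpr.eval (w : ℕ) (σ : RamState) : WordExpr → ℕ
  | .lit c => c % 2 ^ w
  | .reg r => σ.reg r
  | .load a i => σ.arr a (i.eval w σ)
  | .op o e₁ e₂ => o.eval w (e₁.eval w σ) (e₂.eval w σ)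

/-- The number of steps needed to evaluate an expression. -/
def WordExpr.cost : WordExpr → ℕ
  | .lit _ => 1
  | .reg _ => 1
  | .load _ i => i.cost + 1
  | .op _ e₁ e₂ => e₁.cost + e₂.cost + 1

/-- Programs. A test succeeds if the value of its expression is not `0`. -/
inductive RamProg
  | skip
  | set (r : ℕ) (e : WordExpr)
  | store (a : ℕ) (i e : WordExpr)
  | seq (P Q : RamProg)
  | ite (e : WordExpr) (P Q : RamProg)
  | while (e : WordExpr) (P : RamProg)

/-- `RamProg.Exec w P σ t τ`: with words of `w` bits, the program `P` started in the state `σ`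
halts after exactly `t` steps in the state `τ`. -/
inductive RamProg.Exec (w : ℕ) : RamProg → RamState → ℕ → RamState → Prop
  | skip (σ : RamState) : Exec w .skip σ 1 σ
  | set (r : ℕ) (e : WordExpr) (σ : RamState) :
      Exec w (.set r e) σ (e.cost + 1)
        { σ with reg := Function.update σ.reg r (e.eval w σ) }
  | store (a : ℕ) (i e : WordExpr) (σ : RamState) :
      Exec w (.store a i e) σ (i.cost + e.cost + 1)
        { σ with
          arr := Function.update σ.arr a (Function.update (σ.arr a) (i.eval w σ) (e.eval w σ)) }
  | seq {P Q : RamProg} {σ τ υ : RamState} {t t' : ℕ} :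
      Exec w P σ t τ → Exec w Q τ t' υ → Exec w (.seq P Q) σ (t + t') υ
  | ite_true {e : WordExpr} {P Q : RamProg} {σ τ : RamState} {t : ℕ} :
      e.eval w σ ≠ 0 → Exec w P σ t τ → Exec w (.ite e P Q) σ (e.cost + 1 + t) τ
  | ite_false {e : WordExpr} {P Q : RamProg} {σ τ : RamState} {t : ℕ} :
      e.eval w σ = 0 → Exec w Q σ t τ → Exec w (.ite e P Q) σ (e.cost + 1 + t) τ
  | while_true {e : WordExpr} {P : RamProg} {σ τ υ : RamState} {t t' : ℕ} :
      e.eval w σ ≠ 0 → Exec w P σ t τ → Exec w (.while e P) τ t' υ →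
        Exec w (.while e P) σ (e.cost + 1 + t + t') υ
  | while_false {e : WordExpr} {P : RamProg} {σ : RamState} :
      e.eval w σ = 0 → Exec w (.while e P) σ (e.cost + 1) σ

/-! ### Input encoding -/

/-- The list `es` contains every edge of `G` exactly once, in any order and orientation, and
nothing else. -/
def IsEdgeList {V : Type*} (G : SimpleGraph V) (es : List (V × V)) : Prop :=
  (es.map fun e => s(e.1, e.2)).Nodup ∧
    ∀ x y, G.Adj x y ↔ s(x, y) ∈ es.map fun e => s(e.1, e.2)

/-- The initial memory: registers `0, 1, 2, 3` hold `n`, the number of edges, the number of demands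
and the budget `k`; arrays `0, 1` hold the two ends of the edges, and arrays `2, 3` the sources and
the targets of the demands. Everything else is `0`. -/
def inputState (n : ℕ) (es D : List (Fin n × Fin n)) (k : ℕ) : RamState where
  reg r := [n, es.length, D.length, k].getD r 0
  arr a i :=
    ([es.map fun e => (e.1 : ℕ), es.map fun e => (e.2 : ℕ),
      D.map fun p => (p.1 : ℕ), D.map fun p => (p.2 : ℕ)].getD a []).getD i 0

set_option linter.unusedSectionVars false

namespace CactusRouting

open scoped Classical
noncomputable section

open Finset SimpleGraph

/-! ### Flows along forwarding graphs -/

section Flow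

variable {V : Type*} {G : SimpleGraph V}

/-! Geometry. In a cactus the flow of a segment on a cycle of length `L` depends only on the
projections of its two ends to the cycle: it follows the strictly shorter side with value `1`, or
puts `1/2` on every edge if the projections are antipodal (`edgeFlow_of_short`, `edgeFlow_of_half`).
Hence a segment path whose load on a cycle is at most `1` either has load `1` on one side and `0`
elsewhere, or is split evenly (`pathLoad_cases`). A segment that is not split covers at most `(L -
1) / 2` edges, so following a side of `u` edges between two different projections takes `detourCost
L u`, that is `0`, `1` or `2`, waypoints projecting strictly inside the cycle
(`detourCost_le_innerCount`). A waypoint is inside at most one of the cycles separating the ends of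
a demand (`inner_unique`), so these costs add up; conversely detours in different cycles can be
inserted without disturbing each other (`exists_routing`). This gives `routing_iff`: each bridge
serves at most one demand, and in each cycle the demands choose pairwise disjoint sides, except
where the direct flows already fit; each demand can afford the sum of its costs. All of this is
phrased modulo two. A cycle is a set of edges on which every coboundary sums to zero, any two of
whose edges form a cut; the labellings witnessing these cuts replace arguments about cyclic order.

Combinatorics. With respect to a rooted spanning tree, a cycle is a non-tree edge together with the
tree edges it covers, and a demand chooses between the tree side and its complement. Complementary
sides share the non-tree edge, so at most one demand per cycle may take one. If the cycle needs a
choice and no tree edge of it is crossed twice, nobody takes the complement. If some edge is crossed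
twice, exactly one demand does, and it must cross every crossed edge. When this demand is unique all
costs are forced; when two candidates exist they are the only demands on the cycle, and exactly one
of them pays a fixed amount (`exists_valid_iff`). Thus solvability means that forced costs plus
shared costs, each charged to one of two demands, stay within `k` (`solvable_iff`).

Dynamic program. The shared costs form a graph on the demands, but a shared cost sits at a tree edge
crossed by just two demands. Nodes are processed from the largest number to the root. Each end of a
demand is a slot; linked slots are mates, and `need γ x` is the least budget of the mate of `γ` when
`γ` has budget `x`. Before the edge above a node is handled, every demand with both ends below it is
eliminated; it has at most two mates, so elimination either checks a loop, charges a neighbour, or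
composes two need functions (`elim_loop`, `elim_leaf`, `elim_merge`). Then the two crossing demands
are linked to nobody or to each other (`link_cases`), and the shared cost is added to their common
need functions (`link_shift`). At the root all demands are gone and satisfiability is trivial.

Running time. Breadth-first search, subtree sums and the marking of ancestors cost `O(n * d)` up to
lower terms, since a cactus has at most `2 * n` edges. The loop over nodes and demands spends `O(k +
1)` operations on a row of `need` per step, whence `O(k * d * n)` altogether. The programs are
verified with a weakest precondition calculus for loop-free pieces and a rule for bounded loops. -/

theorem exists_append_of_mem_darts {u v x y : V} (h : G.Adj x y)
    (p : G.Walk u v) (hp : (⟨(x, y), h⟩ : G.Dart) ∈ p.darts) :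
    ∃ (q : G.Walk u x) (r : G.Walk y v), p = q.append (.cons h r) := by
  induction p with
  | nil => simp at hp
  | cons h' p' ih =>
    simp only [SimpleGraph.Walk.darts_cons, List.mem_cons] at hp
    rcases hp with hp | hp
    · simp only [SimpleGraph.Dart.mk.injEq, Prod.mk.injEq] at hp
      obtain ⟨rfl, rfl⟩ := hp
      exact ⟨.nil, p', rfl⟩
    · obtain ⟨q, r, rfl⟩ := ih hp
      exact ⟨.cons h' q, r, rfl⟩

theorem _root_.FwdArc.adj {u v x y : V} (h : FwdArc G u v x y) : G.Adj x y := h.1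

theorem _root_.FwdArc.not_symm {u v x y : V} (h : FwdArc G u v x y) : ¬ FwdArc G u v y x :=
  fun h' => absurd h.dist_lt (not_lt.2 h'.dist_lt.le)

theorem _root_.FwdArc.exists_next {u v x y : V} (h : FwdArc G u v y x) (hx : x ≠ v) :
    ∃ z, FwdArc G u v x z := by
  obtain ⟨hyx, p, hp, hd⟩ := h
  obtain ⟨q, r, rfl⟩ := exists_append_of_mem_darts hyx p hd
  cases r with
  | nil => exact absurd rfl hx
  | cons h' r' => exact ⟨_, h', _, hp, by simp⟩

theorem exists_fwdArc_source (hG : G.Connected) {u v : V} (huv : u ≠ v) :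
    ∃ z, FwdArc G u v u z := by
  obtain ⟨p, hp⟩ := hG.exists_walk_length_eq_dist u v
  cases p with
  | nil => exact absurd rfl huv
  | cons h' r' => exact ⟨_, h', _, hp, by simp⟩

variable [Fintype V]

theorem inflow_nonneg (G : SimpleGraph V) (u v x : V) : 0 ≤ inflow G u v x := by
  induction hn : G.dist u x using Nat.strong_induction_on generalizing x with
  | _ n ih =>
    rw [inflow]
    split_ifs
    · exact zero_le_one
    · refine sum_nonneg fun y _ => ?_
      split_ifs with h
      · exact div_nonneg (ih _ (hn ▸ h.dist_lt) y rfl) (Nat.cast_nonneg _)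
      · exact le_rfl

theorem arcFlow_nonneg (G : SimpleGraph V) (u v x y : V) : 0 ≤ arcFlow G u v x y := by
  rw [arcFlow]
  split_ifs
  · exact div_nonneg (inflow_nonneg ..) (Nat.cast_nonneg _)
  · exact le_rfl

theorem arcFlow_eq_zero {u v x y : V} (h : ¬ FwdArc G u v x y) : arcFlow G u v x y = 0 := by
  rw [arcFlow, if_neg h]

theorem inflow_eq_sum {u v x : V} (h : x ≠ u) :
    inflow G u v x = ∑ y, arcFlow G u v y x := by
  rw [inflow, if_neg h]
  refine sum_congr rfl fun y _ => ?_
  rw [arcFlow]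
  split_ifs <;> rfl

theorem sum_arcFlow_source (u v : V) : ∑ y, arcFlow G u v y u = 0 :=
  sum_eq_zero fun y _ => arcFlow_eq_zero fun h => by
    have := h.dist_lt
    simp at this

theorem sum_arcFlow_out {u v x : V} (h : ∃ z, FwdArc G u v x z) :
    ∑ y, arcFlow G u v x y = inflow G u v x := by
  have : fwdOutDeg G u v x ≠ 0 := by
    obtain ⟨z, hz⟩ := h
    rw [fwdOutDeg]
    exact card_ne_zero_of_mem (mem_filter.2 ⟨mem_univ z, hz⟩)
  simp only [arcFlow]
  rw [← sum_filter, sum_const, nsmul_eq_mul]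
  have h2 : ((fwdOutDeg G u v x : ℕ) : ℚ) ≠ 0 := by exact_mod_cast this
  have h3 : (univ.filter fun y => FwdArc G u v x y).card = fwdOutDeg G u v x := by
    rw [fwdOutDeg]
  rw [h3]
  field_simp

theorem flow_conservation (hG : G.Connected) {u v : V} (huv : u ≠ v) {x : V} (hx : x ≠ v) :
    ∑ y, arcFlow G u v x y - ∑ y, arcFlow G u v y x = if x = u then 1 else 0 := by
  split_ifs with hxu
  · subst hxu
    rw [sum_arcFlow_source, sum_arcFlow_out (exists_fwdArc_source hG huv), inflow]
    simp
  · by_cases hz : ∃ z, FwdArc G u v x z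
    · rw [sum_arcFlow_out hz, inflow_eq_sum hxu, sub_self]
    · have h1 : ∀ y, arcFlow G u v x y = 0 := fun y => arcFlow_eq_zero fun h => hz ⟨y, h⟩
      have h2 : ∀ y, arcFlow G u v y x = 0 := fun y => arcFlow_eq_zero fun h =>
        hz (h.exists_next hx)
      simp [h1, h2]

/-- Summing the conservation law over `S` gives `1`, from the source alone; the arcs inside `S`
cancel and the net flow over the boundary remains. -/
theorem cut_flow (hG : G.Connected) {u v : V} (S : V → Prop) (hu : S u) (hv : ¬ S v) :
    ∑ x, ∑ y, (if S x ∧ ¬ S y then arcFlow G u v x y - arcFlow G u v y x else 0) = 1 := by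
  have huv : u ≠ v := fun h => hv (h ▸ hu)
  have h1 : ∑ x, (if S x then (∑ y, arcFlow G u v x y - ∑ y, arcFlow G u v y x) else 0) = 1 := by
    rw [sum_eq_single u]
    · rw [if_pos hu, flow_conservation hG huv huv, if_pos rfl]
    · intro x _ hx
      split_ifs with hS
      · rw [flow_conservation hG huv (fun h => hv (h ▸ hS)), if_neg hx]
      · rfl
    · simp
  -- The inner arcs contribute a sum that is antisymmetric under exchanging `x` and `y`, hence equal
  -- to its own negative.
  have h2 : ∑ x, ∑ y, (if S x ∧ S y then arcFlow G u v x y - arcFlow G u v y x else 0) = 0 := by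
    have : ∑ x, ∑ y, (if S x ∧ S y then arcFlow G u v x y - arcFlow G u v y x else 0)
        = - ∑ x, ∑ y, (if S x ∧ S y then arcFlow G u v x y - arcFlow G u v y x else 0) := by
      conv_lhs => rw [sum_comm]
      rw [← sum_neg_distrib]
      refine sum_congr rfl fun x _ => ?_
      rw [← sum_neg_distrib]
      refine sum_congr rfl fun y _ => ?_
      by_cases hx : S x <;> by_cases hy : S y <;> simp [hx, hy]
    linarith
  rw [← h1]
  refine Eq.trans ?_ ((congrArg₂ (· - ·) rfl h2).trans (sub_zero _))
  rw [← sum_sub_distrib]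
  refine sum_congr rfl fun x _ => ?_
  by_cases hx : S x
  · simp only [hx, if_true, true_and]
    rw [← sum_sub_distrib, ← sum_sub_distrib]
    refine sum_congr rfl fun y _ => ?_
    by_cases hy : S y <;> simp [hy]
  · simp [hx]

/-- The load of an edge under one unit of flow sent from `u` to `v`. -/
def edgeFlow (G : SimpleGraph V) (u v : V) : Sym2 V → ℚ :=
  Sym2.lift ⟨fun x y => arcFlow G u v x y + arcFlow G u v y x, fun _ _ => add_comm _ _⟩

/-- The load of an edge under a segment path. -/
def pathLoad (G : SimpleGraph V) (e : Sym2 V) : V → List V → V → ℚ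
  | s, [], t => edgeFlow G s t e
  | s, w :: ws, t => edgeFlow G s w e + pathLoad G e w ws t

theorem segmentLoad_eq (G : SimpleGraph V) (x y s : V) (W : List V) (t : V) :
    segmentLoad G x y s W t = pathLoad G s(x, y) s W t := by
  induction W generalizing s with
  | nil => rfl
  | cons w ws ih => simp [segmentLoad, pathLoad, ih, edgeFlow]

theorem edgeFlow_nonneg (G : SimpleGraph V) (u v : V) (e : Sym2 V) : 0 ≤ edgeFlow G u v e := by
  induction e with
  | _ x y => exact add_nonneg (arcFlow_nonneg ..) (arcFlow_nonneg ..)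

theorem pathLoad_nonneg (G : SimpleGraph V) (e : Sym2 V) (s : V) (W : List V) (t : V) :
    0 ≤ pathLoad G e s W t := by
  induction W generalizing s with
  | nil => exact edgeFlow_nonneg ..
  | cons w ws ih => exact add_nonneg (edgeFlow_nonneg ..) (ih _)

theorem pathLoad_append (G : SimpleGraph V) (e : Sym2 V) (s : V) (A : List V) (x : V)
    (B : List V) (t : V) :
    pathLoad G e s (A ++ x :: B) t = pathLoad G e s A x + pathLoad G e x B t := by
  induction A generalizing s with
  | nil => rfl
  | cons w ws ih => simp [pathLoad, ih, add_assoc]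

/-- An edge on no shortest path carries no flow. -/
theorem edgeFlow_eq_zero {u v : V} {e : Sym2 V}
    (h : ∀ p : G.Walk u v, p.length = G.dist u v → e ∉ p.edges) : edgeFlow G u v e = 0 := by
  induction e with
  | _ x y =>
    have key : ∀ a b : V, s(a, b) = s(x, y) → ¬ FwdArc G u v a b := by
      rintro a b hab ⟨hadj, p, hp, hd⟩
      refine h p hp ?_
      rw [← hab]
      exact List.mem_map_of_mem (f := SimpleGraph.Dart.edge) hd
    change arcFlow G u v x y + arcFlow G u v y x = 0
    rw [arcFlow_eq_zero (key x y rfl), arcFlow_eq_zero (key y x Sym2.eq_swap), add_zero]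

/-- If every shortest path crosses a cut only once, then the edges of the cut carry one unit of
flow in total. -/
theorem sum_edgeFlow_cut [DecidableEq V] (hG : G.Connected) {u v : V} (S : V → Prop) (hu : S u) (hv : ¬ S v)
    (E : Finset (Sym2 V)) (hE : ∀ x y, G.Adj x y → S x → ¬ S y → s(x, y) ∈ E)
    (hE' : ∀ e ∈ E, ∃ x y, S x ∧ ¬ S y ∧ e = s(x, y))
    (h1 : ∀ p : G.Walk u v, p.length = G.dist u v →
      ∀ e₁ e₂, e₁ ∈ p.edges → e₁ ∈ E → e₂ ∈ p.edges → e₂ ∈ E → e₁ = e₂) :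
    ∑ e ∈ E, edgeFlow G u v e = 1 := by
  -- No flow returns into `S`: before such an arc the shortest path has already left `S` through an
  -- edge of `E`, which by `h1` would be the same edge, repeated on a trail.
  have hin : ∀ x y, S x → ¬ S y → ¬ FwdArc G u v y x := by
    rintro x y hx hy ⟨hadj, p, hp, hd⟩
    obtain ⟨q, r, rfl⟩ := exists_append_of_mem_darts hadj p hd
    obtain ⟨d, hd, hd1, hd2⟩ := q.exists_boundary_dart {z | S z} hu hy
    have hnd := (SimpleGraph.Walk.isPath_of_length_eq_dist _ hp).isTrail.edges_nodup
    rw [SimpleGraph.Walk.edges_append, SimpleGraph.Walk.edges_cons] at hnd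
    have hdq : d.edge ∈ q.edges := List.mem_map_of_mem hd
    have he1 : d.edge ∈ E := hE _ _ d.adj hd1 hd2
    have he2 : s(y, x) ∈ E := by rw [Sym2.eq_swap]; exact hE _ _ hadj.symm hx hy
    have := h1 _ hp d.edge s(y, x) (by simp [hdq]) he1 (by simp) he2
    exact (List.nodup_append.1 hnd).2.2 _ hdq s(y, x) (by simp) this
  have h3 := cut_flow hG S hu hv
  rw [← h3]
  have h4 : ∀ e ∈ E, edgeFlow G u v e =
      ∑ x, ∑ y, if S x ∧ ¬ S y ∧ e = s(x, y) then edgeFlow G u v e else 0 := by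
    intro e he
    obtain ⟨a, b, ha, hb, rfl⟩ := hE' e he
    rw [sum_eq_single a, sum_eq_single b]
    · simp [ha, hb]
    · grind
    · simp
    · intro x _ hx
      refine sum_eq_zero fun y _ => if_neg ?_
      grind
    · simp
  rw [sum_congr rfl h4, sum_comm]
  refine sum_congr rfl fun x _ => ?_
  rw [sum_comm]
  refine sum_congr rfl fun y _ => ?_
  by_cases hxy : S x ∧ ¬ S y
  · rw [if_pos hxy]
    simp only [hxy, not_false_eq_true, true_and]
    rw [sum_ite_eq' E s(x, y)]
    have h6 : edgeFlow G u v s(x, y) = arcFlow G u v x y + arcFlow G u v y x := rfl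
    have h7 := arcFlow_eq_zero (hin x y hxy.1 hxy.2)
    split_ifs with hm
    · rw [h6, h7]; ring
    · have h8 : ¬ FwdArc G u v x y := fun h => hm (hE _ _ h.adj hxy.1 hxy.2)
      rw [h7, arcFlow_eq_zero h8]; ring
  · rw [if_neg hxy]
    refine sum_eq_zero fun e _ => if_neg fun h => hxy ⟨h.1, h.2.1⟩

end Flow

end

end CactusRouting
namespace CactusRouting

open Finset SimpleGraph

/-! ### Cycles described by cuts -/

section Cuts

variable {V : Type*} {G : SimpleGraph V}

/-- The coboundary of a vertex labelling modulo two. -/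
def coboundary (g : V → ZMod 2) : Sym2 V → ZMod 2 :=
  Sym2.lift ⟨fun x y => g x + g y, fun _ _ => add_comm _ _⟩

/-- The truth value of a proposition modulo two. -/
def bit (p : Prop) [Decidable p] : ZMod 2 := if p then 1 else 0

@[simp] theorem coboundary_mk (g : V → ZMod 2) (x y : V) : coboundary g s(x, y) = g x + g y := rfl

theorem zmod_two_cases (a : ZMod 2) : a = 0 ∨ a = 1 := by revert a; decide

theorem zmod_two_add_eq_zero {a b : ZMod 2} : a + b = 0 ↔ a = b := by revert a b; decide

theorem zmod_two_add_self (a : ZMod 2) : a + a = 0 := by revert a; decide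

theorem bit_inj {p q : Prop} [Decidable p] [Decidable q] : bit p = bit q ↔ (p ↔ q) := by
  unfold bit; split_ifs <;> simp [*]

theorem bit_eq_one {p : Prop} [Decidable p] : bit p = 1 ↔ p := by
  unfold bit; split_ifs <;> simp [*]

theorem bit_eq_zero {p : Prop} [Decidable p] : bit p = 0 ↔ ¬ p := by
  unfold bit; split_ifs <;> simp [*]

/-- The sum telescopes, since inner vertices occur twice and cancel modulo two. -/
theorem sum_coboundary_edges (g : V → ZMod 2) {s t : V} (p : G.Walk s t) :
    (p.edges.map (coboundary g)).sum = g s + g t := by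
  induction p with
  | nil => simp [zmod_two_add_self]
  | cons h q ih =>
    rename_i u v w
    simp only [SimpleGraph.Walk.edges_cons, List.map_cons, List.sum_cons, ih, coboundary_mk]
    have : ∀ a b c : ZMod 2, a + b + (b + c) = a + c := by decide
    exact this _ _ _

theorem eq_of_coboundary_eq_zero {g : V → ZMod 2} {s t : V} (p : G.Walk s t)
    (h : ∀ e ∈ p.edges, coboundary g e = 0) : g s = g t := by
  rw [← zmod_two_add_eq_zero, ← sum_coboundary_edges g p]
  refine List.sum_eq_zero fun x hx => ?_
  obtain ⟨e, he, rfl⟩ := List.mem_map.1 hx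
  exact h e he

theorem const_of_coboundary_eq_zero (hG : G.Connected) {g : V → ZMod 2}
    (h : ∀ e ∈ G.edgeSet, coboundary g e = 0) (s t : V) : g s = g t := by
  obtain ⟨p⟩ := hG.preconnected s t
  exact eq_of_coboundary_eq_zero p fun e he => h e (p.edges_subset_edgeSet he)

variable [DecidableEq V]

theorem sum_coboundary_trail (g : V → ZMod 2) {s t : V} {p : G.Walk s t} (hp : p.IsTrail) :
    ∑ e ∈ p.edges.toFinset, coboundary g e = g s + g t := by
  rw [List.sum_toFinset _ hp.edges_nodup, sum_coboundary_edges]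

/-- A cycle of `G` which is a union of pairwise two-edge cuts: `cut e` is a labelling whose
coboundary consists of `e` and the distinguished edge `base`. -/
structure CycleBlock (G : SimpleGraph V) where
  edges : Finset (Sym2 V)
  base : Sym2 V
  cut : Sym2 V → V → ZMod 2
  base_mem : base ∈ edges
  mem_edgeSet : ∀ e ∈ edges, e ∈ G.edgeSet
  cut_spec : ∀ e ∈ edges, ∀ e' ∈ G.edgeSet,
    coboundary (cut e) e' = bit (e' = e) + bit (e' = base)
  even : ∀ g : V → ZMod 2, ∑ e ∈ edges, coboundary g e = 0
  three_le : 3 ≤ edges.card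

namespace CycleBlock

variable (B : CycleBlock G)

/-- The set `U` is one of the two sides of the cycle between (the projections of) `s` and `t`. -/
def Links (U : Finset (Sym2 V)) (s t : V) : Prop :=
  U ⊆ B.edges ∧ ∀ e ∈ B.edges, bit (e ∈ U) + bit (B.base ∈ U) = B.cut e s + B.cut e t

/-- The vertices `s` and `t` have the same projection to the cycle. -/
def Equiv (s t : V) : Prop := ∀ e ∈ B.edges, B.cut e s = B.cut e t

variable {B}

theorem Equiv.refl (s : V) : B.Equiv s s := fun _ _ => rfl
theorem Equiv.symm {s t : V} (h : B.Equiv s t) : B.Equiv t s := fun e he => (h e he).symm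
theorem Equiv.trans {s t u : V} (h : B.Equiv s t) (h' : B.Equiv t u) : B.Equiv s u :=
  fun e he => (h e he).trans (h' e he)

theorem bit_sdiff {U : Finset (Sym2 V)} {e : Sym2 V} (he : e ∈ B.edges) :
    bit (e ∈ B.edges \ U) = 1 + bit (e ∈ U) := by
  unfold bit
  by_cases h : e ∈ U <;> simp [h, he]
  decide

theorem Links.compl {U : Finset (Sym2 V)} {s t : V} (h : B.Links U s t) :
    B.Links (B.edges \ U) s t := by
  refine ⟨sdiff_subset, fun e he => ?_⟩
  rw [← h.2 e he, bit_sdiff he, bit_sdiff B.base_mem]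
  have : ∀ a b : ZMod 2, 1 + a + (1 + b) = a + b := by decide
  exact this _ _

/-- The defining equations fix the membership of each edge relative to that of the base edge, so
only the bit of the base edge is free, and flipping it complements the side. -/
theorem Links.eq_or_eq_compl {U U' : Finset (Sym2 V)} {s t : V} (h : B.Links U s t)
    (h' : B.Links U' s t) : U' = U ∨ U' = B.edges \ U := by
  have key : ∀ e ∈ B.edges, bit (e ∈ U) + bit (B.base ∈ U) = bit (e ∈ U') + bit (B.base ∈ U') :=
    fun e he => (h.2 e he).trans (h'.2 e he).symm
  by_cases hb : (B.base ∈ U ↔ B.base ∈ U')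
  · left
    ext e
    by_cases he : e ∈ B.edges
    · have := key e he
      rw [bit_inj.2 hb] at this
      exact (bit_inj.1 (add_right_cancel this)).symm
    · exact ⟨fun h2 => absurd (h'.1 h2) he, fun h2 => absurd (h.1 h2) he⟩
  · right
    ext e
    by_cases he : e ∈ B.edges
    · have := key e he
      unfold bit at this
      simp only [mem_sdiff, he, true_and]
      by_cases h1 : B.base ∈ U <;> by_cases h2 : B.base ∈ U' <;> by_cases h3 : e ∈ U <;>
        by_cases h4 : e ∈ U' <;> simp_all
    · exact ⟨fun h2 => absurd (h'.1 h2) he, fun h2 => absurd (mem_sdiff.1 h2).1 he⟩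

theorem Links.cut_pair {U : Finset (Sym2 V)} {s t : V} (h : B.Links U s t) {e e' : Sym2 V}
    (he : e ∈ B.edges) (he' : e' ∈ B.edges) :
    B.cut e s + B.cut e' s + (B.cut e t + B.cut e' t) = bit (e ∈ U) + bit (e' ∈ U) := by
  have h1 := h.2 e he
  have h2 := h.2 e' he'
  have : ∀ a b c x y z w : ZMod 2, a + c = x + z → b + c = y + w →
    x + y + (z + w) = a + b := by decide
  exact this _ _ _ _ _ _ _ h1 h2

theorem coboundary_cut_pair {e e' e₁ : Sym2 V} (he : e ∈ B.edges) (he' : e' ∈ B.edges)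
    (h₁ : e₁ ∈ G.edgeSet) :
    coboundary (fun x => B.cut e x + B.cut e' x) e₁ = bit (e₁ = e) + bit (e₁ = e') := by
  have h1 := B.cut_spec e he e₁ h₁
  have h2 := B.cut_spec e' he' e₁ h₁
  induction e₁ with
  | _ x y =>
    rw [coboundary_mk] at *
    have : ∀ a b c x y z w : ZMod 2, x + z = a + c → y + w = b + c →
      x + y + (z + w) = a + b := by decide
    exact this _ _ _ _ _ _ _ h1 h2

-- The edges whose labels separate `s` from `t` form a side. The label of the base edge itself has
-- coboundary zero, so it is constant on the connected graph and the base edge is left out.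
variable (B) in
theorem exists_links (hG : G.Connected) (s t : V) : ∃ U, B.Links U s t ∧ B.base ∉ U := by
  have hb : B.cut B.base s = B.cut B.base t := by
    refine const_of_coboundary_eq_zero hG (fun e he => ?_) s t
    rw [B.cut_spec _ B.base_mem e he, zmod_two_add_self]
  have hb' : B.base ∉ B.edges.filter fun e => B.cut e s ≠ B.cut e t := by simp [hb]
  refine ⟨B.edges.filter fun e => B.cut e s ≠ B.cut e t, ⟨filter_subset _ _,
    fun e he => ?_⟩, hb'⟩
  rw [bit_eq_zero.2 hb', add_zero]
  unfold bit
  simp only [mem_filter, he, true_and]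
  have : ∀ a b : ZMod 2, (if a ≠ b then (1 : ZMod 2) else 0) = a + b := by decide
  exact this _ _

theorem links_empty_iff {s t : V} : B.Links ∅ s t ↔ B.Equiv s t := by
  refine ⟨fun h e he => ?_, fun h => ⟨by simp, fun e he => ?_⟩⟩
  · have := h.2 e he
    simp only [bit, notMem_empty, if_false, add_zero] at this
    exact zmod_two_add_eq_zero.1 this.symm
  · rw [zmod_two_add_eq_zero.2 (h e he)]
    simp [bit]

theorem Links.equiv_iff {U : Finset (Sym2 V)} {s t : V} (h : B.Links U s t) :
    B.Equiv s t ↔ U = ∅ ∨ U = B.edges := by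
  constructor
  · intro h'
    have := (links_empty_iff.2 h').eq_or_eq_compl h
    simpa using this
  · rintro (rfl | rfl)
    · exact links_empty_iff.1 h
    · have := h.compl
      rw [sdiff_self] at this
      exact links_empty_iff.1 this

theorem Links.congr {U : Finset (Sym2 V)} {s t s' t' : V} (h : B.Links U s t) (hs : B.Equiv s s')
    (ht : B.Equiv t t') : B.Links U s' t' :=
  ⟨h.1, fun e he => by rw [h.2 e he, hs e he, ht e he]⟩

theorem Links.union {U U' : Finset (Sym2 V)} {s w t : V} (h : B.Links U s w)
    (h' : B.Links U' w t) (hd : Disjoint U U') : B.Links (U ∪ U') s t := by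
  refine ⟨union_subset h.1 h'.1, fun e he => ?_⟩
  have key : ∀ e, bit (e ∈ U ∪ U') = bit (e ∈ U) + bit (e ∈ U') := by
    intro e
    unfold bit
    by_cases h1 : e ∈ U
    · have h2 : e ∉ U' := disjoint_left.1 hd h1
      simp [h1, h2]
    · simp [h1]
  rw [key, key]
  have h1 := h.2 e he
  have h2 := h'.2 e he
  have : ∀ a b c d x y z : ZMod 2, a + c = x + y → b + d = y + z →
      a + b + (c + d) = x + z := by decide
  exact this _ _ _ _ _ _ _ h1 h2

/-- Along the trail the changes of `cut e` count only `e` and the base edge, each at most once. -/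
theorem links_trail {s t : V} {p : G.Walk s t} (hp : p.IsTrail) :
    B.Links (B.edges.filter (· ∈ p.edges)) s t := by
  refine ⟨filter_subset _ _, fun e he => ?_⟩
  rw [← sum_coboundary_trail (B.cut e) hp]
  have h1 : ∀ e₁ ∈ p.edges.toFinset, coboundary (B.cut e) e₁ = bit (e₁ = e) + bit (e₁ = B.base) :=
    fun e₁ h₁ => B.cut_spec e he e₁ (p.edges_subset_edgeSet (List.mem_toFinset.1 h₁))
  rw [sum_congr rfl h1, sum_add_distrib]
  simp only [bit, sum_ite_eq', List.mem_toFinset, mem_filter, he, B.base_mem,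
    true_and]

/-- Exchanging one side of the cycle for the other. -/
theorem exists_exchange {s t : V} {p : G.Walk s t} (hp : p.IsTrail) :
    ∃ q : G.Walk s t, q.IsPath ∧ ∀ e ∈ q.edges, (e ∈ p.edges ↔ e ∉ B.edges) := by
  classical
  let E : Set (Sym2 V) := {e | e ∈ G.edgeSet ∧ (e ∈ p.edges ↔ e ∉ B.edges)}
  let H := fromEdgeSet E
  have hH : H ≤ G := by
    intro x y hxy
    exact ((fromEdgeSet_adj E).1 hxy).1.1
  -- `H` consists of the edges lying in exactly one of the trail and the cycle. If it did not join
  -- `s` to `t`, the indicator of the component of `s` would have zero coboundary on this symmetric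
  -- difference, so its sums over the trail and over the cycle would agree; but the first is `1` and
  -- the second `0`.
  have hr : H.Reachable s t := by
    by_contra hst
    let g : V → ZMod 2 := fun x => bit (H.Reachable s x)
    have hg : ∀ e ∈ G.edgeSet, (e ∈ p.edges ↔ e ∉ B.edges) → coboundary g e = 0 := by
      intro e he hpe
      induction e with
      | _ x y =>
        have hadj : H.Adj x y := by
          rw [fromEdgeSet_adj]
          exact ⟨⟨he, hpe⟩, G.ne_of_adj he⟩
        rw [coboundary_mk, zmod_two_add_eq_zero]
        exact bit_inj.2 ⟨fun h => h.trans hadj.reachable, fun h => h.trans hadj.symm.reachable⟩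
    have h1 := sum_coboundary_trail g hp
    have h2 := B.even g
    have h3 : ∑ e ∈ p.edges.toFinset, coboundary g e = ∑ e ∈ B.edges, coboundary g e := by
      rw [← sum_sdiff (inter_subset_left : p.edges.toFinset ∩ B.edges ⊆ _),
        ← sum_sdiff (inter_subset_right : p.edges.toFinset ∩ B.edges ⊆ _)]
      congr 1
      rw [sum_eq_zero, sum_eq_zero]
      · intro e he
        simp only [mem_sdiff, mem_inter, List.mem_toFinset] at he
        exact hg e (B.mem_edgeSet e he.1) (by tauto)
      · intro e he
        simp only [mem_sdiff, mem_inter, List.mem_toFinset] at he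
        exact hg e (p.edges_subset_edgeSet he.1) (by tauto)
    rw [h3, h2] at h1
    have h4 : g s = 1 := bit_eq_one.2 (SimpleGraph.Reachable.refl s)
    have h5 : g t = 0 := bit_eq_zero.2 hst
    rw [h4, h5] at h1
    simp at h1
  obtain ⟨q⟩ := hr
  obtain ⟨q, hq⟩ := q.toPath
  refine ⟨q.mapLe hH, SimpleGraph.Walk.IsPath.mapLe hH hq, fun e he => ?_⟩
  have : e ∈ q.edges := by simpa using he
  have h2 := q.edges_subset_edgeSet this
  have h3 : e ∈ E := by
    have : H.edgeSet ⊆ E := by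
      simp only [H, edgeSet_fromEdgeSet]
      exact Set.sdiff_subset
    exact this h2
  exact h3.2

theorem card_edges_of_trail {s t : V} {p : G.Walk s t} (hp : p.IsTrail) :
    p.edges.toFinset.card = p.length := by
  rw [List.toFinset_card_of_nodup hp.edges_nodup, SimpleGraph.Walk.length_edges]

/-- After an exchange the distance is at most the size of the exchanged edge set. -/
theorem length_exchange_le {s t : V} {p q : G.Walk s t} (hp : p.IsTrail) (hq : q.IsPath)
    (h : ∀ e ∈ q.edges, (e ∈ p.edges ↔ e ∉ B.edges)) :
    q.length + (B.edges.filter (· ∈ p.edges)).card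
      ≤ p.length + (B.edges \ B.edges.filter (· ∈ p.edges)).card := by
  have h1 : q.edges.toFinset ⊆ (p.edges.toFinset \ B.edges.filter (· ∈ p.edges)) ∪
      (B.edges \ B.edges.filter (· ∈ p.edges)) := by
    intro e he
    have h2 := h e (List.mem_toFinset.1 he)
    simp only [mem_union, mem_sdiff, mem_filter, List.mem_toFinset]
    tauto
  have h2 := (card_le_card h1).trans (card_union_le _ _)
  rw [card_edges_of_trail hq.isTrail] at h2
  have h3 : B.edges.filter (· ∈ p.edges) ⊆ p.edges.toFinset := by
    intro e he
    exact List.mem_toFinset.2 (mem_filter.1 he).2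
  have h4 := card_sdiff_add_card_eq_card h3
  rw [card_edges_of_trail hp] at h4
  omega

end CycleBlock

end Cuts

end CactusRouting
namespace CactusRouting

open Finset SimpleGraph


/-! ### Flow of a single segment on a cycle or a bridge -/

section EdgeFlow

variable {V : Type*} [Fintype V] {G : SimpleGraph V} [DecidableEq V] {B : CycleBlock G}

theorem exists_first_edge {V : Type*} {G : SimpleGraph V} {s t : V} (p : G.Walk s t) (E : Set (Sym2 V))
    (h : ∃ e ∈ p.edges, e ∈ E) :
    ∃ (a x : V) (q : G.Walk s a) (h : G.Adj a x) (r : G.Walk x t),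
      p = q.append (.cons h r) ∧ s(a, x) ∈ E ∧ ∀ e ∈ q.edges, e ∉ E := by
  induction p with
  | nil => simp at h
  | @cons u v w hadj p ih =>
    by_cases h1 : s(u, v) ∈ E
    · exact ⟨u, v, .nil, hadj, p, rfl, h1, by simp⟩
    · obtain ⟨e, he, heE⟩ := h
      have he' : e ∈ p.edges := by
        rw [SimpleGraph.Walk.edges_cons, List.mem_cons] at he
        grind
      obtain ⟨a, x, q, h2, r, rfl, h3, h4⟩ := ih ⟨e, he', heE⟩
      refine ⟨a, x, .cons hadj q, h2, r, rfl, h3, ?_⟩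
      intro e he
      rw [SimpleGraph.Walk.edges_cons, List.mem_cons] at he
      grind

namespace CycleBlock

/-- The label `cut e + cut e'` shows that `e` and `e'` form an edge cut separating `s` from `t`. A
shortest path uses at most one of the two, so `sum_edgeFlow_cut` applies. -/
theorem edgeFlow_pair (hG : G.Connected) {U : Finset (Sym2 V)} {s t : V} (hU : B.Links U s t)
    {e e' : Sym2 V} (he : e ∈ U) (he'B : e' ∈ B.edges) (he' : e' ∉ U)
    (hp : ∀ p : G.Walk s t, p.length = G.dist s t → ¬ (e ∈ p.edges ∧ e' ∈ p.edges)) :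
    edgeFlow G s t e + edgeFlow G s t e' = 1 := by
  have heB := hU.1 he
  have hne : e ≠ e' := fun h => he' (h ▸ he)
  let g : V → ZMod 2 := fun x => B.cut e x + B.cut e' x
  have hst : g s + g t = 1 := by
    have := hU.cut_pair heB he'B
    simp only [g, this, bit, he, he', if_true, if_false, add_zero]
  have hcob : ∀ e₁ ∈ G.edgeSet, coboundary g e₁ = bit (e₁ = e) + bit (e₁ = e') :=
    fun e₁ h => coboundary_cut_pair heB he'B h
  have hone : ∀ a b c : ZMod 2, a + b = 1 → a + c = 1 → b = c := by decide
  have hcross : ∀ e₁ ∈ ({e, e'} : Finset (Sym2 V)), ∃ x y, g x = g s ∧ ¬ g y = g s ∧ e₁ = s(x, y) := by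
    intro e₁ he₁
    have h1 : e₁ ∈ B.edges := by
      simp only [mem_insert, mem_singleton] at he₁
      rcases he₁ with rfl | rfl <;> assumption
    have h2 := hcob e₁ (B.mem_edgeSet _ h1)
    have h3 : bit (e₁ = e) + bit (e₁ = e') = 1 := by
      simp only [mem_insert, mem_singleton] at he₁
      rcases he₁ with rfl | rfl
      · simp [bit, hne]
      · simp [bit, hne.symm]
    rw [h3] at h2
    clear h1
    induction e₁ with
    | _ x y =>
      rw [coboundary_mk] at h2
      have : ∀ a b c : ZMod 2, a + b = 1 → (a = c ∧ ¬ b = c) ∨ (b = c ∧ ¬ a = c) := by decide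
      rcases this _ _ (g s) h2 with h | h
      · exact ⟨x, y, h.1, h.2, rfl⟩
      · exact ⟨y, x, h.1, h.2, Sym2.eq_swap⟩
  have := sum_edgeFlow_cut hG (fun x => g x = g s) (u := s) (v := t) rfl
    (fun h => by rw [h, zmod_two_add_self] at hst; simp at hst) {e, e'} ?_ hcross ?_
  · rwa [sum_pair hne] at this
  · intro x y hadj hx hy
    have h1 := hcob s(x, y) hadj
    rw [coboundary_mk] at h1
    grind
  · grind

theorem trace_eq_or {U : Finset (Sym2 V)} {s t : V} (hU : B.Links U s t) {p : G.Walk s t}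
    (hp : p.IsTrail) :
    B.edges.filter (· ∈ p.edges) = U ∨ B.edges.filter (· ∈ p.edges) = B.edges \ U :=
  hU.eq_or_eq_compl (links_trail hp)

/-- A segment follows the shorter side of a cycle. -/
theorem edgeFlow_of_short (hG : G.Connected) {U : Finset (Sym2 V)} {s t : V} (hU : B.Links U s t)
    (hc : 2 * U.card < B.edges.card) {e : Sym2 V} (he : e ∈ B.edges) :
    edgeFlow G s t e = if e ∈ U then 1 else 0 := by
  have hcard := card_sdiff_add_card_eq_card hU.1
  -- A shortest path along the longer side could be exchanged for a strictly shorter one.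
  have key : ∀ p : G.Walk s t, p.length = G.dist s t → B.edges.filter (· ∈ p.edges) = U := by
    intro p hp
    have hpath := p.isPath_of_length_eq_dist hp
    rcases trace_eq_or hU hpath.isTrail with h | h
    · exact h
    · exfalso
      obtain ⟨q, hq, hq'⟩ := exists_exchange (B := B) hpath.isTrail
      have h1 := length_exchange_le hpath.isTrail hq hq'
      have h2 := dist_le q
      rw [h, Finset.sdiff_sdiff_eq_self hU.1] at h1
      omega
  have hzero : ∀ e ∈ B.edges, e ∉ U → edgeFlow G s t e = 0 := by
    intro e he heU
    refine edgeFlow_eq_zero fun p hp hep => heU ?_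
    rw [← key p hp]
    exact mem_filter.2 ⟨he, hep⟩
  split_ifs with heU
  · obtain ⟨e', he'⟩ : (B.edges \ U).Nonempty := by
      rw [← card_pos]; omega
    rw [mem_sdiff] at he'
    have := edgeFlow_pair hG hU heU he'.1 he'.2 (fun p hp h => he'.2 ?_)
    · rw [hzero e' he'.1 he'.2, add_zero] at this
      exact this
    · rw [← key p hp]
      exact mem_filter.2 ⟨he'.1, h.2⟩
  · exact hzero e he heU

/-- Evenness applied to the indicator of `a`: the number of cycle edges at `a` is even, so it is not
one. -/
theorem exists_other_edge {a : V} {e : Sym2 V} (he : e ∈ B.edges) (ha : a ∈ e) :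
    ∃ y, s(a, y) ∈ B.edges ∧ s(a, y) ≠ e := by
  by_contra hcon
  push Not at hcon
  have h1 := B.even (fun x => bit (x = a))
  have h2 : ∀ e' ∈ G.edgeSet, coboundary (fun x => bit (x = a)) e' = bit (a ∈ e') := by
    intro e' he'
    induction e' with
    | _ x y =>
      have hne : x ≠ y := G.ne_of_adj he'
      rw [coboundary_mk]
      unfold bit
      grind
  rw [sum_eq_single e] at h1
  · rw [h2 e (B.mem_edgeSet e he), bit_eq_zero] at h1
    exact h1 ha
  · intro e' he' hne
    rw [h2 e' (B.mem_edgeSet e' he'), bit_eq_zero]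
    intro hae'
    obtain ⟨y, rfl⟩ := Sym2.mem_iff_exists.1 hae'
    exact hne (hcon y he')
  · exact fun h => absurd he h

theorem arcFlow_eq_of_fwdArc {u v x y z : V} (hy : FwdArc G u v x y) (hz : FwdArc G u v x z) :
    edgeFlow G u v s(x, y) = edgeFlow G u v s(x, z) := by
  change arcFlow G u v x y + arcFlow G u v y x = arcFlow G u v x z + arcFlow G u v z x
  rw [arcFlow_eq_zero hy.not_symm, arcFlow_eq_zero hz.not_symm, arcFlow, arcFlow, if_pos hy,
    if_pos hz]

/-- Between antipodal vertices of a cycle the flow is divided evenly. -/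
theorem edgeFlow_of_half (hG : G.Connected) {U : Finset (Sym2 V)} {s t : V} (hU : B.Links U s t)
    (hc : 2 * U.card = B.edges.card) {e : Sym2 V} (he : e ∈ B.edges) :
    edgeFlow G s t e = 1 / 2 := by
  obtain ⟨p, hp⟩ := hG.exists_walk_length_eq_dist s t
  have hpath := p.isPath_of_length_eq_dist hp
  -- Both sides have the same size, so the side traced by the chosen shortest path may be called
  -- `U`.
  wlog hpU : B.edges.filter (· ∈ p.edges) = U generalizing U
  · have h1 := (trace_eq_or hU hpath.isTrail).resolve_left hpU
    refine this hU.compl ?_ h1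
    have := card_sdiff_add_card_eq_card hU.1
    omega
  have hcard := card_sdiff_add_card_eq_card hU.1
  have h3 := B.three_le
  obtain ⟨e₀, he₀⟩ : U.Nonempty := by rw [← card_pos]; omega
  have he₀' := he₀
  rw [← hpU, mem_filter] at he₀'
  -- The vertex `a` is where the path enters the cycle. The plan is to show that the flow divides
  -- evenly at `a` between the two cycle edges there.
  obtain ⟨a, x, q, hax, r, rfl, hB, hq⟩ := exists_first_edge p (fun e => e ∈ B.edges)
    ⟨e₀, he₀'.2, he₀'.1⟩
  change s(a, x) ∈ B.edges at hB
  have hU1 : s(a, x) ∈ U := by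
    rw [← hpU, mem_filter]
    exact ⟨hB, by simp⟩
  obtain ⟨y, hyB, hyne⟩ := exists_other_edge hB (Sym2.mem_mk_left a x)
  have hyp : s(a, y) ∉ (q.append (.cons hax r)).edges := by
    rw [SimpleGraph.Walk.edges_append, SimpleGraph.Walk.edges_cons, List.mem_append, List.mem_cons]
    rintro (h | h | h)
    · exact hq _ h hyB
    · exact hyne h
    · have h4 := (SimpleGraph.Walk.cons_isPath_iff _ _).1 hpath.of_append_right
      exact h4.2 (SimpleGraph.Walk.fst_mem_support_of_mem_edges _ h)
  have hyU : s(a, y) ∉ U := by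
    rw [← hpU, mem_filter]
    exact fun h => hyp h.2
  have hx : FwdArc G s t a x := ⟨hax, _, hp, by simp⟩
  -- Exchanging equal sides preserves the length, so the exchanged path is also shortest. It avoids
  -- `s(a, x)`, hence follows the other side and contains `s(a, y)`.
  have hy : FwdArc G s t a y := by
    obtain ⟨p', hp', hpp'⟩ := exists_exchange (B := B) hpath.isTrail
    have h1 := length_exchange_le hpath.isTrail hp' hpp'
    rw [hpU] at h1
    have hlen : p'.length = G.dist s t := by
      have := dist_le p'
      omega
    have hxp' : s(a, x) ∉ p'.edges := fun h => ((hpp' _ h).1 (by simp)) hB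
    have htr := trace_eq_or hU hp'.isTrail
    have hyp' : s(a, y) ∈ p'.edges := by
      rcases htr with h | h
      · grind
      · have : s(a, y) ∈ B.edges \ U := mem_sdiff.2 ⟨hyB, hyU⟩
        rw [← h, mem_filter] at this
        exact this.2
    obtain ⟨d, hd, hde⟩ := List.mem_map.1 hyp'
    have hadj : G.Adj a y := B.mem_edgeSet _ hyB
    rcases dart_edge_eq_mk'_iff.1 hde with h | h
    · refine ⟨hadj, p', hlen, ?_⟩
      rwa [show (⟨(a, y), hadj⟩ : G.Dart) = d from (SimpleGraph.Dart.ext _ _ h).symm]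
    -- Suppose the exchanged path traverses the edge from `y` to `a`. Neither initial part `q`, `q'`
    -- meets the two cycle edges at `a`, so the label `g` has the same value at `s`, `a` and `y`,
    -- although it changes along `s(a, y)`.
    · exfalso
      have hd' : (⟨(y, a), hadj.symm⟩ : G.Dart) ∈ p'.darts := by
        rwa [show (⟨(y, a), hadj.symm⟩ : G.Dart) = d from (SimpleGraph.Dart.ext _ _ h).symm]
      obtain ⟨q', r', rfl⟩ := exists_append_of_mem_darts hadj.symm p' hd'
      have hnd := hp'.isTrail.edges_nodup
      rw [SimpleGraph.Walk.edges_append, SimpleGraph.Walk.edges_cons] at hnd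
      let g : V → ZMod 2 := fun z => B.cut s(a, x) z + B.cut s(a, y) z
      have hcob : ∀ e₁ ∈ G.edgeSet, coboundary g e₁ = bit (e₁ = s(a, x)) + bit (e₁ = s(a, y)) :=
        fun e₁ h => coboundary_cut_pair hB hyB h
      have h5 : g s = g a := eq_of_coboundary_eq_zero q fun e he => by
        rw [hcob e (q.edges_subset_edgeSet he), bit_eq_zero.2, bit_eq_zero.2, add_zero]
        · rintro rfl; exact hq _ he hyB
        · rintro rfl; exact hq _ he hB
      have h6 : g s = g y := eq_of_coboundary_eq_zero q' fun e he => by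
        rw [hcob e (q'.edges_subset_edgeSet he), bit_eq_zero.2, bit_eq_zero.2, add_zero]
        · rintro rfl
          exact (List.nodup_append.1 hnd).2.2 _ he s(y, a) (by simp) Sym2.eq_swap
        · rintro rfl
          exact hxp' (by simp [he])
      have h7 := hcob s(a, y) hadj
      rw [coboundary_mk, ← h5, ← h6, zmod_two_add_self, bit_eq_zero.2 hyne, bit_eq_one.2 rfl] at h7
      simp at h7
  have heq := arcFlow_eq_of_fwdArc hx hy
  -- A shortest path follows one side completely and the other not at all, so it never uses one edge
  -- of each. Pairing with the two edges at `a`, whose flows are equal, then gives `1/2` everywhere.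
  have hpair : ∀ e ∈ U, ∀ e' ∈ B.edges, e' ∉ U → edgeFlow G s t e + edgeFlow G s t e' = 1 := by
    intro e he e' he'B he'
    refine edgeFlow_pair hG hU he he'B he' fun p' hp' h => ?_
    have hm : e ∈ B.edges.filter (· ∈ p'.edges) := mem_filter.2 ⟨hU.1 he, h.1⟩
    have hm' : e' ∈ B.edges.filter (· ∈ p'.edges) := mem_filter.2 ⟨he'B, h.2⟩
    rcases trace_eq_or hU (p'.isPath_of_length_eq_dist hp').isTrail with h1 | h1
    · rw [h1] at hm'
      exact he' hm'
    · rw [h1, mem_sdiff] at hm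
      exact hm.2 he
  have h8 := hpair _ hU1 _ hyB hyU
  by_cases heU : e ∈ U
  · have := hpair e heU _ hyB hyU
    linarith
  · have := hpair _ hU1 e he heU
    linarith

end CycleBlock

/-- The flow on a bridge. -/
theorem edgeFlow_bridge (hG : G.Connected) {g : V → ZMod 2} {e : Sym2 V} (he : e ∈ G.edgeSet)
    (hg : ∀ e' ∈ G.edgeSet, coboundary g e' = bit (e' = e)) (s t : V) :
    edgeFlow G s t e = if g s = g t then 0 else 1 := by
  have hmem : ∀ p : G.Walk s t, p.IsTrail → bit (e ∈ p.edges) = g s + g t := by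
    intro p hp
    rw [← sum_coboundary_trail g hp, sum_congr rfl fun e' he' =>
      hg e' (p.edges_subset_edgeSet (List.mem_toFinset.1 he'))]
    simp [bit]
  split_ifs with hst
  · refine edgeFlow_eq_zero fun p hp => ?_
    have := hmem p (p.isPath_of_length_eq_dist hp).isTrail
    rwa [hst, zmod_two_add_self, bit_eq_zero] at this
  · have := sum_edgeFlow_cut hG (fun x => g x = g s) (u := s) (v := t) rfl
      (fun h => hst h.symm) {e} ?_ ?_ ?_
    · simpa using this
    · intro x y hadj hx hy
      have h1 := hg s(x, y) hadj
      rw [coboundary_mk] at h1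
      by_contra h2
      rw [mem_singleton] at h2
      rw [bit_eq_zero.2 h2, zmod_two_add_eq_zero] at h1
      exact hy (h1 ▸ hx)
    · intro e' he'
      rw [mem_singleton] at he'
      subst he'
      have h1 := hg e' he
      rw [bit_eq_one.2 rfl] at h1
      clear hg hmem he
      induction e' with
      | _ x y =>
        rw [coboundary_mk] at h1
        have : ∀ a b c : ZMod 2, a + b = 1 → (a = c ∧ ¬ b = c) ∨ (b = c ∧ ¬ a = c) := by decide
        rcases this _ _ (g s) h1 with h | h
        · exact ⟨x, y, h.1, h.2, rfl⟩
        · exact ⟨y, x, h.1, h.2, Sym2.eq_swap⟩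
    · grind

end EdgeFlow

end CactusRouting
namespace CactusRouting

open scoped Classical
noncomputable section

open Finset SimpleGraph


/-- The number of waypoints needed to send flow along `u` consecutive edges of a cycle of
length `L`. -/
def detourCost (L u : ℕ) : ℕ :=
  if u ≤ (L - 1) / 2 then 0 else if u ≤ 2 * ((L - 1) / 2) then 1 else 2

/-! ### Load of a segment path on one cycle -/

section PathLoad

variable {V : Type*} [Fintype V] {G : SimpleGraph V} [DecidableEq V] {B : CycleBlock G}

namespace CycleBlock

variable (B) in
theorem exists_links_le (hG : G.Connected) (s t : V) :
    ∃ U, B.Links U s t ∧ 2 * U.card ≤ B.edges.card := by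
  obtain ⟨U, hU, -⟩ := B.exists_links hG s t
  by_cases h : 2 * U.card ≤ B.edges.card
  · exact ⟨U, hU, h⟩
  · refine ⟨_, hU.compl, ?_⟩
    have := card_sdiff_add_card_eq_card hU.1
    omega

/-- The sides linking the ends, and their sizes, depend only on the projections, and these determine
the flow. -/
theorem edgeFlow_congr (hG : G.Connected) {s t s' t' : V} (hs : B.Equiv s s') (ht : B.Equiv t t')
    {e : Sym2 V} (he : e ∈ B.edges) : edgeFlow G s t e = edgeFlow G s' t' e := by
  obtain ⟨U, hU, hc⟩ := B.exists_links_le hG s t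
  have hU' := hU.congr hs ht
  rcases hc.lt_or_eq with h | h
  · rw [edgeFlow_of_short hG hU h he, edgeFlow_of_short hG hU' h he]
  · rw [edgeFlow_of_half hG hU h he, edgeFlow_of_half hG hU' h he]

theorem edgeFlow_of_equiv (hG : G.Connected) {s t : V} (hs : B.Equiv s t)
    {e : Sym2 V} (he : e ∈ B.edges) : edgeFlow G s t e = 0 := by
  rw [edgeFlow_of_short hG (links_empty_iff.2 hs) (by have := B.three_le; rw [card_empty]; omega) he]
  simp

theorem pathLoad_congr (hG : G.Connected) {s t s' t' : V} (hs : B.Equiv s s') (ht : B.Equiv t t')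
    (W : List V) {e : Sym2 V} (he : e ∈ B.edges) :
    pathLoad G e s W t = pathLoad G e s' W t' := by
  induction W generalizing s s' with
  | nil => exact edgeFlow_congr hG hs ht he
  | cons w ws ih =>
    rw [pathLoad, pathLoad, edgeFlow_congr hG hs (Equiv.refl w) he, ih (Equiv.refl w)]

/-- The two labels select regions bounded by `e, f` and by `e', f`. The product `h * h'` has
coboundary supported on `e, e', f`, so it is a combination of `h`, `h'` and a constant; the values
at `s`, `w` and `t` force this combination to vanish. Thus the regions are disjoint. -/
theorem mul_eq_zero_of_cuts (hG : G.Connected) {h h' : V → ZMod 2} {e e' f : Sym2 V}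
    (he : e ∈ B.edges) (he' : e' ∈ B.edges) (hf : f ∈ B.edges) (hee' : e ≠ e') (hef : e ≠ f)
    (he'f : e' ≠ f)
    (hh : ∀ e₁ ∈ G.edgeSet, coboundary h e₁ = bit (e₁ = e) + bit (e₁ = f))
    (hh' : ∀ e₁ ∈ G.edgeSet, coboundary h' e₁ = bit (e₁ = e') + bit (e₁ = f)) {s w t : V}
    (hs : h s = 1) (hs' : h' s = 0) (hw : h w = 0) (hw' : h' w = 1) (ht : h t = 0)
    (ht' : h' t = 0) (x : V) : h x * h' x = 0 := by
  let k : V → ZMod 2 := fun x => h x * h' x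
  have hk0 : ∀ e₁ ∈ G.edgeSet, e₁ ≠ e → e₁ ≠ e' → e₁ ≠ f → coboundary k e₁ = 0 := by
    intro e₁ h₁ h2 h3 h4
    have h5 := hh e₁ h₁
    have h6 := hh' e₁ h₁
    rw [bit_eq_zero.2 h2, bit_eq_zero.2 h4, add_zero] at h5
    rw [bit_eq_zero.2 h3, bit_eq_zero.2 h4, add_zero] at h6
    induction e₁ with
    | _ a b =>
      rw [coboundary_mk, zmod_two_add_eq_zero] at *
      simp only [k, h5, h6]
  have hsum : coboundary k e + coboundary k e' + coboundary k f = 0 := by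
    have h1 := B.even k
    rw [← sum_subset (s₁ := {e, e', f})] at h1
    · rwa [sum_insert (by simp [hee', hef]), sum_pair he'f, ← add_assoc] at h1
    · grind
    · intro e₁ he₁ h2
      simp only [mem_insert, mem_singleton, not_or] at h2
      exact hk0 e₁ (B.mem_edgeSet _ he₁) h2.1 h2.2.1 h2.2.2
  obtain ⟨α, hα⟩ : ∃ α, α = coboundary k e := ⟨_, rfl⟩
  obtain ⟨β, hβ⟩ : ∃ β, β = coboundary k e' := ⟨_, rfl⟩
  -- The multiples of `h` and `h'` cancel the coboundary on `e` and `e'`. On `f` it then vanishes as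
  -- well, because the coboundary of `k` has an even sum over the cycle.
  let l : V → ZMod 2 := fun x => k x + α * h x + β * h' x
  have hl : ∀ e₁ ∈ G.edgeSet, coboundary l e₁ = 0 := by
    intro e₁ h₁
    have h5 := hh e₁ h₁
    have h6 := hh' e₁ h₁
    have h7 : coboundary l e₁ = coboundary k e₁ + α * coboundary h e₁ +
        β * coboundary h' e₁ := by
      induction e₁ with
      | _ a b => simp only [coboundary_mk, l]; ring
    rw [h7, h5, h6]
    have hz : ∀ a b c : ZMod 2, a + b + c = 0 → c + a + b = 0 := by decide
    by_cases h8 : e₁ = e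
    · subst h8
      rw [hα]
      simp [bit, hee', hef, zmod_two_add_self]
    · by_cases h9 : e₁ = e'
      · subst h9
        rw [hβ]
        simp [bit, he'f, h8, zmod_two_add_self]
      · by_cases h10 : e₁ = f
        · subst h10
          simp only [bit, h8, h9, if_true, if_false, zero_add, mul_one]
          rw [hα, hβ]
          exact hz _ _ _ hsum
        · rw [hk0 _ h₁ h8 h9 h10]
          simp [bit, h8, h9, h10]
  have hlx := fun y => const_of_coboundary_eq_zero hG hl y t
  grind

/-- The antipode of an antipode is the original vertex. Both sides may be taken without the base
edge, as initial choices from a cycle cut open at that edge; the point is that they are then equal,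
not merely of equal size. -/
theorem equiv_of_half_of_half (hG : G.Connected) {U U' : Finset (Sym2 V)} {s w t : V}
    (hU : B.Links U s w) (hU' : B.Links U' w t) (hc : 2 * U.card = B.edges.card)
    (hc' : 2 * U'.card = B.edges.card) : B.Equiv s t := by
  wlog hb : B.base ∉ U generalizing U
  · refine this hU.compl ?_ (by simp [not_not.1 hb])
    have := card_sdiff_add_card_eq_card hU.1
    omega
  wlog hb' : B.base ∉ U' generalizing U'
  · refine this hU'.compl ?_ (by simp [not_not.1 hb'])
    have := card_sdiff_add_card_eq_card hU'.1
    omega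
  -- Otherwise edges `e₁`, `e₂`, `e₃` of the three parts give three labels that single out `s`, `w`
  -- and `t` respectively and are pairwise disjoint by `mul_eq_zero_of_cuts`.
  have hcase : U \ U' = ∅ ∨ U ∩ U' = ∅ ∨ U' \ U = ∅ := by
    by_contra hcon
    simp only [not_or, ← ne_eq, ← nonempty_iff_ne_empty] at hcon
    obtain ⟨⟨e₁, h1⟩, ⟨e₂, h2⟩, ⟨e₃, h3⟩⟩ := hcon
    rw [mem_sdiff] at h1 h3
    rw [mem_inter] at h2
    have hcut : ∀ e ∈ B.edges, B.cut e s + B.cut e w = bit (e ∈ U) := by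
      intro e he
      rw [← hU.2 e he, bit_eq_zero.2 hb, add_zero]
    have hcut' : ∀ e ∈ B.edges, B.cut e w + B.cut e t = bit (e ∈ U') := by
      intro e he
      rw [← hU'.2 e he, bit_eq_zero.2 hb', add_zero]
    have b1 := hU.1 h1.1
    have b2 := hU.1 h2.1
    have b3 := hU'.1 h3.1
    have p1 := hcut e₁ b1
    have p2 := hcut e₂ b2
    have p3 := hcut e₃ b3
    have q1 := hcut' e₁ b1
    have q2 := hcut' e₂ b2
    have q3 := hcut' e₃ b3
    rw [bit_eq_one.2 h1.1] at p1
    rw [bit_eq_one.2 h2.1] at p2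
    rw [bit_eq_zero.2 h3.2] at p3
    rw [bit_eq_zero.2 h1.2] at q1
    rw [bit_eq_one.2 h2.2] at q2
    rw [bit_eq_one.2 h3.1] at q3
    have n12 : e₁ ≠ e₂ := fun h => h1.2 (h ▸ h2.2)
    have n13 : e₁ ≠ e₃ := fun h => h1.2 (h ▸ h3.1)
    have n23 : e₂ ≠ e₃ := fun h => h3.2 (h ▸ h2.1)
    have f1 : e₁ ≠ B.base := fun h => hb (h ▸ h1.1)
    have f2 : e₂ ≠ B.base := fun h => hb (h ▸ h2.1)
    have f3 : e₃ ≠ B.base := fun h => hb' (h ▸ h3.1)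
    have hsp : ∀ e ∈ B.edges, ∀ c : V, ∀ e₀ ∈ G.edgeSet,
        coboundary (fun x => B.cut e x + B.cut e c) e₀ = bit (e₀ = e) + bit (e₀ = B.base) := by
      intro e he c e₀ he₀
      rw [← B.cut_spec e he e₀ he₀]
      induction e₀ with
      | _ x y =>
        simp only [coboundary_mk]
        have : ∀ a b c : ZMod 2, a + c + (b + c) = a + b := by decide
        exact this _ _ _
    have hsw : ∀ a b c : ZMod 2, a + b = 1 → b + c = 0 → a + b = 1 ∧ b + b = 0 ∧ c + b = 0 := by
      decide
    have hws : ∀ a b c : ZMod 2, a + b = 1 → b + c = 1 → a + a = 0 ∧ b + a = 1 ∧ c + a = 0 := by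
      decide
    have hts : ∀ a b c : ZMod 2, a + b = 0 → b + c = 1 → a + a = 0 ∧ b + a = 0 ∧ c + a = 1 := by
      decide
    obtain ⟨s1, w1, t1⟩ := hsw _ _ _ p1 q1
    obtain ⟨s2, w2, t2⟩ := hws _ _ _ p2 q2
    obtain ⟨s3, w3, t3⟩ := hts _ _ _ p3 q3
    have k12 := mul_eq_zero_of_cuts hG b1 b2 B.base_mem n12 f1 f2 (hsp e₁ b1 w) (hsp e₂ b2 s)
      (s := s) (w := w) (t := t) s1 s2 w1 w2 t1 t2
    have k13 := mul_eq_zero_of_cuts hG b1 b3 B.base_mem n13 f1 f3 (hsp e₁ b1 w) (hsp e₃ b3 s)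
      (s := s) (w := t) (t := w) s1 s3 t1 t3 w1 w3
    have k23 := mul_eq_zero_of_cuts hG b2 b3 B.base_mem n23 f2 f3 (hsp e₂ b2 s) (hsp e₃ b3 s)
      (s := w) (w := t) (t := s) w2 w3 t2 t3 s2 s3
    have g1 := hsp e₁ b1 w _ (B.mem_edgeSet _ B.base_mem)
    have g2 := hsp e₂ b2 s _ (B.mem_edgeSet _ B.base_mem)
    have g3 := hsp e₃ b3 s _ (B.mem_edgeSet _ B.base_mem)
    rw [bit_eq_one.2 rfl, bit_eq_zero.2 f1.symm, zero_add] at g1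
    rw [bit_eq_one.2 rfl, bit_eq_zero.2 f2.symm, zero_add] at g2
    rw [bit_eq_one.2 rfl, bit_eq_zero.2 f3.symm, zero_add] at g3
    -- All three labels change along the base edge, so each has the value `1` at exactly one of its
    -- two ends; two of them share this end, against disjointness.
    induction hbase : B.base with
    | _ a b =>
      rw [hbase] at g1 g2 g3
      rw [coboundary_mk] at g1 g2 g3
      grind
  have hL := B.three_le
  have c1 := card_sdiff_add_card_inter U U'
  have c2 := card_sdiff_add_card_inter U' U
  rw [inter_comm] at c2
  -- The base edge is missing from both sides of size half the length, so they cannot be disjoint;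
  -- equal cardinality turns inclusion into equality.
  have hbase : (U ∪ U').card + 1 ≤ B.edges.card := by
    have h1 : insert B.base (U ∪ U') ⊆ B.edges :=
      insert_subset B.base_mem (union_subset hU.1 hU'.1)
    have h2 := card_le_card h1
    rwa [card_insert_of_notMem (by simp [hb, hb'])] at h2
  have c3 := card_union_add_card_inter U U'
  have hUU : U = U' := by
    rcases hcase with h | h | h
    · rw [sdiff_eq_empty_iff_subset] at h
      exact eq_of_subset_of_card_le h (by omega)
    · rw [h, card_empty] at c3
      omega
    · rw [sdiff_eq_empty_iff_subset] at h
      exact (eq_of_subset_of_card_le h (by omega)).symm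
  subst hUU
  intro e he
  have h1 := hU.2 e he
  have h2 := hU'.2 e he
  grind

theorem disjoint_of_load_le {U U' : Finset (Sym2 V)} {f f' : Sym2 V → ℚ}
    (hU : U ⊆ B.edges) (h : ∀ e ∈ B.edges, f e = if e ∈ U then 1 else 0)
    (h' : ∀ e ∈ B.edges, f' e = if e ∈ U' then 1 else 0) (hle : ∀ e ∈ B.edges, f e + f' e ≤ 1) :
    Disjoint U U' := by
  rw [Finset.disjoint_left]
  intro e he he'
  have := hle e (hU he)
  rw [h e (hU he), h' e (hU he), if_pos he, if_pos he'] at this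
  norm_num at this

/-- A segment path of load at most one follows one side of a cycle or is split evenly. -/
theorem pathLoad_cases (hG : G.Connected) {s t : V} {W : List V}
    (hle : ∀ e ∈ B.edges, pathLoad G e s W t ≤ 1) :
    (∃ U, B.Links U s t ∧ ∀ e ∈ B.edges, pathLoad G e s W t = if e ∈ U then 1 else 0) ∨
    (∃ U, B.Links U s t ∧ 2 * U.card = B.edges.card ∧
      ∀ e ∈ B.edges, pathLoad G e s W t = 1 / 2) := by
  have single : ∀ s t : V,
      (∃ U, B.Links U s t ∧ ∀ e ∈ B.edges, edgeFlow G s t e = if e ∈ U then 1 else 0) ∨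
      (∃ U, B.Links U s t ∧ 2 * U.card = B.edges.card ∧
        ∀ e ∈ B.edges, edgeFlow G s t e = 1 / 2) := by
    intro s t
    obtain ⟨U, hU, hc⟩ := B.exists_links_le hG s t
    rcases hc.lt_or_eq with h | h
    · exact Or.inl ⟨U, hU, fun e he => edgeFlow_of_short hG hU h he⟩
    · exact Or.inr ⟨U, hU, h, fun e he => edgeFlow_of_half hG hU h he⟩
  have hempty : ∀ {U : Finset (Sym2 V)} {f f' : Sym2 V → ℚ}, U ⊆ B.edges →
      (∀ e ∈ B.edges, f e = if e ∈ U then 1 else 0) → (∀ e ∈ B.edges, f' e = 1 / 2) →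
      (∀ e ∈ B.edges, f e + f' e ≤ 1) → U = ∅ := by
    intro U f f' hU hf hf' hle
    refine eq_empty_of_forall_notMem fun e he => ?_
    have := hle e (hU he)
    rw [hf e (hU he), hf' e (hU he), if_pos he] at this
    norm_num at this
  induction W generalizing s with
  | nil => exact single s t
  | cons w ws ih =>
    have hle' : ∀ e ∈ B.edges, pathLoad G e w ws t ≤ 1 := fun e he => by
      have h1 := hle e he
      have h2 := edgeFlow_nonneg G s w e
      rw [pathLoad] at h1
      linarith
    rcases single s w with ⟨U, hU, hf⟩ | ⟨U, hU, hc, hf⟩ <;>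
      rcases ih hle' with ⟨U', hU', hf'⟩ | ⟨U', hU', hc', hf'⟩
    · left
      have hd := disjoint_of_load_le hU.1 hf hf' hle
      refine ⟨_, hU.union hU' hd, fun e he => ?_⟩
      rw [pathLoad, hf e he, hf' e he]
      by_cases h1 : e ∈ U
      · simp [h1, disjoint_left.1 hd h1]
      · simp [h1]
    · right
      have h0 := hempty hU.1 hf hf' hle
      subst h0
      refine ⟨U', hU'.congr (links_empty_iff.1 hU).symm (Equiv.refl _), hc', fun e he => ?_⟩
      rw [pathLoad, hf e he, hf' e he]
      simp
    · right
      have h0 := hempty hU'.1 hf' hf (fun e he => by rw [add_comm]; exact hle e he)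
      subst h0
      refine ⟨U, hU.congr (Equiv.refl _) (links_empty_iff.1 hU'), hc, fun e he => ?_⟩
      rw [pathLoad, hf e he, hf' e he]
      simp
    -- Two even splits lead back to the projection of the start and together load every edge with
    -- `1`. This is the pattern of the side consisting of the whole cycle.
    · left
      have h0 := equiv_of_half_of_half hG hU hU' hc hc'
      refine ⟨B.edges, ?_, fun e he => ?_⟩
      · simpa using (links_empty_iff.2 h0).compl
      · rw [pathLoad, hf e he, hf' e he, if_pos he]
        norm_num

/-- The number of waypoints of a segment path from `s` to `t` which it visits inside a cycle. -/
def innerCount (B : CycleBlock G) (s t : V) (W : List V) : ℕ :=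
  W.countP fun w => ¬ B.Equiv s w ∧ ¬ B.Equiv w t

/-- The part of the list up to a waypoint projecting as `s`, or from a waypoint projecting as `t`
onwards, can be cut off; this removes only load. What survives consists of inner waypoints. -/
theorem exists_inner_sublist (hG : G.Connected) {s t : V} (W : List V) :
    ∃ W' : List V, W'.length ≤ B.innerCount s t W ∧
      ∀ e ∈ B.edges, pathLoad G e s W' t ≤ pathLoad G e s W t := by
  induction hn : W.length using Nat.strong_induction_on generalizing W with
  | _ n ih =>
    by_cases h1 : ∃ x ∈ W, B.Equiv s x
    · obtain ⟨x, hx, hsx⟩ := h1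
      obtain ⟨A, C, rfl⟩ := List.append_of_mem hx
      obtain ⟨W', hW', hl⟩ := ih C.length (by rw [← hn]; simp; omega) C rfl
      refine ⟨W', hW'.trans ?_, fun e he => (hl e he).trans ?_⟩
      · unfold innerCount
        rw [List.countP_append, List.countP_cons]
        omega
      · rw [pathLoad_append, pathLoad_congr hG hsx (Equiv.refl t) C he]
        linarith [pathLoad_nonneg G e s A x]
    · by_cases h2 : ∃ x ∈ W, B.Equiv x t
      · obtain ⟨x, hx, hsx⟩ := h2
        obtain ⟨A, C, rfl⟩ := List.append_of_mem hx
        obtain ⟨W', hW', hl⟩ := ih A.length (by rw [← hn]; simp) A rfl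
        refine ⟨W', hW'.trans ?_, fun e he => (hl e he).trans ?_⟩
        · unfold innerCount
          rw [List.countP_append]
          omega
        · rw [pathLoad_append, pathLoad_congr hG (Equiv.refl s) hsx A he]
          linarith [pathLoad_nonneg G e x C t]
      · push Not at h1 h2
        refine ⟨W, ?_, fun e he => le_rfl⟩
        unfold innerCount
        rw [List.countP_eq_length.2]
        intro x hx
        simp [h1 x hx, h2 x hx]

/-- An unloaded edge excludes even splits, so each of the `W.length + 1` segments runs along
strictly less than half of the cycle. -/
theorem sum_pathLoad_le (hG : G.Connected) {s t : V} {W : List V} {e₀ : Sym2 V}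
    (he₀ : e₀ ∈ B.edges) (h₀ : pathLoad G e₀ s W t = 0) :
    ∑ e ∈ B.edges, pathLoad G e s W t ≤ (((W.length + 1) * ((B.edges.card - 1) / 2) : ℕ) : ℚ) := by
  have single : ∀ s t : V, edgeFlow G s t e₀ = 0 →
      ∑ e ∈ B.edges, edgeFlow G s t e ≤ (((B.edges.card - 1) / 2 : ℕ) : ℚ) := by
    intro s t h
    obtain ⟨U, hU, hc⟩ := B.exists_links_le hG s t
    rcases hc.lt_or_eq with h1 | h1
    · rw [sum_congr rfl fun e he => edgeFlow_of_short hG hU h1 he]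
      rw [sum_ite_mem, inter_eq_right.2 hU.1]
      simp only [sum_const, nsmul_eq_mul, mul_one]
      exact_mod_cast (by omega : U.card ≤ (B.edges.card - 1) / 2)
    · rw [edgeFlow_of_half hG hU h1 he₀] at h
      norm_num at h
  induction W generalizing s with
  | nil => simpa [pathLoad] using single s t h₀
  | cons w ws ih =>
    rw [pathLoad] at h₀
    have h1 := edgeFlow_nonneg G s w e₀
    have h2 := pathLoad_nonneg G e₀ w ws t
    have h3 := single s w (by linarith)
    have h4 := ih (s := w) (by linarith)
    simp only [pathLoad]
    rw [sum_add_distrib]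
    push_cast at h4 ⊢
    simp only [List.length_cons, Nat.cast_add, Nat.cast_one]
    linarith

/-- Following a side of a cycle takes the required number of waypoints inside the cycle. -/
theorem detourCost_le_innerCount (hG : G.Connected) {s t : V} {W : List V} (hst : ¬ B.Equiv s t)
    {U : Finset (Sym2 V)} (hU : B.Links U s t)
    (hf : ∀ e ∈ B.edges, pathLoad G e s W t = if e ∈ U then 1 else 0) :
    detourCost B.edges.card U.card ≤ B.innerCount s t W := by
  obtain ⟨W', hW', hl⟩ := exists_inner_sublist (B := B) hG (s := s) (t := t) W
  refine le_trans ?_ hW'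
  rw [hU.equiv_iff, not_or] at hst
  have hL := B.three_le
  obtain ⟨e₀, he₀⟩ : (B.edges \ U).Nonempty := by
    rw [sdiff_nonempty]
    exact fun h => hst.2 (Finset.Subset.antisymm hU.1 h)
  obtain ⟨he₀, he₀'⟩ := mem_sdiff.1 he₀
  have hle1 : ∀ e ∈ B.edges, pathLoad G e s W' t ≤ if e ∈ U then 1 else 0 :=
    fun e he => (hl e he).trans (hf e he).le
  have hz : pathLoad G e₀ s W' t = 0 := by
    have h1 := hle1 e₀ he₀
    rw [if_neg he₀'] at h1
    exact le_antisymm h1 (pathLoad_nonneg ..)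
  have hsum := sum_pathLoad_le hG he₀ hz
  -- The shortened list still joins the same projections and has load at most that of `U`. The
  -- complement and the even split are impossible because the edge `e₀` outside `U` carries nothing.
  have hfU : ∀ e ∈ B.edges, pathLoad G e s W' t = if e ∈ U then 1 else 0 := by
    rcases pathLoad_cases hG (B := B) (s := s) (t := t) (W := W')
      (fun e he => (hle1 e he).trans (by split_ifs <;> norm_num)) with
      ⟨U', hU', hf'⟩ | ⟨U', hU', hc', hf'⟩
    · rcases hU.eq_or_eq_compl hU' with rfl | rfl
      · exact hf'
      · grind
    · grind
  rw [sum_congr rfl hfU, sum_ite_mem, inter_eq_right.2 hU.1] at hsum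
  simp only [sum_const, nsmul_eq_mul, mul_one] at hsum
  have hsum' : U.card ≤ (W'.length + 1) * ((B.edges.card - 1) / 2) := by exact_mod_cast hsum
  have hlt : U.card < B.edges.card :=
    card_lt_card ⟨hU.1, fun h => he₀' (h he₀)⟩
  unfold detourCost
  generalize (B.edges.card - 1) / 2 = h at *
  split_ifs with h1 h2
  · exact Nat.zero_le _
  · grind
  · rcases Nat.lt_or_ge W'.length 2 with h3 | h3
    · have h4 : (W'.length + 1) * h ≤ 2 * h := Nat.mul_le_mul_right _ (by omega)
      omega
    · exact h3

end CycleBlock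

end PathLoad

end

end CactusRouting
namespace CactusRouting

open Finset SimpleGraph


/-! ### Interaction of several cycles and bridges -/

section Several

variable {V : Type*} [Fintype V] {G : SimpleGraph V} [DecidableEq V] {B B' : CycleBlock G}

/-- Two labellings each of which vanishes where the other one changes have a product without
coboundary. -/
theorem mul_const_of_vanish (hG : G.Connected) {g h : V → ZMod 2}
    (hg : ∀ x y, G.Adj x y → g x ≠ g y → h x = 0 ∧ h y = 0)
    (hh : ∀ x y, G.Adj x y → h x ≠ h y → g x = 0 ∧ g y = 0) (x y : V) :
    g x * h x = g y * h y := by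
  refine const_of_coboundary_eq_zero hG (g := fun x => g x * h x) (fun e he => ?_) x y
  induction e with
  | _ a b =>
    rw [coboundary_mk, zmod_two_add_eq_zero]
    by_cases h1 : g a = g b
    · by_cases h2 : h a = h b
      · rw [h1, h2]
      · obtain ⟨h3, h4⟩ := hh a b he h2
        rw [h3, h4, zero_mul, zero_mul]
    · obtain ⟨h3, h4⟩ := hg a b he h1
      rw [h3, h4, mul_zero, mul_zero]

namespace CycleBlock

/-- The vertices of the cycle. -/
def verts (B : CycleBlock G) : Set V := {v | ∃ e ∈ B.edges, v ∈ e}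

/-- For vertices `x ∈ e₁` and `y ∈ e₂` of the cycle, multiply `g` by the label of the cut `e₁, e₂`.
Since `g` is constant on each cycle edge, the coboundary of the product is `g x` on `e₁`, `g y` on
`e₂` and `0` on the others, and evenness gives `g x = g y`. -/
theorem const_on_verts {g : V → ZMod 2} (hg : ∀ e ∈ B.edges, coboundary g e = 0) {x y : V}
    (hx : x ∈ B.verts) (hy : y ∈ B.verts) : g x = g y := by
  have hends : ∀ e ∈ B.edges, ∀ a ∈ e, ∀ b ∈ e, g a = g b := by
    intro e he a ha b hb
    have := hg e he
    induction e with
    | _ c d =>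
      rw [coboundary_mk, zmod_two_add_eq_zero] at this
      rw [Sym2.mem_iff] at ha hb
      rcases ha with rfl | rfl <;> rcases hb with rfl | rfl <;> simp [this]
  obtain ⟨e₁, he₁, hx⟩ := hx
  obtain ⟨e₂, he₂, hy⟩ := hy
  by_cases hne : e₁ = e₂
  · subst hne
    exact hends e₁ he₁ x hx y hy
  have key := B.even fun z => g z * (B.cut e₁ z + B.cut e₂ z)
  have h1 : ∀ e ∈ B.edges, ∀ z ∈ e,
      coboundary (fun z => g z * (B.cut e₁ z + B.cut e₂ z)) e =
        g z * (bit (e = e₁) + bit (e = e₂)) := by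
    intro e he z hz
    rw [← coboundary_cut_pair he₁ he₂ (B.mem_edgeSet _ he)]
    have h3 := hends e he
    clear hne hx hy key
    induction e with
    | _ a b =>
      rw [coboundary_mk, coboundary_mk, h3 a (by simp) z hz, h3 b (by simp) z hz]
      ring
  rw [← sum_subset (s₁ := {e₁, e₂})] at key
  · rw [sum_pair hne, h1 e₁ he₁ x hx, h1 e₂ he₂ y hy] at key
    simpa [bit, hne, Ne.symm hne, zmod_two_add_eq_zero] using key
  · grind
  · intro e he h2
    simp only [mem_insert, mem_singleton, not_or] at h2
    induction e with
    | _ a b => rw [h1 _ he a (by simp)]; simp [bit, h2.1, h2.2]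

theorem cut_eq_of_adj {e : Sym2 V} (he : e ∈ B.edges) {x y : V} (hxy : G.Adj x y)
    (hB : s(x, y) ∉ B.edges) : B.cut e x = B.cut e y := by
  have := B.cut_spec e he s(x, y) hxy
  have h1 : s(x, y) ≠ e := fun h => hB (h ▸ he)
  have h2 : s(x, y) ≠ B.base := fun h => hB (h ▸ B.base_mem)
  rwa [bit_eq_zero.2 h1, bit_eq_zero.2 h2, add_zero, coboundary_mk, zmod_two_add_eq_zero] at this

/-- The labels of one cycle do not change along the edges of the other, so the second cycle projects
to a single vertex of the first. -/
theorem equiv_of_mem_verts (hd : Disjoint B.edges B'.edges) {x y : V} (hx : x ∈ B.verts)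
    (hy : y ∈ B.verts) : B'.Equiv x y := by
  intro e he
  refine const_on_verts (B := B) (g := B'.cut e) (fun e' he' => ?_) hx hy
  have h1 := B.mem_edgeSet _ he'
  induction e' with
  | _ a b =>
    rw [coboundary_mk, zmod_two_add_eq_zero]
    exact cut_eq_of_adj he h1 (disjoint_left.1 hd he')

theorem mem_verts_of_cut_ne {e : Sym2 V} (he : e ∈ B.edges) {x y : V} (hxy : G.Adj x y)
    (h : B.cut e x ≠ B.cut e y) : x ∈ B.verts ∧ y ∈ B.verts := by
  have hB : s(x, y) ∈ B.edges := by
    by_contra hB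
    exact h (cut_eq_of_adj he hxy hB)
  exact ⟨⟨_, hB, by simp⟩, ⟨_, hB, by simp⟩⟩

theorem exists_mem_verts (B : CycleBlock G) : ∃ z, z ∈ B.verts := by
  have := B.base_mem
  induction h : B.base with
  | _ a b => exact ⟨a, _, h ▸ this, by simp⟩

/-- Every vertex projects to one of two cycles as the other cycle does. -/
theorem equiv_or_equiv (hG : G.Connected) (hd : Disjoint B.edges B'.edges) (x : V) :
    (∀ z ∈ B'.verts, B.Equiv x z) ∨ (∀ z ∈ B.verts, B'.Equiv x z) := by
  by_contra hcon
  simp only [not_or, not_forall, Equiv] at hcon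
  obtain ⟨⟨z, hz, e, he, h1⟩, ⟨z', hz', e', he', h2⟩⟩ := hcon
  have hadd : ∀ a b c : ZMod 2, a + c ≠ b + c → a ≠ b := by decide
  -- Shifted to vanish on the other cycle, each factor is zero wherever the other changes, so the
  -- product is constant. It is zero at `z` but, by `h1` and `h2`, not at `x`.
  have := mul_const_of_vanish hG (g := fun y => B.cut e y + B.cut e z)
    (h := fun y => B'.cut e' y + B'.cut e' z') ?_ ?_ x z
  · simp only [zmod_two_add_self, zero_mul, mul_eq_zero, zmod_two_add_eq_zero] at this
    tauto
  · intro a b hab h3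
    have h4 := mem_verts_of_cut_ne he hab (hadd _ _ _ h3)
    simp only [zmod_two_add_eq_zero]
    exact ⟨equiv_of_mem_verts hd h4.1 hz' e' he', equiv_of_mem_verts hd h4.2 hz' e' he'⟩
  · intro a b hab h3
    have h4 := mem_verts_of_cut_ne he' hab (hadd _ _ _ h3)
    simp only [zmod_two_add_eq_zero]
    exact ⟨equiv_of_mem_verts hd.symm h4.1 hz e he, equiv_of_mem_verts hd.symm h4.2 hz e he⟩

/-- The bridge hangs at one vertex of the cycle, so only vertices projecting there can be beyond it;
two vertices with different projections are not both beyond it. -/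
theorem equiv_or_bridge (hG : G.Connected) {g : V → ZMod 2} {b : Sym2 V}
    (hg : ∀ e' ∈ G.edgeSet, coboundary g e' = bit (e' = b)) (hb : b ∉ B.edges) {x y : V}
    (hxy : ¬ B.Equiv x y) : (∀ z ∈ B.verts, g x = g z) ∨ (∀ z ∈ B.verts, g y = g z) := by
  have hgv : ∀ z ∈ B.verts, ∀ z' ∈ B.verts, g z = g z' := by
    intro z hz z' hz'
    refine const_on_verts (B := B) (fun e he => ?_) hz hz'
    rw [hg e (B.mem_edgeSet _ he), bit_eq_zero]
    rintro rfl
    exact hb he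
  obtain ⟨e, he, h1⟩ : ∃ e ∈ B.edges, B.cut e x ≠ B.cut e y := by
    simpa [Equiv] using hxy
  obtain ⟨z, hz⟩ := B.exists_mem_verts
  by_contra hcon
  simp only [not_or, not_forall] at hcon
  obtain ⟨⟨z₁, hz₁, h2⟩, ⟨z₂, hz₂, h3⟩⟩ := hcon
  rw [hgv z₁ hz₁ z hz] at h2
  rw [hgv z₂ hz₂ z hz] at h3
  have hgb : ∀ a a', G.Adj a a' → g a + g z ≠ g a' + g z → s(a, a') = b := by
    intro a a' ha hne
    have := hg s(a, a') ha
    rw [coboundary_mk] at this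
    by_contra h4
    rw [bit_eq_zero.2 h4, zmod_two_add_eq_zero] at this
    exact hne (by rw [this])
  have hbe : ∀ a ∈ b, ∀ a' ∈ b, b ∈ G.edgeSet → B.cut e a = B.cut e a' := by
    intro a ha a' ha' hbG
    clear hg hgb
    induction b with
    | _ c d =>
      have := cut_eq_of_adj he hbG hb
      rw [Sym2.mem_iff] at ha ha'
      rcases ha with rfl | rfl <;> rcases ha' with rfl | rfl <;> simp [this]
  have hadd : ∀ a b c : ZMod 2, a + c ≠ b + c → a ≠ b := by decide
  -- The base point `c` is chosen so that the label of the cycle, shifted by its value at `c`,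
  -- vanishes on the bridge.
  have key : ∀ c : V, (∀ a a', G.Adj a a' → s(a, a') = b → B.cut e a = B.cut e c) →
      ∀ w w', (g w + g z) * (B.cut e w + B.cut e c) = (g w' + g z) * (B.cut e w' + B.cut e c) := by
    intro c hc w w'
    refine mul_const_of_vanish hG (g := fun y => g y + g z)
      (h := fun y => B.cut e y + B.cut e c) ?_ ?_ w w'
    · intro a a' ha h4
      have h5 := hgb a a' ha h4
      simp only [zmod_two_add_eq_zero]
      exact ⟨hc _ _ ha h5, hc _ _ ha.symm (by rw [Sym2.eq_swap]; exact h5)⟩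
    · intro a a' ha h4
      have h5 := mem_verts_of_cut_ne he ha (hadd _ _ _ h4)
      simp only [zmod_two_add_eq_zero]
      exact ⟨hgv _ h5.1 _ hz, hgv _ h5.2 _ hz⟩
  -- Both ends of the bridge carry the same label, which is that of `x` or that of `y` because these
  -- differ. With this base point the constant product is zero at one of `x`, `y` and nonzero at the
  -- other.
  have hxy' : (∀ a a', G.Adj a a' → s(a, a') = b → B.cut e a = B.cut e x) ∨
      (∀ a a', G.Adj a a' → s(a, a') = b → B.cut e a = B.cut e y) := by
    by_cases hex : ∃ a a', G.Adj a a' ∧ s(a, a') = b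
    · obtain ⟨a, a', ha, rfl⟩ := hex
      have h6 : ∀ p q r : ZMod 2, p ≠ q → r = p ∨ r = q := by decide
      rcases h6 _ _ (B.cut e a) h1 with h7 | h7
      · left
        intro c c' hc hcb
        rw [← h7]
        exact hbe _ (hcb ▸ by simp) _ (by simp) ha
      · right
        intro c c' hc hcb
        rw [← h7]
        exact hbe _ (hcb ▸ by simp) _ (by simp) ha
    · grind
  grind

/-- A waypoint is visited inside at most one cycle. -/
theorem inner_unique (hG : G.Connected) (hd : Disjoint B.edges B'.edges) {s t w : V}
    (h1 : ¬ B.Equiv s t) (h2 : ¬ B.Equiv s w ∧ ¬ B.Equiv w t) (h1' : ¬ B'.Equiv s t)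
    (h2' : ¬ B'.Equiv s w ∧ ¬ B'.Equiv w t) : False := by
  obtain ⟨z, hz⟩ := B.exists_mem_verts
  obtain ⟨z', hz'⟩ := B'.exists_mem_verts
  -- Each of `s`, `t`, `w` projects to one of the two cycles as the other cycle does. Two of the
  -- three do so for the same cycle and are therefore equivalent there.
  have key := fun x => (equiv_or_equiv hG hd x).imp (fun h => h z' hz') (fun h => h z hz)
  rcases key s with hs | hs <;> rcases key t with ht | ht <;> rcases key w with hw | hw
  · exact h1 (hs.trans ht.symm)
  · exact h1 (hs.trans ht.symm)
  · exact h2.1 (hs.trans hw.symm)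
  · exact h2'.2 (hw.trans ht.symm)
  · exact h2.2 (hw.trans ht.symm)
  · exact h2'.1 (hs.trans hw.symm)
  · exact h1' (hs.trans ht.symm)
  · exact h1' (hs.trans ht.symm)

/-- Counted waypoint by waypoint: each contributes to at most one of the disjoint cycles, by
`inner_unique`. This makes the lower bounds of the single cycles additive. -/
theorem sum_innerCount_le (hG : G.Connected) {ι : Type*} (C : Finset ι) (B : ι → CycleBlock G)
    (hd : ∀ i ∈ C, ∀ j ∈ C, i ≠ j → Disjoint (B i).edges (B j).edges) {s t : V}
    (hst : ∀ i ∈ C, ¬ (B i).Equiv s t) (W : List V) :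
    ∑ i ∈ C, (B i).innerCount s t W ≤ W.length := by
  classical
  induction W with
  | nil => simp [innerCount]
  | cons w ws ih =>
    have h1 : ∀ i, (B i).innerCount s t (w :: ws) = (B i).innerCount s t ws +
        if ¬ (B i).Equiv s w ∧ ¬ (B i).Equiv w t then 1 else 0 := by
      intro i
      simp only [innerCount, List.countP_cons, decide_eq_true_eq]
    simp only [h1]
    rw [sum_add_distrib, List.length_cons, ← card_filter]
    refine Nat.add_le_add ih (card_le_one.2 ?_)
    intro i hi j hj
    rw [mem_filter] at hi hj
    by_contra hne
    exact inner_unique hG (hd i hi.1 j hj.1 hne) (hst i hi.1) hi.2 (hst j hj.1) hj.2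

/-! ### Detours -/

/-- A path taking the other side is exchanged. An edge on the other side of both paths would
contradict the exchange, so the new path takes `U`. -/
theorem exists_trail_of_links {U : Finset (Sym2 V)} {s t : V} (hG : G.Connected)
    (hst : ¬ B.Equiv s t) (hU : B.Links U s t) :
    ∃ p : G.Walk s t, p.IsTrail ∧ B.edges.filter (· ∈ p.edges) = U := by
  obtain ⟨p, hp⟩ := (hG.preconnected s t).exists_isPath
  rcases trace_eq_or hU hp.isTrail with h | h
  · exact ⟨p, hp.isTrail, h⟩
  · obtain ⟨q, hq, hpq⟩ := exists_exchange (B := B) hp.isTrail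
    refine ⟨q, hq.isTrail, (trace_eq_or hU hq.isTrail).resolve_right fun h' => hst ?_⟩
    rw [hU.equiv_iff]
    right
    refine Finset.Subset.antisymm hU.1 fun e he => ?_
    by_contra heU
    have h1 : e ∈ B.edges \ U := mem_sdiff.2 ⟨he, heU⟩
    grind

theorem card_trace {s t : V} {p : G.Walk s t} (hp : p.IsTrail) :
    (B.edges.filter (· ∈ p.edges)).card = p.edges.countP (· ∈ B.edges) := by
  rw [List.countP_eq_length_filter, ← List.toFinset_card_of_nodup (hp.edges_nodup.filter _)]
  congr 1
  ext e
  simp [and_comm]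

/-- The walk is cut right after its `i`-th cycle edge, so the point of division lies on the cycle.
-/
theorem exists_split {s t : V} (p : G.Walk s t) {i : ℕ} (h1 : 1 ≤ i)
    (hi : i ≤ p.edges.countP (· ∈ B.edges)) :
    ∃ w ∈ B.verts, ∃ (q : G.Walk s w) (r : G.Walk w t), p = q.append r ∧
      q.edges.countP (· ∈ B.edges) = i := by
  induction p generalizing i with
  | nil => simp at hi; omega
  | @cons u v w hadj p ih =>
    rw [SimpleGraph.Walk.edges_cons, List.countP_cons] at hi
    by_cases hB : s(u, v) ∈ B.edges
    · rcases h1.eq_or_lt with rfl | h1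
      · exact ⟨v, ⟨_, hB, by simp⟩, .cons hadj .nil, p, rfl, by simp [hB]⟩
      · obtain ⟨z, hz, q, r, rfl, hq⟩ := ih (i := i - 1) (by omega) (by simp [hB] at hi; omega)
        refine ⟨z, hz, .cons hadj q, r, rfl, ?_⟩
        rw [SimpleGraph.Walk.edges_cons, List.countP_cons, hq]
        simp [hB]
        omega
    · obtain ⟨z, hz, q, r, rfl, hq⟩ := ih h1 (by simpa [hB] using hi)
      refine ⟨z, hz, .cons hadj q, r, rfl, ?_⟩
      rw [SimpleGraph.Walk.edges_cons, List.countP_cons, hq]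
      simp [hB]

/-- A waypoint after every `(L - 1) / 2` cycle edges makes each segment span strictly less than half
of the cycle, so that it follows the trail there. -/
theorem exists_waypoints (hG : G.Connected) (j : ℕ) {s t : V} {p : G.Walk s t} (hp : p.IsTrail)
    (hj : (B.edges.filter (· ∈ p.edges)).card ≤ (j + 1) * ((B.edges.card - 1) / 2)) :
    ∃ ws : List V, ws.length ≤ j ∧ (∀ w ∈ ws, w ∈ B.verts) ∧
      ∀ e ∈ B.edges, pathLoad G e s ws t = if e ∈ p.edges then 1 else 0 := by
  have hL := B.three_le
  have hshort : ∀ {s t : V} {p : G.Walk s t}, p.IsTrail →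
      (B.edges.filter (· ∈ p.edges)).card ≤ (B.edges.card - 1) / 2 →
      ∀ e ∈ B.edges, edgeFlow G s t e = if e ∈ p.edges then 1 else 0 := by
    intro s t p hp hc e he
    rw [edgeFlow_of_short hG (links_trail hp) (by omega) he]
    simp [he]
  induction j generalizing s with
  | zero => exact ⟨[], le_rfl, by simp, hshort hp (by simpa using hj)⟩
  | succ j ih =>
    by_cases hc : (B.edges.filter (· ∈ p.edges)).card ≤ (B.edges.card - 1) / 2
    · exact ⟨[], by simp, by simp, hshort hp hc⟩
    · obtain ⟨w, hw, q, r, rfl, hq⟩ := exists_split (B := B) p (i := (B.edges.card - 1) / 2)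
        (by omega) (by rw [← card_trace hp]; omega)
      have hqt : q.IsTrail := hp.of_append_left
      have hrt : r.IsTrail := hp.of_append_right
      have hsum := card_trace (B := B) hp
      rw [SimpleGraph.Walk.edges_append, List.countP_append, hq, ← card_trace hrt] at hsum
      rw [SimpleGraph.Walk.edges_append] at hj
      rw [hsum] at hj
      obtain ⟨ws, h1, h2, h3⟩ := ih hrt (by
        have : (j + 1 + 1) * ((B.edges.card - 1) / 2) =
          (B.edges.card - 1) / 2 + (j + 1) * ((B.edges.card - 1) / 2) := by ring
        omega)
      refine ⟨w :: ws, by simpa using h1, ?_, fun e he => ?_⟩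
      · grind
      · rw [pathLoad, h3 e he, hshort hqt (by rw [card_trace hqt, hq]) e he]
        have hnd := hp.edges_nodup
        rw [SimpleGraph.Walk.edges_append, List.nodup_append] at hnd
        rw [SimpleGraph.Walk.edges_append]
        grind

/-- A detour along a given side of a cycle. -/
theorem exists_detour (hG : G.Connected) {U : Finset (Sym2 V)} {s t : V}
    (hst : ¬ B.Equiv s t) (hU : B.Links U s t) :
    ∃ ws : List V, ws.length ≤ detourCost B.edges.card U.card ∧ (∀ w ∈ ws, w ∈ B.verts) ∧
      ∀ e ∈ B.edges, pathLoad G e s ws t = if e ∈ U then 1 else 0 := by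
  obtain ⟨p, hp, hpU⟩ := exists_trail_of_links hG hst hU
  have hL := B.three_le
  have hlt : U.card < B.edges.card := by
    refine card_lt_card ⟨hU.1, fun h => hst ?_⟩
    rw [hU.equiv_iff]
    exact Or.inr (Finset.Subset.antisymm hU.1 h)
  -- With `h = (L - 1) / 2` one has `U.card ≤ L - 1 ≤ 2 * h + 1 ≤ 3 * h`, the last because `L ≥ 3`;
  -- hence two waypoints always suffice.
  obtain ⟨ws, h1, h2, h3⟩ := exists_waypoints (B := B) hG (detourCost B.edges.card U.card) hp (by
    rw [hpU]
    unfold detourCost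
    split_ifs <;> omega)
  grind

end CycleBlock

/-- The pair `x, y` is the first step of the list that leaves `P`. The new waypoints are inserted
between them, so only this one segment is replaced. The position does not depend on the inserted
list. -/
theorem exists_insertion (P : V → Prop) {s t : V} (hs : P s) (ht : ¬ P t) (W : List V) :
    ∃ x y, P x ∧ ¬ P y ∧ (x = s ∨ x ∈ W) ∧ (y = t ∨ y ∈ W) ∧ ∀ ws : List V, ∃ W' : List V,
      W'.length = W.length + ws.length ∧ (∀ w ∈ W', w ∈ W ∨ w ∈ ws) ∧
      ∀ (G : SimpleGraph V) (e : Sym2 V), pathLoad G e s W' t + edgeFlow G x y e =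
        pathLoad G e s W t + pathLoad G e x ws y := by
  induction W generalizing s with
  | nil =>
    refine ⟨s, t, hs, ht, Or.inl rfl, Or.inl rfl, fun ws => ⟨ws, by simp, fun w hw => Or.inr hw,
      fun G e => ?_⟩⟩
    rw [add_comm]
    rfl
  | cons w W ih =>
    by_cases hw : P w
    · obtain ⟨x, y, hx, hy, hx', hy', h⟩ := ih hw
      refine ⟨x, y, hx, hy, ?_, ?_, fun ws => ?_⟩
      · rcases hx' with rfl | h <;> simp [*]
      · rcases hy' with rfl | h <;> simp [*]
      · obtain ⟨W', h1, h2, h3⟩ := h ws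
        refine ⟨w :: W', by simp [h1]; omega, ?_, fun G e => ?_⟩
        · grind
        · rw [pathLoad, pathLoad]
          linarith [h3 G e]
    · refine ⟨s, w, hs, hw, Or.inl rfl, Or.inr (by simp), fun ws => ⟨ws ++ w :: W, ?_, ?_, ?_⟩⟩
      · simp; omega
      · grind
      · intro G e
        rw [pathLoad_append, pathLoad]
        ring

/-- The relation is that of having the same projection to another cycle or to a bridge. If the
inserted waypoints all project as one end of the segment does, a single step carries the whole load
and the others carry none. -/
theorem pathLoad_of_stay {e : Sym2 V} {R : V → V → Prop} (hR : ∀ a b, R a b → R b a)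
    (h0 : ∀ a b, R a b → edgeFlow G a b e = 0)
    (h1 : ∀ a b c, R a b → edgeFlow G a c e = edgeFlow G b c e)
    (h2 : ∀ a b c, R a b → edgeFlow G c a e = edgeFlow G c b e) {x y : V} {ws : List V}
    (hW : ∀ w ∈ ws, ∀ w' ∈ ws, R w w')
    (hws : (∀ w ∈ ws, R x w) ∨ (∀ w ∈ ws, R y w)) :
    pathLoad G e x ws y = edgeFlow G x y e := by
  rcases hws with hws | hws
  · induction ws generalizing x with
    | nil => rfl
    | cons w ws ih =>
      rw [pathLoad, h0 x w (hws w (by simp)), zero_add, h1 x w y (hws w (by simp))]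
      refine ih (fun a ha b hb => hW a (by simp [ha]) b (by simp [hb])) fun z hz => ?_
      exact hW w (by simp) z (by simp [hz])
  · have hz : ∀ w : V, R y w → (∀ z ∈ ws, R w z) → pathLoad G e w ws y = 0 := by
      induction ws with
      | nil => exact fun w hw _ => h0 w y (hR _ _ hw)
      | cons z ws ih =>
        intro w hw hz
        rw [pathLoad, h0 w z (hz z (by simp)), zero_add]
        exact ih (fun a ha b hb => hW a (by simp [ha]) b (by simp [hb]))
          (fun a ha => hws a (by simp [ha])) z (hws z (by simp))
          fun a ha => hW z (by simp) a (by simp [ha])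
    cases ws with
    | nil => rfl
    | cons w ws =>
      have h3 := hz w (hws w (by simp)) fun z hz' => hW w (by simp) z hz'
      rw [pathLoad, h0 w w (hW w (by simp) w (by simp)), zero_add] at h3
      rw [pathLoad, h3, add_zero, h2 y w x (hws w (by simp))]

namespace CycleBlock

/-- A segment path realizing prescribed sides of some cycles and the default elsewhere. -/
theorem exists_routing (hG : G.Connected) {ι : Type*} [DecidableEq ι] (B : ι → CycleBlock G)
    (hd : ∀ i j, i ≠ j → Disjoint (B i).edges (B j).edges) {s t : V}
    (U : ι → Finset (Sym2 V)) (C : Finset ι) (hst : ∀ i ∈ C, ¬ (B i).Equiv s t)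
    (hU : ∀ i ∈ C, (B i).Links (U i) s t) :
    ∃ W : List V, W.length ≤ ∑ i ∈ C, detourCost (B i).edges.card (U i).card ∧
      (∀ w ∈ W, ∃ i ∈ C, w ∈ (B i).verts) ∧
      (∀ i ∈ C, ∀ e ∈ (B i).edges, pathLoad G e s W t = if e ∈ U i then 1 else 0) ∧
      (∀ i, i ∉ C → ∀ e ∈ (B i).edges, pathLoad G e s W t = edgeFlow G s t e) ∧
      (∀ (g : V → ZMod 2) (b : Sym2 V), b ∈ G.edgeSet →
        (∀ e' ∈ G.edgeSet, coboundary g e' = bit (e' = b)) →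
        (∀ i, b ∉ (B i).edges) → pathLoad G b s W t = edgeFlow G s t b) := by
  induction C using Finset.induction_on with
  | empty =>
    exact ⟨[], by simp, by simp, by simp, fun _ _ _ _ => rfl, fun _ _ _ _ _ => rfl⟩
  | insert c C hc ih =>
    obtain ⟨W, h1, h2, h3, h4, h5⟩ := ih (fun i hi => hst i (mem_insert_of_mem hi))
      (fun i hi => hU i (mem_insert_of_mem hi))
    have hstc := hst c (mem_insert_self _ _)
    -- A waypoint on another cycle `i` projects to cycle `c` as the whole of `i` does. As `i`
    -- separates `s` from `t`, one of these two projects there as well.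
    have hend : ∀ w ∈ W, (B c).Equiv s w ∨ (B c).Equiv t w := by
      intro w hw
      obtain ⟨i, hi, hwi⟩ := h2 w hw
      have hne : i ≠ c := fun h => hc (h ▸ hi)
      obtain ⟨z, hz⟩ := (B c).exists_mem_verts
      have key := equiv_or_equiv hG (hd i c hne)
      rcases key s with hs | hs
      · rcases key t with ht | ht
        · exact absurd ((hs z hz).trans (ht z hz).symm) (hst i (mem_insert_of_mem hi))
        · exact Or.inr (ht w hwi)
      · exact Or.inl (hs w hwi)
    -- The segment from `x` to `y` is where the old list moves on cycle `c` from the projection of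
    -- `s` to that of `t`; the detour replaces it.
    obtain ⟨x, y, hx, hy, hx', hy', hins⟩ := exists_insertion (fun v => (B c).Equiv s v)
      (Equiv.refl s) hstc W
    have hyt : (B c).Equiv t y := by
      rcases hy' with rfl | h
      · exact Equiv.refl _
      · exact (hend y h).resolve_left hy
    have hxy : ¬ (B c).Equiv x y := fun h => hy (hx.trans h)
    obtain ⟨ws, hws1, hws2, hws3⟩ := exists_detour hG hxy
      ((hU c (mem_insert_self _ _)).congr hx hyt)
    obtain ⟨W', hW1, hW2, hW3⟩ := hins ws
    -- The detour stays on cycle `c`, which is a single point as seen from cycle `i`. Because `x`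
    -- and `y` differ on `c`, one of them projects to that same point, and `pathLoad_of_stay` shows
    -- that nothing changes on `i`.
    have hother : ∀ i, i ≠ c → ∀ e ∈ (B i).edges,
        pathLoad G e s W' t = pathLoad G e s W t := by
      intro i hi e he
      have hcov := equiv_or_equiv hG (hd c i hi.symm)
      have hstay : pathLoad G e x ws y = edgeFlow G x y e := by
        refine pathLoad_of_stay (R := (B i).Equiv) (fun _ _ h => h.symm)
          (fun a b h => edgeFlow_of_equiv hG h he)
          (fun a b c h => edgeFlow_congr hG h (Equiv.refl _) he)
          (fun a b c h => edgeFlow_congr hG (Equiv.refl _) h he)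
          (fun w hw w' hw' => equiv_of_mem_verts (hd c i hi.symm) (hws2 w hw) (hws2 w' hw')) ?_
        obtain ⟨z, hz⟩ := (B i).exists_mem_verts
        rcases hcov x with h | h
        · rcases hcov y with h' | h'
          · exact absurd ((h z hz).trans (h' z hz).symm) hxy
          · exact Or.inr fun w hw => h' w (hws2 w hw)
        · exact Or.inl fun w hw => h w (hws2 w hw)
      grind
    refine ⟨W', ?_, ?_, ?_, ?_, ?_⟩
    · rw [sum_insert hc, hW1]
      omega
    · grind
    · intro i hi e he
      rcases mem_insert.1 hi with rfl | hi
      · have h6 := hW3 G e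
        rw [h4 i hc e he, hws3 e he, edgeFlow_congr hG hx hyt he] at h6
        linarith
      · rw [hother i (fun h => hc (h ▸ hi)) e he, h3 i hi e he]
    · grind
    · intro g b hb hg hbi
      have hflow := edgeFlow_bridge hG hb hg
      have hstay : pathLoad G b x ws y = edgeFlow G x y b := by
        refine pathLoad_of_stay (R := fun a a' => g a = g a') (fun _ _ h => h.symm)
          (fun a a' h => by rw [hflow, if_pos h])
          (fun a a' c h => by rw [hflow, hflow, h])
          (fun a a' c h => by rw [hflow, hflow, h]) ?_ ?_
        · intro w hw w' hw'
          refine const_on_verts (B := B c) (fun e he => ?_) (hws2 w hw) (hws2 w' hw')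
          rw [hg e ((B c).mem_edgeSet _ he), bit_eq_zero]
          rintro rfl
          exact hbi c he
        · exact (equiv_or_bridge hG hg (hbi c) hxy).imp (fun h w hw => h w (hws2 w hw))
            (fun h w hw => h w (hws2 w hw))
      have := hW3 G b
      rw [hstay] at this
      rw [← h5 g b hb hg hbi]
      linarith

end CycleBlock

end Several

end CactusRouting
namespace CactusRouting

open scoped Classical

open Finset SimpleGraph


/-! ### Criterion for the existence of a routing -/

section Characterization

variable {V : Type*} [Fintype V] {G : SimpleGraph V} [DecidableEq V]

theorem one_le_pathLoad_bridge (hG : G.Connected) {g : V → ZMod 2} {b : Sym2 V}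
    (hb : b ∈ G.edgeSet) (hg : ∀ e' ∈ G.edgeSet, coboundary g e' = bit (e' = b)) {s t : V}
    (hst : g s ≠ g t) (W : List V) : 1 ≤ pathLoad G b s W t := by
  induction W generalizing s with
  | nil => rw [pathLoad, edgeFlow_bridge hG hb hg, if_neg hst]
  | cons w W ih =>
    rw [pathLoad]
    by_cases hw : g s = g w
    · have := ih (s := w) (hw ▸ hst)
      linarith [edgeFlow_nonneg G s w b]
    · rw [edgeFlow_bridge hG hb hg, if_neg hw]
      linarith [pathLoad_nonneg G b w W t]

theorem CycleBlock.edgeFlow_le_one (hG : G.Connected) (B : CycleBlock G) (s t : V) {e : Sym2 V}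
    (he : e ∈ B.edges) : edgeFlow G s t e ≤ 1 := by
  obtain ⟨U, hU, hc⟩ := B.exists_links_le hG s t
  rcases hc.lt_or_eq with h | h
  · rw [edgeFlow_of_short hG hU h he]
    split_ifs <;> norm_num
  · rw [edgeFlow_of_half hG hU h he]
    norm_num

/-- The chosen side of a cycle. -/
def CycleBlock.side (B : CycleBlock G) (X : Finset (Sym2 V)) (co : Prop) [Decidable co] :
    Finset (Sym2 V) := if co then B.edges \ X else X

theorem CycleBlock.Links.side {B : CycleBlock G} {X : Finset (Sym2 V)} {s t : V}
    (h : B.Links X s t) (co : Prop) [Decidable co] : B.Links (B.side X co) s t := by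
  unfold CycleBlock.side
  split_ifs
  · exact h.compl
  · exact h

/-- A cycle needs no waypoints if at most one demand passes through it, or two demands both of
which are divided evenly. -/
def NoDetour {d : ℕ} (B : CycleBlock G) (s t : Fin d → V) (X : Fin d → Finset (Sym2 V)) : Prop :=
  (∀ i j, ¬ B.Equiv (s i) (t i) → ¬ B.Equiv (s j) (t j) → i = j) ∨
  ((∀ i j l, ¬ B.Equiv (s i) (t i) → ¬ B.Equiv (s j) (t j) → ¬ B.Equiv (s l) (t l) →
      i = j ∨ i = l ∨ j = l) ∧
    ∀ i, ¬ B.Equiv (s i) (t i) → 2 * (X i).card = B.edges.card)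

theorem sum_le_one_of_subsingleton {d : ℕ} {f : Fin d → ℚ} {P : Fin d → Prop}
    (h0 : ∀ i, ¬ P i → f i = 0) (h1 : ∀ i, f i ≤ 1) (hP : ∀ i j, P i → P j → i = j) :
    ∑ i, f i ≤ 1 := by
  by_cases h : ∃ i, P i
  · obtain ⟨i, hi⟩ := h
    rw [sum_eq_single i]
    · exact h1 i
    · exact fun j _ hj => h0 j fun hPj => hj (hP j i hPj hi)
    · simp
  · push Not at h
    rw [sum_eq_zero fun i _ => h0 i (h i)]
    norm_num

theorem pair_le_sum {d : ℕ} {f : Fin d → ℚ} (h0 : ∀ i, 0 ≤ f i) {i j : Fin d} (hij : i ≠ j) :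
    f i + f j ≤ ∑ i, f i := by
  rw [← sum_pair hij]
  exact sum_le_univ_sum_of_nonneg h0

-- For necessity, the sides are read off from the loads, and `sum_innerCount_le` bounds their total
-- cost by the number of waypoints. For sufficiency, `exists_routing` realizes the chosen sides
-- where a choice is needed and the direct flow elsewhere. The set `X c i` is a reference side and
-- `co c i` says whether its complement is used instead.
open CycleBlock in
theorem routing_iff (hG : G.Connected) {ι : Type*} [Fintype ι] (B : ι → CycleBlock G)
    (hd : ∀ i j, i ≠ j → Disjoint (B i).edges (B j).edges) {β : Type*} (g : β → V → ZMod 2)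
    (b : β → Sym2 V) (hb : ∀ r, b r ∈ G.edgeSet)
    (hg : ∀ r, ∀ e' ∈ G.edgeSet, coboundary (g r) e' = bit (e' = b r))
    (hbB : ∀ r i, b r ∉ (B i).edges)
    (hcover : ∀ e ∈ G.edgeSet, (∃ c, e ∈ (B c).edges) ∨ ∃ r, e = b r) {d : ℕ}
    (s t : Fin d → V) (X : ι → Fin d → Finset (Sym2 V))
    (hX : ∀ c i, (B c).Links (X c i) (s i) (t i)) (k : ℕ) :
    (∃ W : Fin d → List V, (∀ i, (W i).length ≤ k) ∧
      ∀ x y, G.Adj x y → ∑ i, pathLoad G s(x, y) (s i) (W i) (t i) ≤ 1) ↔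
    (∀ r i j, g r (s i) ≠ g r (t i) → g r (s j) ≠ g r (t j) → i = j) ∧
    ∃ co : ι → Fin d → Prop,
      (∀ c, NoDetour (B c) s t (X c) ∨ ∀ i j, i ≠ j → ¬ (B c).Equiv (s i) (t i) →
        ¬ (B c).Equiv (s j) (t j) →
        Disjoint ((B c).side (X c i) (co c i)) ((B c).side (X c j) (co c j))) ∧
      ∀ i, ∑ c, (if NoDetour (B c) s t (X c) ∨ (B c).Equiv (s i) (t i) then 0 else
        detourCost (B c).edges.card ((B c).side (X c i) (co c i)).card) ≤ k := by
  constructor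
  · rintro ⟨W, hWk, hW⟩
    have hWe : ∀ e ∈ G.edgeSet, ∑ i, pathLoad G e (s i) (W i) (t i) ≤ 1 := by
      intro e he
      induction e with
      | _ x y => exact hW x y he
    have hle : ∀ e ∈ G.edgeSet, ∀ i, pathLoad G e (s i) (W i) (t i) ≤ 1 := fun e he i =>
      (single_le_sum (f := fun i => pathLoad G e (s i) (W i) (t i))
        (fun i _ => pathLoad_nonneg G e (s i) (W i) (t i))
        (mem_univ i)).trans (hWe e he)
    have hpair : ∀ e ∈ G.edgeSet, ∀ i j, i ≠ j →
        pathLoad G e (s i) (W i) (t i) + pathLoad G e (s j) (W j) (t j) ≤ 1 := fun e he i j hij =>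
      (pair_le_sum (f := fun i => pathLoad G e (s i) (W i) (t i))
        (fun i => pathLoad_nonneg ..) hij).trans (hWe e he)
    refine ⟨fun r i j hi hj => ?_, ?_⟩
    · by_contra hne
      have h1 := hpair (b r) (hb r) i j hne
      have h2 := one_le_pathLoad_bridge hG (hb r) (hg r) hi (W i)
      have h3 := one_le_pathLoad_bridge hG (hb r) (hg r) hj (W j)
      linarith
    -- The complement is declared chosen when the load is exactly that of the complement.
    · obtain ⟨co, hcodef⟩ : ∃ co : ι → Fin d → Prop, ∀ c i, co c i ↔ ∀ e ∈ (B c).edges,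
          pathLoad G e (s i) (W i) (t i) = if e ∈ (B c).edges \ X c i then 1 else 0 :=
        ⟨_, fun _ _ => Iff.rfl⟩
      -- If one demand is split evenly on a cycle, another demand following a side would give the
      -- load `3/2` somewhere; so all demands meeting the cycle are split evenly.
      have hhalf : ∀ c i, (∃ U, (B c).Links U (s i) (t i) ∧ 2 * U.card = (B c).edges.card ∧
          ∀ e ∈ (B c).edges, pathLoad G e (s i) (W i) (t i) = 1 / 2) →
          ∀ j, j ≠ i → ¬ (B c).Equiv (s j) (t j) →
          (∃ U, (B c).Links U (s j) (t j) ∧ 2 * U.card = (B c).edges.card ∧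
          ∀ e ∈ (B c).edges, pathLoad G e (s j) (W j) (t j) = 1 / 2) := by
        rintro c i ⟨U, hU, hUc, hf⟩ j hj hjE
        rcases pathLoad_cases hG (B := B c) (W := W j)
          (fun e he => hle e ((B c).mem_edgeSet e he) j) with ⟨U', hU', hf'⟩ | h
        · exfalso
          rw [hU'.equiv_iff, not_or] at hjE
          obtain ⟨e, he⟩ := nonempty_iff_ne_empty.2 hjE.1
          have h1 := hpair e ((B c).mem_edgeSet e (hU'.1 he)) i j hj.symm
          rw [hf e (hU'.1 he), hf' e (hU'.1 he), if_pos he] at h1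
          norm_num at h1
        · exact h
      have hunit : ∀ c, ¬ NoDetour (B c) s t (X c) → ∀ i, ¬ (B c).Equiv (s i) (t i) →
          ∀ e ∈ (B c).edges, pathLoad G e (s i) (W i) (t i) =
            if e ∈ (B c).side (X c i) (co c i) then 1 else 0 := by
        intro c hc i hi
        rcases pathLoad_cases hG (B := B c) (W := W i)
          (fun e he => hle e ((B c).mem_edgeSet e he) i) with ⟨U', hU', hf'⟩ | hh
        · unfold CycleBlock.side
          split_ifs with hco
          · exact (hcodef c i).1 hco
          · rcases (hX c i).eq_or_eq_compl hU' with rfl | rfl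
            · exact hf'
            · exact absurd ((hcodef c i).2 hf') hco
        · exfalso
          -- With an even split present, at most two demands fit on the cycle and all their sides
          -- are halves; such a cycle needs no detour.
          refine hc (Or.inr ⟨fun i₁ i₂ i₃ h1 h2 h3 => ?_, fun j hj => ?_⟩)
          · have hval : ∀ j, ¬ (B c).Equiv (s j) (t j) → ∀ e ∈ (B c).edges,
                pathLoad G e (s j) (W j) (t j) = 1 / 2 := by
              intro j hj
              by_cases hji : j = i
              · grind
              · obtain ⟨-, -, -, h⟩ := hhalf c i hh j hji hj
                exact h
            by_contra hne
            simp only [not_or] at hne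
            have he := (B c).base_mem
            have h4 := hWe _ ((B c).mem_edgeSet _ he)
            have h5 : ∑ j ∈ ({i₁, i₂, i₃} : Finset (Fin d)),
                pathLoad G (B c).base (s j) (W j) (t j) ≤ 1 :=
              (sum_le_univ_sum_of_nonneg fun j => pathLoad_nonneg ..).trans h4
            rw [sum_insert (by simp [hne.1, hne.2.1]), sum_pair hne.2.2,
              hval _ h1 _ he, hval _ h2 _ he, hval _ h3 _ he] at h5
            norm_num at h5
          · have hj' : ∃ U, (B c).Links U (s j) (t j) ∧ 2 * U.card = (B c).edges.card := by
              by_cases hji : j = i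
              · grind
              · obtain ⟨U, h, h', -⟩ := hhalf c i hh j hji hj
                exact ⟨U, h, h'⟩
            obtain ⟨U, hU, hUc⟩ := hj'
            rcases hU.eq_or_eq_compl (hX c j) with h | h
            · rw [h]; exact hUc
            · have := card_sdiff_add_card_eq_card hU.1
              rw [← h] at this
              omega
      refine ⟨co, fun c => ?_, fun i => ?_⟩
      · by_cases hc : NoDetour (B c) s t (X c)
        · exact Or.inl hc
        · right
          intro i j hij hi hj
          exact disjoint_of_load_le ((hX c i).side _).1 (hunit c hc i hi) (hunit c hc j hj)
            fun e he => hpair e ((B c).mem_edgeSet e he) i j hij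
      · rw [← sum_filter_add_sum_filter_not univ
          (fun c => NoDetour (B c) s t (X c) ∨ (B c).Equiv (s i) (t i)),
          sum_eq_zero, zero_add]
        · refine le_trans ?_ ((sum_innerCount_le hG (univ.filter fun c =>
            ¬ (NoDetour (B c) s t (X c) ∨ (B c).Equiv (s i) (t i))) B
            (fun i _ j _ => hd i j) (s := s i) (t := t i) ?_ (W i)).trans (hWk i))
          · refine sum_le_sum fun c hc => ?_
            have hc := (mem_filter.1 hc).2
            rw [if_neg hc]
            rw [not_or] at hc
            exact detourCost_le_innerCount hG hc.2 ((hX c i).side _) (hunit c hc.1 i hc.2)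
          · grind
        · intro c hc
          rw [if_pos (mem_filter.1 hc).2]
  · rintro ⟨hbr, co, hco, hk⟩
    have hroute := fun i => exists_routing hG B hd (s := s i) (t := t i)
      (fun c => (B c).side (X c i) (co c i))
      (univ.filter fun c => ¬ (NoDetour (B c) s t (X c) ∨ (B c).Equiv (s i) (t i)))
      (fun c hc => fun h => (mem_filter.1 hc).2 (Or.inr h))
      (fun c _ => (hX c i).side _)
    choose W h1 _ h3 h4 h5 using hroute
    refine ⟨W, fun i => ?_, fun x y hxy => ?_⟩
    · refine (h1 i).trans (le_trans (le_of_eq ?_) (hk i))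
      rw [sum_filter]
      refine sum_congr rfl fun c _ => ?_
      rw [ite_not]
    · rcases hcover s(x, y) hxy with ⟨c, hc⟩ | ⟨r, hr⟩
      · have hzero : ∀ i, (B c).Equiv (s i) (t i) →
            pathLoad G s(x, y) (s i) (W i) (t i) = 0 := by
          intro i hi
          rw [h4 i c (by simp [hi]) _ hc, edgeFlow_of_equiv hG hi hc]
        by_cases hn : NoDetour (B c) s t (X c)
        · have hval : ∀ i, pathLoad G s(x, y) (s i) (W i) (t i) = edgeFlow G (s i) (t i) s(x, y) :=
            fun i => h4 i c (by simp [hn]) _ hc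
          rcases hn with hn | ⟨hn, hn'⟩
          · exact sum_le_one_of_subsingleton (P := fun i => ¬ (B c).Equiv (s i) (t i))
              (fun i hi => hzero i (not_not.1 hi))
              (fun i => (hval i).le.trans (edgeFlow_le_one hG _ _ _ hc)) hn
          · have hhalf : ∀ i, ¬ (B c).Equiv (s i) (t i) →
                pathLoad G s(x, y) (s i) (W i) (t i) = 1 / 2 := fun i hi =>
              (hval i).trans (edgeFlow_of_half hG (hX c i) (hn' i hi) hc)
            have hcard : (univ.filter fun i => ¬ (B c).Equiv (s i) (t i)).card ≤ 2 := by
              by_contra hcon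
              rw [not_le, two_lt_card] at hcon
              obtain ⟨i, hi, j, hj, l, hl, h6, h7, h8⟩ := hcon
              rcases hn i j l (mem_filter.1 hi).2 (mem_filter.1 hj).2
                (mem_filter.1 hl).2 with h | h | h <;> contradiction
            rw [← sum_filter_add_sum_filter_not univ
              (fun i => ¬ (B c).Equiv (s i) (t i)),
              sum_congr rfl (fun i hi => hhalf i (mem_filter.1 hi).2),
              sum_eq_zero (s := univ.filter _)
                (fun i hi => hzero i (not_not.1 (mem_filter.1 hi).2)), sum_const,
              nsmul_eq_mul]
            have : ((univ.filter fun i => ¬ (B c).Equiv (s i) (t i)).card : ℚ) ≤ 2 := by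
              exact_mod_cast hcard
            linarith
        · have hdis := (hco c).resolve_left hn
          refine sum_le_one_of_subsingleton (P := fun i => ¬ (B c).Equiv (s i) (t i) ∧
            s(x, y) ∈ (B c).side (X c i) (co c i)) ?_ ?_ ?_
          · grind
          · grind
          · intro i j hi hj
            by_contra hij
            exact disjoint_left.1 (hdis i j hij hi.1 hj.1) hi.2 hj.2
      · have hval : ∀ i, pathLoad G s(x, y) (s i) (W i) (t i) =
            if g r (s i) = g r (t i) then 0 else 1 := by
          intro i
          rw [hr, h5 i (g r) (b r) (hb r) (hg r) (hbB r), edgeFlow_bridge hG (hb r) (hg r)]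
        refine sum_le_one_of_subsingleton (P := fun i => g r (s i) ≠ g r (t i)) ?_ ?_ (hbr r)
        · intro i hi
          rw [hval, if_pos (not_not.1 hi)]
        · grind

end Characterization

end CactusRouting
namespace CactusRouting

open scoped Classical
noncomputable section

open Finset SimpleGraph


/-! ### Rooted spanning trees of cacti -/

/-- In the forest with parent function `par`, the node `j` is an ancestor of `x` or `x` itself. -/
def Anc (par : ℕ → ℕ) (j x : ℕ) : Prop := ∃ m, par^[m] x = j

section Anc

variable {par : ℕ → ℕ}

theorem Anc.refl (x : ℕ) : Anc par x x := ⟨0, rfl⟩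

theorem Anc.of_par {j x : ℕ} (h : Anc par j (par x)) : Anc par j x := by
  obtain ⟨m, hm⟩ := h
  exact ⟨m + 1, by rwa [Function.iterate_succ_apply]⟩

theorem anc_iff {j x : ℕ} : Anc par j x ↔ x = j ∨ Anc par j (par x) := by
  refine ⟨?_, ?_⟩
  · rintro ⟨m, hm⟩
    cases m with
    | zero => exact Or.inl hm
    | succ m => exact Or.inr ⟨m, by rwa [Function.iterate_succ_apply] at hm⟩
  · rintro (rfl | h)
    · exact Anc.refl _
    · exact h.of_par

theorem Anc.trans {i j x : ℕ} (h : Anc par i j) (h' : Anc par j x) : Anc par i x := by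
  obtain ⟨m, rfl⟩ := h'
  obtain ⟨m', rfl⟩ := h
  exact ⟨m' + m, by rw [Function.iterate_add_apply]⟩

variable (h0 : par 0 = 0) (hpar : ∀ j, 0 < j → par j < j)
include h0 hpar

theorem par_le (j : ℕ) : par j ≤ j := by
  grind

theorem Anc.le {j x : ℕ} (h : Anc par j x) : j ≤ x := by
  obtain ⟨m, rfl⟩ := h
  induction m generalizing x with
  | zero => exact le_rfl
  | succ m ih =>
    rw [Function.iterate_succ_apply]
    exact ih.trans (par_le h0 hpar x)

theorem anc_zero (x : ℕ) : Anc par 0 x := by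
  induction x using Nat.strong_induction_on with
  | _ x ih =>
    rcases Nat.eq_zero_or_pos x with rfl | h
    · exact Anc.refl 0
    · exact (ih _ (hpar x h)).of_par

/-- Ancestors of one node form a chain, and the numbering tells which of two is the higher one. -/
theorem Anc.chain {u v x : ℕ} (hu : Anc par u x) (hv : Anc par v x) (h : v ≤ u) : Anc par v u := by
  induction x using Nat.strong_induction_on with
  | _ x ih =>
    rcases anc_iff.1 hu with rfl | hu'
    · exact hv
    · rcases anc_iff.1 hv with rfl | hv'
      · have := hu.le h0 hpar
        have : u = x := le_antisymm this h
        exact this ▸ Anc.refl _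
      · rcases Nat.eq_zero_or_pos x with rfl | hx
        · rw [h0] at hu' hv'
          have h1 := hu'.le h0 hpar
          grind
        · exact ih _ (hpar x hx) hu' hv'

/-- Passing from a node to its parent only leaves the subtree of that node. -/
theorem anc_par_iff {i j : ℕ} (hi : 0 < i) :
    Anc par j (par i) ↔ Anc par j i ∧ i ≠ j := by
  constructor
  · intro h
    refine ⟨h.of_par, ?_⟩
    rintro rfl
    exact absurd (h.le h0 hpar) (not_le.2 (hpar i hi))
  · rintro ⟨h, hne⟩
    exact (anc_iff.1 h).resolve_left hne

end Anc

/-- A rooted spanning tree whose nodes are numbered so that parents precede children. -/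
structure RootedTree {V : Type*} (G : SimpleGraph V) where
  n : ℕ
  par : ℕ → ℕ
  pos : V → ℕ
  ord : ℕ → V
  par_zero : par 0 = 0
  par_lt : ∀ j, 0 < j → par j < j
  pos_lt : ∀ x, pos x < n
  pos_ord : ∀ j, j < n → pos (ord j) = j
  ord_pos : ∀ x, ord (pos x) = x
  adj : ∀ j, 0 < j → j < n → G.Adj (ord j) (ord (par j))

namespace RootedTree

variable {V : Type*} {G : SimpleGraph V} (T : RootedTree G)

/-- The tree edge from a node to its parent. -/
def edge (j : ℕ) : Sym2 V := s(T.ord j, T.ord (T.par j))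

/-- The indicator of the subtree of a node. -/
def cutAt (j : ℕ) (x : V) : ZMod 2 := bit (Anc T.par j (T.pos x))

/-- The edge `f` is not an edge of the tree. -/
def NonTree (f : Sym2 V) : Prop := f ∈ G.edgeSet ∧ ∀ i, 0 < i → i < T.n → f ≠ T.edge i

theorem par_lt_n {i : ℕ} (hi : 0 < i) (hn : i < T.n) : T.par i < T.n :=
  (T.par_lt i hi).trans hn

theorem edge_mem {i : ℕ} (hi : 0 < i) (hn : i < T.n) : T.edge i ∈ G.edgeSet := T.adj i hi hn

/-- A tree edge leaves exactly one subtree, that of its own lower node. -/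
theorem coboundary_cutAt_edge {i j : ℕ} (hi : 0 < i) (hn : i < T.n) :
    coboundary (T.cutAt j) (T.edge i) = bit (i = j) := by
  rw [edge, coboundary_mk, cutAt, cutAt, T.pos_ord i hn, T.pos_ord _ (T.par_lt_n hi hn)]
  have h1 := anc_par_iff T.par_zero T.par_lt (i := i) (j := j) hi
  unfold bit
  by_cases h : i = j
  · subst h
    rw [if_pos (Anc.refl i), if_neg (fun h => (h1.1 h).2 rfl), if_pos rfl, add_zero]
  · grind

theorem edge_inj {i j : ℕ} (hi : 0 < i) (hn : i < T.n) (hj : 0 < j) (hjn : j < T.n)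
    (h : T.edge i = T.edge j) : i = j := by
  have h1 := T.coboundary_cutAt_edge (j := j) hi hn
  rw [h, T.coboundary_cutAt_edge hj hjn, bit_eq_one.2 rfl] at h1
  exact bit_eq_one.1 h1.symm

theorem exists_treePath_root (x : V) :
    ∃ p : G.Walk x (T.ord 0), ∀ e ∈ p.edges, ∃ i, 0 < i ∧ i < T.n ∧ e = T.edge i := by
  induction hk : T.pos x using Nat.strong_induction_on generalizing x with
  | _ k ih =>
    rcases Nat.eq_zero_or_pos k with rfl | hpos
    · have : x = T.ord 0 := by rw [← hk, T.ord_pos]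
      subst this
      exact ⟨.nil, by simp⟩
    · have hkn : k < T.n := hk ▸ T.pos_lt x
      have hx : x = T.ord k := by rw [← hk, T.ord_pos]
      subst hx
      obtain ⟨p, hp⟩ := ih (T.par k) (T.par_lt k hpos) (T.ord (T.par k))
        (T.pos_ord _ (T.par_lt_n hpos hkn))
      refine ⟨.cons (T.adj k hpos hkn) p, fun e he => ?_⟩
      rw [SimpleGraph.Walk.edges_cons, List.mem_cons] at he
      rcases he with rfl | he
      · exact ⟨k, hpos, hkn, rfl⟩
      · exact hp e he

theorem exists_treePath (x y : V) :
    ∃ p : G.Walk x y, p.IsPath ∧ ∀ e ∈ p.edges, ∃ i, 0 < i ∧ i < T.n ∧ e = T.edge i := by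
  obtain ⟨p, hp⟩ := T.exists_treePath_root x
  obtain ⟨q, hq⟩ := T.exists_treePath_root y
  refine ⟨(p.append q.reverse).bypass, SimpleGraph.Walk.bypass_isPath _, fun e he => ?_⟩
  have := SimpleGraph.Walk.edges_bypass_subset_edges _ he
  rw [SimpleGraph.Walk.edges_append, SimpleGraph.Walk.edges_reverse, List.mem_append,
    List.mem_reverse] at this
  grind

variable [DecidableEq V]

/-- On a path inside the tree, the label of the subtree below `j` changes only at the edge above
`j`, so parity detects whether that edge is used. -/
theorem edge_mem_treePath {x y : V} {p : G.Walk x y} (hp : p.IsPath)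
    (hT : ∀ e ∈ p.edges, ∃ i, 0 < i ∧ i < T.n ∧ e = T.edge i) {j : ℕ} (hj : 0 < j)
    (hjn : j < T.n) : T.edge j ∈ p.edges ↔ T.cutAt j x + T.cutAt j y = 1 := by
  rw [← sum_coboundary_trail (T.cutAt j) hp.isTrail]
  have h1 : ∀ e ∈ p.edges.toFinset, coboundary (T.cutAt j) e = bit (e = T.edge j) := by
    intro e he
    obtain ⟨i, hi, hn, rfl⟩ := hT e (List.mem_toFinset.1 he)
    rw [T.coboundary_cutAt_edge hi hn, bit_inj]
    exact ⟨fun h => h ▸ rfl, T.edge_inj hi hn hj hjn⟩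
  rw [sum_congr rfl h1]
  simp [bit]

/-- In a cactus a tree edge is covered by at most one further edge. -/
theorem cover_unique (hG : IsCactus G) {f f' : Sym2 V} (hf : T.NonTree f) (hf' : T.NonTree f')
    {j : ℕ} (hj : 0 < j) (hjn : j < T.n) (h : coboundary (T.cutAt j) f = 1)
    (h' : coboundary (T.cutAt j) f' = 1) : f = f' := by
  by_contra hne
  induction f with
  | _ a b =>
    induction f' with
    | _ a' b' =>
      obtain ⟨p, hp, hpT⟩ := T.exists_treePath b a
      obtain ⟨p', hp', hpT'⟩ := T.exists_treePath b' a'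
      have hab : G.Adj a b := hf.1
      have hab' : G.Adj a' b' := hf'.1
      rw [coboundary_mk, add_comm, ← T.edge_mem_treePath hp hpT hj hjn] at h
      rw [coboundary_mk, add_comm, ← T.edge_mem_treePath hp' hpT' hj hjn] at h'
      have hcyc : (SimpleGraph.Walk.cons hab p).IsCycle := by
        rw [SimpleGraph.Walk.cons_isCycle_iff]
        refine ⟨hp, fun hm => ?_⟩
        obtain ⟨i, hi, hin, he⟩ := hpT _ hm
        exact hf.2 i hi hin he
      have hcyc' : (SimpleGraph.Walk.cons hab' p').IsCycle := by
        rw [SimpleGraph.Walk.cons_isCycle_iff]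
        refine ⟨hp', fun hm => ?_⟩
        obtain ⟨i, hi, hin, he⟩ := hpT' _ hm
        exact hf'.2 i hi hin he
      -- The two fundamental cycles are distinct because each contains just one non-tree edge. Both
      -- contain the two ends of the tree edge above `j`, which a cactus forbids.
      have hsub : (SimpleGraph.Walk.cons hab p).toSubgraph ≠
          (SimpleGraph.Walk.cons hab' p').toSubgraph := by
        intro heq
        have h1 : s(a, b) ∈ (SimpleGraph.Walk.cons hab p).toSubgraph.edgeSet := by
          rw [SimpleGraph.Walk.mem_edges_toSubgraph]; simp
        rw [heq, SimpleGraph.Walk.mem_edges_toSubgraph, SimpleGraph.Walk.edges_cons,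
          List.mem_cons] at h1
        rcases h1 with h1 | h1
        · exact hne h1
        · obtain ⟨i, hi, hin, he⟩ := hpT' _ h1
          exact hf.2 i hi hin he
      have hss := hG.2 _ _ _ _ hcyc hcyc' hsub
      have hv : ∀ {x y z w : V} (c : G.Walk x y), s(z, w) ∈ c.edges →
          z ∈ c.toSubgraph.verts ∧ w ∈ c.toSubgraph.verts := by
        intro x y z w c hc
        simp only [SimpleGraph.Walk.mem_verts_toSubgraph]
        exact ⟨SimpleGraph.Walk.fst_mem_support_of_mem_edges _ hc,
          SimpleGraph.Walk.snd_mem_support_of_mem_edges _ hc⟩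
      have h1 := hv (SimpleGraph.Walk.cons hab p) (z := T.ord j) (w := T.ord (T.par j))
        (by rw [SimpleGraph.Walk.edges_cons]; exact List.mem_cons_of_mem _ h)
      have h2 := hv (SimpleGraph.Walk.cons hab' p') (z := T.ord j) (w := T.ord (T.par j))
        (by rw [SimpleGraph.Walk.edges_cons]; exact List.mem_cons_of_mem _ h')
      have := hss ⟨h1.1, h2.1⟩ ⟨h1.2, h2.2⟩
      exact G.ne_of_adj (T.adj j hj hjn) this

/-- The edges of the cycle closed by an edge outside the tree. -/
def cycleEdges (f : Sym2 V) : Finset (Sym2 V) :=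
  insert f (((Finset.Ioo 0 T.n).filter fun j => coboundary (T.cutAt j) f = 1).image T.edge)

/-- The lower node of an edge. -/
def child : Sym2 V → ℕ := Sym2.lift ⟨fun x y => max (T.pos x) (T.pos y), fun _ _ => max_comm _ _⟩

theorem child_edge {j : ℕ} (hj : 0 < j) (hn : j < T.n) : T.child (T.edge j) = j := by
  change max (T.pos (T.ord j)) (T.pos (T.ord (T.par j))) = j
  rw [T.pos_ord j hn, T.pos_ord _ (T.par_lt_n hj hn)]
  exact max_eq_left (T.par_lt j hj).le

theorem mem_cycleEdges {f e : Sym2 V} : e ∈ T.cycleEdges f ↔ e = f ∨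
    ∃ j, 0 < j ∧ j < T.n ∧ coboundary (T.cutAt j) f = 1 ∧ e = T.edge j := by
  simp only [cycleEdges, mem_insert, mem_image, mem_filter, mem_Ioo]
  grind

/-- By `cover_unique`, the subtree below a covered node `j` is attached to the rest by its tree edge
and by `f` only. -/
theorem cutAt_spec (hG : IsCactus G) {f : Sym2 V} (hf : T.NonTree f) {j : ℕ} (hj : 0 < j)
    (hn : j < T.n) (h : coboundary (T.cutAt j) f = 1) {e : Sym2 V} (he : e ∈ G.edgeSet) :
    coboundary (T.cutAt j) e = bit (e = T.edge j) + bit (e = f) := by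
  by_cases hT : T.NonTree e
  · rw [bit_eq_zero.2 (hT.2 j hj hn), zero_add]
    rcases zmod_two_cases (coboundary (T.cutAt j) e) with h1 | h1
    · rw [h1, eq_comm, bit_eq_zero]
      grind
    · rw [h1, eq_comm, bit_eq_one]
      exact T.cover_unique hG hT hf hj hn h1 h
  · obtain ⟨i, hi, hin, rfl⟩ : ∃ i, 0 < i ∧ i < T.n ∧ e = T.edge i := by
      by_contra hcon
      push Not at hcon
      exact hT ⟨he, hcon⟩
    have hne : T.edge i ≠ f := fun h => hf.2 i hi hin h.symm
    rw [T.coboundary_cutAt_edge hi hin, bit_eq_zero.2 hne, add_zero, bit_inj]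
    exact ⟨fun h => h ▸ rfl, T.edge_inj hi hin hj hn⟩

/-- The fundamental cycle of an edge outside the tree. -/
def block (hG : IsCactus G) (f : Sym2 V) (hf : T.NonTree f) : CycleBlock G where
  edges := T.cycleEdges f
  base := f
  -- For the base edge the required coboundary is twice its own indicator, that is zero, so the zero
  -- label serves.
  cut e := if e = f then fun _ => 0 else T.cutAt (T.child e)
  base_mem := T.mem_cycleEdges.2 (Or.inl rfl)
  mem_edgeSet e he := by
    rcases T.mem_cycleEdges.1 he with rfl | ⟨j, hj, hn, -, rfl⟩
    · exact hf.1
    · exact T.edge_mem hj hn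
  cut_spec e he e' he' := by
    rcases T.mem_cycleEdges.1 he with rfl | ⟨j, hj, hn, hc, rfl⟩
    · rw [if_pos rfl, zmod_two_add_self]
      induction e' with
      | _ x y => simp
    · rw [if_neg (fun h => hf.2 j hj hn h.symm), T.child_edge hj hn]
      exact T.cutAt_spec hG hf hj hn hc he'
  -- The cycle is `f` closed by the tree path between its ends; the coboundary telescopes along this
  -- path and cancels against `f`.
  even g := by
    induction f with
    | _ a b =>
      obtain ⟨p, hp, hpT⟩ := T.exists_treePath b a
      have h1 : T.cycleEdges s(a, b) = insert s(a, b) p.edges.toFinset := by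
        ext e
        rw [T.mem_cycleEdges, mem_insert, List.mem_toFinset]
        refine or_congr Iff.rfl ⟨?_, fun he => ?_⟩
        · rintro ⟨j, hj, hn, hc, rfl⟩
          rw [T.edge_mem_treePath hp hpT hj hn, add_comm]
          exact hc
        · obtain ⟨j, hj, hn, rfl⟩ := hpT e he
          rw [T.edge_mem_treePath hp hpT hj hn, add_comm] at he
          exact ⟨j, hj, hn, he, rfl⟩
      rw [h1, sum_insert, sum_coboundary_trail g hp.isTrail, coboundary_mk, add_comm (g b),
        zmod_two_add_self]
      rw [List.mem_toFinset]
      intro hm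
      obtain ⟨j, hj, hn, he⟩ := hpT _ hm
      exact hf.2 j hj hn he
  three_le := by
    induction f with
    | _ a b =>
      obtain ⟨p, hp, hpT⟩ := T.exists_treePath b a
      have hab : G.Adj a b := hf.1
      have hcyc : (SimpleGraph.Walk.cons hab p).IsCycle := by
        rw [SimpleGraph.Walk.cons_isCycle_iff]
        refine ⟨hp, fun hm => ?_⟩
        obtain ⟨i, hi, hin, he⟩ := hpT _ hm
        exact hf.2 i hi hin he
      refine hcyc.three_le_length.trans ?_
      rw [← CycleBlock.card_edges_of_trail hcyc.isTrail]
      refine card_le_card fun e he => ?_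
      rw [List.mem_toFinset, SimpleGraph.Walk.edges_cons, List.mem_cons] at he
      rw [T.mem_cycleEdges]
      refine he.imp id fun he => ?_
      obtain ⟨j, hj, hn, rfl⟩ := hpT e he
      rw [T.edge_mem_treePath hp hpT hj hn, add_comm] at he
      exact ⟨j, hj, hn, he, rfl⟩

theorem block_disjoint (hG : IsCactus G) {f f' : Sym2 V} (hf : T.NonTree f) (hf' : T.NonTree f')
    (hne : f ≠ f') : Disjoint (T.block hG f hf).edges (T.block hG f' hf').edges := by
  rw [Finset.disjoint_left]
  intro e he he'
  rcases T.mem_cycleEdges.1 he with rfl | ⟨j, hj, hn, hc, rfl⟩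
  · rcases T.mem_cycleEdges.1 he' with rfl | ⟨j, hj, hn, hc, h⟩
    · exact hne rfl
    · exact hf.2 j hj hn h
  · rcases T.mem_cycleEdges.1 he' with h | ⟨i, hi, hin, hci, h⟩
    · exact hf'.2 j hj hn h.symm
    · have := T.edge_inj hj hn hi hin h
      subst this
      exact hne (T.cover_unique hG hf hf' hj hn hc hci)

/-- The tree edges of a cycle that separate `s` from `t`. -/
def treeSide (f : Sym2 V) (s t : V) : Finset (Sym2 V) :=
  ((Finset.Ioo 0 T.n).filter fun j => coboundary (T.cutAt j) f = 1 ∧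
    T.cutAt j s ≠ T.cutAt j t).image T.edge

theorem mem_treeSide {f e : Sym2 V} {s t : V} : e ∈ T.treeSide f s t ↔
    ∃ j, 0 < j ∧ j < T.n ∧ coboundary (T.cutAt j) f = 1 ∧ T.cutAt j s ≠ T.cutAt j t ∧
      e = T.edge j := by
  simp only [treeSide, mem_image, mem_filter, mem_Ioo]
  grind

/-- The tree side omits the base edge, so the defining equations say only that an edge belongs to it
exactly when its subtree label separates `s` from `t`. -/
theorem links_treeSide (hG : IsCactus G) {f : Sym2 V} (hf : T.NonTree f) (s t : V) :
    (T.block hG f hf).Links (T.treeSide f s t) s t := by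
  refine ⟨fun e he => ?_, fun e he => ?_⟩
  · obtain ⟨j, hj, hn, hc, -, rfl⟩ := T.mem_treeSide.1 he
    exact T.mem_cycleEdges.2 (Or.inr ⟨j, hj, hn, hc, rfl⟩)
  · have hbase : f ∉ T.treeSide f s t := by
      rw [T.mem_treeSide]
      rintro ⟨j, hj, hn, -, -, h⟩
      exact hf.2 j hj hn h
    change bit (e ∈ T.treeSide f s t) + bit (f ∈ T.treeSide f s t) =
      (if e = f then fun _ => 0 else T.cutAt (T.child e)) s +
      (if e = f then fun _ => 0 else T.cutAt (T.child e)) t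
    rw [bit_eq_zero.2 hbase, add_zero]
    rcases T.mem_cycleEdges.1 he with rfl | ⟨j, hj, hn, hc, rfl⟩
    · rw [bit_eq_zero.2 hbase, if_pos rfl, add_zero]
    · rw [if_neg (fun h => hf.2 j hj hn h.symm), T.child_edge hj hn]
      have : T.edge j ∈ T.treeSide f s t ↔ T.cutAt j s ≠ T.cutAt j t := by
        rw [T.mem_treeSide]
        constructor
        · rintro ⟨i, hi, hin, -, h, he⟩
          rwa [T.edge_inj hj hn hi hin he]
        · exact fun h => ⟨j, hj, hn, hc, h, rfl⟩
      rw [bit_inj.2 this]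
      have h2 : ∀ a b : ZMod 2, bit (a ≠ b) = a + b := by unfold bit; decide
      exact h2 _ _

end RootedTree

end

end CactusRouting
namespace CactusRouting

open scoped Classical
noncomputable section

open Finset SimpleGraph


/-! ### The problem in terms of a rooted spanning tree -/

/-- A cactus with demands in terms of the node numbers of a rooted spanning tree: `eu, ev` are the
ends of the edges, `sp, tp` the sources and targets of the demands. -/
structure Layout where
  n : ℕ
  m : ℕ
  d : ℕ
  k : ℕ
  par : ℕ → ℕ
  eu : ℕ → ℕ
  ev : ℕ → ℕ
  sp : ℕ → ℕ
  tp : ℕ → ℕ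

namespace Layout

variable (ℓ : Layout)

/-- Edge number `e` does not belong to the tree. -/
def NT (e : ℕ) : Prop := ℓ.par (ℓ.eu e) ≠ ℓ.ev e ∧ ℓ.par (ℓ.ev e) ≠ ℓ.eu e

/-- The tree edge above `v` separates `a` from `b`. -/
def Sep (a b v : ℕ) : Prop := ¬ (Anc ℓ.par v a ↔ Anc ℓ.par v b)

/-- Demand `i` crosses the tree edge above `v`. -/
def Cross (i v : ℕ) : Prop := ℓ.Sep (ℓ.sp i) (ℓ.tp i) v

/-- Sums of the numbers of the non-tree edges with a given end below `v`. -/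
def idSum (ends : ℕ → ℕ) (v : ℕ) : ℕ :=
  ∑ e ∈ range ℓ.m, if ℓ.NT e ∧ Anc ℓ.par v (ends e) then e + 1 else 0

/-- The number of the cycle through the tree edge above `v`, or `0` if it is a bridge. -/
def cyc (v : ℕ) : ℕ :=
  (ℓ.idSum ℓ.eu v - ℓ.idSum ℓ.ev v) + (ℓ.idSum ℓ.ev v - ℓ.idSum ℓ.eu v)

/-- The length of cycle `c`. -/
def len (c : ℕ) : ℕ := ((Finset.Ioo 0 ℓ.n).filter fun v => ℓ.cyc v = c).card + 1

/-- The number of tree edges of cycle `c` crossed by demand `i`. -/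
def pc (i c : ℕ) : ℕ :=
  ((Finset.Ioo 0 ℓ.n).filter fun v => ℓ.cyc v = c ∧ ℓ.Cross i v).card

/-- Cycle `c` needs no waypoints. -/
def Free (c : ℕ) : Prop :=
  (∀ i < ℓ.d, ∀ j < ℓ.d, ℓ.pc i c ≠ 0 → ℓ.pc j c ≠ 0 → i = j) ∨
  ((∀ i < ℓ.d, ∀ j < ℓ.d, ∀ l < ℓ.d, ℓ.pc i c ≠ 0 → ℓ.pc j c ≠ 0 → ℓ.pc l c ≠ 0 →
      i = j ∨ i = l ∨ j = l) ∧
    ∀ i < ℓ.d, ℓ.pc i c ≠ 0 → 2 * ℓ.pc i c = ℓ.len c)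

/-- The sides chosen in cycle `c` by demands `i` and `j` are disjoint. -/
def Compat (c : ℕ) (ci cj : Prop) (i j : ℕ) : Prop :=
  ¬ (ci ∧ cj) ∧ ∀ v, 0 < v → v < ℓ.n → ℓ.cyc v = c →
    (¬ ci ∧ ¬ cj → ¬ (ℓ.Cross i v ∧ ℓ.Cross j v)) ∧ (ci ∧ ¬ cj → ℓ.Cross j v → ℓ.Cross i v) ∧
      (¬ ci ∧ cj → ℓ.Cross i v → ℓ.Cross j v)

/-- The combinatorial form of the routing problem. -/
def Solvable : Prop :=
  (∀ v, 0 < v → v < ℓ.n → ℓ.cyc v = 0 → ∀ i < ℓ.d, ∀ j < ℓ.d, ℓ.Cross i v → ℓ.Cross j v → i = j) ∧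
  ∃ co : ℕ → ℕ → Prop,
    (∀ e < ℓ.m, ℓ.NT e → ℓ.Free (e + 1) ∨ ∀ i < ℓ.d, ∀ j < ℓ.d, i ≠ j → ℓ.pc i (e + 1) ≠ 0 →
      ℓ.pc j (e + 1) ≠ 0 → ℓ.Compat (e + 1) (co e i) (co e j) i j) ∧
    ∀ i < ℓ.d, ∑ e ∈ range ℓ.m,
      (if ℓ.NT e ∧ ¬ ℓ.Free (e + 1) ∧ ℓ.pc i (e + 1) ≠ 0 then
        detourCost (ℓ.len (e + 1))
          (if co e i then ℓ.len (e + 1) - ℓ.pc i (e + 1) else ℓ.pc i (e + 1))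
      else 0) ≤ ℓ.k

/-- Every tree edge is covered by at most one non-tree edge. -/
def Cactus : Prop := ∀ v, 0 < v → v < ℓ.n → ∀ e < ℓ.m, ∀ e' < ℓ.m, ℓ.NT e → ℓ.NT e' →
  ℓ.Sep (ℓ.eu e) (ℓ.ev e) v → ℓ.Sep (ℓ.eu e') (ℓ.ev e') v → e = e'

variable {ℓ}

/-- A non-tree edge contributes equally to the two subtree sums unless it separates the node from
its parent. In a cactus at most one does, so the difference of the sums, in whichever order, is its
number plus one. The shift keeps `0` free for bridges. -/
theorem cyc_eq_of_sep (hc : ℓ.Cactus) {v e : ℕ} (hv : 0 < v) (hn : v < ℓ.n) (he : e < ℓ.m)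
    (hNT : ℓ.NT e) (hs : ℓ.Sep (ℓ.eu e) (ℓ.ev e) v) : ℓ.cyc v = e + 1 := by
  have hrest : ∑ e' ∈ (range ℓ.m).erase e,
      (if ℓ.NT e' ∧ Anc ℓ.par v (ℓ.eu e') then e' + 1 else 0) =
      ∑ e' ∈ (range ℓ.m).erase e,
      (if ℓ.NT e' ∧ Anc ℓ.par v (ℓ.ev e') then e' + 1 else 0) := by
    refine sum_congr rfl fun e' he' => ?_
    rw [mem_erase, mem_range] at he'
    by_cases hNT' : ℓ.NT e'
    · have : ¬ ℓ.Sep (ℓ.eu e') (ℓ.ev e') v := fun h =>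
        he'.1 (hc v hv hn e' he'.2 e he hNT' hNT h hs)
      rw [Sep, not_not] at this
      simp only [this]
    · simp [hNT']
  unfold cyc idSum
  rw [← add_sum_erase _ _ (mem_range.2 he),
    ← add_sum_erase (range ℓ.m) (fun e' =>
      if ℓ.NT e' ∧ Anc ℓ.par v (ℓ.ev e') then e' + 1 else 0) (mem_range.2 he), hrest]
  unfold Sep at hs
  by_cases h1 : Anc ℓ.par v (ℓ.eu e) <;> by_cases h2 : Anc ℓ.par v (ℓ.ev e) <;>
    simp [h1, h2, hNT] at hs ⊢

theorem cyc_eq_zero {v : ℕ} (h : ∀ e < ℓ.m, ℓ.NT e → ¬ ℓ.Sep (ℓ.eu e) (ℓ.ev e) v) :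
    ℓ.cyc v = 0 := by
  have : ℓ.idSum ℓ.eu v = ℓ.idSum ℓ.ev v := by
    unfold idSum
    refine sum_congr rfl fun e he => ?_
    by_cases hNT : ℓ.NT e
    · have := h e (mem_range.1 he) hNT
      rw [Sep, not_not] at this
      grind
    · simp [hNT]
  rw [cyc, this]
  omega

theorem cyc_eq_succ_iff (hc : ℓ.Cactus) {v e : ℕ} (hv : 0 < v) (hn : v < ℓ.n) (he : e < ℓ.m)
    (hNT : ℓ.NT e) : ℓ.cyc v = e + 1 ↔ ℓ.Sep (ℓ.eu e) (ℓ.ev e) v := by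
  refine ⟨fun h => ?_, cyc_eq_of_sep hc hv hn he hNT⟩
  by_contra hs
  by_cases hex : ∃ e' < ℓ.m, ℓ.NT e' ∧ ℓ.Sep (ℓ.eu e') (ℓ.ev e') v
  · obtain ⟨e', he', hNT', hs'⟩ := hex
    have := cyc_eq_of_sep hc hv hn he' hNT' hs'
    grind
  · push Not at hex
    rw [cyc_eq_zero hex] at h
    omega

theorem cyc_eq_zero_iff (hc : ℓ.Cactus) {v : ℕ} (hv : 0 < v) (hn : v < ℓ.n) :
    ℓ.cyc v = 0 ↔ ∀ e < ℓ.m, ℓ.NT e → ¬ ℓ.Sep (ℓ.eu e) (ℓ.ev e) v := by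
  refine ⟨fun h e he hNT hs => ?_, cyc_eq_zero⟩
  rw [cyc_eq_of_sep hc hv hn he hNT hs] at h
  omega

theorem cyc_cases (hc : ℓ.Cactus) {v : ℕ} (hv : 0 < v) (hn : v < ℓ.n) :
    ℓ.cyc v = 0 ∨ ∃ e < ℓ.m, ℓ.NT e ∧ ℓ.cyc v = e + 1 := by
  by_cases hex : ∃ e < ℓ.m, ℓ.NT e ∧ ℓ.Sep (ℓ.eu e) (ℓ.ev e) v
  · obtain ⟨e', he', hNT', hs'⟩ := hex
    exact Or.inr ⟨e', he', hNT', cyc_eq_of_sep hc hv hn he' hNT' hs'⟩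
  · push Not at hex
    exact Or.inl (cyc_eq_zero hex)

end Layout

/-! ### From the graph to the numbered layout -/

section Translate

variable {n : ℕ} {G : SimpleGraph (Fin n)} {es D : List (Fin n × Fin n)} {k : ℕ}

/-- The layout given by a rooted spanning tree. -/
def layoutOf (T : RootedTree G) (es D : List (Fin n × Fin n)) (k : ℕ) : Layout where
  n := T.n
  m := es.length
  d := D.length
  k := k
  par := T.par
  eu e := if h : e < es.length then T.pos es[e].1 else 0
  ev e := if h : e < es.length then T.pos es[e].2 else 0
  sp i := if h : i < D.length then T.pos D[i].1 else 0
  tp i := if h : i < D.length then T.pos D[i].2 else 0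

variable (T : RootedTree G)

theorem coboundary_cutAt_eq_one {a b : Fin n} {j : ℕ} :
    T.cutAt j a + T.cutAt j b = 1 ↔ ¬ (Anc T.par j (T.pos a) ↔ Anc T.par j (T.pos b)) := by
  unfold RootedTree.cutAt bit
  by_cases h1 : Anc T.par j (T.pos a) <;> by_cases h2 : Anc T.par j (T.pos b) <;>
    simp [h1, h2, zmod_two_add_self]

theorem cutAt_ne_iff {a b : Fin n} {j : ℕ} :
    T.cutAt j a ≠ T.cutAt j b ↔ ¬ (Anc T.par j (T.pos a) ↔ Anc T.par j (T.pos b)) := by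
  rw [← coboundary_cutAt_eq_one]
  have : ∀ a b : ZMod 2, a ≠ b ↔ a + b = 1 := by decide
  exact this _ _

theorem pos_injective : Function.Injective T.pos := fun x y h => by
  rw [← T.ord_pos x, ← T.ord_pos y, h]

theorem nonTree_iff {x y : Fin n} (h : G.Adj x y) :
    T.NonTree s(x, y) ↔ T.par (T.pos x) ≠ T.pos y ∧ T.par (T.pos y) ≠ T.pos x := by
  have hkey : ∀ a b : Fin n, G.Adj a b → T.par (T.pos a) = T.pos b →
      ∃ i, 0 < i ∧ i < T.n ∧ s(a, b) = T.edge i := by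
    intro a b hab hp
    refine ⟨T.pos a, ?_, T.pos_lt a, ?_⟩
    · by_contra h0
      have h1 : T.pos a = 0 := by omega
      rw [h1, T.par_zero, ← h1] at hp
      exact G.ne_of_adj hab (pos_injective T hp)
    · rw [RootedTree.edge, hp, T.ord_pos, T.ord_pos]
  constructor
  · rintro ⟨-, h2⟩
    refine ⟨fun hp => ?_, fun hp => ?_⟩
    · obtain ⟨i, hi, hn, he⟩ := hkey x y h hp
      exact h2 i hi hn he
    · obtain ⟨i, hi, hn, he⟩ := hkey y x h.symm hp
      exact h2 i hi hn (Sym2.eq_swap.trans he)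
  · rintro ⟨h1, h2⟩
    refine ⟨h, fun i hi hn he => ?_⟩
    rw [RootedTree.edge, Sym2.eq_iff] at he
    rcases he with ⟨rfl, rfl⟩ | ⟨rfl, rfl⟩
    · rw [T.pos_ord i hn, T.pos_ord _ (T.par_lt_n hi hn)] at h1
      exact h1 rfl
    · rw [T.pos_ord i hn, T.pos_ord _ (T.par_lt_n hi hn)] at h2
      exact h2 rfl

theorem _root_.IsEdgeList.adj (hes : IsEdgeList G es) {e : ℕ} (he : e < es.length) :
    G.Adj es[e].1 es[e].2 := by
  rw [hes.2]
  exact List.mem_map.2 ⟨es[e], List.getElem_mem he, rfl⟩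

theorem _root_.IsEdgeList.inj (hes : IsEdgeList G es) {e e' : ℕ} (he : e < es.length)
    (he' : e' < es.length) (h : s(es[e].1, es[e].2) = s(es[e'].1, es[e'].2)) : e = e' := by
  have := (List.Nodup.getElem_inj_iff hes.1 (i := e) (j := e') (hi := by simpa using he)
    (hj := by simpa using he')).1
  exact this (by simpa using h)

theorem _root_.IsEdgeList.exists_index (hes : IsEdgeList G es) {f : Sym2 (Fin n)} (hf : f ∈ G.edgeSet) :
    ∃ (e : ℕ) (he : e < es.length), s(es[e].1, es[e].2) = f := by
  induction f with
  | _ x y =>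
    have := (hes.2 x y).1 hf
    obtain ⟨p, hp, hpe⟩ := List.mem_map.1 this
    obtain ⟨e, he, rfl⟩ := List.getElem_of_mem hp
    exact ⟨e, he, hpe⟩

theorem layoutOf_NT (hes : IsEdgeList G es) {e : ℕ} (he : e < es.length) :
    (layoutOf T es D k).NT e ↔ T.NonTree s(es[e].1, es[e].2) := by
  rw [nonTree_iff T (hes.adj he)]
  simp [Layout.NT, layoutOf, he]

theorem layoutOf_sep {e j : ℕ} (he : e < es.length) :
    (layoutOf T es D k).Sep ((layoutOf T es D k).eu e) ((layoutOf T es D k).ev e) j ↔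
      coboundary (T.cutAt j) s(es[e].1, es[e].2) = 1 := by
  rw [coboundary_mk, coboundary_cutAt_eq_one]
  simp [Layout.Sep, layoutOf, he]

theorem layoutOf_cross {i j : ℕ} (hi : i < D.length) :
    (layoutOf T es D k).Cross i j ↔ T.cutAt j D[i].1 ≠ T.cutAt j D[i].2 := by
  rw [cutAt_ne_iff]
  simp [Layout.Cross, Layout.Sep, layoutOf, hi]

theorem layoutOf_cactus (hG : IsCactus G) (hes : IsEdgeList G es) :
    (layoutOf T es D k).Cactus := by
  intro v hv hn e he e' he' hNT hNT' hs hs'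
  rw [layoutOf_NT T hes he] at hNT
  rw [layoutOf_NT T hes he'] at hNT'
  rw [layoutOf_sep T he] at hs
  rw [layoutOf_sep T he'] at hs'
  exact hes.inj he he' (T.cover_unique hG hNT hNT' hv hn hs hs')

theorem layoutOf_cyc (hG : IsCactus G) (hes : IsEdgeList G es) {e v : ℕ} (he : e < es.length)
    (hNT : T.NonTree s(es[e].1, es[e].2)) (hv : 0 < v) (hn : v < T.n) :
    (layoutOf T es D k).cyc v = e + 1 ↔ coboundary (T.cutAt v) s(es[e].1, es[e].2) = 1 := by
  rw [Layout.cyc_eq_succ_iff (layoutOf_cactus T hG hes) hv hn he ((layoutOf_NT T hes he).2 hNT),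
    layoutOf_sep T he]

theorem card_image_edge (S : Finset ℕ) (hS : S ⊆ Finset.Ioo 0 T.n) :
    (S.image T.edge).card = S.card := by
  refine card_image_of_injOn fun i hi j hj h => ?_
  have h1 := mem_Ioo.1 (hS hi)
  have h2 := mem_Ioo.1 (hS hj)
  exact T.edge_inj h1.1 h1.2 h2.1 h2.2 h

theorem card_treeSide (hG : IsCactus G) (hes : IsEdgeList G es) {e i : ℕ} (he : e < es.length)
    (hNT : T.NonTree s(es[e].1, es[e].2)) (hi : i < D.length) :
    (T.treeSide s(es[e].1, es[e].2) D[i].1 D[i].2).card = (layoutOf T es D k).pc i (e + 1) := by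
  rw [RootedTree.treeSide, card_image_edge T _ (filter_subset _ _), Layout.pc]
  congr 1
  ext v
  simp only [mem_filter, mem_Ioo]
  refine and_congr_right fun h => ?_
  rw [layoutOf_cyc T hG hes he hNT h.1 h.2, layoutOf_cross T hi]

theorem card_cycleEdges (hG : IsCactus G) (hes : IsEdgeList G es) {e : ℕ} (he : e < es.length)
    (hNT : T.NonTree s(es[e].1, es[e].2)) :
    (T.cycleEdges s(es[e].1, es[e].2)).card = (layoutOf T es D k).len (e + 1) := by
  rw [RootedTree.cycleEdges, card_insert_of_notMem,
    card_image_edge T _ (filter_subset _ _), Layout.len]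
  · congr 2
    ext v
    simp only [mem_filter, mem_Ioo]
    refine and_congr_right fun h => ?_
    rw [layoutOf_cyc T hG hes he hNT h.1 h.2]
  · rw [mem_image]
    rintro ⟨j, hj, h⟩
    rw [mem_filter, mem_Ioo] at hj
    exact hNT.2 j hj.1.1 hj.1.2 h.symm

theorem equiv_iff_pc (hG : IsCactus G) (hes : IsEdgeList G es) {e i : ℕ} (he : e < es.length)
    (hNT : T.NonTree s(es[e].1, es[e].2)) (hi : i < D.length) :
    (T.block hG _ hNT).Equiv D[i].1 D[i].2 ↔ (layoutOf T es D k).pc i (e + 1) = 0 := by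
  have hl := T.links_treeSide hG hNT D[i].1 D[i].2
  rw [hl.equiv_iff, ← card_treeSide T hG hes he hNT hi, card_eq_zero]
  refine or_iff_left fun h => ?_
  have h1 := (T.block hG _ hNT).base_mem
  rw [← h, T.mem_treeSide] at h1
  obtain ⟨j, hj, hn, -, -, h2⟩ := h1
  exact hNT.2 j hj hn h2

theorem sides_meet {p q a b : Prop} (h : ¬ (p ∧ q)) (h' : (¬ p ∧ ¬ q → ¬ (a ∧ b)) ∧
    (p ∧ ¬ q → b → a) ∧ (¬ p ∧ q → a → b)) (hp : p ↔ ¬ a) (hq : q ↔ ¬ b) : False := by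
  tauto

/-- The base edge lies on every complementary side and on no tree side, so two complements always
meet. On the tree edges of the cycle, disjointness is compared edge by edge, which gives the three
implications of `Compat`. -/
theorem side_disjoint_iff (hG : IsCactus G) (hes : IsEdgeList G es) {e i j : ℕ}
    (he : e < es.length) (hNT : T.NonTree s(es[e].1, es[e].2)) (hi : i < D.length)
    (hj : j < D.length) (ci cj : Prop) :
    Disjoint ((T.block hG _ hNT).side (T.treeSide s(es[e].1, es[e].2) D[i].1 D[i].2) ci)
      ((T.block hG _ hNT).side (T.treeSide s(es[e].1, es[e].2) D[j].1 D[j].2) cj) ↔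
    (layoutOf T es D k).Compat (e + 1) ci cj i j := by
  have hbase : ∀ i (hi : i < D.length),
      s(es[e].1, es[e].2) ∉ T.treeSide s(es[e].1, es[e].2) D[i].1 D[i].2 := by
    intro i hi h
    obtain ⟨v, hv, hn, -, -, h2⟩ := T.mem_treeSide.1 h
    exact hNT.2 v hv hn h2
  have hmem : ∀ i (hi : i < D.length) v, 0 < v → v < T.n → (layoutOf T es D k).cyc v = e + 1 →
      (T.edge v ∈ T.treeSide s(es[e].1, es[e].2) D[i].1 D[i].2 ↔
        (layoutOf T es D k).Cross i v) := by
    intro i hi v hv hn hc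
    rw [T.mem_treeSide, layoutOf_cross T hi]
    constructor
    · rintro ⟨w, hw, hwn, -, h, he⟩
      rwa [T.edge_inj hv hn hw hwn he]
    · intro h
      exact ⟨v, hv, hn, (layoutOf_cyc T hG hes he hNT hv hn).1 hc, h, rfl⟩
  have hcyc : ∀ f, f ∈ T.cycleEdges s(es[e].1, es[e].2) ↔ f = s(es[e].1, es[e].2) ∨
      ∃ v, 0 < v ∧ v < T.n ∧ (layoutOf T es D k).cyc v = e + 1 ∧ f = T.edge v := by
    intro f
    rw [T.mem_cycleEdges]
    refine or_congr_right (exists_congr fun v => ⟨?_, ?_⟩)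
    · rintro ⟨hv, hn, h1, h2⟩
      exact ⟨hv, hn, (layoutOf_cyc T hG hes he hNT hv hn).2 h1, h2⟩
    · rintro ⟨hv, hn, h1, h2⟩
      exact ⟨hv, hn, (layoutOf_cyc T hG hes he hNT hv hn).1 h1, h2⟩
  have hsub : ∀ i (hi : i < D.length),
      T.treeSide s(es[e].1, es[e].2) D[i].1 D[i].2 ⊆ T.cycleEdges s(es[e].1, es[e].2) :=
    fun i hi => (T.links_treeSide hG hNT D[i].1 D[i].2).1
  have hside : ∀ (ci : Prop) i (hi : i < D.length), ∀ f, f ∈ (T.block hG _ hNT).side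
      (T.treeSide s(es[e].1, es[e].2) D[i].1 D[i].2) ci ↔
      f ∈ T.cycleEdges s(es[e].1, es[e].2) ∧
        (ci ↔ f ∉ T.treeSide s(es[e].1, es[e].2) D[i].1 D[i].2) := by
    intro ci i hi f
    have := @hsub i hi f
    by_cases hci : ci
    · simp [CycleBlock.side, hci, RootedTree.block]
    · simp only [CycleBlock.side, hci, if_false, false_iff, not_not]
      tauto
  have hcc : ∀ v, 0 < v → v < T.n → (layoutOf T es D k).cyc v = e + 1 →
      T.edge v ∈ T.cycleEdges s(es[e].1, es[e].2) := fun v hv hn hc =>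
    (hcyc _).2 (Or.inr ⟨v, hv, hn, hc, rfl⟩)
  rw [Finset.disjoint_left]
  simp only [hside ci i hi, hside cj j hj]
  constructor
  · intro h
    refine ⟨fun hc => ?_, fun v hv hn hcv => ?_⟩
    · have hm := (hcyc _).2 (Or.inl rfl)
      exact h ⟨hm, by simp [hc.1, hbase i hi]⟩ ⟨hm, by simp [hc.2, hbase j hj]⟩
    · have h1 := hmem i hi v hv hn hcv
      have h2 := hmem j hj v hv hn hcv
      grind
  · rintro ⟨h1, h2⟩ f ⟨hf, hfi⟩ ⟨-, hfj⟩
    rcases (hcyc f).1 hf with rfl | ⟨v, hv, hn, hcv, rfl⟩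
    · exact h1 ⟨hfi.2 (hbase i hi), hfj.2 (hbase j hj)⟩
    · rw [hmem i hi v hv hn hcv] at hfi
      rw [hmem j hj v hv hn hcv] at hfj
      exact sides_meet h1 (h2 v hv hn hcv) hfi hfj

theorem noDetour_iff (hG : IsCactus G) (hes : IsEdgeList G es) {e : ℕ}
    (he : e < es.length) (hNT : T.NonTree s(es[e].1, es[e].2)) :
    NoDetour (T.block hG _ hNT) (fun i => (D.get i).1) (fun i => (D.get i).2)
      (fun i => T.treeSide s(es[e].1, es[e].2) (D.get i).1 (D.get i).2) ↔
    (layoutOf T es D k).Free (e + 1) := by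
  have hE : ∀ i : Fin D.length, (T.block hG _ hNT).Equiv (D.get i).1 (D.get i).2 ↔
      (layoutOf T es D k).pc i (e + 1) = 0 := fun i => equiv_iff_pc T hG hes he hNT i.2
  have hX : ∀ i : Fin D.length,
      (T.treeSide s(es[e].1, es[e].2) (D.get i).1 (D.get i).2).card =
      (layoutOf T es D k).pc i (e + 1) := fun i => card_treeSide T hG hes he hNT i.2
  have hL : (T.block hG _ hNT).edges.card = (layoutOf T es D k).len (e + 1) :=
    card_cycleEdges T hG hes he hNT
  unfold NoDetour Layout.Free
  simp only [hE, hX, hL, Fin.forall_iff, Fin.mk.injEq]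
  refine or_congr ⟨fun h i hi j hj => h i hi j hj, fun h i hi j hj => h i hi j hj⟩
    (and_congr ⟨fun h i hi j hj l hl => h i hi j hj l hl, fun h i hi j hj l hl => h i hi j hj l hl⟩
      Iff.rfl)

/-- A node with cycle number zero is separated from its parent by no non-tree edge, so the tree edge
above it is the only edge leaving its subtree. -/
theorem coboundary_bridge (hG : IsCactus G) (hes : IsEdgeList G es) {j : ℕ} (hj : 0 < j)
    (hn : j < T.n) (hc : (layoutOf T es D k).cyc j = 0) {e' : Sym2 (Fin n)}
    (he' : e' ∈ G.edgeSet) : coboundary (T.cutAt j) e' = bit (e' = T.edge j) := by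
  by_cases h : ∃ i, 0 < i ∧ i < T.n ∧ e' = T.edge i
  · obtain ⟨i, hi, hin, rfl⟩ := h
    rw [T.coboundary_cutAt_edge hi hin, bit_inj]
    exact ⟨fun h => h ▸ rfl, T.edge_inj hi hin hj hn⟩
  · push Not at h
    have hNT : T.NonTree e' := ⟨he', h⟩
    rw [bit_eq_zero.2 (h j hj hn)]
    obtain ⟨e, he, rfl⟩ := hes.exists_index he'
    have := (Layout.cyc_eq_zero_iff (layoutOf_cactus T hG hes (D := D) (k := k)) hj hn).1 hc e he
      ((layoutOf_NT T hes he).2 hNT)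
    rw [layoutOf_sep T he] at this
    exact (zmod_two_cases _).resolve_right this

/-- This is `routing_iff` for the fundamental cycles, indexed by the non-tree edges, and the
bridges, which are the tree edges with cycle number zero; the tree sides serve as reference sides.
-/
theorem unitSegmentRouting_iff (hG : IsCactus G) (hes : IsEdgeList G es) :
    UnitSegmentRouting G D k ↔ (layoutOf T es D k).Solvable := by
  let ι := {e : Fin es.length // T.NonTree s(es[e].1, es[e].2)}
  let β := {j : ℕ // 0 < j ∧ j < T.n ∧ (layoutOf T es D k).cyc j = 0}
  have hr := routing_iff hG.1 (ι := ι) (fun c => T.block hG _ c.2)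
    (fun c c' h => T.block_disjoint hG c.2 c'.2 fun h' => h (Subtype.ext (Fin.ext
      (hes.inj c.1.2 c'.1.2 h'))))
    (β := β) (fun r => T.cutAt r.1) (fun r => T.edge r.1)
    (fun r => T.edge_mem r.2.1 r.2.2.1)
    (fun r e' he' => coboundary_bridge T hG hes r.2.1 r.2.2.1 r.2.2.2 he')
    (by
      intro r c h
      rcases T.mem_cycleEdges.1 h with h | ⟨j, hj, hn, hc, h⟩
      · exact c.2.2 _ r.2.1 r.2.2.1 h.symm
      · have h2 := T.edge_inj r.2.1 r.2.2.1 hj hn h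
        have h3 := (layoutOf_cyc T hG hes (D := D) (k := k) c.1.2 c.2 hj hn).2 hc
        rw [← h2, r.2.2.2] at h3
        omega)
    (by
      intro f hf
      by_cases h : ∃ i, 0 < i ∧ i < T.n ∧ f = T.edge i
      · obtain ⟨i, hi, hin, rfl⟩ := h
        rcases Layout.cyc_cases (layoutOf_cactus T hG hes (D := D) (k := k)) hi hin with h0 |
          ⟨e, he, hNT, hc⟩
        · exact Or.inr ⟨⟨i, hi, hin, h0⟩, rfl⟩
        · have hNT' := (layoutOf_NT T hes he).1 hNT
          exact Or.inl ⟨⟨⟨e, he⟩, hNT'⟩, T.mem_cycleEdges.2 (Or.inr ⟨i, hi, hin,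
            (layoutOf_cyc T hG hes he hNT' hi hin).1 hc, rfl⟩)⟩
      · push Not at h
        obtain ⟨e, he, rfl⟩ := hes.exists_index hf
        exact Or.inl ⟨⟨⟨e, he⟩, hf, h⟩, (T.block hG _ _).base_mem⟩)
    (fun i : Fin D.length => (D.get i).1) (fun i => (D.get i).2)
    (fun c i => T.treeSide _ (D.get i).1 (D.get i).2)
    (fun c i => T.links_treeSide hG c.2 _ _) k
  simp only [UnitSegmentRouting, segmentLoad_eq]
  rw [hr]
  clear hr
  have hN : ∀ c : ι, NoDetour (T.block hG _ c.2) (fun i => (D.get i).1) (fun i => (D.get i).2)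
      (fun i => T.treeSide s(es[c.1].1, es[c.1].2) (D.get i).1 (D.get i).2) ↔
      (layoutOf T es D k).Free (c.1 + 1) := fun c => noDetour_iff T hG hes c.1.2 c.2
  have hE : ∀ (c : ι) (i : Fin D.length), (T.block hG _ c.2).Equiv (D.get i).1 (D.get i).2 ↔
      (layoutOf T es D k).pc i (c.1 + 1) = 0 := fun c i => equiv_iff_pc T hG hes c.1.2 c.2 i.2
  have hS : ∀ (c : ι) (i j : Fin D.length) (ci cj : Prop),
      Disjoint ((T.block hG _ c.2).side
        (T.treeSide s(es[c.1].1, es[c.1].2) (D.get i).1 (D.get i).2) ci)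
      ((T.block hG _ c.2).side
        (T.treeSide s(es[c.1].1, es[c.1].2) (D.get j).1 (D.get j).2) cj) ↔
      (layoutOf T es D k).Compat (c.1 + 1) ci cj i j :=
    fun c i j ci cj => side_disjoint_iff T hG hes c.1.2 c.2 i.2 j.2 ci cj
  have hL : ∀ c : ι, (T.block hG _ c.2).edges.card = (layoutOf T es D k).len (c.1 + 1) :=
    fun c => card_cycleEdges T hG hes c.1.2 c.2
  have hC : ∀ (c : ι) (i : Fin D.length) (ci : Prop), ((T.block hG _ c.2).side
        (T.treeSide s(es[c.1].1, es[c.1].2) (D.get i).1 (D.get i).2) ci).card =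
      if ci then (layoutOf T es D k).len (c.1 + 1) - (layoutOf T es D k).pc i (c.1 + 1)
      else (layoutOf T es D k).pc i (c.1 + 1) := by
    intro c i ci
    have h1 : (T.treeSide s(es[c.1].1, es[c.1].2) (D.get i).1 (D.get i).2).card =
      (layoutOf T es D k).pc i (c.1 + 1) := card_treeSide T hG hes c.1.2 c.2 i.2
    unfold CycleBlock.side
    by_cases hci : ci
    · rw [if_pos hci, if_pos hci, card_sdiff_of_subset
        (T.links_treeSide hG c.2 _ _).1, hL, h1]
    · rw [if_neg hci, if_neg hci, h1]
  simp only [hN, hE, hS, hL, hC]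
  have hNT : ∀ e : Fin es.length, (layoutOf T es D k).NT e ↔ T.NonTree s(es[e].1, es[e].2) :=
    fun e => layoutOf_NT T hes e.2
  have hsum : ∀ φ : ℕ → ℕ, (∑ c : ι, φ c.1) =
      ∑ e ∈ range es.length, if (layoutOf T es D k).NT e then φ e else 0 := by
    intro φ
    rw [sum_range]
    simp only [hNT]
    rw [← sum_filter]
    exact (sum_subtype _ (by simp) fun e : Fin es.length => φ e).symm
  unfold Layout.Solvable
  refine and_congr ?_ ?_
  · constructor
    · intro h v hv hn hc i hi j hj h1 h2
      have := h ⟨v, hv, hn, hc⟩ ⟨i, hi⟩ ⟨j, hj⟩ ((layoutOf_cross T hi).1 h1)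
        ((layoutOf_cross T hj).1 h2)
      exact congrArg Fin.val this
    · intro h r i j h1 h2
      exact Fin.ext (h r.1 r.2.1 r.2.2.1 r.2.2.2 i i.2 j j.2 ((layoutOf_cross T i.2).2 h1)
        ((layoutOf_cross T j.2).2 h2))
  · have hterm : ∀ (co : ℕ → ℕ → Prop) (i : ℕ), (∑ c : ι,
        if (layoutOf T es D k).Free (c.1 + 1) ∨ (layoutOf T es D k).pc i (c.1 + 1) = 0 then 0 else
          detourCost ((layoutOf T es D k).len (c.1 + 1)) (if co c.1 i then
            (layoutOf T es D k).len (c.1 + 1) - (layoutOf T es D k).pc i (c.1 + 1) else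
            (layoutOf T es D k).pc i (c.1 + 1))) =
        ∑ e ∈ range es.length, if (layoutOf T es D k).NT e ∧
          ¬ (layoutOf T es D k).Free (e + 1) ∧ (layoutOf T es D k).pc i (e + 1) ≠ 0 then
          detourCost ((layoutOf T es D k).len (e + 1)) (if co e i then
            (layoutOf T es D k).len (e + 1) - (layoutOf T es D k).pc i (e + 1) else
            (layoutOf T es D k).pc i (e + 1)) else 0 := by
      intro co i
      rw [hsum fun e => if (layoutOf T es D k).Free (e + 1) ∨
        (layoutOf T es D k).pc i (e + 1) = 0 then 0 else
          detourCost ((layoutOf T es D k).len (e + 1)) (if co e i then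
            (layoutOf T es D k).len (e + 1) - (layoutOf T es D k).pc i (e + 1) else
            (layoutOf T es D k).pc i (e + 1))]
      refine sum_congr rfl fun e _ => ?_
      by_cases h1 : (layoutOf T es D k).NT e <;>
        by_cases h2 : (layoutOf T es D k).Free (e + 1) <;>
        by_cases h3 : (layoutOf T es D k).pc i (e + 1) = 0 <;> simp [h1, h2, h3]
    constructor
    · rintro ⟨co, h1, h2⟩
      -- The choice is extended to all pairs of natural numbers by declaring it false outside the
      -- range.
      obtain ⟨co', hco⟩ : ∃ co' : ℕ → ℕ → Prop,
          ∀ (c : ι) (i : Fin D.length), co' c.1 i ↔ co c i :=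
        ⟨fun e i => ∃ (he : e < es.length) (h : T.NonTree s(es[e].1, es[e].2))
          (hi : i < D.length), co ⟨⟨e, he⟩, h⟩ ⟨i, hi⟩,
          fun c i => ⟨fun ⟨_, _, _, h⟩ => h, fun h => ⟨c.1.2, c.2, i.2, h⟩⟩⟩
      simp only [← hco] at h1 h2
      refine ⟨co', fun e he hNTe => ?_, fun i hi => ?_⟩
      · refine (h1 ⟨⟨e, he⟩, (layoutOf_NT T hes he).1 hNTe⟩).imp_right fun h => ?_
        intro i hi j hj hij h3 h4
        exact h ⟨i, hi⟩ ⟨j, hj⟩ (fun h => hij (congrArg Fin.val h)) h3 h4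
      · exact (hterm co' i).ge.trans (h2 ⟨i, hi⟩)
    · rintro ⟨co, h1, h2⟩
      refine ⟨fun c i => co c.1 i, fun c => ?_, fun i => ?_⟩
      · refine (h1 c.1 c.1.2 ((hNT c.1).2 c.2)).imp_right fun h i j hij h3 h4 => ?_
        exact h i i.2 j j.2 (fun h => hij (Fin.ext h)) h3 h4
      · rw [hterm co i]
        exact h2 i i.2

end Translate

end

end CactusRouting
namespace CactusRouting

open scoped Classical
noncomputable section

open Finset SimpleGraph


namespace Layout

variable (ℓ : Layout)

/-! ### Counting demands -/

/-- The number of demands crossing the tree edge above `v`. -/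
def cnt (v : ℕ) : ℕ := ((range ℓ.d).filter fun i => ℓ.Cross i v).card

/-- The number of demands meeting cycle `c`. -/
def numMeet (c : ℕ) : ℕ := ((range ℓ.d).filter fun i => ℓ.pc i c ≠ 0).card

/-- The number of demands meeting cycle `c` that are not split evenly. -/
def numUneven (c : ℕ) : ℕ :=
  ((range ℓ.d).filter fun i => ℓ.pc i c ≠ 0 ∧ 2 * ℓ.pc i c ≠ ℓ.len c).card

/-- The number of tree edges of cycle `c` that are crossed by some demand. -/
def numUsed (c : ℕ) : ℕ :=
  ((Finset.Ioo 0 ℓ.n).filter fun v => ℓ.cyc v = c ∧ ℓ.cnt v ≠ 0).card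

/-- The number of demands that cross every crossed tree edge of cycle `c`. -/
def numFull (c : ℕ) : ℕ :=
  ((range ℓ.d).filter fun i => ℓ.pc i c = ℓ.numUsed c).card

theorem free_iff (c : ℕ) :
    ℓ.Free c ↔ ℓ.numMeet c ≤ 1 ∨ ℓ.numMeet c ≤ 2 ∧ ℓ.numUneven c = 0 := by
  unfold Free numMeet numUneven
  refine or_congr ?_ (and_congr ?_ ?_)
  · rw [card_le_one]
    simp only [mem_filter, mem_range]
    exact ⟨fun h i hi j hj => h i hi.1 j hj.1 hi.2 hj.2,
      fun h i hi j hj h1 h2 => h i ⟨hi, h1⟩ j ⟨hj, h2⟩⟩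
  · rw [← not_lt, two_lt_card]
    simp only [mem_filter, mem_range]
    constructor
    · grind
    · intro h i hi j hj l hl h1 h2 h3
      by_contra! hne
      exact h ⟨i, ⟨hi, h1⟩, j, ⟨hj, h2⟩, l, ⟨hl, h3⟩, hne.1, hne.2.1, hne.2.2⟩
  · rw [card_eq_zero, filter_eq_empty_iff]
    simp only [mem_range]
    exact ⟨fun h i hi h1 => h1.2 (h i hi h1.1), fun h i hi h1 => by
      by_contra h2
      exact h hi ⟨h1, h2⟩⟩

variable {ℓ}

theorem three_le_cnt {v i j l : ℕ} (hi : i < ℓ.d) (hj : j < ℓ.d) (hl : l < ℓ.d)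
    (h1 : ℓ.Cross i v) (h2 : ℓ.Cross j v) (h3 : ℓ.Cross l v) (hij : i ≠ j) (hil : i ≠ l)
    (hjl : j ≠ l) : 3 ≤ ℓ.cnt v := by
  refine two_lt_card.2 ⟨i, ?_, j, ?_, l, ?_, hij, hil, hjl⟩ <;>
    simp only [mem_filter, mem_range] <;> tauto

theorem two_le_cnt {v i j : ℕ} (hi : i < ℓ.d) (hj : j < ℓ.d)
    (h1 : ℓ.Cross i v) (h2 : ℓ.Cross j v) (hij : i ≠ j) : 2 ≤ ℓ.cnt v := by
  refine one_lt_card.2 ⟨i, ?_, j, ?_, hij⟩ <;>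
    simp only [mem_filter, mem_range] <;> tauto

theorem cnt_ne_zero {v i : ℕ} (hi : i < ℓ.d) (h : ℓ.Cross i v) : ℓ.cnt v ≠ 0 := by
  exact card_ne_zero.2 ⟨i, by simp [hi, h]⟩

theorem exists_cross_of_cnt {v : ℕ} (h : ℓ.cnt v ≠ 0) : ∃ i < ℓ.d, ℓ.Cross i v := by
  obtain ⟨i, hi⟩ := card_ne_zero.1 h
  rw [mem_filter, mem_range] at hi
  exact ⟨i, hi⟩

theorem exists_three_of_cnt {v : ℕ} (h : 3 ≤ ℓ.cnt v) : ∃ i < ℓ.d, ∃ j < ℓ.d, ∃ l < ℓ.d,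
    ℓ.Cross i v ∧ ℓ.Cross j v ∧ ℓ.Cross l v ∧ i ≠ j ∧ i ≠ l ∧ j ≠ l := by
  obtain ⟨i, hi, j, hj, l, hl, h1⟩ := two_lt_card.1 h
  rw [mem_filter, mem_range] at hi hj hl
  exact ⟨i, hi.1, j, hj.1, l, hl.1, hi.2, hj.2, hl.2, h1⟩

theorem pc_ne_zero_iff {i c : ℕ} :
    ℓ.pc i c ≠ 0 ↔ ∃ v, 0 < v ∧ v < ℓ.n ∧ ℓ.cyc v = c ∧ ℓ.Cross i v := by
  unfold pc
  rw [card_ne_zero]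
  simp only [Finset.Nonempty, mem_filter, mem_Ioo, and_assoc]

/-- Demand `i` crosses every crossed tree edge of cycle `c`. -/
theorem pc_eq_numUsed_iff {i c : ℕ} (hi : i < ℓ.d) : ℓ.pc i c = ℓ.numUsed c ↔
    ∀ v, 0 < v → v < ℓ.n → ℓ.cyc v = c → ∀ j < ℓ.d, ℓ.Cross j v → ℓ.Cross i v := by
  have hsub : ((Finset.Ioo 0 ℓ.n).filter fun v => ℓ.cyc v = c ∧ ℓ.Cross i v) ⊆
      ((Finset.Ioo 0 ℓ.n).filter fun v => ℓ.cyc v = c ∧ ℓ.cnt v ≠ 0) := by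
    intro v hv
    rw [mem_filter] at hv ⊢
    exact ⟨hv.1, hv.2.1, cnt_ne_zero hi hv.2.2⟩
  unfold pc numUsed
  constructor
  · intro h v hv hn hc j hj hcr
    have := eq_of_subset_of_card_le hsub h.ge
    have h2 : v ∈ (Finset.Ioo 0 ℓ.n).filter fun v => ℓ.cyc v = c ∧ ℓ.cnt v ≠ 0 := by
      rw [mem_filter, mem_Ioo]
      exact ⟨⟨hv, hn⟩, hc, cnt_ne_zero hj hcr⟩
    rw [← this, mem_filter] at h2
    exact h2.2.2
  · intro h
    congr 1
    refine Finset.Subset.antisymm hsub fun v hv => ?_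
    rw [mem_filter, mem_Ioo] at hv ⊢
    obtain ⟨j, hj, hcr⟩ := exists_cross_of_cnt hv.2.2
    exact ⟨hv.1, hv.2.1, h v hv.1.1 hv.1.2 hv.2.1 j hj hcr⟩

theorem one_le_numFull {j c : ℕ} (hj : j < ℓ.d) (h : ℓ.pc j c = ℓ.numUsed c) :
    ℓ.numFull c ≠ 0 := by
  exact card_ne_zero.2 ⟨j, by simp [hj, h]⟩

theorem exists_full {c : ℕ} (h : ℓ.numFull c ≠ 0) : ∃ j < ℓ.d, ℓ.pc j c = ℓ.numUsed c := by
  obtain ⟨i, hi⟩ := card_ne_zero.1 h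
  rw [mem_filter, mem_range] at hi
  exact ⟨i, hi⟩

theorem full_unique {i j c : ℕ} (h : ℓ.numFull c = 1) (hi : i < ℓ.d) (hj : j < ℓ.d)
    (h1 : ℓ.pc i c = ℓ.numUsed c) (h2 : ℓ.pc j c = ℓ.numUsed c) : i = j := by
  exact card_le_one.1 h.le i (by simp [hi, h1]) j (by simp [hj, h2])

theorem exists_other_full {j c : ℕ} (h : 2 ≤ ℓ.numFull c) : ∃ l < ℓ.d, l ≠ j ∧ ℓ.pc l c = ℓ.numUsed c := by
  obtain ⟨l, hl, hne⟩ := exists_mem_ne h j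
  rw [mem_filter, mem_range] at hl
  exact ⟨l, hl.1, hne, hl.2⟩

theorem exists_other_meet {j c : ℕ} (hF : ¬ ℓ.Free c) : ∃ l < ℓ.d, l ≠ j ∧ ℓ.pc l c ≠ 0 := by
  rw [free_iff] at hF
  have : 1 < ℓ.numMeet c := by omega
  obtain ⟨l, hl, hne⟩ := exists_mem_ne this j
  rw [mem_filter, mem_range] at hl
  exact ⟨l, hl.1, hne, hl.2⟩

/-! ### Choosing sides in one cycle -/

variable (ℓ) in
/-- Witnesses computed by the algorithm: `two c` is a tree edge of cycle `c` crossed by two demands,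
or `0`, and `c₁ v`, `c₂ v` are the demands crossing the tree edge above `v` if there are two. -/
structure Witness (two c₁ c₂ : ℕ → ℕ) : Prop where
  two_eq_zero : ∀ c, two c = 0 → ∀ v, 0 < v → v < ℓ.n → ℓ.cyc v = c → ℓ.cnt v ≠ 2
  two_lt : ∀ c, two c ≠ 0 → two c < ℓ.n
  cyc_two : ∀ c, two c ≠ 0 → ℓ.cyc (two c) = c
  cnt_two : ∀ c, two c ≠ 0 → ℓ.cnt (two c) = 2
  lt₁ : ∀ v, 0 < v → v < ℓ.n → ℓ.cnt v = 2 → c₁ v < ℓ.d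
  lt₂ : ∀ v, 0 < v → v < ℓ.n → ℓ.cnt v = 2 → c₂ v < ℓ.d
  ne : ∀ v, 0 < v → v < ℓ.n → ℓ.cnt v = 2 → c₁ v ≠ c₂ v
  cross₁ : ∀ v, 0 < v → v < ℓ.n → ℓ.cnt v = 2 → ℓ.Cross (c₁ v) v
  cross₂ : ∀ v, 0 < v → v < ℓ.n → ℓ.cnt v = 2 → ℓ.Cross (c₂ v) v

theorem Witness.eq_or_eq {two c₁ c₂ : ℕ → ℕ} (hw : ℓ.Witness two c₁ c₂) {v i : ℕ} (hv : 0 < v)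
    (hn : v < ℓ.n) (hc : ℓ.cnt v = 2) (hi : i < ℓ.d) (hcr : ℓ.Cross i v) :
    i = c₁ v ∨ i = c₂ v := by
  by_contra! h
  have := three_le_cnt hi (hw.lt₁ v hv hn hc) (hw.lt₂ v hv hn hc) hcr (hw.cross₁ v hv hn hc)
    (hw.cross₂ v hv hn hc) h.1 h.2 (hw.ne v hv hn hc)
  omega

variable (ℓ)

/-- The cost of cycle `c` for demand `i`, depending on the side it chooses. -/
def sideCost (c : ℕ) (co : Prop) (i : ℕ) : ℕ :=
  if ¬ ℓ.Free c ∧ ℓ.pc i c ≠ 0 then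
    detourCost (ℓ.len c) (if co then ℓ.len c - ℓ.pc i c else ℓ.pc i c) else 0

/-- The cost of cycle `c` that is forced on demand `i`. -/
def forced (two : ℕ → ℕ) (c i : ℕ) : ℕ :=
  if ℓ.Free c then 0 else if two c = 0 then detourCost (ℓ.len c) (ℓ.pc i c) else
    if ℓ.numFull c = 1 then
      if ℓ.pc i c = ℓ.numUsed c then detourCost (ℓ.len c) (ℓ.len c - ℓ.pc i c)
      else detourCost (ℓ.len c) (ℓ.pc i c)
    else 0

/-- The cost of cycle `c` that has to be paid by one of two demands. -/
def shared (two : ℕ → ℕ) (c : ℕ) : ℕ :=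
  if ¬ ℓ.Free c ∧ two c ≠ 0 ∧ 2 ≤ ℓ.numFull c then
    detourCost (ℓ.len c) (ℓ.numUsed c) + detourCost (ℓ.len c) (ℓ.len c - ℓ.numUsed c) else 0

/-- The sides chosen in cycle `c` are pairwise disjoint. -/
def Valid (c : ℕ) (co : ℕ → Prop) : Prop :=
  ℓ.Free c ∨ ∀ i < ℓ.d, ∀ j < ℓ.d, i ≠ j → ℓ.pc i c ≠ 0 → ℓ.pc j c ≠ 0 →
    ℓ.Compat c (co i) (co j) i j

variable {ℓ}

theorem detourCost_zero (L : ℕ) : detourCost L 0 = 0 := by simp [detourCost]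

theorem detourCost_of_two_mul_lt {L p : ℕ} (h : 2 * p < L) : detourCost L p = 0 := by
  rw [detourCost, if_pos (by omega)]

/-- A demand crossing all crossed edges may take the other side. -/
theorem valid_of_full {c j : ℕ} (h3 : ∀ v, 0 < v → v < ℓ.n → ℓ.cyc v = c → ℓ.cnt v < 3)
    (hj : j < ℓ.d) (hfull : ℓ.pc j c = ℓ.numUsed c) : ℓ.Valid c fun i => i = j := by
  rw [pc_eq_numUsed_iff hj] at hfull
  refine Or.inr fun i hi l hl hil _ _ => ⟨fun h => hil (h.1.trans h.2.symm), ?_⟩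
  intro v hv hn hc
  refine ⟨?_, ?_, ?_⟩
  · rintro ⟨h1, h2⟩ ⟨hci, hcl⟩
    exact absurd (three_le_cnt hi hl hj hci hcl (hfull v hv hn hc i hi hci) hil h1 h2)
      (not_le.2 (h3 v hv hn hc))
  · rintro ⟨rfl, h2⟩ hcl
    exact hfull v hv hn hc l hl hcl
  · rintro ⟨h1, rfl⟩ hci
    exact hfull v hv hn hc i hi hci

section Local

variable {two c₁ c₂ : ℕ → ℕ} (hw : ℓ.Witness two c₁ c₂) {c : ℕ} (hF : ¬ ℓ.Free c)
  (h3 : ∀ v, 0 < v → v < ℓ.n → ℓ.cyc v = c → ℓ.cnt v < 3)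
include hw hF h3

/-- A cycle that is not free meets a second demand. If `i` took the complement, the tree side of the
second demand would have to avoid it, so `i` would cross an edge that the second demand also
crosses; such an edge is crossed exactly twice. -/
theorem not_co_of_two_eq_zero (h2 : two c = 0) {co : ℕ → Prop} (hco : ℓ.Valid c co) {i : ℕ}
    (hi : i < ℓ.d) (hp : ℓ.pc i c ≠ 0) : ¬ co i := by
  intro hc
  obtain ⟨l, hl, hne, hpl⟩ := exists_other_meet (j := i) hF
  have h := hco.resolve_left hF i hi l hl hne.symm hp hpl
  obtain ⟨v, hv, hn, hcv, hcr⟩ := pc_ne_zero_iff.1 hpl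
  have h4 := (h.2 v hv hn hcv).2.1 ⟨hc, fun hcl => h.1 ⟨hc, hcl⟩⟩ hcr
  have h5 := two_le_cnt hi hl h4 hcr hne.symm
  have h6 := h3 v hv hn hcv
  have h7 := hw.two_eq_zero c h2 v hv hn hcv
  omega

theorem valid_of_two_eq_zero (h2 : two c = 0) : ℓ.Valid c fun _ => False := by
  refine Or.inr fun i hi l hl hil _ _ => ⟨fun h => h.1, fun v hv hn hc => ?_⟩
  refine ⟨fun _ h => ?_, fun h => h.1.elim, fun h => h.2.elim⟩
  have h5 := two_le_cnt hi hl h.1 h.2 hil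
  have h6 := h3 v hv hn hc
  have h7 := hw.two_eq_zero c h2 v hv hn hc
  omega

/-- The two demands crossing the edge `two c` cannot both take the tree side, so one demand takes
the complement, and only one because complements meet. Every other demand stays off this complement,
so the exceptional demand crosses all edges the others cross. -/
theorem exists_co_full (h2 : two c ≠ 0) {co : ℕ → Prop} (hco : ℓ.Valid c co) :
    ∃ j < ℓ.d, ℓ.pc j c = ℓ.numUsed c ∧ ∀ i < ℓ.d, ℓ.pc i c ≠ 0 → (co i ↔ i = j) := by
  have hv := Nat.pos_of_ne_zero h2
  have hn := hw.two_lt c h2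
  have hc := hw.cnt_two c h2
  have hcy := hw.cyc_two c h2
  have key : ∃ j < ℓ.d, ℓ.pc j c ≠ 0 ∧ co j := by
    have ha : ℓ.pc (c₁ (two c)) c ≠ 0 :=
      pc_ne_zero_iff.2 ⟨_, hv, hn, hcy, hw.cross₁ _ hv hn hc⟩
    have hb : ℓ.pc (c₂ (two c)) c ≠ 0 :=
      pc_ne_zero_iff.2 ⟨_, hv, hn, hcy, hw.cross₂ _ hv hn hc⟩
    have h := hco.resolve_left hF _ (hw.lt₁ _ hv hn hc) _ (hw.lt₂ _ hv hn hc)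
      (hw.ne _ hv hn hc) ha hb
    by_cases h4 : co (c₁ (two c))
    · exact ⟨_, hw.lt₁ _ hv hn hc, ha, h4⟩
    · by_cases h5 : co (c₂ (two c))
      · exact ⟨_, hw.lt₂ _ hv hn hc, hb, h5⟩
      · exact absurd ⟨hw.cross₁ _ hv hn hc, hw.cross₂ _ hv hn hc⟩
          ((h.2 _ hv hn hcy).1 ⟨h4, h5⟩)
  obtain ⟨j, hj, hpj, hcj⟩ := key
  have hnot : ∀ i < ℓ.d, ℓ.pc i c ≠ 0 → i ≠ j → ¬ co i := fun i hi hp hij hci =>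
    (hco.resolve_left hF i hi j hj hij hp hpj).1 ⟨hci, hcj⟩
  refine ⟨j, hj, (pc_eq_numUsed_iff hj).2 fun v hv hn hcv i hi hcr => ?_, fun i hi hp => ?_⟩
  · by_cases hij : i = j
    · exact hij ▸ hcr
    · have hp : ℓ.pc i c ≠ 0 := pc_ne_zero_iff.2 ⟨v, hv, hn, hcv, hcr⟩
      exact ((hco.resolve_left hF i hi j hj hij hp hpj).2 v hv hn hcv).2.2
        ⟨hnot i hi hp hij, hcj⟩ hcr
  · exact ⟨fun h => by
      by_contra hij
      exact hnot i hi hp hij h, fun h => h ▸ hcj⟩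

theorem numUsed_ne_zero (h2 : two c ≠ 0) : ℓ.numUsed c ≠ 0 := by
  refine card_ne_zero.2 ⟨two c, ?_⟩
  rw [mem_filter, mem_Ioo, hw.cnt_two c h2]
  exact ⟨⟨Nat.pos_of_ne_zero h2, hw.two_lt c h2⟩, hw.cyc_two c h2, by omega⟩

/-- If two demands cross all crossed edges, no other demand meets the cycle. -/
theorem eq_or_eq_of_two_le_numFull (h2 : two c ≠ 0) (hf : 2 ≤ ℓ.numFull c) :
    ℓ.pc (c₁ (two c)) c = ℓ.numUsed c ∧ ℓ.pc (c₂ (two c)) c = ℓ.numUsed c ∧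
      ∀ i < ℓ.d, ℓ.pc i c ≠ 0 → i = c₁ (two c) ∨ i = c₂ (two c) := by
  have hv := Nat.pos_of_ne_zero h2
  have hn := hw.two_lt c h2
  have hc := hw.cnt_two c h2
  have hcy := hw.cyc_two c h2
  obtain ⟨j, hj, hjf⟩ := exists_full (show ℓ.numFull c ≠ 0 by omega)
  obtain ⟨l, hl, hne, hlf⟩ := exists_other_full (j := j) hf
  have hj' := (pc_eq_numUsed_iff hj).1 hjf
  have hl' := (pc_eq_numUsed_iff hl).1 hlf
  have h1 := hw.lt₁ _ hv hn hc
  have hcrj := hj' _ hv hn hcy _ h1 (hw.cross₁ _ hv hn hc)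
  have hcrl := hl' _ hv hn hcy _ h1 (hw.cross₁ _ hv hn hc)
  have hjc := hw.eq_or_eq hv hn hc hj hcrj
  have hlc := hw.eq_or_eq hv hn hc hl hcrl
  have hthird : ∀ i < ℓ.d, ℓ.pc i c ≠ 0 → i = j ∨ i = l := by
    intro i hi hp
    by_contra! h
    obtain ⟨v, hv, hn, hcv, hcr⟩ := pc_ne_zero_iff.1 hp
    exact absurd (three_le_cnt hi hj hl hcr (hj' v hv hn hcv i hi hcr) (hl' v hv hn hcv i hi hcr)
      h.1 h.2 hne.symm) (not_le.2 (h3 v hv hn hcv))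
  rcases hjc with rfl | rfl <;> rcases hlc with rfl | rfl
  · exact absurd rfl hne
  · exact ⟨hjf, hlf, hthird⟩
  · exact ⟨hlf, hjf, fun i hi hp => (hthird i hi hp).symm⟩
  · exact absurd rfl hne

/-- Two demands crossing all crossed edges are not split evenly. -/
theorem two_mul_numUsed_ne (h2 : two c ≠ 0) (hf : 2 ≤ ℓ.numFull c) :
    2 * ℓ.numUsed c ≠ ℓ.len c := by
  obtain ⟨h4, h5, h6⟩ := eq_or_eq_of_two_le_numFull hw hF h3 h2 hf
  intro h
  refine hF (Or.inr ⟨fun i hi j hj l hl hpi hpj hpl => ?_, fun i hi hp => ?_⟩)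
  · rcases h6 i hi hpi with h | h <;> rcases h6 j hj hpj with h' | h' <;>
      rcases h6 l hl hpl with h'' | h'' <;> omega
  · rcases h6 i hi hp with rfl | rfl <;> omega

/-- The costs that can be obtained in a cycle. -/
theorem exists_valid_iff (f : ℕ → ℕ) :
    (∃ co, ℓ.Valid c co ∧ ∀ i < ℓ.d, f i = ℓ.sideCost c (co i) i) ↔
    (two c ≠ 0 → ℓ.numFull c ≠ 0) ∧ ∃ o : Prop, ∀ i < ℓ.d,
      f i = ℓ.forced two c i +
        if i = (if o then c₁ (two c) else c₂ (two c)) then ℓ.shared two c else 0 := by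
  by_cases h2 : two c = 0
  · have hs : ℓ.shared two c = 0 := by simp [shared, h2]
    have hfc : ∀ i, ℓ.forced two c i = ℓ.sideCost c False i := by
      intro i
      by_cases hp : ℓ.pc i c = 0 <;> simp [forced, sideCost, hF, h2, hp, detourCost_zero]
    simp only [hs, ite_self, add_zero, hfc, h2, ne_eq, not_true_eq_false, false_imp_iff, true_and,
      exists_const]
    constructor
    · rintro ⟨co, hco, hf⟩ i hi
      rw [hf i hi]
      by_cases hp : ℓ.pc i c = 0
      · simp [sideCost, hp]
      · simp [sideCost, not_co_of_two_eq_zero hw hF h3 h2 hco hi hp]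
    · intro h
      exact ⟨fun _ => False, valid_of_two_eq_zero hw hF h3 h2, h⟩
  have hS := numUsed_ne_zero hw hF h3 h2
  have hv := Nat.pos_of_ne_zero h2
  have hn := hw.two_lt c h2
  have hc := hw.cnt_two c h2
  have hcy := hw.cyc_two c h2
  have hL : ℓ.numUsed c < ℓ.len c := by
    unfold numUsed len
    refine Nat.lt_succ_of_le (card_le_card fun v => ?_)
    simp only [mem_filter]
    tauto
  have hl1 := hw.lt₁ _ hv hn hc
  have hl2 := hw.lt₂ _ hv hn hc
  have hne := hw.ne _ hv hn hc
  by_cases hf1 : ℓ.numFull c = 1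
  · have hs : ℓ.shared two c = 0 := by simp [shared, hf1]
    obtain ⟨j, hj, hjf⟩ := exists_full (show ℓ.numFull c ≠ 0 by omega)
    have hcost : ∀ i < ℓ.d, ∀ p : Prop, (ℓ.pc i c ≠ 0 → (p ↔ i = j)) →
        ℓ.sideCost c p i = ℓ.forced two c i := by
      intro i hi p hp
      by_cases h0 : ℓ.pc i c = 0
      · simp [sideCost, forced, h0, hF, h2, hf1, hS.symm, detourCost_zero]
      · have hp := hp h0
        by_cases hij : i = j
        · subst hij
          simp [sideCost, forced, hF, h2, hf1, hjf, hp, hS]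
        · have h4 : ℓ.pc i c ≠ ℓ.numUsed c := fun h => hij (full_unique hf1 hi hj h hjf)
          simp [sideCost, forced, h0, hF, h2, hf1, h4, hp, hij]
    simp only [hs, ite_self, add_zero, exists_const, hf1]
    constructor
    · rintro ⟨co, hco, hf⟩
      refine ⟨fun _ => one_ne_zero, fun i hi => ?_⟩
      obtain ⟨j', hj', hjf', h⟩ := exists_co_full hw hF h3 h2 hco
      have := full_unique hf1 hj' hj hjf' hjf
      subst this
      rw [hf i hi, hcost i hi _ (h i hi)]
    · rintro ⟨-, h⟩
      refine ⟨fun i => i = j, valid_of_full h3 hj hjf, fun i hi => ?_⟩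
      rw [h i hi, hcost i hi _ fun _ => Iff.rfl]
  by_cases hf2 : 2 ≤ ℓ.numFull c
  · obtain ⟨ha, hb, hthird⟩ := eq_or_eq_of_two_le_numFull hw hF h3 h2 hf2
    have hne2 := two_mul_numUsed_ne hw hF h3 h2 hf2
    have hs : ℓ.shared two c = detourCost (ℓ.len c) (ℓ.numUsed c) +
        detourCost (ℓ.len c) (ℓ.len c - ℓ.numUsed c) := by simp [shared, hF, h2, hf2]
    have hfor : ∀ i, ℓ.forced two c i = 0 := fun i => by simp [forced, hF, h2, hf1]
    -- The two candidates have tree sides of the same size, which is not half of the cycle. One of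
    -- the two sides is short and costs nothing, so only one demand pays: the one on the complement
    -- if the tree side is short, and the other one otherwise.
    have hcost : ∀ i < ℓ.d, ∀ co : ℕ → Prop, (co (c₁ (two c)) ↔ ¬ co (c₂ (two c))) →
        ℓ.sideCost c (co i) i = if i = (if (2 * ℓ.numUsed c < ℓ.len c ↔ co (c₁ (two c)))
          then c₁ (two c) else c₂ (two c)) then ℓ.shared two c else 0 := by
      intro i hi co hco
      by_cases h0 : ℓ.pc i c = 0
      · have h4 : i ≠ c₁ (two c) := by
          rintro rfl
          omega
        have h5 : i ≠ c₂ (two c) := by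
          rintro rfl
          omega
        split_ifs <;> simp_all [sideCost]
      · rcases lt_or_gt_of_ne hne2 with h | h
        · have h4 := detourCost_of_two_mul_lt h
          rcases hthird i hi h0 with rfl | rfl <;> by_cases h5 : co (c₁ (two c)) <;>
            by_cases h6 : co (c₂ (two c)) <;>
            simp_all [sideCost, hne.symm]
        · have h4 := detourCost_of_two_mul_lt (L := ℓ.len c) (p := ℓ.len c - ℓ.numUsed c)
            (by omega)
          rcases hthird i hi h0 with rfl | rfl <;> by_cases h5 : co (c₁ (two c)) <;>
            by_cases h6 : co (c₂ (two c)) <;>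
            simp_all [sideCost, hne.symm, not_lt.2 h.le]
    simp only [hfor, zero_add]
    constructor
    · rintro ⟨co, hco, hf⟩
      refine ⟨fun _ => by omega, (2 * ℓ.numUsed c < ℓ.len c ↔ co (c₁ (two c))), fun i hi => ?_⟩
      obtain ⟨j, hj, hjf, h⟩ := exists_co_full hw hF h3 h2 hco
      have hside : co (c₁ (two c)) ↔ ¬ co (c₂ (two c)) := by
        grind
      rw [hf i hi, hcost i hi co hside]
      congr
    · rintro ⟨-, o, h⟩
      obtain ⟨j, hj, hjf, hjc, hjo⟩ : ∃ j < ℓ.d, ℓ.pc j c = ℓ.numUsed c ∧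
          (c₁ (two c) = j ↔ ¬ c₂ (two c) = j) ∧
          ((2 * ℓ.numUsed c < ℓ.len c ↔ c₁ (two c) = j) ↔ o) := by
        grind
      refine ⟨fun i => i = j, valid_of_full h3 hj hjf, fun i hi => ?_⟩
      rw [h i hi, hcost i hi (fun i => i = j) hjc]
      simp only [hjo]
  · have hf0 : ℓ.numFull c = 0 := by omega
    simp only [hf0, ne_eq, h2, not_false_eq_true, not_true_eq_false, imp_false, false_and,
      iff_false]
    rintro ⟨co, hco, -⟩
    obtain ⟨j, hj, hjf, -⟩ := exists_co_full hw hF h3 h2 hco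
    exact one_le_numFull hj hjf hf0

end Local

/-! ### The combined criterion -/

theorem cyc_le (hc : ℓ.Cactus) {v : ℕ} (hv : 0 < v) (hn : v < ℓ.n) : ℓ.cyc v ≤ ℓ.m := by
  rcases cyc_cases hc hv hn with h | ⟨e, he, -, h⟩ <;> omega

theorem pc_eq_zero_of_not_NT (hc : ℓ.Cactus) {e : ℕ} (h : ¬ ℓ.NT e) (i : ℕ) :
    ℓ.pc i (e + 1) = 0 := by
  by_contra hp
  obtain ⟨v, hv, hn, hcv, -⟩ := pc_ne_zero_iff.1 hp
  rcases cyc_cases hc hv hn with h0 | ⟨e', he', hNT, h1⟩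
  · omega
  · grind

theorem solvable_iff_sideCost (hc : ℓ.Cactus) : ℓ.Solvable ↔
    (∀ v, 0 < v → v < ℓ.n → ℓ.cyc v = 0 → ℓ.cnt v < 2) ∧ ∃ co : ℕ → ℕ → Prop,
      (∀ e < ℓ.m, ℓ.Valid (e + 1) (co e)) ∧
      ∀ i < ℓ.d, ∑ e ∈ range ℓ.m, ℓ.sideCost (e + 1) (co e i) i ≤ ℓ.k := by
  unfold Solvable
  refine and_congr ?_ (exists_congr fun co => and_congr ?_ ?_)
  · refine forall_congr' fun v => forall_congr' fun _ => forall_congr' fun _ =>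
      forall_congr' fun _ => ?_
    constructor
    · intro h
      by_contra h2
      obtain ⟨i, hi, j, hj, hij⟩ := one_lt_card.1 (show 1 < ℓ.cnt v by omega)
      rw [mem_filter, mem_range] at hi hj
      exact hij (h i hi.1 j hj.1 hi.2 hj.2)
    · intro h i hi j hj h1 h2
      by_contra hij
      exact absurd (two_le_cnt hi hj h1 h2 hij) (not_le.2 h)
  · refine forall_congr' fun e => forall_congr' fun _ => ?_
    by_cases hNT : ℓ.NT e
    · simp only [hNT, true_imp_iff, Valid]
    · refine iff_of_true (fun h => absurd h hNT) (Or.inl (Or.inl fun i _ j _ h => ?_))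
      exact absurd (pc_eq_zero_of_not_NT hc hNT i) h
  · refine forall_congr' fun i => forall_congr' fun _ => ?_
    rw [sum_congr rfl]
    intro e _
    by_cases hNT : ℓ.NT e
    · simp only [hNT, true_and, sideCost]
    · have := pc_eq_zero_of_not_NT hc hNT i
      simp [sideCost, hNT, this]

variable (ℓ) in
/-- The amount that has to be paid at the tree edge above `v` by one of the two demands crossing
it. -/
def weight (two : ℕ → ℕ) (v : ℕ) : ℕ :=
  if ℓ.cyc v ≠ 0 ∧ two (ℓ.cyc v) = v then ℓ.shared two (ℓ.cyc v) else 0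

/-- The shared cost of a cycle is placed at its witness node `two c`, and the cycle is recovered as
the cycle number of that node. Cycles without a witness share nothing. -/
theorem sum_weight (hc : ℓ.Cactus) {two c₁ c₂ : ℕ → ℕ} (hw : ℓ.Witness two c₁ c₂) (x : ℕ → ℕ)
    (i : ℕ) : ∑ v ∈ Finset.Ioo 0 ℓ.n, (if i = x v then ℓ.weight two v else 0) =
      ∑ e ∈ range ℓ.m, if i = x (two (e + 1)) then ℓ.shared two (e + 1) else 0 := by
  rw [← sum_filter_add_sum_filter_not (range ℓ.m) (fun e => two (e + 1) ≠ 0)]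
  rw [← sum_filter_add_sum_filter_not (Finset.Ioo 0 ℓ.n)
    (fun v => ℓ.cyc v ≠ 0 ∧ two (ℓ.cyc v) = v)]
  congr 1
  · refine sum_bij' (fun v _ => ℓ.cyc v - 1) (fun e _ => two (e + 1)) ?_ ?_ ?_ ?_ ?_
    · intro v hv
      simp only [mem_filter, mem_Ioo, mem_range] at hv ⊢
      have := cyc_le hc hv.1.1 hv.1.2
      rw [Nat.sub_add_cancel (by omega)]
      omega
    · intro e he
      simp only [mem_filter, mem_Ioo, mem_range] at he ⊢
      rw [hw.cyc_two _ he.2]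
      have := hw.two_lt _ he.2
      omega
    · grind
    · intro e he
      simp only [mem_filter, mem_range] at he
      rw [hw.cyc_two _ he.2]
      omega
    · intro v hv
      simp only [mem_filter, mem_Ioo] at hv
      rw [Nat.sub_add_cancel (by omega), hv.2.2, weight, if_pos hv.2]
  · rw [sum_eq_zero, sum_eq_zero]
    · intro e he
      simp only [mem_filter, not_not] at he
      simp [shared, he.2]
    · intro v hv
      simp only [mem_filter] at hv
      rw [weight, if_neg hv.2, ite_self]

/-- After `exists_valid_iff` the choices in different cycles interact only through the budgets, and
what is left to decide is which of two demands pays at each witness node. -/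
theorem solvable_iff (hc : ℓ.Cactus) {two c₁ c₂ : ℕ → ℕ} (hw : ℓ.Witness two c₁ c₂) :
    ℓ.Solvable ↔ (∀ v, 0 < v → v < ℓ.n → ℓ.cnt v < 3 ∧ (ℓ.cyc v = 0 → ℓ.cnt v < 2)) ∧
      (∀ e < ℓ.m, ¬ ℓ.Free (e + 1) → two (e + 1) ≠ 0 → ℓ.numFull (e + 1) ≠ 0) ∧
      ∃ o : ℕ → Prop, ∀ i < ℓ.d, ∑ e ∈ range ℓ.m, ℓ.forced two (e + 1) i +
        ∑ v ∈ Finset.Ioo 0 ℓ.n,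
          (if i = (if o v then c₁ v else c₂ v) then ℓ.weight two v else 0) ≤ ℓ.k := by
  rw [solvable_iff_sideCost hc]
  have hfree : ∀ c, ℓ.Free c → (∀ i, ℓ.forced two c i = 0) ∧ ℓ.shared two c = 0 ∧
      ∀ p i, ℓ.sideCost c p i = 0 := fun c h => by simp [forced, shared, sideCost, h]
  constructor
  · rintro ⟨h1, co, h2, h4⟩
    -- Of three demands crossing one tree edge of a cycle, at most one takes the complement, so two
    -- tree sides would overlap in that edge; and a free cycle does not meet three demands.
    have h3 : ∀ v, 0 < v → v < ℓ.n → ℓ.cnt v < 3 := by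
      intro v hv hn
      by_contra h
      rcases cyc_cases hc hv hn with h0 | ⟨e, he, -, hcv⟩
      · have := h1 v hv hn h0
        omega
      · obtain ⟨i, hi, j, hj, l, hl, hci, hcj, hcl, hij, hil, hjl⟩ := exists_three_of_cnt
          (not_lt.1 h)
        have hpi : ℓ.pc i (e + 1) ≠ 0 := pc_ne_zero_iff.2 ⟨v, hv, hn, hcv, hci⟩
        have hpj : ℓ.pc j (e + 1) ≠ 0 := pc_ne_zero_iff.2 ⟨v, hv, hn, hcv, hcj⟩
        have hpl : ℓ.pc l (e + 1) ≠ 0 := pc_ne_zero_iff.2 ⟨v, hv, hn, hcv, hcl⟩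
        rcases h2 e he with hF | hcomp
        · rcases hF with hF | hF
          · exact hij (hF i hi j hj hpi hpj)
          · rcases hF.1 i hi j hj l hl hpi hpj hpl with h | h | h
            exacts [hij h, hil h, hjl h]
        · have a1 := hcomp i hi j hj hij hpi hpj
          have a2 := hcomp i hi l hl hil hpi hpl
          have a3 := hcomp j hj l hl hjl hpj hpl
          have b1 := (a1.2 v hv hn hcv).1
          have b2 := (a2.2 v hv hn hcv).1
          have b3 := (a3.2 v hv hn hcv).1
          by_cases hi' : co e i
          · exact b3 ⟨fun h => a1.1 ⟨hi', h⟩, fun h => a2.1 ⟨hi', h⟩⟩ ⟨hcj, hcl⟩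
          · by_cases hj' : co e j
            · exact b2 ⟨hi', fun h => a3.1 ⟨hj', h⟩⟩ ⟨hci, hcl⟩
            · exact b1 ⟨hi', hj'⟩ ⟨hci, hcj⟩
    refine ⟨fun v hv hn => ⟨h3 v hv hn, h1 v hv hn⟩, ?_⟩
    have hloc : ∀ e, ∃ o : Prop, e < ℓ.m → (¬ ℓ.Free (e + 1) → two (e + 1) ≠ 0 →
        ℓ.numFull (e + 1) ≠ 0) ∧ ∀ i < ℓ.d, ℓ.sideCost (e + 1) (co e i) i =
        ℓ.forced two (e + 1) i + if i = (if o then c₁ (two (e + 1)) else c₂ (two (e + 1))) then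
          ℓ.shared two (e + 1) else 0 := by
      intro e
      by_cases he : e < ℓ.m
      · by_cases hF : ℓ.Free (e + 1)
        · obtain ⟨a1, a2, a3⟩ := hfree _ hF
          exact ⟨True, fun _ => ⟨fun h => absurd hF h, fun i _ => by simp [a1, a2, a3]⟩⟩
        · obtain ⟨hb, o, ho⟩ := (exists_valid_iff hw hF (fun v hv hn _ => h3 v hv hn)
            fun i => ℓ.sideCost (e + 1) (co e i) i).1 ⟨co e, h2 e he, fun i _ => rfl⟩
          exact ⟨o, fun _ => ⟨fun _ => hb, ho⟩⟩
      · exact ⟨True, fun h => absurd h he⟩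
    choose o ho using hloc
    -- The choice belonging to a witness node is that of its cycle, whose index is the cycle number
    -- minus one.
    refine ⟨fun e he => (ho e he).1, fun v => o (ℓ.cyc v - 1), fun i hi => ?_⟩
    refine le_trans (le_of_eq ?_) (h4 i hi)
    rw [sum_weight hc hw, ← sum_add_distrib]
    refine sum_congr rfl fun e he => ?_
    rw [(ho e (mem_range.1 he)).2 i hi]
    by_cases h0 : two (e + 1) = 0
    · simp [shared, h0]
    · simp only [hw.cyc_two _ h0, Nat.add_sub_cancel]
  · rintro ⟨h3, hb, o, ho⟩
    refine ⟨fun v hv hn => (h3 v hv hn).2, ?_⟩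
    have hloc : ∀ e, ∃ co : ℕ → Prop, e < ℓ.m → ℓ.Valid (e + 1) co ∧
        ∀ i < ℓ.d, ℓ.forced two (e + 1) i +
        (if i = (if o (two (e + 1)) then c₁ (two (e + 1)) else c₂ (two (e + 1))) then
          ℓ.shared two (e + 1) else 0) = ℓ.sideCost (e + 1) (co i) i := by
      intro e
      by_cases he : e < ℓ.m
      · by_cases hF : ℓ.Free (e + 1)
        · obtain ⟨a1, a2, a3⟩ := hfree _ hF
          exact ⟨fun _ => True, fun _ => ⟨Or.inl hF, fun i _ => by simp [a1, a2, a3]⟩⟩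
        · obtain ⟨co, h⟩ := (exists_valid_iff hw hF (fun v hv hn _ => (h3 v hv hn).1) _).2
            ⟨hb e he hF, o (two (e + 1)), fun i _ => rfl⟩
          exact ⟨co, fun _ => h⟩
      · exact ⟨fun _ => True, fun h => absurd h he⟩
    choose co hco using hloc
    refine ⟨co, fun e he => (hco e he).1, fun i hi => ?_⟩
    refine le_trans (le_of_eq ?_) (ho i hi)
    rw [sum_weight hc hw, ← sum_add_distrib]
    refine sum_congr rfl fun e he => ?_
    rw [(hco e (mem_range.1 he)).2 i hi]

end Layout

end

end CactusRouting
namespace CactusRouting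

open scoped Classical
noncomputable section


/-! ### The dynamic program -/

/-- The state of the dynamic program. Demand `i` has the slots `2 * i` and `2 * i + 1`, one for each
of its ends. `mate γ` is `0` or one more than the slot sharing costs with `γ`, and `need γ x` is the
least budget for the mate of `γ` if `γ` has budget `x`. -/
structure Ledger where
  mate : ℕ → ℕ
  need : ℕ → ℕ → ℕ
  used : ℕ → ℕ
  done : ℕ → ℕ

namespace Layout

variable (ℓ : Layout)

/-- The node at which the slot `γ` starts. -/
def slotEnd (γ : ℕ) : ℕ := if γ % 2 = 0 then ℓ.sp (γ / 2) else ℓ.tp (γ / 2)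

/-- Both ends of demand `i` are below `v`. -/
def Below (i v : ℕ) : Prop := Anc ℓ.par v (ℓ.sp i) ∧ Anc ℓ.par v (ℓ.tp i)

/-- Well-formedness of the state of the dynamic program while node `v` is processed. -/
structure Inv (S : Ledger) (v : ℕ) : Prop where
  symm : ∀ γ δ, S.mate γ = δ + 1 → S.mate δ = γ + 1
  ne : ∀ γ δ, S.mate γ = δ + 1 → γ ≠ δ
  lt : ∀ γ, S.mate γ ≠ 0 → γ / 2 < ℓ.d
  active : ∀ γ, S.mate γ ≠ 0 → S.done (γ / 2) = 0
  ends : ∀ γ δ, S.mate γ = δ + 1 → ∀ u ≤ v, Anc ℓ.par u (ℓ.slotEnd γ) → Anc ℓ.par u (ℓ.slotEnd δ)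
  galois : ∀ γ δ, S.mate γ = δ + 1 → ∀ x ≤ ℓ.k, ∀ y ≤ ℓ.k, S.need γ x ≤ y → S.need δ y ≤ x
  need_le : ∀ γ, S.mate γ ≠ 0 → ∀ x ≤ ℓ.k, S.need γ x ≤ ℓ.k + 1
  used_le : ∀ i < ℓ.d, S.used i ≤ ℓ.k
  done_below : ∀ i < ℓ.d, S.done i ≠ 0 → ∃ u, v ≤ u ∧ ℓ.Below i u

/-- The slot `ε` is properly linked to its mate `ζ`. -/
def Paired (S : Ledger) (v ε ζ : ℕ) : Prop :=
  S.mate ζ = ε + 1 ∧ ε ≠ ζ ∧ ε / 2 < ℓ.d ∧ S.done (ε / 2) = 0 ∧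
    (∀ u ≤ v, Anc ℓ.par u (ℓ.slotEnd ε) → Anc ℓ.par u (ℓ.slotEnd ζ)) ∧
    (∀ x ≤ ℓ.k, ∀ y ≤ ℓ.k, S.need ε x ≤ y → S.need ζ y ≤ x) ∧ ∀ x ≤ ℓ.k, S.need ε x ≤ ℓ.k + 1

variable (q c₁ c₂ : ℕ → ℕ)

/-- The amount paid by demand `i` at the tree edge above `v` under the choice `o`. -/
def pay (o : ℕ → Prop) (v i : ℕ) : ℕ :=
  if i = (if o v then c₁ v else c₂ v) then q v else 0

/-- The allocation `a` of budgets to slots and the choices `o` at the remaining nodes below `t`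
respect all budgets. -/
def Feasible (S : Ledger) (t : ℕ) (o : ℕ → Prop) (a : ℕ → ℕ) : Prop :=
  (∀ i < ℓ.d, S.done i = 0 → S.used i + (a (2 * i) + a (2 * i + 1)) +
    ∑ v ∈ Finset.Ioo 0 t, pay q c₁ c₂ o v i ≤ ℓ.k) ∧
  ∀ γ δ, S.mate γ = δ + 1 → S.need γ (a γ) ≤ a δ

/-- The remaining problem has a solution. -/
def Sat (S : Ledger) (t : ℕ) : Prop := ∃ o a, ℓ.Feasible q c₁ c₂ S t o a

variable {ℓ} {q c₁ c₂}

theorem Feasible.le {S : Ledger} {t : ℕ} {o : ℕ → Prop} {a : ℕ → ℕ}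
    (h : ℓ.Feasible q c₁ c₂ S t o a) {γ : ℕ} (hd : γ / 2 < ℓ.d) (ha : S.done (γ / 2) = 0) :
    S.used (γ / 2) + a γ ≤ ℓ.k := by
  have h1 := h.1 _ hd ha
  have : γ = 2 * (γ / 2) ∨ γ = 2 * (γ / 2) + 1 := by omega
  rcases this with h2 | h2 <;> rw [← h2] at h1 <;> omega

theorem Inv.pair {S : Ledger} {v : ℕ} (h : ℓ.Inv S v) (ε ζ : ℕ) (he : S.mate ε = ζ + 1) :
    ℓ.Paired S v ε ζ :=
  ⟨h.symm ε ζ he, h.ne ε ζ he, h.lt ε (by omega), h.active ε (by omega), h.ends ε ζ he,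
    h.galois ε ζ he, h.need_le ε (by omega)⟩

theorem inv_of_pairs {S' : Ledger} {v : ℕ}
    (h : ∀ ε ζ, S'.mate ε = ζ + 1 → ℓ.Paired S' v ε ζ) (hu : ∀ i < ℓ.d, S'.used i ≤ ℓ.k)
    (hd : ∀ i < ℓ.d, S'.done i ≠ 0 → ∃ u, v ≤ u ∧ ℓ.Below i u) : ℓ.Inv S' v := by
  have h' : ∀ ε, S'.mate ε ≠ 0 → ∃ ζ, ℓ.Paired S' v ε ζ := fun ε he =>
    (Nat.exists_eq_succ_of_ne_zero he).imp fun ζ hζ => h ε ζ hζ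
  exact ⟨fun ε ζ he => (h ε ζ he).1, fun ε ζ he => (h ε ζ he).2.1,
    fun ε he => (h' ε he).elim fun _ h => h.2.2.1, fun ε he => (h' ε he).elim fun _ h => h.2.2.2.1,
    fun ε ζ he => (h ε ζ he).2.2.2.2.1, fun ε ζ he => (h ε ζ he).2.2.2.2.2.1,
    fun ε he => (h' ε he).elim fun _ h => h.2.2.2.2.2.2, hu, hd⟩

theorem slotEnd_even (i : ℕ) : ℓ.slotEnd (2 * i) = ℓ.sp i := by
  unfold slotEnd
  rw [if_pos (by omega), Nat.mul_div_cancel_left _ two_pos]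

theorem slotEnd_odd (i : ℕ) : ℓ.slotEnd (2 * i + 1) = ℓ.tp i := by
  unfold slotEnd
  rw [if_neg (by omega), show (2 * i + 1) / 2 = i by omega]

theorem slotEnd_of_below {i v γ : ℕ} (h : ℓ.Below i v) (hγ : γ / 2 = i) :
    Anc ℓ.par v (ℓ.slotEnd γ) := by
  unfold slotEnd
  split_ifs
  · exact hγ ▸ h.1
  · exact hγ ▸ h.2

section Tree

variable (h0 : ℓ.par 0 = 0) (hpar : ∀ j, 0 < j → ℓ.par j < j)
include h0 hpar

/-- Two nodes below `v` have the same ancestors among the nodes numbered at most `v`. This lets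
links between slots survive an elimination at `v`. -/
theorem anc_of_anc {u v x y : ℕ} (hx : Anc ℓ.par v x) (hy : Anc ℓ.par v y) (huv : u ≤ v)
    (h : Anc ℓ.par u x) : Anc ℓ.par u y :=
  (hx.chain h0 hpar h huv).trans hy

theorem not_cross_of_below {i u v : ℕ} (h : ℓ.Below i v) (huv : u ≤ v) : ¬ ℓ.Cross i u := by
  unfold Cross Sep
  rw [not_not]
  exact ⟨anc_of_anc h0 hpar h.1 h.2 huv, anc_of_anc h0 hpar h.2 h.1 huv⟩

/-- A demand that has been below a processed node has nothing left to pay. -/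
theorem sum_pay_eq_zero (hq : ∀ v, q v ≠ 0 → ℓ.Cross (c₁ v) v ∧ ℓ.Cross (c₂ v) v) {i v t : ℕ}
    (h : ℓ.Below i v) (ht : t ≤ v + 1) (o : ℕ → Prop) :
    ∑ u ∈ Finset.Ioo 0 t, pay q c₁ c₂ o u i = 0 := by
  refine Finset.sum_eq_zero fun u hu => ?_
  rw [Finset.mem_Ioo] at hu
  unfold pay
  by_contra hne
  have h1 : i = (if o u then c₁ u else c₂ u) ∧ q u ≠ 0 := by
    by_contra h2
    refine hne (ite_eq_right_iff.2 fun h3 => ?_)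
    by_contra h4
    exact h2 ⟨h3, h4⟩
  have h2 := hq u h1.2
  refine not_cross_of_below h0 hpar h (u := u) (by omega) ?_
  rw [h1.1]
  split_ifs
  exacts [h2.1, h2.2]

variable (hq : ∀ v, q v ≠ 0 → ℓ.Cross (c₁ v) v ∧ ℓ.Cross (c₂ v) v)
  {S S' : Ledger} {v i A B : ℕ} (hI : ℓ.Inv S v) (hi : i < ℓ.d) (hdone : S.done i = 0)
  (hb : ℓ.Below i v) (hAB : A = 2 * i ∧ B = 2 * i + 1 ∨ A = 2 * i + 1 ∧ B = 2 * i)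
  (hd' : ∀ j, S'.done j = if j = i then 1 else S.done j)
include hq hI hi hdone hb hAB hd'

/-- Nothing remains to be paid at unprocessed nodes, so the two slots have exactly the unused budget
between them. -/
theorem budget_of_below (t : ℕ) (ht : t ≤ v + 1) {o : ℕ → Prop} {a : ℕ → ℕ}
    (hf : ℓ.Feasible q c₁ c₂ S t o a) : a A + a B ≤ ℓ.k - S.used i := by
  have h1 := hf.1 i hi hdone
  rw [sum_pay_eq_zero h0 hpar hq hb ht] at h1
  have := hI.used_le i hi
  rcases hAB with ⟨rfl, rfl⟩ | ⟨rfl, rfl⟩ <;> omega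

theorem done_below_of_elim : ∀ j < ℓ.d, S'.done j ≠ 0 → ∃ u, v ≤ u ∧ ℓ.Below j u := by
  intro j hj h
  rw [hd'] at h
  by_cases hji : j = i
  · exact ⟨v, le_rfl, hji ▸ hb⟩
  · rw [if_neg hji] at h
    exact hI.done_below j hj h


/-- Eliminating a demand without mates. -/
theorem elim_free (hA : S.mate A = 0) (hB : S.mate B = 0) (hm : S'.mate = S.mate)
    (hn : S'.need = S.need) (hu : S'.used = S.used) :
    ℓ.Inv S' v ∧ (ℓ.Sat q c₁ c₂ S' (v + 1) ↔ ℓ.Sat q c₁ c₂ S (v + 1)) := by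
  have hni : ∀ γ, S.mate γ ≠ 0 → γ / 2 ≠ i := by grind
  have hz : ∀ o j, j = i → ∑ u ∈ Finset.Ioo 0 (v + 1), pay q c₁ c₂ o u j = 0 := fun o j h =>
    h ▸ sum_pay_eq_zero h0 hpar hq hb le_rfl o
  have hup := hI.used_le i hi
  have hs := hI.symm
  refine ⟨inv_of_pairs (fun ε ζ h => ?_) (hu ▸ hI.used_le)
    (done_below_of_elim h0 hpar hq hI hi hdone hb hAB hd'), ?_, ?_⟩
  · obtain ⟨h1, h2, h3, h4, h5⟩ := hI.pair ε ζ (hm ▸ h)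
    unfold Paired
    rw [hd', if_neg (hni ε (by rw [← hm]; omega)), hm, hn]
    exact ⟨h1, h2, h3, h4, h5⟩
  · rintro ⟨o, a, h1, h2⟩
    rw [hm, hn] at h2
    rw [hu] at h1
    refine ⟨o, fun γ => if γ = A ∨ γ = B then 0 else a γ, fun j hj hdj => ?_, fun γ δ h => ?_⟩
    · have := h1 j hj
      have := hz o j
      grind
    · grind
  · rintro ⟨o, a, h1, h2⟩
    refine ⟨o, a, fun j hj hdj => ?_, by rw [hm, hn]; exact h2⟩
    grind

/-- Eliminating a demand whose two slots are mates of each other. -/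
theorem elim_loop (hA : S.mate A = B + 1) (hm : ∀ γ, S'.mate γ = if γ = A ∨ γ = B then 0 else
      S.mate γ) (hn : S'.need = S.need) (hu : S'.used = S.used) :
    ℓ.Inv S' v ∧ (ℓ.Sat q c₁ c₂ S (v + 1) ↔
      (∃ x ≤ ℓ.k - S.used i, x + S.need A x ≤ ℓ.k - S.used i) ∧ ℓ.Sat q c₁ c₂ S' (v + 1)) := by
  have hs := hI.symm
  have hB := hs _ _ hA
  have hup := hI.used_le i hi
  have hz : ∀ o j, j = i → ∑ u ∈ Finset.Ioo 0 (v + 1), pay q c₁ c₂ o u j = 0 := fun o j h =>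
    h ▸ sum_pay_eq_zero h0 hpar hq hb le_rfl o
  have hmate : ∀ γ δ, S'.mate γ = δ + 1 → S.mate γ = δ + 1 ∧ S'.mate δ = γ + 1 ∧ γ / 2 ≠ i ∧
      δ / 2 ≠ i := by grind
  refine ⟨inv_of_pairs (fun ε ζ h => ?_) (hu ▸ hI.used_le)
    (done_below_of_elim h0 hpar hq hI hi hdone hb hAB hd'), ?_, ?_⟩
  · obtain ⟨e1, e2, e3, -⟩ := hmate ε ζ h
    unfold Paired
    rw [hd', if_neg e3, hn]
    exact ⟨e2, (hI.pair ε ζ e1).2⟩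
  · rintro ⟨o, a, hf⟩
    have h3 := budget_of_below h0 hpar hq hI hi hdone hb hAB hd' _ le_rfl hf
    have h4 := hf.2 A B hA
    refine ⟨⟨a A, by omega, by omega⟩, o, a, fun j hj hdj => ?_, fun γ δ h => ?_⟩
    · have := hf.1 j hj
      grind
    · rw [hn]
      exact hf.2 γ δ (hmate γ δ h).1
  · rintro ⟨⟨x, hx, hx'⟩, o, a, h1, h2⟩
    -- The slot `A` receives `x` and its mate `B` just what it then needs; the converse constraint
    -- is the Galois condition.
    refine ⟨o, fun γ => if γ = A then x else if γ = B then S.need A x else a γ,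
      fun j hj hdj => ?_, fun γ δ h => ?_⟩
    · have := h1 j hj
      have := hz o j
      grind
    · have h5 := hI.galois _ _ hA x (by omega) (S.need A x) (by omega) le_rfl
      have := h2 γ δ
      grind

/-- Eliminating a demand one of whose slots has a mate. -/
theorem elim_leaf {δ : ℕ} (hA : S.mate A = δ + 1) (hB : S.mate B = 0)
    (hm : ∀ γ, S'.mate γ = if γ = A ∨ γ = δ then 0 else S.mate γ) (hn : S'.need = S.need)
    (hu : ∀ j, S'.used j = if j = δ / 2 then S.used j + S.need A (ℓ.k - S.used i) else S.used j) :
    (S'.used (δ / 2) ≤ ℓ.k → ℓ.Inv S' v) ∧ (ℓ.Sat q c₁ c₂ S (v + 1) ↔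
      S'.used (δ / 2) ≤ ℓ.k ∧ ℓ.Sat q c₁ c₂ S' (v + 1)) := by
  have hup := hI.used_le i hi
  have hs := hI.symm
  have hδ := hs _ _ hA
  have hz : ∀ o j, j = i → ∑ u ∈ Finset.Ioo 0 (v + 1), pay q c₁ c₂ o u j = 0 := fun o j h =>
    h ▸ sum_pay_eq_zero h0 hpar hq hb le_rfl o
  obtain ⟨-, hδA, hδd, hδa, -⟩ := hI.pair _ _ hδ
  have hδi : δ / 2 ≠ i := by grind
  have hmate : ∀ γ ε, S'.mate γ = ε + 1 → S.mate γ = ε + 1 ∧ S'.mate ε = γ + 1 ∧ γ / 2 ≠ i ∧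
      γ ≠ δ ∧ ε / 2 ≠ i ∧ ε ≠ δ := fun γ ε h => by
    have := hs γ ε
    grind (splits := 20)
  refine ⟨fun hle => inv_of_pairs (fun ε ζ h => ?_) (fun j hj => ?_)
    (done_below_of_elim h0 hpar hq hI hi hdone hb hAB hd'), ?_, ?_⟩
  · obtain ⟨e1, e2, e3, -⟩ := hmate ε ζ h
    unfold Paired
    rw [hd', if_neg e3, hn]
    exact ⟨e2, (hI.pair ε ζ e1).2⟩
  · have := hI.used_le j hj
    grind
  · rintro ⟨o, a, hf⟩
    have h3 := budget_of_below h0 hpar hq hI hi hdone hb hAB hd' _ le_rfl hf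
    have h4 := hf.2 δ A hδ
    have h5 := hf.le hδd hδa
    have h6 := hI.galois δ A hδ (a δ) (by omega) (ℓ.k - S.used i) (by omega) (by omega)
    -- The contribution of `δ` to the eliminated demand moves from its allocation to the used part,
    -- so it is subtracted here.
    refine ⟨by grind, o, fun γ => if γ = δ then a δ - S.need A (ℓ.k - S.used i) else a γ,
      fun j hj hdj => ?_, fun γ ε h => ?_⟩
    · have := hf.1 j hj
      grind
    · have := hf.2 γ ε
      grind
  · rintro ⟨hle, o, a, hf⟩
    have hlea := hf.le hδd (by rw [hd', if_neg hδi, hδa])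
    have hneed := hI.galois A δ hA (ℓ.k - S.used i) (by omega)
      (a δ + S.need A (ℓ.k - S.used i)) (by grind) (by omega)
    -- Conversely, `A` may as well take the whole remaining budget of its demand, since the other
    -- slot has no mate; this makes the charge on `δ` least possible.
    refine ⟨o, fun γ => if γ = δ then a δ + S.need A (ℓ.k - S.used i) else
      if γ = A then ℓ.k - S.used i else if γ = B then 0 else a γ, fun j hj hdj => ?_,
      fun γ ε h => ?_⟩
    · have := hf.1 j hj
      have := hz o j
      grind (splits := 20)
    · have := hf.2 γ ε
      grind

set_option maxHeartbeats 1000000 in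
/-- Eliminating a demand whose two slots have different mates. -/
theorem elim_merge {γ δ : ℕ} (hA : S.mate A = γ + 1) (hB : S.mate B = δ + 1) (hne : γ ≠ B)
    (hm : ∀ ε, S'.mate ε = if ε = γ then δ + 1 else if ε = δ then γ + 1 else
      if ε = A ∨ ε = B then 0 else S.mate ε)
    (hγ : ∀ x ≤ ℓ.k, S'.need γ x = if S.need γ x ≤ ℓ.k - S.used i then
      S.need B (ℓ.k - S.used i - S.need γ x) else ℓ.k + 1)
    (hδ : ∀ x ≤ ℓ.k, S'.need δ x = if S.need δ x ≤ ℓ.k - S.used i then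
      S.need A (ℓ.k - S.used i - S.need δ x) else ℓ.k + 1)
    (hn : ∀ ε, ε ≠ γ → ε ≠ δ → ∀ x ≤ ℓ.k, S'.need ε x = S.need ε x) (hu : S'.used = S.used) :
    ℓ.Inv S' v ∧ (ℓ.Sat q c₁ c₂ S (v + 1) ↔ ℓ.Sat q c₁ c₂ S' (v + 1)) := by
  have hup := hI.used_le i hi
  have hs := hI.symm
  have hγA := hs _ _ hA
  have hδB := hs _ _ hB
  have n1 := (hI.pair _ _ hγA).2.1
  have n2 := (hI.pair _ _ hδB).2.1
  have n3 : δ ≠ A := by grind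
  have n4 : γ ≠ δ := by grind
  have hγi : γ / 2 ≠ i := by omega
  have hδi : δ / 2 ≠ i := by omega
  have hmγ : S'.mate γ = δ + 1 := by rw [hm, if_pos rfl]
  have hmδ : S'.mate δ = γ + 1 := by rw [hm, if_neg n4.symm, if_pos rfl]
  have hmate : ∀ ε ζ, S'.mate ε = ζ + 1 → (ε = γ ∧ ζ = δ) ∨ (ε = δ ∧ ζ = γ) ∨
      (S.mate ε = ζ + 1 ∧ S'.mate ζ = ε + 1 ∧ ε / 2 ≠ i ∧ ζ / 2 ≠ i ∧ ε ≠ γ ∧ ε ≠ δ ∧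
        ζ ≠ γ ∧ ζ ≠ δ) := fun ε ζ h => by
    have := hs ε ζ
    clear hq hb hd' hγ hδ hn
    grind (splits := 20)
  have hz : ∀ o j, j = i → ∑ u ∈ Finset.Ioo 0 (v + 1), pay q c₁ c₂ o u j = 0 := fun o j h =>
    h ▸ sum_pay_eq_zero h0 hpar hq hb le_rfl o
  obtain ⟨-, -, hγd, hγa, hγe, hγg, -⟩ := hI.pair _ _ hγA
  obtain ⟨-, -, hδd, hδa, hδe, hδg, -⟩ := hI.pair _ _ hδB
  obtain ⟨-, -, -, -, hAe, hAg, hAn⟩ := hI.pair _ _ hA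
  obtain ⟨-, -, -, -, hBe, hBg, hBn⟩ := hI.pair _ _ hB
  set K := ℓ.k - S.used i with hK
  -- By the Galois condition, the composed function expresses the symmetric constraint that the
  -- needs caused by `x` at `γ` and `y` at `δ` fit together into the remaining budget `K`. The value
  -- `ℓ.k + 1` stands for impossibility.
  have key1 : ∀ x ≤ ℓ.k, ∀ y ≤ ℓ.k, S'.need γ x ≤ y ↔ S.need γ x + S.need δ y ≤ K := by
    intro x hx y hy
    rw [hγ x hx]
    have h1 := hBg (K - S.need γ x) (by omega) y hy
    have h2 := hδg y hy (K - S.need γ x) (by omega)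
    split_ifs <;> omega
  have key2 : ∀ x ≤ ℓ.k, ∀ y ≤ ℓ.k, S'.need δ x ≤ y ↔ S.need δ x + S.need γ y ≤ K := by
    intro x hx y hy
    rw [hδ x hx]
    have h1 := hAg (K - S.need δ x) (by omega) y hy
    have h2 := hγg y hy (K - S.need δ x) (by omega)
    split_ifs <;> omega
  have hg : ∀ x ≤ ℓ.k, ∀ y ≤ ℓ.k, S'.need γ x ≤ y ↔ S'.need δ y ≤ x := fun x hx y hy => by
    rw [key1 x hx y hy, key2 y hy x hx, add_comm]
  have hbA := slotEnd_of_below hb (γ := A) (by omega)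
  have hbB := slotEnd_of_below hb (γ := B) (by omega)
  refine ⟨inv_of_pairs (fun ε ζ h => ?_) (hu ▸ hI.used_le)
    (done_below_of_elim h0 hpar hq hI hi hdone hb hAB hd'), ?_, ?_⟩
  · unfold Paired
    rw [hd']
    rcases hmate ε ζ h with ⟨rfl, rfl⟩ | ⟨rfl, rfl⟩ | ⟨h1, h2, h3, -, h5, h6, h7, h8⟩
    · exact ⟨hmδ, n4, hγd, by rwa [if_neg hγi], fun u huv hu => hBe u huv
        (anc_of_anc h0 hpar hbA hbB huv (hγe u huv hu)), fun x hx y hy => (hg x hx y hy).1,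
        fun x hx => by
          rw [hγ x hx]
          split_ifs
          exacts [hBn _ (by omega), le_rfl]⟩
    · exact ⟨hmγ, n4.symm, hδd, by rwa [if_neg hδi], fun u huv hu => hAe u huv
        (anc_of_anc h0 hpar hbB hbA huv (hδe u huv hu)), fun x hx y hy => (hg y hy x hx).2,
        fun x hx => by
          rw [hδ x hx]
          split_ifs
          exacts [hAn _ (by omega), le_rfl]⟩
    · obtain ⟨-, p2, p3, p4, p5, p6, p7⟩ := hI.pair ε ζ h1
      refine ⟨h2, p2, p3, by rwa [if_neg h3], p5, fun x hx y hy => ?_, fun x hx => ?_⟩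
      · rw [hn _ h5 h6 x hx, hn _ h7 h8 y hy]
        exact p6 x hx y hy
      · rw [hn _ h5 h6 x hx]
        exact p7 x hx
  · rintro ⟨o, a, hf⟩
    have h3 := budget_of_below h0 hpar hq hI hi hdone hb hAB hd' _ le_rfl hf
    have hγk := hf.le hγd hγa
    have hδk := hf.le hδd hδa
    have h4 := hf.2 _ _ hγA
    have h5 := hf.2 _ _ hδB
    refine ⟨o, a, fun j hj hdj => ?_, fun ε ζ h => ?_⟩
    · rw [hd'] at hdj
      rw [hu]
      split_ifs at hdj
      exact hf.1 j hj hdj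
    · rcases hmate ε ζ h with ⟨rfl, rfl⟩ | ⟨rfl, rfl⟩ | ⟨h1, h2⟩
      · rw [key1 _ (by omega) _ (by omega)]
        omega
      · rw [key2 _ (by omega) _ (by omega)]
        omega
      · obtain ⟨-, -, p3, p4, -⟩ := hI.pair ε ζ h1
        rw [hn _ h2.2.2.2.1 h2.2.2.2.2.1 _ (by have := hf.le p3 p4; omega)]
        exact hf.2 _ _ h1
  · rintro ⟨o, a, hf⟩
    have hd1 : ∀ j, j ≠ i → S.done j = 0 → S'.done j = 0 := fun j hj h => by
      rw [hd', if_neg hj, h]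
    have hγk := hf.le hγd (hd1 _ hγi hγa)
    have hδk := hf.le hδd (hd1 _ hδi hδa)
    have h4 := (key1 (a γ) (by omega) (a δ) (by omega)).1 (hf.2 _ _ hmγ)
    have h5 := hγg (a γ) (by omega) _ (by omega) le_rfl
    have h6 := hδg (a δ) (by omega) _ (by omega) le_rfl
    -- The eliminated slots get exactly what their mates require of them.
    refine ⟨o, fun ε => if ε = A then S.need γ (a γ) else if ε = B then S.need δ (a δ) else a ε,
      fun j hj hdj => ?_, fun ε ζ h => ?_⟩
    · have := hf.1 j hj
      have := hz o j
      clear hb hq key1 key2 hg hγ hδ hn hγg hδg hAg hBg hγe hδe hAe hBe hmate hm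
      grind
    · beta_reduce
      by_cases e1 : ε = A
      · have : ζ = γ := by grind
        rw [if_pos e1, this, if_neg n1, if_neg hne, e1]
        exact hγg _ (by omega) _ (by omega) le_rfl
      by_cases e2 : ε = B
      · have : ζ = δ := by grind
        rw [if_neg e1, if_pos e2, this, if_neg n3, if_neg n2, e2]
        exact hδg _ (by omega) _ (by omega) le_rfl
      rw [if_neg e1, if_neg e2]
      by_cases e3 : ε = γ
      · rw [if_pos (by grind : ζ = A), e3]
      by_cases e4 : ε = δ
      · rw [if_neg (by grind), if_pos (by grind : ζ = B), e4]
      have h7 : S'.mate ε = ζ + 1 := by rw [hm, if_neg e3, if_neg e4, if_neg (by tauto), h]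
      obtain ⟨-, -, p3, p4, -⟩ := hI.pair ε ζ h
      have p5 := hf.le p3 (hd1 _ (by omega) p4)
      have p6 := hf.2 _ _ h7
      rw [hn _ e3 e4 _ (by omega)] at p6
      rwa [if_neg, if_neg]
      all_goals
        rintro rfl
        have := hs _ _ h
        omega

end Tree

section Link

variable {S S' : Ledger} {v : ℕ}

/-- Joining two free slots by a trivial constraint. -/
theorem link_fresh (h0 : ℓ.par 0 = 0) (hpar : ∀ j, 0 < j → ℓ.par j < j) (hI : ℓ.Inv S v) {γ δ : ℕ}
    (hγ : S.mate γ = 0) (hδ : S.mate δ = 0) (hne : γ ≠ δ)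
    (hγd : γ / 2 < ℓ.d) (hδd : δ / 2 < ℓ.d) (hγa : S.done (γ / 2) = 0) (hδa : S.done (δ / 2) = 0)
    (hγv : Anc ℓ.par v (ℓ.slotEnd γ)) (hδv : Anc ℓ.par v (ℓ.slotEnd δ))
    (hm : ∀ ε, S'.mate ε = if ε = γ then δ + 1 else if ε = δ then γ + 1 else S.mate ε)
    (hn0 : ∀ x ≤ ℓ.k, S'.need γ x = 0 ∧ S'.need δ x = 0)
    (hn : ∀ ε, ε ≠ γ → ε ≠ δ → ∀ x ≤ ℓ.k, S'.need ε x = S.need ε x) (hu : S'.used = S.used)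
    (hd : S'.done = S.done) (t : ℕ) :
    ℓ.Inv S' v ∧ (ℓ.Sat q c₁ c₂ S t ↔ ℓ.Sat q c₁ c₂ S' t) := by
  have hs := hI.symm
  have hmate : ∀ ε ζ, S'.mate ε = ζ + 1 → (ε = γ ∧ ζ = δ) ∨ (ε = δ ∧ ζ = γ) ∨
      (S.mate ε = ζ + 1 ∧ S'.mate ζ = ε + 1 ∧ ε ≠ γ ∧ ε ≠ δ ∧ ζ ≠ γ ∧ ζ ≠ δ) := by grind
  have hI' : ℓ.Inv S' v := by
    refine inv_of_pairs (fun ε ζ h => ?_) (hu ▸ hI.used_le) (hd ▸ hI.done_below)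
    unfold Paired
    rw [hd]
    rcases hmate ε ζ h with ⟨rfl, rfl⟩ | ⟨rfl, rfl⟩ | ⟨h1, -⟩
    · exact ⟨by grind, hne, hγd, hγa, fun u => anc_of_anc h0 hpar hγv hδv, by grind, by grind⟩
    · exact ⟨by grind, hne.symm, hδd, hδa, fun u => anc_of_anc h0 hpar hδv hγv, by grind, by grind⟩
    · have := hI.pair ε ζ h1
      unfold Paired at this
      grind
  refine ⟨hI', exists_congr fun o => exists_congr fun a => ⟨fun hf => ?_, fun hf => ?_⟩⟩
  · refine ⟨by rw [hd, hu]; exact hf.1, fun ε ζ h => ?_⟩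
    obtain ⟨-, -, h1, h2, -⟩ := hI'.pair ε ζ h
    have := hf.le h1 (hd ▸ h2)
    have := hf.2 ε ζ
    grind
  · refine ⟨by rw [← hd, ← hu]; exact hf.1, fun ε ζ h => ?_⟩
    obtain ⟨-, -, h1, h2, -⟩ := hI.pair ε ζ h
    have := hf.le h1 (hd ▸ h2)
    have := hf.2 ε ζ
    grind

set_option maxHeartbeats 1000000 in
/-- Adding an amount that has to be paid by one of two mates. -/
theorem link_shift (hI : ℓ.Inv S v) (hv : 0 < v) {γ δ : ℕ} (hγ : S.mate γ = δ + 1)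
    (h1 : γ / 2 = c₁ v) (h2 : δ / 2 = c₂ v)
    (hm : S'.mate = S.mate) (hnγ : ∀ x ≤ ℓ.k, S'.need γ x = min (ℓ.k + 1)
      (min (if q v ≤ x then S.need γ (x - q v) else ℓ.k + 1) (S.need γ x + q v)))
    (hnδ : ∀ x ≤ ℓ.k, S'.need δ x = min (ℓ.k + 1)
      (min (if q v ≤ x then S.need δ (x - q v) else ℓ.k + 1) (S.need δ x + q v)))
    (hn : ∀ ε, ε ≠ γ → ε ≠ δ → ∀ x ≤ ℓ.k, S'.need ε x = S.need ε x) (hu : S'.used = S.used)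
    (hd : S'.done = S.done) :
    ℓ.Inv S' v ∧ (ℓ.Sat q c₁ c₂ S (v + 1) ↔ ℓ.Sat q c₁ c₂ S' v) := by
  have hs := hI.symm
  obtain ⟨hδ, hne, hγd, hγa, -, hγg, -⟩ := hI.pair _ _ hγ
  obtain ⟨-, -, hδd, hδa, -, hδg, -⟩ := hI.pair _ _ hδ
  -- The two alternatives are that `γ` pays the amount out of `x`, or that `δ` pays it out of `y`.
  have key : ∀ x ≤ ℓ.k, ∀ y ≤ ℓ.k, S'.need γ x ≤ y ↔
      (q v ≤ x ∧ S.need γ (x - q v) ≤ y) ∨ S.need γ x + q v ≤ y := by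
    intro x hx y hy
    rw [hnγ x hx]
    split_ifs <;> omega
  have key2 : ∀ x ≤ ℓ.k, ∀ y ≤ ℓ.k, S'.need γ x ≤ y ↔ S'.need δ y ≤ x := by
    intro x hx y hy
    rw [key x hx y hy, hnδ y hy]
    have a1 := hγg (x - q v) (by omega) y hy
    have a2 := hδg y hy (x - q v) (by omega)
    have a3 := hγg x hx (y - q v) (by omega)
    have a4 := hδg (y - q v) (by omega) x hx
    split_ifs <;> omega
  have hmate : ∀ ε ζ, S.mate ε = ζ + 1 → (ε = γ ∧ ζ = δ) ∨ (ε = δ ∧ ζ = γ) ∨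
      (ε ≠ γ ∧ ε ≠ δ ∧ ζ ≠ γ ∧ ζ ≠ δ) := by grind
  have hsum : ∀ o i, ∑ u ∈ Finset.Ioo 0 (v + 1), pay q c₁ c₂ o u i =
      pay q c₁ c₂ o v i + ∑ u ∈ Finset.Ioo 0 v, pay q c₁ c₂ o u i := by
    intro o i
    have : Finset.Ioo 0 (v + 1) = insert v (Finset.Ioo 0 v) := by grind
    rw [this, Finset.sum_insert (by simp)]
  have hI' : ℓ.Inv S' v := by
    refine inv_of_pairs (fun ε ζ h => ?_) (hu ▸ hI.used_le) (hd ▸ hI.done_below)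
    rw [hm] at h
    have := hI.pair ε ζ h
    unfold Paired at this ⊢
    grind
  -- Here `η` is the slot that pays at `v`; the payment is moved into its allocation, or back out of
  -- it in the converse direction.
  have hpay : ∀ (o : ℕ → Prop) (η : ℕ), (o v ∧ η = γ ∨ ¬ o v ∧ η = δ) → ∀ j,
      pay q c₁ c₂ o v j = if j = η / 2 then q v else 0 := by
    rintro o η (⟨ho, rfl⟩ | ⟨ho, rfl⟩) j <;> simp [pay, ho, h1, h2]
  refine ⟨hI', ?_, ?_⟩
  · rintro ⟨o, a, hf⟩
    obtain ⟨η, hη⟩ : ∃ η, o v ∧ η = γ ∨ ¬ o v ∧ η = δ := by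
      by_cases ho : o v <;> simp [ho]
    have hbud : ∀ i < ℓ.d, S'.done i = 0 → S'.used i +
        ((a (2 * i) + if 2 * i = η then q v else 0) +
        (a (2 * i + 1) + if 2 * i + 1 = η then q v else 0)) +
        ∑ u ∈ Finset.Ioo 0 v, pay q c₁ c₂ o u i ≤ ℓ.k := by
      intro j hj hdj
      have := hf.1 j hj (hd ▸ hdj)
      rw [hsum, hpay o η hη] at this
      grind
    have hle : ∀ ε, ε / 2 < ℓ.d → S.done (ε / 2) = 0 →
        a ε + (if ε = η then q v else 0) ≤ ℓ.k := by
      intro ε h3 h4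
      have := hbud (ε / 2) h3 (by rw [hd, h4])
      obtain h5 | h5 : 2 * (ε / 2) = ε ∨ 2 * (ε / 2) + 1 = ε := by omega
      all_goals
        rw [h5] at this
        omega
    have hγle := hle γ hγd hγa
    have hδle := hle δ hδd hδa
    have hmain : S'.need γ (a γ + (if γ = η then q v else 0)) ≤
        a δ + (if δ = η then q v else 0) := by
      rw [key _ hγle _ hδle]
      have := hf.2 _ _ hγ
      rcases hη with ⟨-, rfl⟩ | ⟨-, rfl⟩
      · left
        simp only [if_true, hne.symm, if_false, Nat.add_sub_cancel]
        omega
      · right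
        simp only [if_true, hne, if_false]
        exact Nat.add_le_add_right this _
    refine ⟨o, fun ε => a ε + if ε = η then q v else 0, hbud, fun ε ζ h => ?_⟩
    rw [hm] at h
    obtain ⟨-, -, e1, e2, -⟩ := hI.pair ε ζ h
    have hε := hle ε e1 e2
    have := hf.2 ε ζ h
    rcases hmate ε ζ h with ⟨rfl, rfl⟩ | ⟨rfl, rfl⟩ | ⟨e3, e4, e5, e6⟩
    · exact hmain
    · exact (key2 _ hγle _ hδle).1 hmain
    · have e7 : ε ≠ η ∧ ζ ≠ η := by
        rcases hη with ⟨-, rfl⟩ | ⟨-, rfl⟩ <;> exact ⟨‹_›, ‹_›⟩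
      beta_reduce
      rw [if_neg e7.1] at hε ⊢
      rw [if_neg e7.2, hn _ e3 e4 _ hε]
      exact this
  · rintro ⟨o, a, hf⟩
    have hγk := hf.le hγd (hd ▸ hγa)
    have hδk := hf.le hδd (hd ▸ hδa)
    have hle := hf.2 γ δ (by rw [hm, hγ])
    rw [key _ (by omega) _ (by omega)] at hle
    -- The alternative that holds in the new constraint fixes the choice `p` at node `v` and the
    -- paying slot.
    obtain ⟨p, η, hp, hqη, hmain⟩ : ∃ (p : Prop) (η : ℕ), (p ∧ η = γ ∨ ¬ p ∧ η = δ) ∧ q v ≤ a η ∧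
        S.need γ (a γ - if γ = η then q v else 0) ≤ a δ - if δ = η then q v else 0 := by
      rcases hle with h | h
      · refine ⟨True, γ, Or.inl ⟨trivial, rfl⟩, h.1, ?_⟩
        simpa only [if_true, hne.symm, if_false, Nat.sub_zero] using h.2
      · refine ⟨False, δ, Or.inr ⟨id, rfl⟩, by omega, ?_⟩
        simp only [if_true, hne, if_false, Nat.sub_zero]
        omega
    have hother : ∀ i, ∑ u ∈ Finset.Ioo 0 v, pay q c₁ c₂ (fun u => if u = v then p else o u) u i =
        ∑ u ∈ Finset.Ioo 0 v, pay q c₁ c₂ o u i := by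
      intro i
      refine Finset.sum_congr rfl fun u hu => ?_
      simp [pay, (Finset.mem_Ioo.1 hu).2.ne]
    refine ⟨fun u => if u = v then p else o u,
      fun ε => a ε - if ε = η then q v else 0, fun j hj hdj => ?_, fun ε ζ h => ?_⟩
    · have h4 := hf.1 j hj (hd ▸ hdj)
      rw [hsum, hother, hpay _ η (by simpa using hp)]
      beta_reduce
      clear key key2 hnγ hnδ hmate
      by_cases hj : j = η / 2
      · obtain rfl | rfl : η = 2 * j ∨ η = 2 * j + 1 := by omega
        all_goals grind
      · rw [if_neg hj, if_neg (by omega), if_neg (by omega), Nat.sub_zero, Nat.sub_zero, zero_add]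
        exact hu ▸ h4
    · obtain ⟨-, -, e1, e2, -⟩ := hI.pair ε ζ h
      have h4 := hf.2 ε ζ (by rw [hm, h])
      have h5 := hf.le e1 (hd ▸ e2)
      beta_reduce
      rcases hmate ε ζ h with ⟨rfl, rfl⟩ | ⟨rfl, rfl⟩ | ⟨e3, e4, e5, e6⟩
      · exact hmain
      · exact hγg _ (by omega) _ (by omega) hmain
      · have e7 : ε ≠ η ∧ ζ ≠ η := by
          clear hf hmain
          rcases hp with ⟨-, rfl⟩ | ⟨-, rfl⟩ <;> exact ⟨‹_›, ‹_›⟩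
        rwa [if_neg e7.1, if_neg e7.2, Nat.sub_zero, Nat.sub_zero, ← hn _ e3 e4 _ (by omega)]

end Link

end Layout

end

end CactusRouting
namespace CactusRouting


/-! ### Initial and final states, and the slots at a tree edge -/

namespace Layout

variable {ℓ : Layout} {q c₁ c₂ : ℕ → ℕ} {S : Ledger} {v : ℕ}

theorem Inv.mono (h : ℓ.Inv S (v + 1)) : ℓ.Inv S v where
  symm := h.symm
  ne := h.ne
  lt := h.lt
  active := h.active
  ends γ δ hm u hu := h.ends γ δ hm u (by omega)
  galois := h.galois
  need_le := h.need_le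
  used_le := h.used_le
  done_below i hi hd := by
    obtain ⟨u, hu, hb⟩ := h.done_below i hi hd
    exact ⟨u, by omega, hb⟩

theorem inv_init (hm : ∀ γ, S.mate γ = 0) (hd : ∀ i < ℓ.d, S.done i = 0)
    (hu : ∀ i < ℓ.d, S.used i ≤ ℓ.k) : ℓ.Inv S v := by
  exact ⟨fun _ _ h => by simp [hm] at h, fun _ _ h => by simp [hm] at h,
    fun _ h => absurd (hm _) h, fun _ h => absurd (hm _) h, fun _ _ h => by simp [hm] at h,
    fun _ _ h => by simp [hm] at h, fun _ h => absurd (hm _) h, hu,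
    fun i hi h => absurd (hd i hi) h⟩

theorem sat_init (hm : ∀ γ, S.mate γ = 0) (hd : ∀ i < ℓ.d, S.done i = 0) (t : ℕ) :
    ℓ.Sat q c₁ c₂ S t ↔
      ∃ o, ∀ i < ℓ.d, S.used i + ∑ v ∈ Finset.Ioo 0 t, pay q c₁ c₂ o v i ≤ ℓ.k := by
  constructor
  · rintro ⟨o, a, h, -⟩
    exact ⟨o, fun i hi => le_trans (by omega) (h i hi (hd i hi))⟩
  · rintro ⟨o, h⟩
    exact ⟨o, fun _ => 0, fun i hi _ => by simpa using h i hi, fun γ δ h => by simp [hm] at h⟩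

/-- Mates belong to demands that are not done, so when all are done no constraint is left. -/
theorem sat_of_done (hI : ℓ.Inv S v) (hd : ∀ i < ℓ.d, S.done i ≠ 0) (t : ℕ) :
    ℓ.Sat q c₁ c₂ S t := by
  refine ⟨fun _ => True, fun _ => 0, fun i hi h => absurd h (hd i hi), fun γ δ h => ?_⟩
  exact absurd (hI.active γ (by omega)) (hd _ (hI.lt γ (by omega)))

theorem sat_succ_of_eq_zero (hq : 0 < v → q v = 0) :
    ℓ.Sat q c₁ c₂ S (v + 1) ↔ ℓ.Sat q c₁ c₂ S v := by
  have : ∀ o i, ∑ u ∈ Finset.Ioo 0 (v + 1), pay q c₁ c₂ o u i =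
      ∑ u ∈ Finset.Ioo 0 v, pay q c₁ c₂ o u i := by
    intro o i
    refine (Finset.sum_subset (fun u => ?_) fun u hu hu' => ?_).symm
    · simp only [Finset.mem_Ioo]
      omega
    · simp only [Finset.mem_Ioo] at hu hu'
      have : u = v := by omega
      subst this
      simp [pay, hq hu.1]
  simp only [Sat, Feasible, this]

section Tree

variable (h0 : ℓ.par 0 = 0) (hpar : ∀ j, 0 < j → ℓ.par j < j)
include h0 hpar

theorem Inv.done_eq_zero (hI : ℓ.Inv S v) {i : ℕ} (hi : i < ℓ.d) (hc : ℓ.Cross i v) :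
    S.done i = 0 := by
  by_contra h
  obtain ⟨u, hu, hb⟩ := hI.done_below i hi h
  exact not_cross_of_below h0 hpar hb hu hc

theorem cross_of_slot {γ : ℕ} (hγ : Anc ℓ.par v (ℓ.slotEnd γ)) (h : ¬ ℓ.Below (γ / 2) v) :
    ℓ.Cross (γ / 2) v := by
  unfold slotEnd at hγ
  unfold Below at h
  unfold Cross Sep
  split_ifs at hγ <;> tauto

/-- A demand crossing the tree edge above `v` has only one end below `v`. -/
theorem slot_unique {γ δ : ℕ} (hc : ℓ.Cross (γ / 2) v) (hγ : Anc ℓ.par v (ℓ.slotEnd γ))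
    (hδ : Anc ℓ.par v (ℓ.slotEnd δ)) (h : γ / 2 = δ / 2) : γ = δ := by
  unfold Cross Sep at hc
  unfold slotEnd at hγ hδ
  rw [← h] at hδ
  split_ifs at hγ hδ with h1 h2 h2
  · omega
  · exact absurd (iff_of_true hγ hδ) hc
  · exact absurd (iff_of_true hδ hγ) hc
  · omega

/-- The two demands crossing a tree edge share costs only with each other. -/
theorem link_cases (hI : ℓ.Inv S v) (hact : ∀ i < ℓ.d, S.done i = 0 → ¬ ℓ.Below i v) {γ δ : ℕ}
    (hγ : Anc ℓ.par v (ℓ.slotEnd γ)) (hδ : Anc ℓ.par v (ℓ.slotEnd δ))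
    (hcγ : ℓ.Cross (γ / 2) v) (hcδ : ℓ.Cross (δ / 2) v)
    (honly : ∀ i < ℓ.d, ℓ.Cross i v → i = γ / 2 ∨ i = δ / 2) :
    S.mate γ = 0 ∧ S.mate δ = 0 ∨ S.mate γ = δ + 1 := by
  -- The mate of `γ` starts below `v`. Its demand is neither done nor completely below `v`, so it
  -- crosses the edge and is one of the two; the slot is not `γ` itself, hence it is `δ`.
  have key : ∀ γ δ, Anc ℓ.par v (ℓ.slotEnd γ) → Anc ℓ.par v (ℓ.slotEnd δ) →
      ℓ.Cross (γ / 2) v → ℓ.Cross (δ / 2) v →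
      (∀ i < ℓ.d, ℓ.Cross i v → i = γ / 2 ∨ i = δ / 2) →
      ∀ ε, S.mate γ = ε + 1 → ε = δ := by
    intro γ δ hγ hδ hcγ hcδ honly ε h
    have h1 := hI.ends _ _ h v le_rfl hγ
    have h2 := hI.symm _ _ h
    have h3 := hI.lt ε (by omega)
    have h4 := hact _ h3 (hI.active ε (by omega))
    have h5 := cross_of_slot h0 hpar h1 h4
    rcases honly _ h3 h5 with h6 | h6
    · exact absurd (slot_unique h0 hpar h5 h1 hγ h6).symm (hI.ne _ _ h)
    · exact slot_unique h0 hpar h5 h1 hδ h6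
  rcases h : S.mate γ with _ | ε
  · refine Or.inl ⟨rfl, ?_⟩
    rcases h' : S.mate δ with _ | ε
    · rfl
    · have h1 := key δ γ hδ hγ hcδ hcγ (fun i hi hc => (honly i hi hc).symm) ε h'
      have h2 := hI.symm _ _ h'
      rw [h1, h] at h2
      omega
  · have h1 := key γ δ hγ hδ hcγ hcδ honly ε h
    exact Or.inr (by rw [h1])

end Tree

end Layout

end CactusRouting

/-! ### Reasoning about programs -/

namespace WordOp

/-- The result of an operation on natural numbers. -/
def val : WordOp → ℕ → ℕ → ℕ
  | add, a, b => a + b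
  | sub, a, b => a - b
  | mul, a, b => a * b
  | div, a, b => a / b
  | mod, a, b => a % b
  | lt, a, b => if a < b then 1 else 0
  | eq, a, b => if a = b then 1 else 0

/-- The operation does not overflow. -/
def Ok (w : ℕ) : WordOp → ℕ → ℕ → Prop
  | add, a, b => a + b < 2 ^ w
  | mul, a, b => a * b < 2 ^ w
  | _, _, _ => True

end WordOp

/-- All words have less than `w` bits. -/
structure RamState.Bdd (w : ℕ) (σ : RamState) : Prop where
  one_lt : 1 < 2 ^ w
  reg : ∀ r, σ.reg r < 2 ^ w
  arr : ∀ a i, σ.arr a i < 2 ^ w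

namespace WordExpr

instance : Add WordExpr := ⟨.op .add⟩
instance : Sub WordExpr := ⟨.op .sub⟩
instance : Mul WordExpr := ⟨.op .mul⟩
instance : Div WordExpr := ⟨.op .div⟩

/-- Comparison of words. -/
def less (e₁ e₂ : WordExpr) : WordExpr := .op .lt e₁ e₂

/-- Equality of words. -/
def equal (e₁ e₂ : WordExpr) : WordExpr := .op .eq e₁ e₂

/-- The value of an expression without reduction modulo `2 ^ w`. -/
def val (σ : RamState) : WordExpr → ℕ
  | .lit c => c
  | .reg r => σ.reg r
  | .load a i => σ.arr a (i.val σ)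
  | .op o e₁ e₂ => o.val (e₁.val σ) (e₂.val σ)

/-- No overflow occurs in the evaluation of the expression. -/
def Ok (w : ℕ) (σ : RamState) : WordExpr → Prop
  | .lit c => c < 2 ^ w
  | .reg _ => True
  | .load _ i => i.Ok w σ
  | .op o e₁ e₂ => e₁.Ok w σ ∧ e₂.Ok w σ ∧ o.Ok w (e₁.val σ) (e₂.val σ)

variable {w : ℕ} {σ : RamState} {e e₁ e₂ : WordExpr} {a c r : ℕ}

theorem eval_lt (h : σ.Bdd w) (e : WordExpr) : e.eval w σ < 2 ^ w := by
  have h2 : 0 < 2 ^ w := by positivity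
  cases e with
  | lit c => exact Nat.mod_lt _ h2
  | reg r => exact h.reg r
  | load a i => exact h.arr _ _
  | op o e₁ e₂ => cases o <;> exact Nat.mod_lt _ h2

/-- Only literals, sums and products can overflow; the other operations do not exceed their first
argument or are bits. -/
theorem eval_eq_val (h : σ.Bdd w) (e : WordExpr) (he : e.Ok w σ) : e.eval w σ = e.val σ := by
  induction e with
  | lit c => exact Nat.mod_eq_of_lt he
  | reg r => rfl
  | load a i ih => rw [eval, val, ih he]
  | op o e₁ e₂ ih₁ ih₂ =>
    have h1 := eval_lt h e₁
    obtain ⟨he₁, he₂, hok⟩ := he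
    rw [eval, val, ← ih₁ he₁, ← ih₂ he₂]
    rw [← ih₁ he₁, ← ih₂ he₂] at hok
    cases o with
    | add => exact Nat.mod_eq_of_lt hok
    | mul => exact Nat.mod_eq_of_lt hok
    | sub => exact Nat.mod_eq_of_lt ((Nat.sub_le _ _).trans_lt h1)
    | div => exact Nat.mod_eq_of_lt ((Nat.div_le_self _ _).trans_lt h1)
    | mod => exact Nat.mod_eq_of_lt ((Nat.mod_le _ _).trans_lt h1)
    | lt =>
      refine Nat.mod_eq_of_lt ?_
      have := h.one_lt
      split_ifs <;> omega
    | eq =>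
      refine Nat.mod_eq_of_lt ?_
      have := h.one_lt
      split_ifs <;> omega

@[simp] theorem val_lit : (WordExpr.lit c).val σ = c := rfl
@[simp] theorem val_reg : (WordExpr.reg r).val σ = σ.reg r := rfl
@[simp] theorem val_load : (WordExpr.load a e).val σ = σ.arr a (e.val σ) := rfl
@[simp] theorem val_add : (e₁ + e₂).val σ = e₁.val σ + e₂.val σ := rfl
@[simp] theorem val_sub : (e₁ - e₂).val σ = e₁.val σ - e₂.val σ := rfl
@[simp] theorem val_mul : (e₁ * e₂).val σ = e₁.val σ * e₂.val σ := rfl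
@[simp] theorem val_div : (e₁ / e₂).val σ = e₁.val σ / e₂.val σ := rfl
theorem val_less : (less e₁ e₂).val σ = if e₁.val σ < e₂.val σ then 1 else 0 := rfl
theorem val_equal : (equal e₁ e₂).val σ = if e₁.val σ = e₂.val σ then 1 else 0 := rfl

@[simp] theorem val_less_eq_zero : (less e₁ e₂).val σ = 0 ↔ ¬ e₁.val σ < e₂.val σ := by
  simp [val_less]
@[simp] theorem val_equal_eq_zero : (equal e₁ e₂).val σ = 0 ↔ ¬ e₁.val σ = e₂.val σ := by
  simp [val_equal]

@[simp] theorem ok_lit : (WordExpr.lit c).Ok w σ ↔ c < 2 ^ w := Iff.rfl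
@[simp] theorem ok_reg : (WordExpr.reg r).Ok w σ ↔ True := Iff.rfl
@[simp] theorem ok_load : (WordExpr.load a e).Ok w σ ↔ e.Ok w σ := Iff.rfl
@[simp] theorem ok_add : (e₁ + e₂).Ok w σ ↔ e₁.Ok w σ ∧ e₂.Ok w σ ∧ e₁.val σ + e₂.val σ < 2 ^ w := Iff.rfl
@[simp] theorem ok_mul : (e₁ * e₂).Ok w σ ↔ e₁.Ok w σ ∧ e₂.Ok w σ ∧ e₁.val σ * e₂.val σ < 2 ^ w := Iff.rfl
@[simp] theorem ok_sub : (e₁ - e₂).Ok w σ ↔ e₁.Ok w σ ∧ e₂.Ok w σ :=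
  ⟨fun h => ⟨h.1, h.2.1⟩, fun h => ⟨h.1, h.2, trivial⟩⟩
@[simp] theorem ok_div : (e₁ / e₂).Ok w σ ↔ e₁.Ok w σ ∧ e₂.Ok w σ :=
  ⟨fun h => ⟨h.1, h.2.1⟩, fun h => ⟨h.1, h.2, trivial⟩⟩
@[simp] theorem ok_less : (less e₁ e₂).Ok w σ ↔ e₁.Ok w σ ∧ e₂.Ok w σ :=
  ⟨fun h => ⟨h.1, h.2.1⟩, fun h => ⟨h.1, h.2, trivial⟩⟩
@[simp] theorem ok_equal : (equal e₁ e₂).Ok w σ ↔ e₁.Ok w σ ∧ e₂.Ok w σ :=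
  ⟨fun h => ⟨h.1, h.2.1⟩, fun h => ⟨h.1, h.2, trivial⟩⟩

end WordExpr

namespace RamProg

/-- Sequential composition of a list of programs. -/
def block : List RamProg → RamProg
  | [] => .skip
  | P :: Ps => .seq P (block Ps)

/-- The loop `for r = 0, 1, …, (register lim) - 1`. -/
def forLoop (r lim : ℕ) (P : RamProg) : RamProg :=
  .seq (.set r (.lit 0)) (.while (.less (.reg r) (.reg lim)) (.seq P (.set r (.reg r + .lit 1))))

/-- The registers written by a program. -/
def regs : RamProg → List ℕ
  | .skip => []
  | .set r _ => [r]
  | .store _ _ _ => []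
  | .seq P Q => P.regs ++ Q.regs
  | .ite _ P Q => P.regs ++ Q.regs
  | .while _ P => P.regs

/-- The arrays written by a program. -/
def arrs : RamProg → List ℕ
  | .skip => []
  | .set _ _ => []
  | .store a _ _ => [a]
  | .seq P Q => P.arrs ++ Q.arrs
  | .ite _ P Q => P.arrs ++ Q.arrs
  | .while _ P => P.arrs

/-- The states agree except for the registers and arrays written by the program. -/
def Frame (P : RamProg) (σ τ : RamState) : Prop :=
  (∀ r, (_ : r ∉ P.regs := by decide) → τ.reg r = σ.reg r) ∧
    ∀ a, (_ : a ∉ P.arrs := by decide) → τ.arr a = σ.arr a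

theorem Frame.refl (P : RamProg) (σ : RamState) : P.Frame σ σ := ⟨fun _ _ => rfl, fun _ _ => rfl⟩

theorem Frame.trans {P : RamProg} {σ τ υ : RamState} (h : P.Frame σ τ) (h' : P.Frame τ υ) :
    P.Frame σ υ :=
  ⟨fun r hr => (h'.1 r hr).trans (h.1 r hr), fun a ha => (h'.2 a ha).trans (h.2 a ha)⟩

theorem Frame.mono {P Q : RamProg} {σ τ : RamState} (h : P.Frame σ τ) (hr : P.regs ⊆ Q.regs)
    (ha : P.arrs ⊆ Q.arrs) : Q.Frame σ τ :=
  ⟨fun r h' => h.1 r fun h'' => h' (hr h''), fun a h' => h.2 a fun h'' => h' (ha h'')⟩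

variable {w : ℕ}

theorem Exec.frame {P : RamProg} {σ τ : RamState} {t : ℕ} (h : P.Exec w σ t τ) : P.Frame σ τ := by
  induction h with
  | skip σ => exact Frame.refl _ _
  | set r e σ =>
    refine ⟨fun r' hr => ?_, fun _ _ => rfl⟩
    exact Function.update_of_ne (by simpa [regs] using hr) _ _
  | store a i e σ =>
    refine ⟨fun _ _ => rfl, fun a' ha => ?_⟩
    exact Function.update_of_ne (by simpa [arrs] using ha) _ _
  | seq _ _ ih₁ ih₂ =>
    exact (ih₁.mono (List.subset_append_left _ _) (List.subset_append_left _ _)).trans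
      (ih₂.mono (List.subset_append_right _ _) (List.subset_append_right _ _))
  | ite_true _ _ ih => exact ih.mono (List.subset_append_left _ _) (List.subset_append_left _ _)
  | ite_false _ _ ih => exact ih.mono (List.subset_append_right _ _) (List.subset_append_right _ _)
  | while_true _ _ _ ih₁ ih₂ => 
    exact Frame.trans (ih₁.mono (List.Subset.refl _) (List.Subset.refl _)) ih₂
  | while_false _ => exact Frame.refl _ _

theorem Exec.bdd {P : RamProg} {σ τ : RamState} {t : ℕ} (h : P.Exec w σ t τ) (hσ : σ.Bdd w) :
    τ.Bdd w := by
  induction h with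
  | skip σ => exact hσ
  | set r e σ =>
    refine ⟨hσ.one_lt, fun r' => ?_, hσ.arr⟩
    by_cases h : r' = r
    · subst h
      simpa using WordExpr.eval_lt hσ e
    · simpa [h] using hσ.reg r'
  | store a i e σ =>
    refine ⟨hσ.one_lt, hσ.reg, fun a' j => ?_⟩
    by_cases h : a' = a
    · subst h
      by_cases h' : j = i.eval w σ
      · subst h'
        simpa using WordExpr.eval_lt hσ e
      · simpa [h'] using hσ.arr a' j
    · simpa [h] using hσ.arr a' j
  | seq _ _ ih₁ ih₂ => exact ih₂ (ih₁ hσ)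
  | ite_true _ _ ih => exact ih hσ
  | ite_false _ _ ih => exact ih hσ
  | while_true _ _ _ ih₁ ih₂ => exact ih₂ (ih₁ hσ)
  | while_false _ => exact hσ

/-- The program halts within `T` steps in a state satisfying `Q`. -/
def Run (w : ℕ) (P : RamProg) (σ : RamState) (T : ℕ) (Q : RamState → Prop) : Prop :=
  ∃ t τ, P.Exec w σ t τ ∧ t ≤ T ∧ Q τ

variable {P P' : RamProg} {Ps : List RamProg} {σ : RamState} {T T' : ℕ} {Q Q' : RamState → Prop}

theorem Run.mono (h : Run w P σ T Q) (hT : T ≤ T') (hQ : ∀ τ, Q τ → Q' τ) : Run w P σ T' Q' := by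
  obtain ⟨t, τ, he, ht, hq⟩ := h
  exact ⟨t, τ, he, ht.trans hT, hQ τ hq⟩

theorem Run.le (h : Run w P σ T Q) (hT : T ≤ T') : Run w P σ T' Q := h.mono hT fun _ => id

theorem Run.nil (h : Q σ) : Run w (block []) σ 1 Q := ⟨1, σ, .skip σ, le_rfl, h⟩

theorem Run.seq (hσ : σ.Bdd w) (h₁ : Run w P σ T Q)
    (h₂ : ∀ τ, τ.Bdd w → P.Frame σ τ → Q τ → Run w P' τ T' Q') :
    Run w (.seq P P') σ (T + T') Q' := by
  obtain ⟨t, τ, he, ht, hq⟩ := h₁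
  obtain ⟨t', υ, he', ht', hq'⟩ := h₂ τ (he.bdd hσ) he.frame hq
  exact ⟨t + t', υ, .seq he he', by omega, hq'⟩

theorem Run.cons (hσ : σ.Bdd w) (h₁ : Run w P σ T Q)
    (h₂ : ∀ τ, τ.Bdd w → P.Frame σ τ → Q τ → Run w (block Ps) τ T' Q') :
    Run w (block (P :: Ps)) σ (T + T') Q' := Run.seq hσ h₁ h₂

theorem Run.ite {e : WordExpr} (hσ : σ.Bdd w) (he : e.Ok w σ) (h₁ : e.val σ ≠ 0 → Run w P σ T Q)
    (h₂ : e.val σ = 0 → Run w P' σ T Q) : Run w (.ite e P P') σ (e.cost + 1 + T) Q := by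
  have hv := WordExpr.eval_eq_val hσ e he
  by_cases h : e.val σ = 0
  · obtain ⟨t, τ, he, ht, hq⟩ := h₂ h
    exact ⟨_, τ, .ite_false (hv.trans h) he, by omega, hq⟩
  · obtain ⟨t, τ, he, ht, hq⟩ := h₁ h
    exact ⟨_, τ, .ite_true (by rwa [hv]) he, by omega, hq⟩

/-- The rule for loops with an invariant on the arrays. -/
theorem Run.for {r lim : ℕ} {I : ℕ → (ℕ → ℕ → ℕ) → Prop} (hσ : σ.Bdd w) (h0 : I 0 σ.arr)
    (hstep : ∀ i < σ.reg lim, ∀ τ, τ.Bdd w → (forLoop r lim P).Frame σ τ → τ.reg r = i →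
      I i τ.arr → Run w P τ T fun υ => I (i + 1) υ.arr)
    (hr : r ∉ P.regs := by decide) (hlim : lim ∉ r :: P.regs := by decide) :
    Run w (forLoop r lim P) σ (σ.reg lim * (T + 8) + 6) fun τ => I (σ.reg lim) τ.arr := by
  have hOk : ∀ τ, (WordExpr.less (.reg r) (.reg lim)).Ok w τ := fun τ =>
    ⟨trivial, trivial, trivial⟩
  have hlr : lim ≠ r := fun h => hlim (h ▸ List.mem_cons_self)
  have hlP : lim ∉ P.regs := fun h => hlim (List.mem_cons_of_mem _ h)
  have hsub : P.regs ⊆ (forLoop r lim P).regs := by simp [forLoop, regs]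
  have hsub' : P.arrs ⊆ (forLoop r lim P).arrs := by simp [forLoop, arrs]
  have hframe : ∀ τ v, (forLoop r lim P).Frame τ
      { τ with reg := Function.update τ.reg r v } := by
    intro τ v
    refine ⟨fun r' hr' => Function.update_of_ne ?_ _ _, fun _ _ => rfl⟩
    rintro rfl
    exact hr' (by simp [forLoop, regs])
  -- Induction on the number `j` of remaining rounds. A round costs `T` plus four steps for the test
  -- and four for the increment; the final test costs four and the initial assignment two, which
  -- explains `8` and `6`.
  have hloop : ∀ j i, i + j = σ.reg lim → ∀ τ, τ.Bdd w → (forLoop r lim P).Frame σ τ →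
      τ.reg r = i → I i τ.arr → Run w (.while (.less (.reg r) (.reg lim))
        (.seq P (.set r (.reg r + .lit 1)))) τ (j * (T + 8) + 4) fun τ => I (σ.reg lim) τ.arr := by
    intro j
    induction j with
    | zero =>
      intro i hij τ hτ hF hri hI
      have hl : τ.reg lim = σ.reg lim := hF.1 lim (by simp [forLoop, regs, hlP, hlr])
      refine ⟨4, τ, .while_false ?_, by omega, ?_⟩
      · rw [WordExpr.eval_eq_val hτ _ (hOk τ), WordExpr.val_less,
          WordExpr.val_reg, WordExpr.val_reg, hl, if_neg (by omega)]
      · rw [← hij]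
        exact hI
    | succ j ih =>
      intro i hij τ hτ hF hri hI
      have hl : τ.reg lim = σ.reg lim := hF.1 lim (by simp [forLoop, regs, hlP, hlr])
      obtain ⟨t, υ, he, ht, hq⟩ := hstep i (by omega) τ hτ hF hri hI
      have hυ := he.bdd hτ
      have hυr : υ.reg r = i := (he.frame.1 r hr).trans hri
      have hυl : υ.reg lim = σ.reg lim := (he.frame.1 lim hlP).trans hl
      have hset : (WordExpr.reg r + .lit 1).eval w υ = i + 1 := by
        have := hυ.reg lim
        rw [WordExpr.eval_eq_val hυ]
        · rw [WordExpr.val_add, WordExpr.val_reg, hυr]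
          rfl
        · refine ⟨trivial, hυ.one_lt, ?_⟩
          change υ.reg r + 1 < 2 ^ w
          omega
      have hex := Exec.set (w := w) r (.reg r + .lit 1) υ
      rw [hset] at hex
      obtain ⟨t', ρ, he', ht', hq'⟩ := ih (i + 1) (by omega) _ (hex.bdd hυ)
        ((hF.trans (he.frame.mono hsub hsub')).trans (hframe _ _)) (by simp) hq
      refine ⟨_, ρ, .while_true ?_ (.seq he hex) he', ?_, hq'⟩
      · rw [WordExpr.eval_eq_val hτ _ (hOk τ), WordExpr.val_less,
          WordExpr.val_reg, WordExpr.val_reg, hl, if_pos (by omega)]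
        exact one_ne_zero
      · have h1 : (WordExpr.less (.reg r) (.reg lim)).cost = 3 := rfl
        have h2 : (WordExpr.reg r + .lit 1).cost = 3 := rfl
        grind
  have hset : (WordExpr.lit 0).eval w σ = 0 := by
    rw [WordExpr.eval_eq_val hσ]
    · rfl
    · exact zero_lt_one.trans hσ.one_lt
  have hex := Exec.set (w := w) r (.lit 0) σ
  rw [hset] at hex
  obtain ⟨t, τ, he, ht, hq⟩ := hloop (σ.reg lim) 0 (zero_add _) _ (hex.bdd hσ) (hframe σ 0)
    (by simp) h0
  refine ⟨_, τ, .seq hex he, ?_, hq⟩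
  have h2 : (WordExpr.lit 0).cost = 1 := rfl
  rw [h2]
  omega

/-- The weakest precondition of a loop-free program. -/
def wp (w : ℕ) : RamProg → (RamState → Prop) → RamState → Prop
  | .skip, Q, σ => Q σ
  | .set r e, Q, σ => e.Ok w σ ∧ Q { σ with reg := Function.update σ.reg r (e.val σ) }
  | .store a i e, Q, σ => i.Ok w σ ∧ e.Ok w σ ∧ Q { σ with
      arr := Function.update σ.arr a (Function.update (σ.arr a) (i.val σ) (e.val σ)) }
  | .seq P P', Q, σ => P.wp w (P'.wp w Q) σ
  | .ite e P P', Q, σ => e.Ok w σ ∧ (e.val σ ≠ 0 → P.wp w Q σ) ∧ (e.val σ = 0 → P'.wp w Q σ)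
  | .while _ _, _, _ => False

/-- A bound for the running time of a loop-free program. -/
def time : RamProg → ℕ
  | .skip => 1
  | .set _ e => e.cost + 1
  | .store _ i e => i.cost + e.cost + 1
  | .seq P P' => P.time + P'.time
  | .ite e P P' => e.cost + 1 + (P.time + P'.time)
  | .while _ _ => 0

attribute [simp] wp block

theorem Run.of_wp (hσ : σ.Bdd w) (h : P.wp w Q σ) (hT : P.time ≤ T := by decide) :
    Run w P σ T Q := by
  refine Run.le ?_ hT
  clear hT
  induction P generalizing σ Q with
  | skip => exact ⟨1, σ, .skip σ, le_rfl, h⟩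
  | set r e =>
    refine ⟨_, _, .set r e σ, le_rfl, ?_⟩
    rw [WordExpr.eval_eq_val hσ e h.1]
    exact h.2
  | store a i e =>
    refine ⟨_, _, .store a i e σ, le_rfl, ?_⟩
    rw [WordExpr.eval_eq_val hσ i h.1, WordExpr.eval_eq_val hσ e h.2.1]
    exact h.2.2
  | seq P P' ih ih' => exact Run.seq hσ (ih hσ h) fun τ hτ _ hq => ih' hτ hq
  | ite e P P' ih ih' =>
    exact Run.ite hσ h.1 (fun he => (ih hσ (h.2.1 he)).le (Nat.le_add_right _ _))
      fun he => (ih' hσ (h.2.2 he)).le (Nat.le_add_left _ _)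
  | _ => exact h.elim

end RamProg
namespace CactusRouting


open RamProg WordExpr

/-! ### Adjacency lists -/

/-- The last arc before `b + 1` with source `x`, or `0`. -/
def lastArc (src : ℕ → ℕ) (x : ℕ) : ℕ → ℕ
  | 0 => 0
  | b + 1 => if src (b + 1) = x then b + 1 else lastArc src x b

/-- The source of an arc: edge `e` consists of the arcs `2 * e + 1` and `2 * e + 2`. -/
def arcSrc (eu ev : ℕ → ℕ) (b : ℕ) : ℕ := if b % 2 = 1 then eu ((b - 1) / 2) else ev ((b - 1) / 2)

/-- Adjacency lists: array `4` holds the heads, array `5` the links and array `6` the targets. -/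
def adjacencyProg : RamProg := forLoop 6 1 <| block [
  .store 6 (.lit 2 * .reg 6 + .lit 1) (.load 1 (.reg 6)),
  .store 5 (.lit 2 * .reg 6 + .lit 1) (.load 4 (.load 0 (.reg 6))),
  .store 4 (.load 0 (.reg 6)) (.lit 2 * .reg 6 + .lit 1),
  .store 6 (.lit 2 * .reg 6 + .lit 2) (.load 0 (.reg 6)),
  .store 5 (.lit 2 * .reg 6 + .lit 2) (.load 4 (.load 1 (.reg 6))),
  .store 4 (.load 1 (.reg 6)) (.lit 2 * .reg 6 + .lit 2)]

/-- The arrays after constructing adjacency lists for the first `m` edges. -/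
def Adjacency (eu ev : ℕ → ℕ) (m : ℕ) (arr : ℕ → ℕ → ℕ) : Prop :=
  (∀ x, arr 4 x = lastArc (arcSrc eu ev) x (2 * m)) ∧ ∀ b, 0 < b → b ≤ 2 * m →
    arr 6 b = arcSrc ev eu b ∧ arr 5 b = lastArc (arcSrc eu ev) (arcSrc eu ev b) (b - 1)

theorem arcSrc_odd (eu ev : ℕ → ℕ) (e : ℕ) : arcSrc eu ev (2 * e + 1) = eu e := by
  rw [arcSrc, if_pos (by omega), Nat.add_sub_cancel, Nat.mul_div_cancel_left _ two_pos]

theorem arcSrc_even (eu ev : ℕ → ℕ) (e : ℕ) : arcSrc eu ev (2 * e + 2) = ev e := by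
  rw [arcSrc, if_neg (by omega), show (2 * e + 2 - 1) / 2 = e by omega]

theorem run_adjacency {w : ℕ} {σ : RamState} (hσ : σ.Bdd w) {B : ℕ} (hB : 2 ^ w = B) (hw : 2 * σ.reg 1 + 2 < B)
    (h4 : ∀ x, σ.arr 4 x = 0) :
    Run w adjacencyProg σ (σ.reg 1 * 100 + 6) fun τ =>
      Adjacency (σ.arr 0) (σ.arr 1) (σ.reg 1) τ.arr := by
  refine (Run.for (I := fun m arr => Adjacency (σ.arr 0) (σ.arr 1) m arr) (T := 92) hσ ⟨fun x => by simpa [lastArc] using h4 x, fun b h h' => by omega⟩ ?_).le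
    (by omega)
  intro e he τ hτ hF hr hI
  have a0 := hF.2 0
  have a1 := hF.2 1
  obtain ⟨hI1, hI2⟩ := hI
  refine Run.of_wp hτ ?_
  simp [hr, a0, a1, hB]
  refine ⟨by omega, by omega, fun x => ?_, fun b hb hb' => ?_⟩
  · simp only [Function.update_self, Function.update_apply, hI1]
    rw [show 2 * (e + 1) = 2 * e + 1 + 1 by ring, lastArc, lastArc, arcSrc_odd, arcSrc_even]
    simp only [eq_comm]
  · have h1 : b ≠ 2 * e + 2 → b ≠ 2 * e + 1 → b ≤ 2 * e := by omega
    by_cases e1 : b = 2 * e + 2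
    · subst e1
      simp [arcSrc_even, hI1, lastArc, arcSrc_odd, Function.update_apply, eq_comm]
    by_cases e2 : b = 2 * e + 1
    · subst e2
      simp [arcSrc_odd, hI1]
    simpa [e1, e2] using hI2 b hb (h1 e1 e2)

end CactusRouting
namespace CactusRouting

open scoped Classical
noncomputable section

open Function Nat


open RamProg WordExpr

/-! ### Breadth-first search -/

section

variable (eu ev : ℕ → ℕ) (n m : ℕ)

/-- Arc `b` has been examined by the search. -/
def Examined (pos : ℕ → ℕ) (J A b : ℕ) : Prop :=
  pos (arcSrc eu ev b) ≠ 0 ∧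
    (pos (arcSrc eu ev b) ≤ J ∨ pos (arcSrc eu ev b) = J + 1 ∧ A < b)

/-- The number of arcs that have been examined. -/
def numExamined (pos : ℕ → ℕ) (J A : ℕ) : ℕ :=
  ((Finset.Icc 1 (2 * m)).filter fun b => Examined eu ev pos J A b).card

/-- The invariant of breadth-first search after `i` steps: `pos` is one more than the number of a
vertex, `J` is the current node, `A` the current arc and `L` the number of nodes found so far. -/
structure BfsInv (pos ord par : ℕ → ℕ) (J A L i : ℕ) : Prop where
  L_pos : 0 < L
  L_le : L ≤ n
  ord_zero : ord 0 = 0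
  ord_lt : ∀ j < L, ord j < n
  pos_ord : ∀ j < L, pos (ord j) = j + 1
  pos_le : ∀ y, pos y ≤ L
  ord_pos : ∀ y, pos y ≠ 0 → ord (pos y - 1) = y
  par_lt : ∀ j, 0 < j → par j < j
  par_zero : par 0 = 0
  par_late : ∀ j, L ≤ j → par j = 0
  arc : ∀ j, 0 < j → j < L → ∃ b, 0 < b ∧ b ≤ 2 * m ∧ arcSrc eu ev b = ord (par j) ∧
    arcSrc ev eu b = ord j
  J_le : J ≤ n
  J_lt : J < n → J < L
  L_eq : J = n → L = n
  done : ∀ b, 0 < b → b ≤ 2 * m → Examined eu ev pos J A b → pos (arcSrc ev eu b) ≠ 0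
  A_le : A ≠ 0 → A ≤ 2 * m ∧ pos (arcSrc eu ev A) = J + 1 ∧ J < n
  count : i ≤ J + numExamined eu ev m pos J A ∨ J = n

variable {eu ev n m}

theorem lastArc_le (src : ℕ → ℕ) (x b : ℕ) : lastArc src x b ≤ b := by
  induction b with
  | zero => exact le_rfl
  | succ b ih =>
    rw [lastArc]
    grind

theorem src_lastArc {src : ℕ → ℕ} {x b : ℕ} (h : lastArc src x b ≠ 0) :
    src (lastArc src x b) = x := by
  induction b with
  | zero => exact absurd rfl h
  | succ b ih =>
    rw [lastArc] at h ⊢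
    grind

theorem le_lastArc {src : ℕ → ℕ} {b c : ℕ} (hc : 0 < c) (hb : c ≤ b) :
    c ≤ lastArc src (src c) b := by
  induction b with
  | zero => omega
  | succ b ih =>
    rw [lastArc]
    grind

theorem arcSrc_lt (hu : ∀ e < m, eu e < n) (hv : ∀ e < m, ev e < n) {b : ℕ} (hb : 0 < b)
    (hbm : b ≤ 2 * m) : arcSrc eu ev b < n := by
  unfold arcSrc
  grind

namespace BfsInv

variable {pos ord par : ℕ → ℕ} {J A L i : ℕ}

theorem start (hn : 0 < n) (hpos : ∀ y, pos y = if y = 0 then 1 else 0) (hord : ord 0 = 0)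
    (hpar : ∀ j, par j = 0) : BfsInv eu ev n m pos ord par 0
      (lastArc (arcSrc eu ev) 0 (2 * m)) 1 0 := by
  have hsrc : ∀ b, 0 < b → b ≤ 2 * m → ¬ Examined eu ev pos 0
      (lastArc (arcSrc eu ev) 0 (2 * m)) b := by
    rintro b hb hbm ⟨h1, h2⟩
    rw [hpos] at h1 h2
    split_ifs at h1 h2 with h
    · have := le_lastArc (src := arcSrc eu ev) hb hbm
      rw [h] at this
      omega
    · exact h1 rfl
  refine ⟨one_pos, hn, hord, ?_, ?_, ?_, ?_, ?_, hpar 0, fun j _ => hpar j, ?_, hn.le,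
    fun _ => one_pos, fun h => h.symm ▸ by omega, fun b hb hbm h => absurd h (hsrc b hb hbm), ?_,
    Or.inl (zero_le _)⟩
  · grind
  · grind
  · grind
  · grind
  · grind
  · intro j h1 h2
    omega
  · intro h
    refine ⟨lastArc_le _ _ _, ?_, hn⟩
    rw [src_lastArc h, hpos, if_pos rfl]

variable (h : BfsInv eu ev n m pos ord par J A L i)
include h

/-- The vertices found so far are distinct and different from `y`, so there are fewer than `n` of
them. -/
theorem L_lt {y : ℕ} (hy : y < n) (hpy : pos y = 0) : L < n := by
  have hsub : (Finset.range L).image ord ⊆ (Finset.range n).erase y := by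
    intro x hx
    obtain ⟨j, hj, rfl⟩ := Finset.mem_image.1 hx
    rw [Finset.mem_range] at hj
    rw [Finset.mem_erase, Finset.mem_range]
    refine ⟨?_, h.ord_lt j hj⟩
    rintro rfl
    rw [h.pos_ord j hj] at hpy
    omega
  have h1 := Finset.card_le_card hsub
  rw [Finset.card_image_of_injOn, Finset.card_range, Finset.card_erase_of_mem
    (Finset.mem_range.2 hy), Finset.card_range] at h1
  · omega
  · intro a ha b hb hab
    have h2 := h.pos_ord a (by simpa using ha)
    rw [show ord a = ord b from hab, h.pos_ord b (by simpa using hb)] at h2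
    omega

/-- A new vertex is found. -/
theorem discover (hu : ∀ e < m, eu e < n) (hv : ∀ e < m, ev e < n) (hA : A ≠ 0)
    (hy : pos (arcSrc ev eu A) = 0) :
    BfsInv eu ev n m (Function.update pos (arcSrc ev eu A) (L + 1))
      (Function.update ord L (arcSrc ev eu A)) (Function.update par L J) J A (L + 1) i := by
  obtain ⟨hA1, hA2, hA3⟩ := h.A_le hA
  set y := arcSrc ev eu A with hydef
  have hyn : y < n := arcSrc_lt hv hu (pos_of_ne_zero hA) hA1
  have hL := h.L_lt hyn hy
  have hJL := h.J_lt hA3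
  have hne : ∀ j < L, ord j ≠ y := by
    rintro j hj he
    have := h.pos_ord j hj
    rw [he, hy] at this
    omega
  have hord : ∀ j < L, Function.update ord L y j = ord j := fun j hj =>
    update_of_ne (by omega) _ _
  have hpos : ∀ x, pos x ≠ 0 → Function.update pos y (L + 1) x = pos x := fun x hx =>
    update_of_ne (fun he => hx (by rw [he, hy])) _ _
  -- The new vertex gets position `L + 1`, beyond the current node, so none of its arcs becomes
  -- examined.
  have hEx : ∀ b, Examined eu ev (Function.update pos y (L + 1)) J A b ↔
      Examined eu ev pos J A b := by
    intro b
    unfold Examined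
    grind
  refine ⟨by omega, by omega, ?_, ?_, ?_, ?_, ?_, ?_, ?_, ?_, ?_, h.J_le, by omega, by omega, ?_,
    ?_, ?_⟩
  · rw [hord 0 h.L_pos, h.ord_zero]
  · intro j hj
    by_cases hjL : j = L
    · rw [hjL, update_self]
      exact hyn
    · rw [hord j (by omega)]
      exact h.ord_lt j (by omega)
  · intro j hj
    by_cases hjL : j = L
    · rw [hjL, update_self, update_self]
    · rw [hord j (by omega), hpos]
      · exact h.pos_ord j (by omega)
      · rw [h.pos_ord j (by omega)]
        omega
  · intro x
    have := h.pos_le x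
    grind
  · intro x hx
    by_cases hxy : x = y
    · grind
    · rw [update_of_ne hxy] at hx ⊢
      have := h.pos_le x
      rw [hord _ (by omega)]
      exact h.ord_pos x hx
  · intro j hj
    rw [update_apply]
    split_ifs
    · omega
    · exact h.par_lt j hj
  · rw [update_of_ne (by have := h.L_pos; omega), h.par_zero]
  · intro j hj
    rw [update_of_ne (by omega)]
    exact h.par_late j (by omega)
  · intro j hj hjL
    by_cases hjL' : j = L
    · subst hjL'
      refine ⟨A, pos_of_ne_zero hA, hA1, ?_, ?_⟩
      · rw [update_self, hord _ hJL, ← h.ord_pos (arcSrc eu ev A) (by omega), hA2,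
          Nat.add_sub_cancel]
      · rw [update_self]
    · obtain ⟨b, hb, hbm, h1, h2⟩ := h.arc j hj (by omega)
      refine ⟨b, hb, hbm, ?_, ?_⟩
      · have := h.par_lt j hj
        grind
      · rw [hord _ (by omega), h2]
  · intro b hb hbm hx
    rw [hEx] at hx
    have := h.done b hb hbm hx
    rwa [hpos _ this]
  · grind
  · have : numExamined eu ev m (Function.update pos y (L + 1)) J A =
        numExamined eu ev m pos J A := by
      unfold numExamined
      congr 1
      grind
    rw [this]
    exact h.count

/-- The target of the current arc is known already. -/
theorem pass (hA : A ≠ 0) (hy : pos (arcSrc ev eu A) ≠ 0) : BfsInv eu ev n m pos ord par J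
    (lastArc (arcSrc eu ev) (arcSrc eu ev A) (A - 1)) L (i + 1) := by
  obtain ⟨hA1, hA2, hA3⟩ := h.A_le hA
  set A' := lastArc (arcSrc eu ev) (arcSrc eu ev A) (A - 1) with hA'
  have hlt : A' < A := by
    have := lastArc_le (arcSrc eu ev) (arcSrc eu ev A) (A - 1)
    omega
  -- The link leads to the next smaller arc with the same source, so moving on examines the arc `A`
  -- and no other.
  have hEx : ∀ b, 0 < b → (Examined eu ev pos J A' b ↔ Examined eu ev pos J A b ∨ b = A) := by
    intro b hb
    unfold Examined
    constructor
    · rintro ⟨h1, h2 | h2⟩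
      · grind
      · rcases lt_trichotomy A b with h3 | h3 | h3
        · grind
        · exact Or.inr h3.symm
        · have h4 : arcSrc eu ev b = arcSrc eu ev A := by
            rw [← h.ord_pos _ h1, h2.1, ← h.ord_pos (arcSrc eu ev A) (by omega), hA2]
          have h5 := le_lastArc (src := arcSrc eu ev) hb (show b ≤ A - 1 by omega)
          rw [h4] at h5
          omega
    · grind
  refine ⟨h.L_pos, h.L_le, h.ord_zero, h.ord_lt, h.pos_ord, h.pos_le, h.ord_pos, h.par_lt,
    h.par_zero, h.par_late, h.arc, h.J_le, h.J_lt, h.L_eq, ?_, ?_, ?_⟩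
  · intro b hb hbm hx
    rcases (hEx b hb).1 hx with hx | rfl
    · exact h.done b hb hbm hx
    · exact hy
  · intro h0
    refine ⟨by omega, ?_, hA3⟩
    rw [hA', src_lastArc h0, hA2]
  · refine h.count.imp_left fun hc => ?_
    have hsub : insert A ((Finset.Icc 1 (2 * m)).filter fun b => Examined eu ev pos J A b) ⊆
        (Finset.Icc 1 (2 * m)).filter fun b => Examined eu ev pos J A' b := by
      grind
    have h1 := Finset.card_le_card hsub
    rw [Finset.card_insert_of_notMem] at h1
    · unfold numExamined at hc ⊢
      omega
    · rw [Finset.mem_filter]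
      rintro ⟨-, -, hx⟩
      omega

/-- If all arcs of the known vertices have been examined, then all vertices are known. -/
theorem pos_ne_zero (hconn : ∀ P : ℕ → Prop, P 0 →
      (∀ b, 0 < b → b ≤ 2 * m → P (arcSrc eu ev b) → P (arcSrc ev eu b)) → ∀ y < n, P y)
    (hJ : ∀ b, 0 < b → b ≤ 2 * m → pos (arcSrc eu ev b) ≠ 0 → Examined eu ev pos J A b) :
    ∀ y < n, pos y ≠ 0 := by
  refine hconn (fun y => pos y ≠ 0) ?_ fun b hb hbm hx => h.done b hb hbm (hJ b hb hbm hx)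
  have := h.pos_ord 0 h.L_pos
  rw [h.ord_zero] at this
  omega

/-- The search proceeds to the next node. -/
theorem advance (hconn : ∀ P : ℕ → Prop, P 0 →
      (∀ b, 0 < b → b ≤ 2 * m → P (arcSrc eu ev b) → P (arcSrc ev eu b)) → ∀ y < n, P y)
    (hA : A = 0) (hJ : J < n) : BfsInv eu ev n m pos ord par (J + 1)
    (if J + 1 < n then lastArc (arcSrc eu ev) (ord (J + 1)) (2 * m) else 0) L (i + 1) := by
  subst hA
  have hJL := h.J_lt hJ
  -- If the current node were the last one found, all arcs of known vertices would be examined, so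
  -- connectivity would make every vertex known and `L` equal to `n`.
  have hL : J + 1 < n → J + 1 < L := by
    intro h1
    by_contra h2
    have h3 := h.pos_ne_zero hconn fun b hb hbm hx => ⟨hx, by
      have := h.pos_le (arcSrc eu ev b)
      omega⟩
    have h4 : (Finset.range n).card ≤ (Finset.range L).card := by
      refine Finset.card_le_card_of_injOn (fun y => pos y - 1) (fun y hy => ?_) ?_
      · have h5 := h.pos_le y
        grind
      · intro a ha b hb hab
        rw [← h.ord_pos a (h3 a (by simpa using ha)), ← h.ord_pos b (h3 b (by simpa using hb))]
        exact congrArg ord hab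
    grind
  set A' := if J + 1 < n then lastArc (arcSrc eu ev) (ord (J + 1)) (2 * m) else 0 with hA'
  have hEx : ∀ b, 0 < b → b ≤ 2 * m → (Examined eu ev pos (J + 1) A' b ↔
      Examined eu ev pos J 0 b) := by
    intro b hb hbm
    unfold Examined
    constructor
    · rintro ⟨h1, h2 | ⟨h2, h3⟩⟩
      · exact ⟨h1, by omega⟩
      · have h4 := h.pos_le (arcSrc eu ev b)
        have h5 : J + 1 < n := by
          have := h.L_le
          omega
        have h6 := le_lastArc (src := arcSrc eu ev) hb hbm
        rw [hA', if_pos h5] at h3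
        have h7 := h.ord_pos _ h1
        grind
    · grind
  refine ⟨h.L_pos, h.L_le, h.ord_zero, h.ord_lt, h.pos_ord, h.pos_le, h.ord_pos, h.par_lt,
    h.par_zero, h.par_late, h.arc, hJ, hL, fun he => ?_, ?_, ?_, ?_⟩
  · have := h.L_le
    omega
  · intro b hb hbm hx
    exact h.done b hb hbm ((hEx b hb hbm).1 hx)
  · intro h0
    by_cases h1 : J + 1 < n
    · rw [hA', if_pos h1] at h0 ⊢
      refine ⟨lastArc_le _ _ _, ?_, h1⟩
      rw [src_lastArc h0, h.pos_ord _ (hL h1)]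
    · grind
  · left
    have hc := h.count.resolve_right (by omega)
    have : numExamined eu ev m pos (J + 1) A' = numExamined eu ev m pos J 0 := by
      unfold numExamined
      congr 1
      grind
    omega

theorem stay (hJ : ¬ J < n) : BfsInv eu ev n m pos ord par J A L (i + 1) := by
  refine ⟨h.L_pos, h.L_le, h.ord_zero, h.ord_lt, h.pos_ord, h.pos_le, h.ord_pos, h.par_lt,
    h.par_zero, h.par_late, h.arc, h.J_le, h.J_lt, h.L_eq, h.done, h.A_le, Or.inr ?_⟩
  have := h.J_le
  omega

/-- Until the last node is passed, every step either advances to the next node or examines one more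
arc. There are `n` nodes and `2 * m` arcs, so `n + 2 * m` steps suffice. -/
theorem finish (hconn : ∀ P : ℕ → Prop, P 0 →
      (∀ b, 0 < b → b ≤ 2 * m → P (arcSrc eu ev b) → P (arcSrc ev eu b)) → ∀ y < n, P y)
    (hi : i = n + 2 * m) : L = n ∧ ∀ y < n, pos y ≠ 0 := by
  have hJ : J = n := by
    rcases h.count with hc | hc
    · have h1 : numExamined eu ev m pos J A ≤ 2 * m := by
        refine (Finset.card_filter_le _ _).trans ?_
        rw [card_Icc]
        omega
      have := h.J_le
      omega
    · exact hc
  have hL := h.L_eq hJ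
  refine ⟨hL, h.pos_ne_zero hconn fun b hb hbm hx => ⟨hx, Or.inl ?_⟩⟩
  have := h.pos_le (arcSrc eu ev b)
  omega

end BfsInv

end

/-- One step of breadth-first search. Array `7` holds the order of the vertices, array `8` one more
than their positions, array `9` the parents; array `10` holds the current node, the current arc and
the number of nodes found. -/
def bfsStep : RamProg :=
  .ite (.equal (.load 10 (.lit 1)) (.lit 0))
    (.ite (.less (.load 10 (.lit 0)) (.reg 0))
      (block [.store 10 (.lit 0) (.load 10 (.lit 0) + .lit 1),
        .ite (.less (.load 10 (.lit 0)) (.reg 0))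
          (.store 10 (.lit 1) (.load 4 (.load 7 (.load 10 (.lit 0))))) .skip]) .skip)
    (block [.set 10 (.load 6 (.load 10 (.lit 1))),
      .ite (.equal (.load 8 (.reg 10)) (.lit 0))
        (block [.store 7 (.load 10 (.lit 2)) (.reg 10),
          .store 8 (.reg 10) (.load 10 (.lit 2) + .lit 1),
          .store 9 (.load 10 (.lit 2)) (.load 10 (.lit 0)),
          .store 10 (.lit 2) (.load 10 (.lit 2) + .lit 1)]) .skip,
      .store 10 (.lit 1) (.load 5 (.load 10 (.lit 1)))])

def bfsProg : RamProg := block [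
  block [.set 5 (.reg 0 + .lit 2 * .reg 1),
    .store 8 (.lit 0) (.lit 1), .store 10 (.lit 1) (.load 4 (.lit 0)), .store 10 (.lit 2) (.lit 1)],
  forLoop 6 5 bfsStep]

/-- The arrays after breadth-first search. -/
def Searched (eu ev : ℕ → ℕ) (n m : ℕ) (arr : ℕ → ℕ → ℕ) : Prop :=
  ∃ J A i, BfsInv eu ev n m (arr 8) (arr 7) (arr 9) J A n i ∧ ∀ y < n, arr 8 y ≠ 0

set_option maxHeartbeats 1000000 in
theorem run_bfs {w : ℕ} {σ : RamState} (hσ : σ.Bdd w) {eu ev : ℕ → ℕ} {n m : ℕ}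
    (hn0 : σ.reg 0 = n) (hm0 : σ.reg 1 = m) (hn : 0 < n)
    {B : ℕ} (hB : 2 ^ w = B) (hw : n + 2 * m + 2 < B)
    (hu : ∀ e < m, eu e < n) (hv : ∀ e < m, ev e < n)
    (hconn : ∀ P : ℕ → Prop, P 0 →
      (∀ b, 0 < b → b ≤ 2 * m → P (arcSrc eu ev b) → P (arcSrc ev eu b)) → ∀ y < n, P y)
    (hadj : Adjacency eu ev m σ.arr)
    (h7 : ∀ x, σ.arr 7 x = 0) (h8 : ∀ x, σ.arr 8 x = 0) (h9 : ∀ x, σ.arr 9 x = 0)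
    (h10 : ∀ x, σ.arr 10 x = 0) :
    Run w bfsProg σ ((n + 2 * m) * 200 + 200) fun τ => Searched eu ev n m τ.arr := by
  have b0 : 0 < B := by omega
  have b1 : 1 < B := by omega
  have b2 : 2 < B := by omega
  let I : ℕ → (ℕ → ℕ → ℕ) → Prop := fun i arr =>
    BfsInv eu ev n m (arr 8) (arr 7) (arr 9) (arr 10 0) (arr 10 1) (arr 10 2) i
  refine (Run.cons (T := 100) (T' := (n + 2 * m) * 200 + 100)
    (Q := fun τ => τ.reg 5 = n + 2 * m ∧ I 0 τ.arr) hσ ?_ ?_).le (by omega)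
  · refine Run.of_wp hσ ?_
    simp [hB, hn0, hm0, b0, b1, b2]
    refine ⟨by omega, ?_⟩
    have := BfsInv.start (eu := eu) (ev := ev) (m := m) (pos := Function.update (σ.arr 8) 0 1) hn
      (fun y => by simp [update_apply, h8]) (h7 0) h9
    simpa [I, h10, hadj.1] using this
  rintro τ hτ hF ⟨h5, hI⟩
  refine (Run.cons (T := (n + 2 * m) * (150 + 8) + 6) (T' := 1) (Q := fun υ => I (n + 2 * m) υ.arr)
    hτ ?_ ?_).le (by omega)
  swap
  · rintro υ hυ - hυI
    refine Run.nil ?_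
    obtain ⟨hL, hpos⟩ := hυI.finish hconn rfl
    have h : BfsInv eu ev n m (υ.arr 8) (υ.arr 7) (υ.arr 9) (υ.arr 10 0) (υ.arr 10 1)
      (υ.arr 10 2) (n + 2 * m) := hυI
    rw [hL] at h
    exact ⟨_, _, _, h, hpos⟩
  rw [← h5]
  refine Run.for (I := I) hτ hI ?_
  intro i hi υ hυ hF' hr hI
  have a4 : υ.arr 4 = σ.arr 4 := (hF'.2 4).trans (hF.2 4)
  have a5 : υ.arr 5 = σ.arr 5 := (hF'.2 5).trans (hF.2 5)
  have a6 : υ.arr 6 = σ.arr 6 := (hF'.2 6).trans (hF.2 6)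
  have r0 : υ.reg 0 = n := ((hF'.1 0).trans (hF.1 0)).trans hn0
  refine Run.of_wp hυ ?_
  have hL := hI.L_le
  have hJ := hI.J_le
  simp [bfsStep, hB, r0, a4, a5, a6, b0, b1, b2]
  refine ⟨fun hA => ⟨fun hJn => ⟨by omega, fun hJn' => ?_, fun hJn' => ?_⟩, fun hJn => ?_⟩,
    fun hA => ⟨fun hy => ⟨by omega, ?_⟩, fun hy => ?_⟩⟩
  · have := hI.advance hconn hA hJn
    rw [if_pos hJn', ← hadj.1] at this
    simpa [I] using this
  · have := hI.advance hconn hA hJn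
    rw [if_neg (by omega)] at this
    simpa [I, hA] using this
  · exact hI.stay (by omega)
  · obtain ⟨hA1, -, -⟩ := hI.A_le hA
    obtain ⟨h1, h2⟩ := hadj.2 _ (pos_of_ne_zero hA) hA1
    rw [h1] at hy ⊢
    -- Recording a new vertex and moving past the arc make up one step of the program.
    have := (hI.discover hu hv hA hy).pass hA (by simp)
    rw [← h2] at this
    simpa [I] using this
  · obtain ⟨hA1, -, -⟩ := hI.A_le hA
    obtain ⟨h1, h2⟩ := hadj.2 _ (pos_of_ne_zero hA) hA1
    rw [h1] at hy
    have := hI.pass hA hy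
    rw [← h2] at this
    simpa [I] using this

end

end CactusRouting
namespace CactusRouting

open scoped Classical
noncomputable section

open Function Nat


open RamProg WordExpr

/-! ### Loading a layout -/

namespace Layout

/-- The ranges of the data of a layout. -/
structure Tame (ℓ : Layout) : Prop where
  par_zero : ℓ.par 0 = 0
  par_lt : ∀ j, 0 < j → ℓ.par j < j
  eu_lt : ∀ e < ℓ.m, ℓ.eu e < ℓ.n
  ev_lt : ∀ e < ℓ.m, ℓ.ev e < ℓ.n
  sp_lt : ∀ i < ℓ.d, ℓ.sp i < ℓ.n
  tp_lt : ∀ i < ℓ.d, ℓ.tp i < ℓ.n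
  cactus : ℓ.Cactus

/-- The layout is stored in the memory. -/
structure Loaded (ℓ : Layout) (σ : RamState) : Prop where
  n : σ.reg 0 = ℓ.n
  m : σ.reg 1 = ℓ.m
  d : σ.reg 2 = ℓ.d
  k : σ.reg 3 = ℓ.k
  par : σ.arr 9 = ℓ.par
  eu : σ.arr 11 = ℓ.eu
  ev : σ.arr 12 = ℓ.ev
  sp : σ.arr 13 = ℓ.sp
  tp : σ.arr 14 = ℓ.tp

variable {ℓ : Layout}

theorem Loaded.frame {P : RamProg} {σ τ : RamState} (h : ℓ.Loaded σ) (hF : P.Frame σ τ)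
    (hr : ∀ r < 4, r ∉ P.regs := by decide)
    (ha : ∀ a ∈ [9, 11, 12, 13, 14], a ∉ P.arrs := by decide) : ℓ.Loaded τ where
  n := (hF.1 0 (hr 0 (by decide))).trans h.n
  m := (hF.1 1 (hr 1 (by decide))).trans h.m
  d := (hF.1 2 (hr 2 (by decide))).trans h.d
  k := (hF.1 3 (hr 3 (by decide))).trans h.k
  par := (hF.2 9 (ha 9 (by decide))).trans h.par
  eu := (hF.2 11 (ha 11 (by decide))).trans h.eu
  ev := (hF.2 12 (ha 12 (by decide))).trans h.ev
  sp := (hF.2 13 (ha 13 (by decide))).trans h.sp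
  tp := (hF.2 14 (ha 14 (by decide))).trans h.tp

/-- All quantities occurring in the computation are less than `B`. -/
structure Fits (ℓ : Layout) (B : ℕ) : Prop where
  lin : 8 * (ℓ.n + ℓ.m + ℓ.d + ℓ.k + 8) < B
  edges : (ℓ.m + 1) * (ℓ.m + 1) < B
  marks : (ℓ.d + 1) * ℓ.n < B
  counts : (ℓ.d + 1) * (ℓ.m + 1) < B
  rows : (2 * ℓ.d + 1) * (ℓ.k + 1) < B
  costs : 4 * (ℓ.m + 1) + ℓ.k < B

end Layout

/-- Translation of the input to node numbers. -/
def loadProg : RamProg := block [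
  forLoop 6 1 (block [.store 11 (.reg 6) (.load 8 (.load 0 (.reg 6)) - .lit 1),
    .store 12 (.reg 6) (.load 8 (.load 1 (.reg 6)) - .lit 1)]),
  forLoop 6 2 (block [.store 13 (.reg 6) (.load 8 (.load 2 (.reg 6)) - .lit 1),
    .store 14 (.reg 6) (.load 8 (.load 3 (.reg 6)) - .lit 1)])]

theorem run_load {w : ℕ} {σ : RamState} (hσ : σ.Bdd w) {B : ℕ} (hB : 2 ^ w = B)
    (h11 : ∀ x, σ.arr 11 x = 0) (h12 : ∀ x, σ.arr 12 x = 0) (h13 : ∀ x, σ.arr 13 x = 0)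
    (h14 : ∀ x, σ.arr 14 x = 0) :
    Run w loadProg σ (σ.reg 1 * 50 + σ.reg 2 * 50 + 20) fun τ =>
      (∀ e, τ.arr 11 e = if e < σ.reg 1 then σ.arr 8 (σ.arr 0 e) - 1 else 0) ∧
      (∀ e, τ.arr 12 e = if e < σ.reg 1 then σ.arr 8 (σ.arr 1 e) - 1 else 0) ∧
      (∀ e, τ.arr 13 e = if e < σ.reg 2 then σ.arr 8 (σ.arr 2 e) - 1 else 0) ∧
      (∀ e, τ.arr 14 e = if e < σ.reg 2 then σ.arr 8 (σ.arr 3 e) - 1 else 0) := by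
  have b1 : 1 < B := hB ▸ hσ.one_lt
  let I : ℕ → (ℕ → ℕ → ℕ) → Prop := fun i arr =>
    (∀ e, arr 11 e = if e < i then σ.arr 8 (σ.arr 0 e) - 1 else 0) ∧
    (∀ e, arr 12 e = if e < i then σ.arr 8 (σ.arr 1 e) - 1 else 0)
  let I' : ℕ → (ℕ → ℕ → ℕ) → Prop := fun i arr =>
    (∀ e, arr 13 e = if e < i then σ.arr 8 (σ.arr 2 e) - 1 else 0) ∧
    (∀ e, arr 14 e = if e < i then σ.arr 8 (σ.arr 3 e) - 1 else 0)
  refine (Run.cons (T := σ.reg 1 * (40 + 8) + 6) (T' := σ.reg 2 * (40 + 8) + 6 + 1)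
    (Q := fun τ => I (σ.reg 1) τ.arr) hσ ?_ ?_).le (by omega)
  · refine Run.for hσ ⟨by simpa using h11, by simpa using h12⟩ ?_
    intro i hi τ hτ hF hr hI
    obtain ⟨hI1, hI2⟩ := hI
    have a0 := hF.2 0
    have a1 := hF.2 1
    have a8 := hF.2 8
    refine Run.of_wp hτ ?_
    simp [I, hr, a0, a1, a8, hB, b1, hI1, hI2, update_apply]
    grind
  · intro τ hτ hF hI
    have r2 := hF.1 2
    rw [← r2]
    refine Run.cons (Q := fun υ => I' (τ.reg 2) υ.arr) hτ (Run.for (I := I') hτ ⟨fun x => ?_, fun x => ?_⟩ ?_) ?_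
    · rw [hF.2 13]; simpa using h13 x
    · rw [hF.2 14]; simpa using h14 x
    · intro i hi υ hυ hF' hr hI
      obtain ⟨hI1, hI2⟩ := hI
      have a2 := (hF'.2 2).trans (hF.2 2)
      have a3 := (hF'.2 3).trans (hF.2 3)
      have a8 := (hF'.2 8).trans (hF.2 8)
      refine Run.of_wp hυ ?_
      simp [I', hr, a2, a3, a8, hB, b1, hI1, hI2, update_apply]
      grind
    · intro υ hυ hF' hI'
      refine Run.nil ⟨?_, ?_, hI'.1, hI'.2⟩
      · rw [hF'.2 11]; exact hI.1
      · rw [hF'.2 12]; exact hI.2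

/-! ### Cycle numbers -/

namespace Layout

variable (ℓ : Layout)

/-- The sum of the numbers of the first `i` non-tree edges with a given end at `x`. -/
def endSum (ends : ℕ → ℕ) (i x : ℕ) : ℕ :=
  ∑ e ∈ Finset.range i, if ℓ.NT e ∧ ends e = x then e + 1 else 0

variable {ℓ}

theorem endSum_succ (ends : ℕ → ℕ) (i x : ℕ) : ℓ.endSum ends (i + 1) x =
    ℓ.endSum ends i x + if ℓ.NT i ∧ ends i = x then i + 1 else 0 := by
  unfold endSum
  rw [Finset.sum_range_succ]

theorem endSum_le (ends : ℕ → ℕ) {i : ℕ} (hi : i ≤ ℓ.m) (x : ℕ) : ℓ.endSum ends i x ≤ ℓ.m * ℓ.m := by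
  refine (Finset.sum_le_card_nsmul _ _ ℓ.m fun e he => ?_).trans ?_
  · grind
  · rw [Finset.card_range, smul_eq_mul]
    exact mul_le_mul_right _ hi

theorem idSum_le (ends : ℕ → ℕ) (x : ℕ) : ℓ.idSum ends x ≤ ℓ.m * ℓ.m := by
  refine (Finset.sum_le_card_nsmul _ _ ℓ.m fun e he => ?_).trans ?_
  · grind
  · grind

/-- A node below `x` is `x` itself or lies below exactly one child of `x`. The induction passes from
`u` to its parent, which changes the set of nodes above by `u` alone. -/
theorem ite_anc_eq (h : ℓ.Tame) (x y u : ℕ) (hu : u < ℓ.n) :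
    (if Anc ℓ.par x u then y else 0) = (if u = x then y else 0) +
      ∑ c ∈ Finset.Ioo 0 ℓ.n, if ℓ.par c = x then (if Anc ℓ.par c u then y else 0) else 0 := by
  induction u using Nat.strong_induction_on with
  | _ u ih =>
    by_cases hux : u = x
    · subst hux
      rw [if_pos (Anc.refl u), if_pos rfl, Finset.sum_eq_zero, add_zero]
      intro c hc
      rw [Finset.mem_Ioo] at hc
      refine ite_eq_right_iff.2 fun hcu => if_neg fun ha => ?_
      have := ha.le h.par_zero h.par_lt
      have := h.par_lt c hc.1
      omega
    rcases Nat.eq_zero_or_pos u with rfl | hpos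
    · have h1 : ¬ Anc ℓ.par x 0 := fun ha => by
        have := ha.le h.par_zero h.par_lt
        omega
      rw [if_neg h1, if_neg hux, Finset.sum_eq_zero, add_zero]
      intro c hc
      rw [Finset.mem_Ioo] at hc
      refine ite_eq_right_iff.2 fun hcu => if_neg fun ha => ?_
      have := ha.le h.par_zero h.par_lt
      omega
    have hlt := h.par_lt u hpos
    have h1 : ∀ c, (if Anc ℓ.par c u then y else 0) =
        (if c = u then y else 0) + if Anc ℓ.par c (ℓ.par u) then y else 0 := by
      intro c
      by_cases hcu : c = u
      · subst hcu
        rw [if_pos (Anc.refl _), if_pos rfl, if_neg, add_zero]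
        intro ha
        have := ha.le h.par_zero h.par_lt
        omega
      · rw [if_neg hcu, zero_add]
        exact if_congr (by rw [anc_iff]; simp [Ne.symm hcu]) rfl rfl
    rw [h1 x, if_neg (Ne.symm hux), if_neg hux, ih _ hlt (by omega), zero_add, zero_add]
    have h2 : ∀ c ∈ Finset.Ioo 0 ℓ.n,
        (if ℓ.par c = x then (if Anc ℓ.par c u then y else 0) else 0) =
        (if c = u then (if ℓ.par u = x then y else 0) else 0) +
        if ℓ.par c = x then (if Anc ℓ.par c (ℓ.par u) then y else 0) else 0 := by
      grind
    rw [Finset.sum_congr rfl h2, Finset.sum_add_distrib, Finset.sum_ite_eq' (Finset.Ioo 0 ℓ.n) u,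
      if_pos (Finset.mem_Ioo.2 ⟨hpos, hu⟩)]

theorem idSum_eq (h : ℓ.Tame) (ends : ℕ → ℕ) (he : ∀ e < ℓ.m, ends e < ℓ.n) (x : ℕ) :
    ℓ.idSum ends x = ℓ.endSum ends ℓ.m x +
      ∑ c ∈ Finset.Ioo 0 ℓ.n, if ℓ.par c = x then ℓ.idSum ends c else 0 := by
  have h1 : ∀ c, (if ℓ.par c = x then ℓ.idSum ends c else 0) = ∑ e ∈ Finset.range ℓ.m,
      if ℓ.NT e then (if ℓ.par c = x then (if Anc ℓ.par c (ends e) then e + 1 else 0) else 0)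
      else 0 := by
    intro c
    unfold idSum
    split_ifs with hc
    · refine Finset.sum_congr rfl fun e _ => ?_
      split_ifs <;> simp_all
    · simp
  simp only [h1]
  rw [Finset.sum_comm]
  unfold endSum
  rw [← Finset.sum_add_distrib, idSum]
  refine Finset.sum_congr rfl fun e hm => ?_
  by_cases hNT : ℓ.NT e
  · simpa [hNT] using ite_anc_eq h x (e + 1) (ends e) (he e (Finset.mem_range.1 hm))
  · simp [hNT]

/-- Partial subtree sums, after processing the nodes from `t` on. -/
def accSum (ℓ : Layout) (ends : ℕ → ℕ) (t x : ℕ) : ℕ := ℓ.endSum ends ℓ.m x +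
  ∑ c ∈ Finset.Ioo 0 ℓ.n, if t ≤ c ∧ ℓ.par c = x then ℓ.idSum ends c else 0

theorem accSum_n (ends : ℕ → ℕ) (x : ℕ) : ℓ.accSum ends ℓ.n x = ℓ.endSum ends ℓ.m x := by
  unfold accSum
  rw [Finset.sum_eq_zero, add_zero]
  grind

theorem accSum_le (h : ℓ.Tame) (ends : ℕ → ℕ) (he : ∀ e < ℓ.m, ends e < ℓ.n) (t x : ℕ) :
    ℓ.accSum ends t x ≤ ℓ.idSum ends x := by
  rw [idSum_eq h ends he, accSum]
  refine Nat.add_le_add_left (Finset.sum_le_sum fun c _ => ?_) _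
  split_ifs <;> simp_all

/-- Children have larger numbers than their parent, so in descending order all children of `x` have
been added before `x` is read. -/
theorem accSum_of_le (h : ℓ.Tame) (ends : ℕ → ℕ) (he : ∀ e < ℓ.m, ends e < ℓ.n) {t x : ℕ}
    (hx : t ≤ x + 1) : ℓ.accSum ends t x = ℓ.idSum ends x := by
  rw [idSum_eq h ends he, accSum]
  congr 1
  refine Finset.sum_congr rfl fun c hc => ?_
  rw [Finset.mem_Ioo] at hc
  have := h.par_lt c hc.1
  exact if_congr ⟨fun h => h.2, fun h => ⟨by omega, h⟩⟩ rfl rfl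

theorem accSum_step (ends : ℕ → ℕ) {v : ℕ} (hv : 0 < v) (hn : v < ℓ.n) (x : ℕ) :
    ℓ.accSum ends v x = ℓ.accSum ends (v + 1) x + if ℓ.par v = x then ℓ.idSum ends v else 0 := by
  unfold accSum
  rw [add_assoc]
  congr 1
  have h1 : ∀ c ∈ Finset.Ioo 0 ℓ.n, (if v ≤ c ∧ ℓ.par c = x then ℓ.idSum ends c else 0) =
      (if v + 1 ≤ c ∧ ℓ.par c = x then ℓ.idSum ends c else 0) +
      if c = v then (if ℓ.par v = x then ℓ.idSum ends v else 0) else 0 := by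
    grind
  rw [Finset.sum_congr rfl h1, Finset.sum_add_distrib, Finset.sum_ite_eq' (Finset.Ioo 0 ℓ.n) v,
    if_pos (Finset.mem_Ioo.2 ⟨hv, hn⟩)]

theorem accSum_zero (ends : ℕ → ℕ) (x : ℕ) : ℓ.accSum ends 0 x = ℓ.accSum ends 1 x := by
  unfold accSum
  congr 1
  refine Finset.sum_congr rfl fun c hc => ?_
  grind

/-- The arrays holding the cycle numbers of the tree edges and the numbers of tree edges of the
cycles. -/
def Cycles (ℓ : Layout) (arr : ℕ → ℕ → ℕ) : Prop :=
  (∀ v, 0 < v → v < ℓ.n → arr 17 v = ℓ.cyc v) ∧ ∀ c, arr 18 c + 1 = ℓ.len c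

end Layout

theorem card_filter_Ioo_succ (p : ℕ → Prop) [DecidablePred p] {i : ℕ} (hi : 0 < i) :
    ((Finset.Ioo 0 (i + 1)).filter p).card =
      ((Finset.Ioo 0 i).filter p).card + if p i then 1 else 0 := by
  have : Finset.Ioo 0 (i + 1) = insert i (Finset.Ioo 0 i) := by
    grind
  rw [this, Finset.filter_insert]
  grind

theorem card_filter_range_succ (p : ℕ → Prop) [DecidablePred p] (i : ℕ) :
    ((Finset.range (i + 1)).filter p).card =
      ((Finset.range i).filter p).card + if p i then 1 else 0 := by
  rw [Finset.range_add_one, Finset.filter_insert]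
  grind

/-- Sums of the numbers of the non-tree edges ending at the nodes. -/
def endSumProg : RamProg := forLoop 6 1 <|
  .ite (.equal (.load 9 (.load 11 (.reg 6))) (.load 12 (.reg 6))) .skip <|
  .ite (.equal (.load 9 (.load 12 (.reg 6))) (.load 11 (.reg 6))) .skip <| block [
    .store 15 (.load 11 (.reg 6)) (.load 15 (.load 11 (.reg 6)) + (.reg 6 + .lit 1)),
    .store 16 (.load 12 (.reg 6)) (.load 16 (.load 12 (.reg 6)) + (.reg 6 + .lit 1))]

/-- Subtree sums. -/
def idSumProg : RamProg := forLoop 6 0 <| block [.set 11 (.reg 0 - .reg 6 - .lit 1),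
  .ite (.reg 11) (block [
    .store 15 (.load 9 (.reg 11)) (.load 15 (.load 9 (.reg 11)) + .load 15 (.reg 11)),
    .store 16 (.load 9 (.reg 11)) (.load 16 (.load 9 (.reg 11)) + .load 16 (.reg 11))]) .skip]

/-- Cycle numbers and lengths of cycles. -/
def cycleProg : RamProg := forLoop 6 0 <| .ite (.reg 6) (block [
  .store 17 (.reg 6) ((.load 15 (.reg 6) - .load 16 (.reg 6)) +
    (.load 16 (.reg 6) - .load 15 (.reg 6))),
  .store 18 (.load 17 (.reg 6)) (.load 18 (.load 17 (.reg 6)) + .lit 1)]) .skip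

section

variable {w : ℕ} {σ : RamState} {ℓ : Layout} {B : ℕ}

theorem run_endSum (hσ : σ.Bdd w) (hℓ : ℓ.Loaded σ) (hB : 2 ^ w = B) (hw : ℓ.Fits B)
    (h15 : ∀ x, σ.arr 15 x = 0) (h16 : ∀ x, σ.arr 16 x = 0) :
    Run w endSumProg σ (ℓ.m * 100 + 6) fun τ =>
      (∀ x, τ.arr 15 x = ℓ.endSum ℓ.eu ℓ.m x) ∧ ∀ x, τ.arr 16 x = ℓ.endSum ℓ.ev ℓ.m x := by
  have b1 : 1 < B := hB ▸ hσ.one_lt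
  have hl := hw.lin
  have hm := hw.edges
  rw [← hℓ.m]
  refine (Run.for (T := 92) (I := fun i arr => (∀ x, arr 15 x = ℓ.endSum ℓ.eu i x) ∧
    ∀ x, arr 16 x = ℓ.endSum ℓ.ev i x) hσ
    ⟨fun x => by simp [h15, Layout.endSum], fun x => by simp [h16, Layout.endSum]⟩ ?_).le
    (by omega)
  intro i hi τ hτ hF hr ⟨h1, h2⟩
  have hL := hℓ.frame hF
  refine Run.of_wp hτ ?_
  rw [hℓ.m] at hi
  have hb : ∀ ends x, ℓ.endSum ends i x + (i + 1) < B := by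
    intro ends x
    have := Layout.endSum_le (ℓ := ℓ) ends hi.le x
    nlinarith
  simp only [Layout.endSum_succ]
  simp [hr, hL.par, hL.eu, hL.ev, hB, b1, h1, h2, hb, update_apply]
  refine ⟨fun h => ?_, fun h => ⟨fun h' => ?_, fun h' => ⟨by omega, fun x => ?_, fun x => ?_⟩⟩⟩
  · simp [Layout.NT, h]
  · simp [Layout.NT, h']
  · have : ℓ.NT i := ⟨h, h'⟩
    grind
  · have : ℓ.NT i := ⟨h, h'⟩
    grind

theorem run_idSum (hσ : σ.Bdd w) (hℓ : ℓ.Loaded σ) (ht : ℓ.Tame) (hB : 2 ^ w = B) (hw : ℓ.Fits B)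
    (h15 : ∀ x, σ.arr 15 x = ℓ.endSum ℓ.eu ℓ.m x) (h16 : ∀ x, σ.arr 16 x = ℓ.endSum ℓ.ev ℓ.m x) :
    Run w idSumProg σ (ℓ.n * 100 + 6) fun τ =>
      (∀ x, τ.arr 15 x = ℓ.idSum ℓ.eu x) ∧ ∀ x, τ.arr 16 x = ℓ.idSum ℓ.ev x := by
  have b1 : 1 < B := hB ▸ hσ.one_lt
  have hl := hw.lin
  have hm := hw.edges
  have hup : ∀ ends x, ℓ.idSum ends x ≤ ℓ.m * ℓ.m := fun ends x => Layout.idSum_le ends x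
  rw [← hℓ.n]
  refine (Run.for (T := 92) (I := fun i arr => (∀ x, arr 15 x = ℓ.accSum ℓ.eu (ℓ.n - i) x) ∧
    ∀ x, arr 16 x = ℓ.accSum ℓ.ev (ℓ.n - i) x) hσ
    ⟨fun x => by simp [h15, Layout.accSum_n], fun x => by simp [h16, Layout.accSum_n]⟩ ?_).mono
    (by omega) fun τ h => ?_
  swap
  · rw [hℓ.n, Nat.sub_self] at h
    refine ⟨fun x => ?_, fun x => ?_⟩
    · rw [h.1, Layout.accSum_of_le ht _ ht.eu_lt (by omega)]
    · rw [h.2, Layout.accSum_of_le ht _ ht.ev_lt (by omega)]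
  intro i hi τ hτ hF hr ⟨h1, h2⟩
  have hL := hℓ.frame hF
  refine Run.of_wp hτ ?_
  rw [hℓ.n] at hi
  -- Nodes are visited in descending order. The root is skipped: it is its own parent and would be
  -- added to itself.
  obtain ⟨v, hv⟩ : ∃ v, v + 1 = ℓ.n - i := ⟨ℓ.n - i - 1, by omega⟩
  rw [show ℓ.n - (i + 1) = v by omega]
  rw [← hv] at h1 h2
  have e1 := Layout.accSum_of_le ht _ ht.eu_lt (le_refl (v + 1))
  have e2 := Layout.accSum_of_le ht _ ht.ev_lt (le_refl (v + 1))
  have f1 := Layout.accSum_of_le ht _ ht.eu_lt (show v + 1 ≤ v + 1 from le_rfl)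
  simp [hr, hL.n, hL.par, hB, b1, ← hv, h1, h2, update_apply]
  refine ⟨fun hv0 => ?_, fun hv0 => ?_⟩
  · have s1 := Layout.accSum_step (ℓ := ℓ) ℓ.eu (pos_of_ne_zero hv0) (by omega)
    have s2 := Layout.accSum_step (ℓ := ℓ) ℓ.ev (pos_of_ne_zero hv0) (by omega)
    have g1 := s1 (ℓ.par v)
    have g2 := s2 (ℓ.par v)
    rw [if_pos rfl] at g1 g2
    have k1 := Layout.accSum_le ht _ ht.eu_lt v (ℓ.par v)
    have k2 := Layout.accSum_le ht _ ht.ev_lt v (ℓ.par v)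
    grind
  · subst hv0
    exact ⟨fun x => (Layout.accSum_zero _ x).symm, fun x => (Layout.accSum_zero _ x).symm⟩

theorem run_cycle (hσ : σ.Bdd w) (hℓ : ℓ.Loaded σ) (hB : 2 ^ w = B) (hw : ℓ.Fits B)
    (h15 : ∀ x, σ.arr 15 x = ℓ.idSum ℓ.eu x) (h16 : ∀ x, σ.arr 16 x = ℓ.idSum ℓ.ev x)
    (h18 : ∀ x, σ.arr 18 x = 0) :
    Run w cycleProg σ (ℓ.n * 100 + 6) fun τ => ℓ.Cycles τ.arr := by
  have b1 : 1 < B := hB ▸ hσ.one_lt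
  have hl := hw.lin
  have hm := hw.edges
  have hup : ∀ ends x, ℓ.idSum ends x ≤ ℓ.m * ℓ.m := fun ends x => Layout.idSum_le ends x
  rw [← hℓ.n]
  refine (Run.for (T := 92) (I := fun i arr => (∀ v, 0 < v → v < i → arr 17 v = ℓ.cyc v) ∧
    ∀ c, arr 18 c = ((Finset.Ioo 0 i).filter fun v => ℓ.cyc v = c).card) hσ ⟨fun v h h' => by omega, fun x => by simp [h18]⟩ ?_).mono
    (by omega) fun τ h => ?_
  swap
  · rw [hℓ.n] at h
    exact ⟨h.1, fun c => by rw [h.2, Layout.len]⟩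
  intro i hi τ hτ hF hr ⟨h1, h2⟩
  have hL := hℓ.frame hF
  have a15 := hF.2 15
  have a16 := hF.2 16
  refine Run.of_wp hτ ?_
  rw [hℓ.n] at hi
  have hc : ∀ c, ((Finset.Ioo 0 i).filter fun v => ℓ.cyc v = c).card ≤ i := fun c =>
    (Finset.card_filter_le _ _).trans (by simp)
  simp [hr, a15, a16, h15, h16, hB, b1, h2, update_apply]
  refine ⟨fun hi0 => ⟨?_, ?_, fun v hv hvi => ?_, fun c => ?_⟩, fun hi0 => ?_⟩
  · grind
  · have := hc (ℓ.idSum ℓ.eu i - ℓ.idSum ℓ.ev i + (ℓ.idSum ℓ.ev i - ℓ.idSum ℓ.eu i))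
    omega
  · split_ifs with h
    · rw [h, Layout.cyc]
    · exact h1 v hv (by omega)
  · rw [card_filter_Ioo_succ _ (pos_of_ne_zero hi0)]
    change (if c = ℓ.cyc i then ((Finset.Ioo 0 i).filter fun v => ℓ.cyc v = ℓ.cyc i).card + 1 else _)
      = _
    by_cases h : c = ℓ.cyc i
    · simp [h]
    · simp [h, Ne.symm h]
  · subst hi0
    exact ⟨fun v h h' => by omega, fun c => by simp [show Finset.Ioo 0 1 = ∅ from rfl]⟩

end

end

end CactusRouting
namespace CactusRouting

open scoped Classical
noncomputable section

open Function Nat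


open RamProg WordExpr

/-! ### Ends below nodes -/

theorem mul_add_inj {n i j x y : ℕ} (hx : x < n) (hy : y < n) :
    i * n + x = j * n + y ↔ i = j ∧ x = y := by
  refine ⟨fun h => ?_, fun ⟨h, h'⟩ => by rw [h, h']⟩
  have hn : 0 < n := by omega
  have h1 : (i * n + x) / n = (j * n + y) / n := by rw [h]
  rw [add_comm, add_mul_div_right _ _ hn, add_comm (j * n),
    add_mul_div_right _ _ hn, div_eq_of_lt hx, div_eq_of_lt hy] at h1
  grind

theorem ite_or_and {J P E F : Prop} [Decidable (J ∧ F)] [Decidable (P ∨ J ∧ E)]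
    [Decidable (P ∨ J ∧ (E ∨ F))] : (if J ∧ F then 1 else if P ∨ J ∧ E then 1 else 0) =
      if P ∨ J ∧ (E ∨ F) then 1 else 0 := by
  grind

theorem mul_add_lt {n d i x B : ℕ} (hi : i < d) (hx : x < n) (h : (d + 1) * n < B) :
    i * n + x + n < B := by
  have : (i + 1) * n ≤ d * n := mul_le_mul_right _ hi
  grind

/-- Parents decrease strictly until the root, so `s` steps reach it and `n` rounds of climbing see
every ancestor; extra rounds stay at the root. -/
theorem anc_iff_exists_lt {par : ℕ → ℕ} (h0 : par 0 = 0) (hpar : ∀ j, 0 < j → par j < j)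
    {n s : ℕ} (hs : s < n) (x : ℕ) : Anc par x s ↔ ∃ l < n, par^[l] s = x := by
  have hle : ∀ l, par^[l] s ≤ s - l := by
    intro l
    induction l with
    | zero => exact le_rfl
    | succ l ih =>
      rw [Function.iterate_succ_apply']
      grind
  constructor
  · rintro ⟨l, hl⟩
    by_cases hln : l < n
    · exact ⟨l, hln, hl⟩
    · have h1 := hle l
      have h2 := hle s
      exact ⟨s, hs, by omega⟩
  · rintro ⟨l, -, hl⟩
    exact ⟨l, hl⟩

namespace Layout

variable (ℓ : Layout)

/-- For the first `b` demands, arrays `19` and `20` indicate the ends below the nodes. -/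
def Marked (b : ℕ) (arr : ℕ → ℕ → ℕ) : Prop := ∀ i < ℓ.d, ∀ v < ℓ.n,
  arr 19 (i * ℓ.n + v) = (if i < b ∧ Anc ℓ.par v (ℓ.sp i) then 1 else 0) ∧
  arr 20 (i * ℓ.n + v) = (if i < b ∧ Anc ℓ.par v (ℓ.tp i) then 1 else 0)

end Layout

def climbProg : RamProg := forLoop 7 0 <| block [
  .store 19 (.reg 12 + .load 10 (.lit 3)) (.lit 1),
  .store 20 (.reg 12 + .load 10 (.lit 4)) (.lit 1),
  .store 10 (.lit 3) (.load 9 (.load 10 (.lit 3))),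
  .store 10 (.lit 4) (.load 9 (.load 10 (.lit 4)))]

/-- Marks the nodes above the ends of the demands. -/
def markProg : RamProg := forLoop 6 2 <| block [
  block [.set 12 (.reg 6 * .reg 0), .store 10 (.lit 3) (.load 13 (.reg 6)),
    .store 10 (.lit 4) (.load 14 (.reg 6))], climbProg]

section

variable {w : ℕ} {σ : RamState} {ℓ : Layout} {B : ℕ}

theorem run_climb (hσ : σ.Bdd w) (hℓ : ℓ.Loaded σ) (ht : ℓ.Tame) (hB : 2 ^ w = B) (hw : ℓ.Fits B)
    {i : ℕ} (hi : i < ℓ.d) (hr : σ.reg 12 = i * ℓ.n) (hs : σ.arr 10 3 = ℓ.sp i)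
    (ht' : σ.arr 10 4 = ℓ.tp i) (hM : ℓ.Marked i σ.arr) :
    Run w climbProg σ (ℓ.n * 100 + 6) fun τ => ℓ.Marked (i + 1) τ.arr := by
  have b1 : 1 < B := hB ▸ hσ.one_lt
  have hl := hw.lin
  have b3 : 3 < B := by omega
  have b4 : 4 < B := by omega
  let I : ℕ → (ℕ → ℕ → ℕ) → Prop := fun t arr =>
    arr 10 3 = ℓ.par^[t] (ℓ.sp i) ∧ arr 10 4 = ℓ.par^[t] (ℓ.tp i) ∧ ∀ j < ℓ.d, ∀ v < ℓ.n,
      arr 19 (j * ℓ.n + v) = (if (j < i ∧ Anc ℓ.par v (ℓ.sp j)) ∨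
        (j = i ∧ ∃ l < t, ℓ.par^[l] (ℓ.sp i) = v) then 1 else 0) ∧
      arr 20 (j * ℓ.n + v) = (if (j < i ∧ Anc ℓ.par v (ℓ.tp j)) ∨
        (j = i ∧ ∃ l < t, ℓ.par^[l] (ℓ.tp i) = v) then 1 else 0)
  rw [← hℓ.n]
  refine (Run.for (T := 92) (I := I) hσ
    ⟨by simpa using hs, by simpa using ht', fun j hj v hv => by simpa using hM j hj v hv⟩ ?_).mono
    (by omega) fun τ h => ?_
  swap
  · rw [hℓ.n] at h
    intro j hj v hv
    rw [(h.2.2 j hj v hv).1, (h.2.2 j hj v hv).2]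
    have h1 := anc_iff_exists_lt ht.par_zero ht.par_lt (ht.sp_lt i hi) v
    have h2 := anc_iff_exists_lt ht.par_zero ht.par_lt (ht.tp_lt i hi) v
    grind
  intro t ht0 τ hτ hF hr7 ⟨h3, h4, h5⟩
  have hL := hℓ.frame hF
  have r12 := (hF.1 12).trans hr
  have hlt : ∀ s < ℓ.n, ℓ.par^[t] s < ℓ.n := by
    intro s hs
    have : ∀ l, ℓ.par^[l] s < ℓ.n := by
      intro l
      induction l with
      | zero => exact hs
      | succ l ih =>
        rw [Function.iterate_succ_apply']
        rcases Nat.eq_zero_or_pos (ℓ.par^[l] s) with h | h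
        · rw [h, ht.par_zero]
          omega
        · exact (ht.par_lt _ h).trans ih
    exact this t
  have l1 := hlt _ (ht.sp_lt i hi)
  have l2 := hlt _ (ht.tp_lt i hi)
  have hlast : ∀ s x, (∃ l < t + 1, ℓ.par^[l] s = x) ↔ (∃ l < t, ℓ.par^[l] s = x) ∨
      x = ℓ.par^[t] s := by
    grind
  refine Run.of_wp hτ ?_
  have m1 := mul_add_lt hi l1 hw.marks
  have m2 := mul_add_lt hi l2 hw.marks
  simp only [I, hlast]
  simp [hL.par, hB, b1, b3, b4, h3, h4, r12, update_apply,
    iterate_succ_apply']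
  refine ⟨by omega, by omega, fun j hj v hv => ⟨?_, ?_⟩⟩
  · simp only [mul_add_inj hv l1, (h5 j hj v hv).1]
    exact ite_or_and
  · simp only [mul_add_inj hv l2, (h5 j hj v hv).2]
    exact ite_or_and

theorem run_mark (hσ : σ.Bdd w) (hℓ : ℓ.Loaded σ) (ht : ℓ.Tame) (hB : 2 ^ w = B) (hw : ℓ.Fits B)
    (h19 : ∀ x, σ.arr 19 x = 0) (h20 : ∀ x, σ.arr 20 x = 0) :
    Run w markProg σ (ℓ.d * (ℓ.n * 100 + 50) + 6) fun τ => ℓ.Marked ℓ.d τ.arr := by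
  have b1 : 1 < B := hB ▸ hσ.one_lt
  have hl := hw.lin
  have b3 : 3 < B := by omega
  have b4 : 4 < B := by omega
  rw [← hℓ.d]
  refine (Run.for (T := ℓ.n * 100 + 42) (I := fun i arr => ℓ.Marked i arr) hσ (fun i hi v hv => by simp [h19, h20]) ?_).le (by rw [hℓ.d])
  intro i hi τ hτ hF hr hI
  rw [hℓ.d] at hi
  have hL := hℓ.frame hF
  refine (Run.cons (T := 30) (T' := ℓ.n * 100 + 6 + 1)
    (Q := fun υ => υ.reg 12 = i * ℓ.n ∧ υ.arr 10 3 = ℓ.sp i ∧ υ.arr 10 4 = ℓ.tp i) hτ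
    (Run.of_wp hτ ?_) ?_).le (by omega)
  · have h0 := ht.sp_lt i hi
    have := mul_add_lt hi h0 hw.marks
    simp [hL.n, hL.sp, hL.tp, hB, hr, b3, b4]
    omega
  · rintro υ hυ hF' ⟨h1, h2, h3⟩
    have hL' := hL.frame hF'
    refine Run.cons (Q := fun τ => ℓ.Marked (i + 1) τ.arr) hυ
      (run_climb hυ hL' ht hB hw hi h1 h2 h3 ?_) fun ρ hρ _ h => Run.nil h
    intro j hj v hv
    rw [hF'.2 19, hF'.2 20]
    exact hI j hj v hv

end

/-! ### Crossings -/

namespace Layout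

variable (ℓ : Layout)

/-- The number of demands crossing the tree edge above `v` among the first `b` ones. -/
def cntUpto (b v : ℕ) : ℕ := ((Finset.range b).filter fun i => ℓ.Cross i v).card

/-- One of the first `b` demands crosses the tree edge above `v`, and the slot `γ` belongs to its
end below `v`. -/
def CrossSlot (b v γ : ℕ) : Prop :=
  γ / 2 < b ∧ ℓ.Cross (γ / 2) v ∧ Anc ℓ.par v (ℓ.slotEnd γ)

/-- The number of the first `b` demands that cross the tree edge above `v` is `a`, and two of them
have the slots `γ` and `δ`. -/
def Crossing (b v a γ δ : ℕ) : Prop :=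
  a = ℓ.cntUpto b v ∧ (1 ≤ a → ℓ.CrossSlot b v γ) ∧
    (2 ≤ a → ℓ.CrossSlot b v δ ∧ γ / 2 ≠ δ / 2)

/-- The number of tree edges of cycle `c` above the nodes less than `t` crossed by demand `i`. -/
def pcUpto (i t c : ℕ) : ℕ :=
  ((Finset.Ioo 0 t).filter fun v => ℓ.cyc v = c ∧ ℓ.Cross i v).card

/-- The arrays holding information about crossings of tree edges by the first `b` demands. -/
def Crossed (b : ℕ) (arr : ℕ → ℕ → ℕ) : Prop :=
  (∀ v, 0 < v → v < ℓ.n → ℓ.Crossing b v (arr 21 v) (arr 22 v) (arr 23 v)) ∧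
  ∀ i < ℓ.d, ∀ c ≤ ℓ.m, arr 24 (i * (ℓ.m + 1) + c) = if i < b then ℓ.pc i c else 0

variable {ℓ} {b v a γ δ ε : ℕ}

theorem CrossSlot.succ (h : ℓ.CrossSlot b v γ) : ℓ.CrossSlot (b + 1) v γ :=
  ⟨h.1.trans (lt_succ_self b), h.2⟩

theorem Crossing.zero : ℓ.Crossing 0 v 0 γ δ :=
  ⟨by simp [cntUpto], fun h => by omega, fun h => by omega⟩

theorem Crossing.succ_of_not (h : ℓ.Crossing b v a γ δ) (hb : ¬ ℓ.Cross b v) :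
    ℓ.Crossing (b + 1) v a γ δ := by
  refine ⟨?_, fun h' => (h.2.1 h').succ, fun h' => ⟨(h.2.2 h').1.succ, (h.2.2 h').2⟩⟩
  rw [h.1, cntUpto, cntUpto, card_filter_range_succ, if_neg hb, add_zero]

/-- The first crossing demand fills the slot `γ`, and every later one overwrites `δ`; the two remain
different because demands come in increasing order. -/
theorem Crossing.succ (h : ℓ.Crossing b v a γ δ) (hb : ℓ.Cross b v) (hε : ε / 2 = b)
    (ha : Anc ℓ.par v (ℓ.slotEnd ε)) :
    ℓ.Crossing (b + 1) v (a + 1) (if a = 0 then ε else γ) (if a = 0 then δ else ε) := by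
  have hs : ℓ.CrossSlot (b + 1) v ε := ⟨by omega, hε ▸ hb, ha⟩
  refine ⟨?_, fun _ => ?_, fun h' => ?_⟩
  · rw [h.1, cntUpto, cntUpto, card_filter_range_succ, if_pos hb]
  · split_ifs with h0
    · exact hs
    · exact (h.2.1 (by omega)).succ
  · rw [if_neg (by omega), if_neg (by omega)]
    have := (h.2.1 (by omega)).1
    exact ⟨hs, by omega⟩

theorem pcUpto_succ_of_not {i t : ℕ} (h : 0 < t → ¬ ℓ.Cross i t) (c : ℕ) :
    ℓ.pcUpto i (t + 1) c = ℓ.pcUpto i t c := by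
  unfold pcUpto
  rcases Nat.eq_zero_or_pos t with rfl | ht
  · rfl
  · rw [card_filter_Ioo_succ _ ht, if_neg fun h' => h ht h'.2, add_zero]

theorem pcUpto_succ {i t : ℕ} (ht : 0 < t) (h : ℓ.Cross i t) (c : ℕ) :
    ℓ.pcUpto i (t + 1) c = ℓ.pcUpto i t c + if c = ℓ.cyc t then 1 else 0 := by
  unfold pcUpto
  rw [card_filter_Ioo_succ _ ht]
  congr 1
  grind

theorem pcUpto_le (i t c : ℕ) : ℓ.pcUpto i t c ≤ t := by
  exact (Finset.card_filter_le _ _).trans (by simp)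

theorem cntUpto_le (b v : ℕ) : ℓ.cntUpto b v ≤ b := by
  exact (Finset.card_filter_le _ _).trans (by simp)

end Layout

/-- The marks in arrays `19` and `20` differ exactly for a crossing. The mark of the target end in
array `20` is then also the parity of the slot whose end is below the node. -/
def crossStep : RamProg :=
  .ite (.reg 7) (.ite (.equal (.load 19 (.reg 12 + .reg 7)) (.load 20 (.reg 12 + .reg 7))) .skip
    (block [
      .ite (.load 21 (.reg 7))
        (.store 23 (.reg 7) (.lit 2 * .reg 6 + .load 20 (.reg 12 + .reg 7)))
        (.store 22 (.reg 7) (.lit 2 * .reg 6 + .load 20 (.reg 12 + .reg 7))),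
      .store 21 (.reg 7) (.load 21 (.reg 7) + .lit 1),
      .store 24 (.reg 13 + .load 17 (.reg 7)) (.load 24 (.reg 13 + .load 17 (.reg 7)) + .lit 1)]))
    .skip

/-- Counts the crossings of tree edges and cycles by demands. -/
def crossProg : RamProg := forLoop 6 2 <| block [
  block [.set 12 (.reg 6 * .reg 0), .set 13 (.reg 6 * (.reg 1 + .lit 1))],
  forLoop 7 0 crossStep]

section

variable {w : ℕ} {σ : RamState} {ℓ : Layout} {B : ℕ}

theorem run_cross_demand (hσ : σ.Bdd w) (hℓ : ℓ.Loaded σ) (ht : ℓ.Tame) (hB : 2 ^ w = B)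
    (hw : ℓ.Fits B) {i : ℕ} (hi : i < ℓ.d) (r6 : σ.reg 6 = i) (r12 : σ.reg 12 = i * ℓ.n)
    (r13 : σ.reg 13 = i * (ℓ.m + 1))
    (hC : ℓ.Cycles σ.arr) (hM : ℓ.Marked ℓ.d σ.arr) (hX : ℓ.Crossed i σ.arr) :
    Run w (forLoop 7 0 crossStep) σ (ℓ.n * 100 + 6) fun τ => ℓ.Crossed (i + 1) τ.arr := by
  have b1 : 1 < B := hB ▸ hσ.one_lt
  have hl := hw.lin
  have b2 : 2 < B := by omega
  let I : ℕ → (ℕ → ℕ → ℕ) → Prop := fun t arr =>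
    (∀ v, 0 < v → v < ℓ.n →
      ℓ.Crossing (if v < t then i + 1 else i) v (arr 21 v) (arr 22 v) (arr 23 v)) ∧
    ∀ j < ℓ.d, ∀ c ≤ ℓ.m, arr 24 (j * (ℓ.m + 1) + c) =
      if j < i then ℓ.pc j c else if j = i then ℓ.pcUpto i t c else 0
  rw [← hℓ.n]
  refine (Run.for (T := 92) (I := I) hσ
    ⟨fun v hv hn => by simpa using hX.1 v hv hn, fun j hj c hc => ?_⟩ ?_).mono
    (by omega) fun τ h => ?_
  · rw [hX.2 j hj c hc]
    simp [Layout.pcUpto]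
  swap
  · rw [hℓ.n] at h
    refine ⟨fun v hv hn => ?_, fun j hj c hc => ?_⟩
    · grind
    · rw [h.2 j hj c hc]
      by_cases h1 : j < i
      · grind
      by_cases h2 : j = i
      · subst h2
        rw [if_neg h1, if_pos rfl, if_pos (by omega)]
        rfl
      · grind
  intro t ht0 τ hτ hF r7 ⟨h1, h2⟩
  rw [hℓ.n] at ht0
  have hL := hℓ.frame hF
  have s6 := (hF.1 6).trans r6
  have s12 := (hF.1 12).trans r12
  have s13 := (hF.1 13).trans r13
  have a17 := hF.2 17
  have a19 := hF.2 19
  have a20 := hF.2 20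
  have hMt := hM i hi t ht0
  have hlt := mul_add_lt hi ht0 hw.marks
  refine Run.of_wp hτ ?_
  have hskip : (0 < t → ¬ ℓ.Cross i t) → I (t + 1) τ.arr := by
    intro hc
    refine ⟨fun v hv hn => ?_, fun j hj c hcm => ?_⟩
    · have h3 := h1 v hv hn
      by_cases hvt : v = t
      · subst hvt
        rw [if_neg (by omega)] at h3
        rw [if_pos (by omega)]
        exact h3.succ_of_not (hc hv)
      · grind
    · rw [h2 j hj c hcm, Layout.pcUpto_succ_of_not hc]
  by_cases ht00 : t = 0
  · simp [crossStep, r7, ht00]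
    grind
  have htpos := pos_of_ne_zero ht00
  have hcm := Layout.cyc_le ht.cactus htpos ht0
  have hi' : (ℓ.d + 1) * (ℓ.m + 1) < B := hw.counts
  have hlt' := mul_add_lt hi (lt_add_one_of_le hcm) hi'
  simp only [hi, true_and] at hMt
  by_cases hc : ℓ.Cross i t
  swap
  · have : τ.arr 19 (i * ℓ.n + t) = τ.arr 20 (i * ℓ.n + t) := by
      rw [a19, a20, hMt.1, hMt.2]
      unfold Layout.Cross Layout.Sep at hc
      grind
    simp [crossStep, r7, s12, hB, ht00, this]
    grind
  have hne : ¬ τ.arr 19 (i * ℓ.n + t) = τ.arr 20 (i * ℓ.n + t) := by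
    rw [a19, a20, hMt.1, hMt.2]
    unfold Layout.Cross Layout.Sep at hc
    split_ifs <;> simp_all
  have hslot : ∃ y, τ.arr 20 (i * ℓ.n + t) = y ∧ y ≤ 1 ∧ Anc ℓ.par t (ℓ.slotEnd (2 * i + y)) := by
    rw [a20, hMt.2]
    unfold Layout.Cross Layout.Sep at hc
    by_cases h : Anc ℓ.par t (ℓ.tp i)
    · refine ⟨1, if_pos h, le_rfl, ?_⟩
      rwa [Layout.slotEnd_odd]
    · refine ⟨0, if_neg h, by omega, ?_⟩
      rw [add_zero, Layout.slotEnd_even]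
      tauto
  obtain ⟨y, hy, hy1, hanc⟩ := hslot
  rw [hy] at hne
  have ha := h1 t htpos ht0
  rw [if_neg (lt_irrefl t)] at ha
  have hcnt := Layout.cntUpto_le (ℓ := ℓ) i t
  rw [← ha.1] at hcnt
  have hstep := ha.succ hc (show (2 * i + y) / 2 = i by omega) hanc
  have hp := h2 i hi _ hcm
  rw [if_neg (lt_irrefl i), if_pos rfl] at hp
  have hple := Layout.pcUpto_le (ℓ := ℓ) i t (ℓ.cyc t)
  have hfin : ∀ c₁ c₂ : ℕ, ∀ arr : ℕ → ℕ → ℕ,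
      (∀ v, arr 21 v = if v = t then τ.arr 21 t + 1 else τ.arr 21 v) →
      (∀ v, arr 22 v = if v = t then (if τ.arr 21 t = 0 then 2 * i + y else τ.arr 22 t) else
        τ.arr 22 v) →
      (∀ v, arr 23 v = if v = t then (if τ.arr 21 t = 0 then τ.arr 23 t else 2 * i + y) else
        τ.arr 23 v) →
      (∀ x, arr 24 x = if x = i * (ℓ.m + 1) + ℓ.cyc t then ℓ.pcUpto i t (ℓ.cyc t) + 1 else
        τ.arr 24 x) → I (t + 1) arr := by
    intro _ _ arr e1 e2 e3 e4
    refine ⟨fun v hv hn => ?_, fun j hj c hcm' => ?_⟩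
    · grind
    · rw [e4, h2 j hj c hcm', Layout.pcUpto_succ htpos hc,
        if_congr (mul_add_inj (lt_add_one_of_le hcm') (lt_add_one_of_le hcm)) rfl rfl]
      grind
  have h17 : σ.arr 17 t = ℓ.cyc t := hC.1 t htpos ht0
  simp [crossStep, r7, s6, s12, s13, hB, ht00, hne, hy, b1, b2, a17, h17, hp]
  refine ⟨by omega, fun h0 => ⟨by omega, by omega, by omega, by omega, ?_⟩,
    fun h0 => ⟨by omega, by omega, by omega, by omega, ?_⟩⟩
  · refine hfin 0 0 _ (fun v => ?_) (fun v => ?_) (fun v => ?_) fun v => ?_ <;>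
      simp [update_apply, h0]
    rintro rfl; rfl
  · refine hfin 0 0 _ (fun v => ?_) (fun v => ?_) (fun v => ?_) fun v => ?_ <;>
      simp [update_apply, h0]
    rintro rfl; rfl

theorem run_cross (hσ : σ.Bdd w) (hℓ : ℓ.Loaded σ) (ht : ℓ.Tame) (hB : 2 ^ w = B)
    (hw : ℓ.Fits B) (hC : ℓ.Cycles σ.arr) (hM : ℓ.Marked ℓ.d σ.arr)
    (h21 : ∀ x, σ.arr 21 x = 0) (h24 : ∀ x, σ.arr 24 x = 0) :
    Run w crossProg σ (ℓ.d * (ℓ.n * 100 + 50) + 6) fun τ => ℓ.Crossed ℓ.d τ.arr := by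
  have b1 : 1 < B := hB ▸ hσ.one_lt
  have hl := hw.lin
  rw [← hℓ.d]
  refine (Run.for (T := ℓ.n * 100 + 42) (I := fun i arr => ℓ.Crossed i arr) hσ ⟨fun v hv hn => ?_, fun i hi c hc => ?_⟩ ?_).le (by rw [hℓ.d])
  · rw [h21]
    exact Layout.Crossing.zero
  · rw [h24]
    simp
  intro i hi τ hτ hF hr hI
  rw [hℓ.d] at hi
  have hL := hℓ.frame hF
  refine (Run.cons (T := 30) (T' := ℓ.n * 100 + 6 + 1)
    (Q := fun υ => υ.reg 12 = i * ℓ.n ∧ υ.reg 13 = i * (ℓ.m + 1)) hτ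
    (Run.of_wp hτ ?_) ?_).le (by omega)
  · have h0 := ht.sp_lt i hi
    have := mul_add_lt hi h0 hw.marks
    have := mul_add_lt hi (show 0 < ℓ.m + 1 by omega) hw.counts
    simp [hL.n, hL.m, hB, hr, b1]
    omega
  · rintro υ hυ hF' ⟨h1, h2⟩
    have hL' := hL.frame hF'
    refine Run.cons (Q := fun τ => ℓ.Crossed (i + 1) τ.arr) hυ
      (run_cross_demand hυ hL' ht hB hw hi ((hF'.1 6).trans hr) h1 h2 ?_ ?_ ?_)
      fun ρ hρ _ h => Run.nil h
    · unfold Layout.Cycles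
      rw [hF'.2 17, hF'.2 18, hF.2 17, hF.2 18]
      exact hC
    · unfold Layout.Marked
      rw [hF'.2 19, hF'.2 20, hF.2 19, hF.2 20]
      exact hM
    · unfold Layout.Crossed
      rw [hF'.2 21, hF'.2 22, hF'.2 23, hF'.2 24]
      exact hI

end

end

end CactusRouting
namespace CactusRouting

open scoped Classical

open Function Nat


open RamProg WordExpr

/-! ### Checking the tree edges -/

namespace Layout

variable (ℓ : Layout)

/-- The result of checking the tree edges above the nodes less than `t`: `f` is `0` if no conflict
occurs, `s` counts the crossed edges of the cycles, and `two` holds edges crossed twice. -/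
def Checked (t f : ℕ) (s two : ℕ → ℕ) : Prop :=
  (f = 0 ↔ ∀ v, 0 < v → v < t → ℓ.cnt v < 3 ∧ (ℓ.cyc v = 0 → ℓ.cnt v < 2)) ∧
  (∀ c, s c = ((Finset.Ioo 0 t).filter fun v => ℓ.cyc v = c ∧ ℓ.cnt v ≠ 0).card) ∧
  (∀ c, two c = 0 → ∀ v, 0 < v → v < t → ℓ.cyc v = c → ℓ.cnt v ≠ 2) ∧
  ∀ c, two c ≠ 0 → two c < t ∧ ℓ.cyc (two c) = c ∧ ℓ.cnt (two c) = 2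

variable {ℓ}

theorem Checked.zero : ℓ.Checked 0 0 (fun _ => 0) fun _ => 0 :=
  ⟨⟨fun _ v _ h => by omega, fun _ => rfl⟩, fun c => by simp, fun c _ v _ h => by omega,
    fun c h => absurd rfl h⟩

theorem Checked.step {t f : ℕ} {s two : ℕ → ℕ} (h : ℓ.Checked t f s two) {f' : ℕ}
    {s' two' : ℕ → ℕ} (hf : f' = 0 ↔ f = 0 ∧ (0 < t → ℓ.cnt t < 3 ∧ (ℓ.cyc t = 0 → ℓ.cnt t < 2)))
    (hs : ∀ c, s' c = s c + if 0 < t ∧ c = ℓ.cyc t ∧ ℓ.cnt t ≠ 0 then 1 else 0)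
    (ht : ∀ c, two' c = if 0 < t ∧ c = ℓ.cyc t ∧ ℓ.cnt t = 2 then t else two c) :
    ℓ.Checked (t + 1) f' s' two' := by
  obtain ⟨h1, h2, h3, h4⟩ := h
  refine ⟨?_, fun c => ?_, fun c hc v hv hvt hcv => ?_, fun c hc => ?_⟩
  · grind
  · rw [hs, h2]
    rcases Nat.eq_zero_or_pos t with rfl | h0
    · simp [show Finset.Ioo 0 1 = ∅ from rfl]
    · rw [card_filter_Ioo_succ _ h0]
      congr 1
      grind
  · grind
  · grind

theorem Checked.witness {f : ℕ} {s two : ℕ → ℕ} (h : ℓ.Checked ℓ.n f s two)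
    {arr : ℕ → ℕ → ℕ} (hX : ℓ.Crossed ℓ.d arr) :
    ℓ.Witness two (fun v => arr 22 v / 2) fun v => arr 23 v / 2 := by
  have key : ∀ v, 0 < v → v < ℓ.n → ℓ.cnt v = 2 → arr 21 v = 2 := fun v hv hn h2 =>
    (hX.1 v hv hn).1.trans h2
  exact {
    two_eq_zero := h.2.2.1
    two_lt := fun c hc => (h.2.2.2 c hc).1
    cyc_two := fun c hc => (h.2.2.2 c hc).2.1
    cnt_two := fun c hc => (h.2.2.2 c hc).2.2
    lt₁ := fun v hv hn h2 => ((hX.1 v hv hn).2.1 (by rw [key v hv hn h2]; omega)).1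
    lt₂ := fun v hv hn h2 => ((hX.1 v hv hn).2.2 (by rw [key v hv hn h2])).1.1
    ne := fun v hv hn h2 => ((hX.1 v hv hn).2.2 (by rw [key v hv hn h2])).2
    cross₁ := fun v hv hn h2 => ((hX.1 v hv hn).2.1 (by rw [key v hv hn h2]; omega)).2.1
    cross₂ := fun v hv hn h2 => ((hX.1 v hv hn).2.2 (by rw [key v hv hn h2])).1.2.1 }

/-- The arrays holding the data of the cycles. -/
structure CycleData (arr : ℕ → ℕ → ℕ) : Prop where
  pc : ∀ i < ℓ.d, ∀ c ≤ ℓ.m, arr 24 (i * (ℓ.m + 1) + c) = ℓ.pc i c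
  len : ∀ c, arr 18 c + 1 = ℓ.len c
  used : ∀ c, arr 25 c = ℓ.numUsed c

theorem CycleData.congr {arr arr' : ℕ → ℕ → ℕ} (h : CycleData (ℓ := ℓ) arr) (h18 : arr' 18 = arr 18)
    (h24 : arr' 24 = arr 24) (h25 : arr' 25 = arr 25) : CycleData (ℓ := ℓ) arr' :=
  ⟨by rw [h24]; exact h.pc, by rw [h18]; exact h.len, by rw [h25]; exact h.used⟩

theorem len_le (c : ℕ) : ℓ.len c ≤ ℓ.n + 1 := by
  have := Finset.card_filter_le (Finset.Ioo 0 ℓ.n) fun v => ℓ.cyc v = c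
  rw [card_Ioo] at this
  unfold len
  omega

theorem pc_le (i c : ℕ) : ℓ.pc i c ≤ ℓ.n := pcUpto_le i ℓ.n c

end Layout

def checkProg : RamProg := forLoop 6 0 <| .ite (.reg 6) (block [
  .ite (.less (.lit 2) (.load 21 (.reg 6))) (.store 32 (.lit 0) (.lit 1)) .skip,
  .ite (.load 21 (.reg 6)) (block [
    .store 25 (.load 17 (.reg 6)) (.load 25 (.load 17 (.reg 6)) + .lit 1),
    .ite (.equal (.load 21 (.reg 6)) (.lit 2)) (.store 26 (.load 17 (.reg 6)) (.reg 6)) .skip,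
    .ite (.less (.lit 1) (.load 21 (.reg 6)))
      (.ite (.load 17 (.reg 6)) .skip (.store 32 (.lit 0) (.lit 1))) .skip]) .skip]) .skip

section

variable {w : ℕ} {σ : RamState} {ℓ : Layout} {B : ℕ}

theorem run_check (hσ : σ.Bdd w) (hℓ : ℓ.Loaded σ) (hB : 2 ^ w = B) (hw : ℓ.Fits B)
    (hC : ℓ.Cycles σ.arr) (hX : ℓ.Crossed ℓ.d σ.arr) (h25 : ∀ x, σ.arr 25 x = 0)
    (h26 : ∀ x, σ.arr 26 x = 0) (h32 : ∀ x, σ.arr 32 x = 0) :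
    Run w checkProg σ (ℓ.n * 100 + 6) fun τ =>
      ℓ.Checked ℓ.n (τ.arr 32 0) (τ.arr 25) (τ.arr 26) := by
  have b1 : 1 < B := hB ▸ hσ.one_lt
  have hl := hw.lin
  have b0 : 0 < B := by omega
  have b2 : 2 < B := by omega
  rw [← hℓ.n]
  refine (Run.for (T := 92) (I := fun i arr => ℓ.Checked i (arr 32 0) (arr 25) (arr 26)) hσ ?_ ?_).le (by omega)
  · rw [h32, show σ.arr 25 = fun _ => 0 from funext h25, show σ.arr 26 = fun _ => 0 from funext h26]
    exact Layout.Checked.zero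
  intro t ht τ hτ hF r6 hI
  rw [hℓ.n] at ht
  have a17 := hF.2 17
  have a21 := hF.2 21
  refine Run.of_wp hτ ?_
  rcases Nat.eq_zero_or_pos t with rfl | h0
  · simp [r6]
    exact hI.step (by simp) (by simp) (by simp)
  have hcyc : τ.arr 17 t = ℓ.cyc t := by rw [a17, hC.1 t h0 ht]
  have hcnt : τ.arr 21 t = ℓ.cnt t := by rw [a21, (hX.1 t h0 ht).1]; rfl
  have hs := hI.2.1 (ℓ.cyc t)
  have hs' := Finset.card_filter_le (Finset.Ioo 0 t) fun v => ℓ.cyc v = ℓ.cyc t ∧ ℓ.cnt v ≠ 0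
  rw [← hs, card_Ioo] at hs'
  have hsb : τ.arr 25 (ℓ.cyc t) + 1 < B := by omega
  simp [r6, hB, b0, b1, b2, hcyc, hcnt, h0.ne', hsb]
  refine ⟨fun h2 => ⟨fun hc0 => ⟨fun hc2 => ⟨fun h1 => ⟨fun hcy => ?_, fun hcy => ?_⟩,
    fun h1 => ?_⟩, fun hc2 => ⟨fun h1 => ⟨fun hcy => ?_, fun hcy => ?_⟩, fun h1 => ?_⟩⟩,
    fun hc0 => ?_⟩, fun h2 => ⟨fun hc0 => ⟨fun hc2 => ⟨fun h1 => ⟨fun hcy => ?_, fun hcy => ?_⟩,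
    fun h1 => ?_⟩, fun hc2 => ⟨fun h1 => ⟨fun hcy => ?_, fun hcy => ?_⟩, fun h1 => ?_⟩⟩,
    fun hc0 => ?_⟩⟩
  all_goals
    first
    | exfalso; omega
    | refine hI.step ?_ (fun c => ?_) fun c => ?_
  all_goals first
    | simp [h0]; done
    | simp [h0]; omega
    | simp only [update_apply, h0, true_and]
      grind

end

/-! ### Charging the cycles -/

/-- The cost of `u` edges of a cycle of length `L`. -/
def detourExpr (L u : WordExpr) : WordExpr :=
  .less ((L - .lit 1) / .lit 2) u + .less (.lit 2 * ((L - .lit 1) / .lit 2)) u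

/-- The thresholds of `detourCost` are nested, so the cost is the number of thresholds exceeded. -/
theorem val_detourExpr (σ : RamState) (L u : WordExpr) :
    (detourExpr L u).val σ = detourCost (L.val σ) (u.val σ) := by
  simp only [detourExpr, val_add, val_less, val_div, val_sub, val_mul, val_lit, detourCost, ← not_le,
    ite_not]
  split_ifs <;> omega

theorem ok_detourExpr {w : ℕ} {σ : RamState} {L u : WordExpr} (hL : L.Ok w σ) (hu : u.Ok w σ)
    (h : L.val σ + 3 < 2 ^ w) : (detourExpr L u).Ok w σ := by
  simp only [detourExpr, ok_add, ok_less, ok_div, ok_sub, ok_mul, ok_lit, val_less, val_div,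
    val_sub, val_mul, val_lit]
  grind

theorem detourCost_le (L u : ℕ) : detourCost L u ≤ 2 := by
  unfold detourCost
  split_ifs <;> omega

theorem detourCost_zero (L : ℕ) : detourCost L 0 = 0 := if_pos (zero_le _)

/-- The entries `0`, `1`, `2` of array `33` count the demands meeting the cycle, those among them
not split evenly, and those crossing all crossed edges. -/
def countStep : RamProg := block [
  .set 14 (.load 24 (.reg 7 * (.reg 1 + .lit 1) + .reg 13)),
  .ite (.reg 14) (block [.store 33 (.lit 0) (.load 33 (.lit 0) + .lit 1),
    .ite (.equal (.lit 2 * .reg 14) (.load 18 (.reg 13) + .lit 1)) .skip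
      (.store 33 (.lit 1) (.load 33 (.lit 1) + .lit 1))]) .skip,
  .ite (.equal (.reg 14) (.load 25 (.reg 13)))
    (.store 33 (.lit 2) (.load 33 (.lit 2) + .lit 1)) .skip]

/-- Register `15` flags a free cycle, `16` holds its length and `17` its doubly crossed edge or `0`.
Register `14` becomes the number of edges charged; it is set to `0` where the cost is shared instead
of forced. -/
def chargeStep : RamProg := .ite (.reg 15) .skip (block [
  .set 14 (.load 24 (.reg 7 * (.reg 1 + .lit 1) + .reg 13)),
  .ite (.reg 17) (.ite (.equal (.load 33 (.lit 2)) (.lit 1))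
    (.ite (.equal (.reg 14) (.load 25 (.reg 13))) (.set 14 (.reg 16 - .reg 14)) .skip)
    (.set 14 (.lit 0))) .skip,
  .store 27 (.reg 7) (.load 27 (.reg 7) + detourExpr (.reg 16) (.reg 14))])

def shareStep : RamProg := .ite (.reg 15) .skip (.ite (.reg 17) (block [
  .ite (.load 33 (.lit 2)) .skip (.store 32 (.lit 0) (.lit 1)),
  .ite (.less (.lit 1) (.load 33 (.lit 2)))
    (.store 28 (.reg 17) (detourExpr (.reg 16) (.load 25 (.reg 13)) +
      detourExpr (.reg 16) (.reg 16 - .load 25 (.reg 13)))) .skip]) .skip)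

def freeStep : RamProg := block [.set 15 (.lit 0), .set 16 (.load 18 (.reg 13) + .lit 1),
  .set 17 (.load 26 (.reg 13)),
  .ite (.less (.load 33 (.lit 0)) (.lit 2)) (.set 15 (.lit 1))
    (.ite (.less (.load 33 (.lit 0)) (.lit 3))
      (.ite (.load 33 (.lit 1)) .skip (.set 15 (.lit 1))) .skip)]

/-- Computes the forced costs of the demands and the shared costs at the nodes. -/
def chargeProg : RamProg := forLoop 6 1 <| block [
  block [.set 13 (.reg 6 + .lit 1), .store 33 (.lit 0) (.lit 0), .store 33 (.lit 1) (.lit 0),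
    .store 33 (.lit 2) (.lit 0)],
  forLoop 7 2 countStep, freeStep, forLoop 7 2 chargeStep, shareStep]

section

variable {w : ℕ} {σ : RamState} {ℓ : Layout} {B : ℕ}

theorem run_count (hσ : σ.Bdd w) (hℓ : ℓ.Loaded σ) (hB : 2 ^ w = B) (hw : ℓ.Fits B)
    (hD : Layout.CycleData (ℓ := ℓ) σ.arr) {c : ℕ} (hc : c ≤ ℓ.m) (r13 : σ.reg 13 = c)
    (h0 : σ.arr 33 0 = 0) (h1 : σ.arr 33 1 = 0) (h2 : σ.arr 33 2 = 0) :
    Run w (forLoop 7 2 countStep) σ (ℓ.d * 100 + 6) fun τ =>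
      τ.arr 33 0 = ℓ.numMeet c ∧ τ.arr 33 1 = ℓ.numUneven c ∧ τ.arr 33 2 = ℓ.numFull c := by
  have hl := hw.lin
  have b0 : 0 < B := by omega
  have b1 : 1 < B := by omega
  have b2 : 2 < B := by omega
  let I : ℕ → (ℕ → ℕ → ℕ) → Prop := fun t arr =>
    arr 33 0 = ((Finset.range t).filter fun i => ℓ.pc i c ≠ 0).card ∧
    arr 33 1 = ((Finset.range t).filter fun i => ℓ.pc i c ≠ 0 ∧ 2 * ℓ.pc i c ≠ ℓ.len c).card ∧
    arr 33 2 = ((Finset.range t).filter fun i => ℓ.pc i c = ℓ.numUsed c).card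
  rw [← hℓ.d]
  refine (Run.for (T := 92) (I := I) hσ
    ⟨by simpa using h0, by simpa using h1, by simpa using h2⟩ ?_).mono (by omega) fun τ h => ?_
  swap
  · rw [hℓ.d] at h
    exact h
  intro i hi τ hτ hF r7 ⟨k0, k1, k2⟩
  rw [hℓ.d] at hi
  have hL := hℓ.frame hF
  have s13 := (hF.1 13).trans r13
  have hD' := hD.congr (hF.2 18) (hF.2 24) (hF.2 25)
  refine Run.of_wp hτ ?_
  have hm := mul_add_lt hi (lt_add_one_of_le hc) hw.counts
  have hpl := Layout.pc_le (ℓ := ℓ) i c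
  have hll := Layout.len_le (ℓ := ℓ) c
  have hcard : ∀ p : ℕ → Prop, [DecidablePred p] → ((Finset.range i).filter p).card ≤ i := fun p _ =>
    (Finset.card_filter_le _ _).trans (by simp)
  have c0 := hcard fun i => ℓ.pc i c ≠ 0
  have c1 := hcard fun i => ℓ.pc i c ≠ 0 ∧ 2 * ℓ.pc i c ≠ ℓ.len c
  have c2 := hcard fun i => ℓ.pc i c = ℓ.numUsed c
  rw [← k0] at c0
  rw [← k1] at c1
  rw [← k2] at c2
  have d0 : τ.arr 33 0 + 1 < B := by omega
  have d1 : τ.arr 33 1 + 1 < B := by omega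
  have d2 : τ.arr 33 2 + 1 < B := by omega
  have hm1 : i * (ℓ.m + 1) < B := by omega
  have hm2 : i * (ℓ.m + 1) + c < B := by omega
  have hm3 : ℓ.m + 1 < B := by omega
  have hp2 : 2 * ℓ.pc i c < B := by omega
  have hl2 : ℓ.len c < B := by omega
  simp only [I, card_filter_range_succ, ← k0, ← k1, ← k2]
  simp [countStep, r7, s13, hL.m, hB, b0, b1, b2, hD'.pc i hi c hc, hD'.len, hD'.used, d0, d1, d2,
    hm1, hm2, hm3, hp2, hl2]
  tauto

theorem run_charge_cycle (hσ : σ.Bdd w) (hℓ : ℓ.Loaded σ) (hB : 2 ^ w = B) (hw : ℓ.Fits B)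
    (hD : Layout.CycleData (ℓ := ℓ) σ.arr) {c : ℕ} (hc : c ≤ ℓ.m) (r13 : σ.reg 13 = c)
    {two : ℕ → ℕ} (hF : σ.reg 15 ≠ 0 ↔ ℓ.Free c) (r16 : σ.reg 16 = ℓ.len c)
    (r17 : σ.reg 17 = two c) (h33 : σ.arr 33 2 = ℓ.numFull c)
    (hu : ∀ i < ℓ.d, σ.arr 27 i ≤ 2 * ℓ.m) :
    Run w (forLoop 7 2 chargeStep) σ (ℓ.d * 100 + 6) fun τ =>
      ∀ i < ℓ.d, τ.arr 27 i = σ.arr 27 i + ℓ.forced two c i := by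
  have hl := hw.lin
  have b0 : 0 < B := by omega
  have b1 : 1 < B := by omega
  have b2 : 2 < B := by omega
  let I : ℕ → (ℕ → ℕ → ℕ) → Prop := fun t arr => ∀ i < ℓ.d,
    arr 27 i = σ.arr 27 i + if i < t then ℓ.forced two c i else 0
  rw [← hℓ.d]
  refine (Run.for (T := 92) (I := I) hσ
    (fun i hi => by simp) ?_).mono (by omega) fun τ h => ?_
  swap
  · intro i hi
    rw [h i (hℓ.d ▸ hi), if_pos hi]
  intro i hi τ hτ hF' r7 hI
  rw [hℓ.d] at hi
  have hL := hℓ.frame hF'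
  have s13 := (hF'.1 13).trans r13
  have s15 := hF'.1 15
  have s16 := (hF'.1 16).trans r16
  have s17 := (hF'.1 17).trans r17
  have a33 : τ.arr 33 2 = ℓ.numFull c := by rw [hF'.2 33, h33]
  have hD' := hD.congr (hF'.2 18) (hF'.2 24) (hF'.2 25)
  refine Run.of_wp hτ ?_
  have hm := mul_add_lt hi (lt_add_one_of_le hc) hw.counts
  have hpl := Layout.pc_le (ℓ := ℓ) i c
  have hll := Layout.len_le (ℓ := ℓ) c
  have hfin : ∀ (arr : ℕ → ℕ → ℕ) (x : ℕ), x = ℓ.forced two c i →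
      arr 27 = Function.update (τ.arr 27) i (τ.arr 27 i + x) → I (i + 1) arr := by
    intro arr x hx ha j hj
    rw [ha, update_apply]
    grind
  have hu0 : τ.arr 27 i ≤ 2 * ℓ.m := by
    grind
  have hok : ∀ x, τ.arr 27 i + detourCost (ℓ.len c) x < B := by
    intro x
    have := detourCost_le (ℓ.len c) x
    omega
  have hok2 : ∀ σ' : RamState, σ'.reg 16 = ℓ.len c →
      (detourExpr (.reg 16) (.reg 14)).Ok w σ' := by
    intro σ' h
    refine ok_detourExpr (ok_reg.2 trivial) (ok_reg.2 trivial) ?_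
    rw [val_reg, h, hB]
    omega
  have hm1 : i * (ℓ.m + 1) < B := by omega
  have hm2 : i * (ℓ.m + 1) + c < B := by omega
  have hm3 : ℓ.m + 1 < B := by omega
  simp [chargeStep, r7, s13, s15, s16, s17, a33, hL.m, hB, b0, b1, b2, hD'.pc i hi c hc, hD'.used,
    hm1, hm2, hm3, val_detourExpr, hok, hok2, detourCost_zero]
  refine ⟨fun hfr => ?_, fun hfr => ⟨fun htw => ⟨fun h1 => ⟨fun hp => ?_, fun hp => ?_⟩,
    fun h1 => ?_⟩, fun htw => ?_⟩⟩
  · intro j hj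
    rw [hI j hj]
    congr 1
    by_cases hji : j = i
    · subst hji
      rw [if_neg (lt_irrefl j), if_pos (by omega), Layout.forced, if_pos (hF.1 hfr)]
    · grind
  all_goals
    have hfr' : ¬ ℓ.Free c := fun h => hF.2 h hfr
    first
      | refine hfin _ _ ?_ rfl
        simp_all [Layout.forced]
      | refine ⟨by omega, hfin _ 0 ?_ ?_⟩
        · simp_all [Layout.forced]
        · simp

end

end CactusRouting
namespace CactusRouting

open scoped Classical

open Function Nat


open RamProg WordExpr

namespace Layout

variable (ℓ : Layout)

/-- The result of charging the first `t` cycles; `F` tells if no conflict has occurred before. -/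
structure Charged (two : ℕ → ℕ) (F : Prop) (t : ℕ) (arr : ℕ → ℕ → ℕ) : Prop where
  used : ∀ i < ℓ.d, arr 27 i = ∑ e ∈ Finset.range t, ℓ.forced two (e + 1) i
  weight : ∀ v, arr 28 v =
    if ℓ.cyc v ≠ 0 ∧ ℓ.cyc v ≤ t ∧ two (ℓ.cyc v) = v then ℓ.shared two (ℓ.cyc v) else 0
  fail : arr 32 0 = 0 ↔
    F ∧ ∀ e < t, ¬ ℓ.Free (e + 1) → two (e + 1) ≠ 0 → ℓ.numFull (e + 1) ≠ 0

variable {ℓ}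

theorem forced_le (two : ℕ → ℕ) (c i : ℕ) : ℓ.forced two c i ≤ 2 := by
  unfold forced
  split_ifs <;> first | exact detourCost_le _ _ | omega

theorem sum_forced_le (two : ℕ → ℕ) {t : ℕ} (ht : t ≤ ℓ.m) (i : ℕ) :
    ∑ e ∈ Finset.range t, ℓ.forced two (e + 1) i ≤ 2 * ℓ.m := by
  refine (Finset.sum_le_card_nsmul _ _ 2 fun e _ => forced_le two _ i).trans ?_
  grind

theorem shared_eq_zero {two : ℕ → ℕ} {c : ℕ} (h : ¬ (¬ ℓ.Free c ∧ two c ≠ 0 ∧ 2 ≤ ℓ.numFull c)) :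
    ℓ.shared two c = 0 := by
  exact if_neg h

theorem shared_le (two : ℕ → ℕ) (c : ℕ) : ℓ.shared two c ≤ 4 := by
  unfold shared
  have h1 := detourCost_le (ℓ.len c) (ℓ.numUsed c)
  have h2 := detourCost_le (ℓ.len c) (ℓ.len c - ℓ.numUsed c)
  split_ifs <;> omega

theorem weight_le (two : ℕ → ℕ) (v : ℕ) : ℓ.weight two v ≤ 4 := by
  unfold weight
  have h1 := shared_le (ℓ := ℓ) two (ℓ.cyc v)
  split_ifs <;> omega

theorem Charged.step {two : ℕ → ℕ} {F : Prop} {t : ℕ} {arr arr' : ℕ → ℕ → ℕ}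
    (h : ℓ.Charged two F t arr) (hcyc : two (t + 1) ≠ 0 → ℓ.cyc (two (t + 1)) = t + 1)
    (hu : ∀ i < ℓ.d, arr' 27 i = arr 27 i + ℓ.forced two (t + 1) i)
    (hq : ∀ v, ℓ.shared two (t + 1) ≠ 0 →
      arr' 28 v = if v = two (t + 1) then ℓ.shared two (t + 1) else arr 28 v)
    (hq' : ℓ.shared two (t + 1) = 0 → ∀ v, v ≠ two (t + 1) ∨ v = 0 → arr' 28 v = arr 28 v)
    (hq0 : ℓ.shared two (t + 1) = 0 → two (t + 1) ≠ 0 → arr' 28 (two (t + 1)) = 0)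
    (hf : arr' 32 0 = 0 ↔ arr 32 0 = 0 ∧
      (¬ ℓ.Free (t + 1) → two (t + 1) ≠ 0 → ℓ.numFull (t + 1) ≠ 0)) :
    ℓ.Charged two F (t + 1) arr' := by
  refine ⟨fun i hi => ?_, fun v => ?_, ?_⟩
  · rw [hu i hi, h.used i hi, Finset.sum_range_succ]
  · by_cases h0 : ℓ.shared two (t + 1) = 0
    · have hv : arr' 28 v = if v = two (t + 1) ∧ v ≠ 0 then 0 else arr 28 v := by
        grind
      rw [hv, h.weight v]
      grind
    · have h2 : two (t + 1) ≠ 0 := by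
        intro h2
        exact h0 (shared_eq_zero fun h3 => h3.2.1 h2)
      rw [hq v h0, h.weight v]
      grind
  · rw [hf, h.fail]
    grind

theorem Charged.weight_eq {two : ℕ → ℕ} {F : Prop} {arr : ℕ → ℕ → ℕ} (hc : ℓ.Cactus)
    (h : ℓ.Charged two F ℓ.m arr) (hlt : ∀ c, two c ≠ 0 → two c < ℓ.n) (v : ℕ) :
    arr 28 v = ℓ.weight two v := by
  rw [h.weight, Layout.weight]
  by_cases h1 : ℓ.cyc v ≠ 0 ∧ two (ℓ.cyc v) = v
  · rw [if_pos h1]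
    by_cases h2 : two (ℓ.cyc v) = 0
    · rw [shared_eq_zero fun h3 => h3.2.1 h2]
      simp
    · have h3 := hlt _ h2
      rw [h1.2] at h2 h3
      rw [if_pos ⟨h1.1, cyc_le hc (pos_of_ne_zero h2) h3, h1.2⟩]
  · grind

end Layout

section

variable {w : ℕ} {σ : RamState} {ℓ : Layout} {B : ℕ}

theorem run_free (hσ : σ.Bdd w) (hB : 2 ^ w = B) (hw : ℓ.Fits B)
    (hD : Layout.CycleData (ℓ := ℓ) σ.arr) {c : ℕ} (r13 : σ.reg 13 = c)
    (h0 : σ.arr 33 0 = ℓ.numMeet c) (h1 : σ.arr 33 1 = ℓ.numUneven c) :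
    Run w freeStep σ 60 fun τ => (τ.reg 15 ≠ 0 ↔ ℓ.Free c) ∧ τ.reg 16 = ℓ.len c ∧
      τ.reg 17 = σ.arr 26 c := by
  have hl := hw.lin
  have b0 : 0 < B := by omega
  have b1 : 1 < B := by omega
  have b2 : 2 < B := by omega
  have b3 : 3 < B := by omega
  refine Run.of_wp hσ ?_
  have hll := Layout.len_le (ℓ := ℓ) c
  have hl2 : ℓ.len c < B := by omega
  simp [freeStep, r13, hB, b0, b1, b2, b3, hD.len, hl2, h0, h1, Layout.free_iff]
  omega

theorem run_share (hσ : σ.Bdd w) (hB : 2 ^ w = B) (hw : ℓ.Fits B)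
    (hD : Layout.CycleData (ℓ := ℓ) σ.arr) {c : ℕ} (r13 : σ.reg 13 = c)
    {two : ℕ → ℕ} (hF : σ.reg 15 ≠ 0 ↔ ℓ.Free c) (r16 : σ.reg 16 = ℓ.len c)
    (r17 : σ.reg 17 = two c) (h33 : σ.arr 33 2 = ℓ.numFull c) :
    Run w shareStep σ 80 fun τ => (∀ v, τ.arr 28 v =
        if (¬ ℓ.Free c ∧ two c ≠ 0 ∧ 2 ≤ ℓ.numFull c) ∧ v = two c then ℓ.shared two c
        else σ.arr 28 v) ∧
      (τ.arr 32 0 = 0 ↔ σ.arr 32 0 = 0 ∧ (¬ ℓ.Free c → two c ≠ 0 → ℓ.numFull c ≠ 0)) := by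
  have hl := hw.lin
  have b0 : 0 < B := by omega
  have b1 : 1 < B := by omega
  have b2 : 2 < B := by omega
  have hll := Layout.len_le (ℓ := ℓ) c
  refine Run.of_wp hσ ?_
  have hok : ∀ (σ' : RamState) (u : WordExpr), σ'.reg 16 = ℓ.len c → u.Ok w σ' →
      (detourExpr (.reg 16) u).Ok w σ' := by
    intro σ' u h hu
    refine ok_detourExpr (ok_reg.2 trivial) hu ?_
    rw [val_reg, h, hB]
    omega
  have hok2 : detourCost (ℓ.len c) (ℓ.numUsed c) + detourCost (ℓ.len c) (ℓ.len c - ℓ.numUsed c)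
      < B := by
    have h1 := detourCost_le (ℓ.len c) (ℓ.numUsed c)
    have h2 := detourCost_le (ℓ.len c) (ℓ.len c - ℓ.numUsed c)
    omega
  simp [shareStep, r13, r16, r17, h33, hB, b0, b1, b2, hD.used, val_detourExpr, hok, hok2,
    update_apply, Layout.shared]
  have hF' : σ.reg 15 = 0 ↔ ¬ ℓ.Free c := by rw [← hF, not_not]
  rw [hF']
  refine ⟨fun h => ?_, fun h => ⟨fun h2 => ⟨fun h3 => ⟨fun h4 => ?_, fun h4 => ?_⟩, fun h3 => ?_⟩,
    fun h2 => ?_⟩⟩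
  · grind
  · grind
  · have : ¬ 2 ≤ ℓ.numFull c := by omega
    simp [h, h2, h3, this]
  · simp [h, h2, h3]
  · simp [h2]

theorem run_charge (hσ : σ.Bdd w) (hℓ : ℓ.Loaded σ) (hB : 2 ^ w = B) (hw : ℓ.Fits B)
    (hD : Layout.CycleData (ℓ := ℓ) σ.arr)
    (hcyc : ∀ c, σ.arr 26 c ≠ 0 → ℓ.cyc (σ.arr 26 c) = c)
    (h27 : ∀ x, σ.arr 27 x = 0) (h28 : ∀ x, σ.arr 28 x = 0) :
    Run w chargeProg σ (ℓ.m * (ℓ.d * 200 + 200) + 6) fun τ =>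
      ℓ.Charged (σ.arr 26) (σ.arr 32 0 = 0) ℓ.m τ.arr := by
  have hl := hw.lin
  have b0 : 0 < B := by omega
  have b1 : 1 < B := by omega
  have b2 : 2 < B := by omega
  rw [← hℓ.m]
  refine (Run.for (T := ℓ.d * 200 + 192) (I := ℓ.Charged (σ.arr 26) (σ.arr 32 0 = 0)) hσ ⟨fun i hi => by simp [h27], fun v => ?_, by simp⟩ ?_).le
    (by rw [hℓ.m])
  · grind
  intro e he τ hτ hF r6 hI
  rw [hℓ.m] at he
  have hL := hℓ.frame hF
  have hD1 := hD.congr (hF.2 18) (hF.2 24) (hF.2 25)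
  refine (Run.cons (T := 20) (T' := (ℓ.d * 100 + 6) + (60 + ((ℓ.d * 100 + 6) + (80 + 1))))
    (Q := fun υ => υ.reg 13 = e + 1 ∧ υ.arr 33 0 = 0 ∧ υ.arr 33 1 = 0 ∧ υ.arr 33 2 = 0) hτ
    (Run.of_wp hτ ?_) ?_).le (by omega)
  · simp [hB, r6, b0, b1, b2]
    omega
  rintro σ₁ hσ₁ hF₁ ⟨r13, z0, z1, z2⟩
  have hL₁ := hL.frame hF₁
  have hD₁ := hD1.congr (hF₁.2 18) (hF₁.2 24) (hF₁.2 25)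
  refine Run.cons hσ₁ (run_count hσ₁ hL₁ hB hw hD₁ (c := e + 1) he r13 z0 z1 z2) ?_
  rintro σ₂ hσ₂ hF₂ ⟨n0, n1, n2⟩
  have hL₂ := hL₁.frame hF₂
  have hD₂ := hD₁.congr (hF₂.2 18) (hF₂.2 24) (hF₂.2 25)
  have s13 := (hF₂.1 13).trans r13
  refine Run.cons hσ₂ (run_free hσ₂ hB hw hD₂ s13 n0 n1) ?_
  rintro σ₃ hσ₃ hF₃ ⟨hfree, r16, r17⟩
  have hL₃ := hL₂.frame hF₃
  have hD₃ := hD₂.congr (hF₃.2 18) (hF₃.2 24) (hF₃.2 25)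
  have t13 := (hF₃.1 13).trans s13
  have m2 : σ₃.arr 33 2 = ℓ.numFull (e + 1) := by rw [hF₃.2 33, n2]
  have t17 : σ₃.reg 17 = σ.arr 26 (e + 1) := by
    rw [r17, hF₂.2 26, hF₁.2 26, hF.2 26]
  have a27 : σ₃.arr 27 = τ.arr 27 := by
    rw [hF₃.2 27, hF₂.2 27, hF₁.2 27]
  have a28 : σ₃.arr 28 = τ.arr 28 := by
    rw [hF₃.2 28, hF₂.2 28, hF₁.2 28]
  have a32 : σ₃.arr 32 = τ.arr 32 := by
    rw [hF₃.2 32, hF₂.2 32, hF₁.2 32]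
  refine Run.cons hσ₃ (run_charge_cycle hσ₃ hL₃ hB hw hD₃ he t13 hfree r16 t17 m2 fun i hi => ?_) ?_
  · rw [a27, hI.used i hi]
    exact Layout.sum_forced_le _ he.le i
  rintro σ₄ hσ₄ hF₄ hu
  have hD₄ := hD₃.congr (hF₄.2 18) (hF₄.2 24) (hF₄.2 25)
  have f15 := hF₄.1 15
  refine Run.cons hσ₄ (run_share (two := σ.arr 26) hσ₄ hB hw hD₄ ((hF₄.1 13).trans t13)
    (by rw [f15]; exact hfree) ((hF₄.1 16).trans r16)
    ((hF₄.1 17).trans t17) (by rw [hF₄.2 33, m2])) ?_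
  rintro σ₅ hσ₅ hF₅ ⟨hq, hf⟩
  have b28 : σ₄.arr 28 = τ.arr 28 := (hF₄.2 28).trans a28
  have b32 : σ₄.arr 32 = τ.arr 32 := (hF₄.2 32).trans a32
  rw [b28] at hq
  rw [b32] at hf
  refine Run.nil (hI.step (hcyc _) (fun i hi => ?_) (fun v h0 => ?_) (fun h0 v hv => ?_)
    (fun h0 h2 => ?_) hf)
  · rw [hF₅.2 27, hu i hi, a27]
  · have h1 : ¬ ℓ.Free (e + 1) ∧ σ.arr 26 (e + 1) ≠ 0 ∧ 2 ≤ ℓ.numFull (e + 1) := by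
      by_contra h1
      exact h0 (Layout.shared_eq_zero h1)
    rw [hq v]
    exact if_congr ⟨fun h => h.2, fun h => ⟨h1, h⟩⟩ rfl rfl
  · grind
  · rw [hq]
    split_ifs with h1
    · exact h0
    · rw [hI.weight, if_neg]
      grind

end

/-- Checks the forced costs. -/
def budgetProg : RamProg := forLoop 6 2 <|
  .ite (.less (.reg 3) (.load 27 (.reg 6))) (.store 32 (.lit 0) (.lit 1)) .skip

theorem run_budget {w : ℕ} {σ : RamState} {ℓ : Layout} (hσ : σ.Bdd w) (hℓ : ℓ.Loaded σ) :
    Run w budgetProg σ (ℓ.d * 50 + 6) fun τ =>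
      (τ.arr 32 0 = 0 ↔ σ.arr 32 0 = 0 ∧ ∀ i < ℓ.d, σ.arr 27 i ≤ ℓ.k) := by
  have b1 := hσ.one_lt
  rw [← hℓ.d]
  refine (Run.for (T := 42) (I := fun t arr => (arr 32 0 = 0 ↔
    σ.arr 32 0 = 0 ∧ ∀ i < t, σ.arr 27 i ≤ ℓ.k)) hσ (by simp) ?_).le
    (by omega)
  intro t ht τ hτ hF r6 hI
  have hL := hℓ.frame hF
  have a27 := hF.2 27
  refine Run.of_wp hτ ?_
  simp [r6, hL.k, a27, b1, zero_lt_one.trans b1]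
  grind

end CactusRouting
namespace CactusRouting

open Function Nat


open RamProg WordExpr

/-! ### Elimination of demands -/

namespace Layout

variable (ℓ : Layout)

/-- The state of the dynamic program stored in the arrays. -/
def ledger (arr : ℕ → ℕ → ℕ) : Ledger where
  mate := arr 29
  need γ x := arr 30 (γ * (ℓ.k + 1) + x)
  used := arr 27
  done := arr 31

/-- The arrays after eliminating demand `i` from the state `S` at node `v`. -/
def Eliminated (q c₁ c₂ : ℕ → ℕ) (S : Ledger) (v i : ℕ) (arr : ℕ → ℕ → ℕ) : Prop :=
  (arr 32 0 = 0 → ℓ.Inv (ℓ.ledger arr) v ∧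
    (ℓ.Sat q c₁ c₂ (ℓ.ledger arr) (v + 1) ↔ ℓ.Sat q c₁ c₂ S (v + 1))) ∧
  (arr 32 0 ≠ 0 → ¬ ℓ.Sat q c₁ c₂ S (v + 1)) ∧ arr 31 = Function.update S.done i 1

/-- The registers and arrays prepared for the elimination of demand `i` with the slots `A` and `B`
from the state `S`. -/
structure ElimReady (S : Ledger) (i A B : ℕ) (σ : RamState) : Prop where
  loaded : ℓ.Loaded σ
  r4 : σ.reg 4 = ℓ.k + 1
  r7 : σ.reg 7 = i
  r12 : σ.reg 12 = A
  r13 : σ.reg 13 = B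
  r14 : σ.reg 14 = ℓ.k - S.used i
  mate : σ.arr 29 = S.mate
  need : (ℓ.ledger σ.arr).need = S.need
  used : σ.arr 27 = S.used
  done : σ.arr 31 = Function.update S.done i 1
  flag : σ.arr 32 0 = 0

/-- The ranges of an elimination step. -/
structure ElimCtx (q c₁ c₂ : ℕ → ℕ) (S : Ledger) (v i A B : ℕ) : Prop where
  tame : ℓ.Tame
  cross : ∀ v, q v ≠ 0 → ℓ.Cross (c₁ v) v ∧ ℓ.Cross (c₂ v) v
  inv : ℓ.Inv S v
  lt : i < ℓ.d
  done : S.done i = 0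
  below : ℓ.Below i v
  slots : A = 2 * i ∧ B = 2 * i + 1 ∨ A = 2 * i + 1 ∧ B = 2 * i

end Layout

/-- Eliminates a demand whose slots are mates of each other. -/
def elimLoopProg : RamProg := block [.store 33 (.lit 3) (.lit 0),
  forLoop 8 4 (.ite (.less (.reg 14) (.reg 8 + .load 30 (.reg 12 * .reg 4 + .reg 8))) .skip
    (.store 33 (.lit 3) (.lit 1))),
  block [.ite (.load 33 (.lit 3)) .skip (.store 32 (.lit 0) (.lit 1)),
    .store 29 (.reg 12) (.lit 0), .store 29 (.reg 13) (.lit 0)]]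

/-- Eliminates a demand one of whose slots has a mate. -/
def elimLeafProg : RamProg := block [.set 15 (.load 29 (.reg 12) - .lit 1),
  .store 27 (.reg 15 / .lit 2) (.load 27 (.reg 15 / .lit 2) +
    .load 30 (.reg 12 * .reg 4 + .reg 14)),
  .store 29 (.reg 12) (.lit 0), .store 29 (.reg 15) (.lit 0),
  .ite (.less (.reg 3) (.load 27 (.reg 15 / .lit 2))) (.store 32 (.lit 0) (.lit 1)) .skip]

/-- Both rows are rewritten in place: an entry is read before it is overwritten and is not used
again, and the rows of the eliminated slots are only read. The content `k + 1` of register `4`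
encodes impossibility. -/
def composeStep : RamProg := block [
  .ite (.less (.reg 14) (.load 30 (.reg 15 * .reg 4 + .reg 8)))
    (.store 30 (.reg 15 * .reg 4 + .reg 8) (.reg 4))
    (.store 30 (.reg 15 * .reg 4 + .reg 8)
      (.load 30 (.reg 13 * .reg 4 + (.reg 14 - .load 30 (.reg 15 * .reg 4 + .reg 8))))),
  .ite (.less (.reg 14) (.load 30 (.reg 16 * .reg 4 + .reg 8)))
    (.store 30 (.reg 16 * .reg 4 + .reg 8) (.reg 4))
    (.store 30 (.reg 16 * .reg 4 + .reg 8)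
      (.load 30 (.reg 12 * .reg 4 + (.reg 14 - .load 30 (.reg 16 * .reg 4 + .reg 8)))))]

/-- Eliminates a demand whose slots have different mates. -/
def elimMergeProg : RamProg := block [
  block [.set 15 (.load 29 (.reg 12) - .lit 1), .set 16 (.load 29 (.reg 13) - .lit 1)],
  forLoop 8 4 composeStep,
  block [.store 29 (.reg 12) (.lit 0), .store 29 (.reg 13) (.lit 0),
    .store 29 (.reg 16) (.reg 15 + .lit 1), .store 29 (.reg 15) (.reg 16 + .lit 1)]]

section

variable {w : ℕ} {σ : RamState} {ℓ : Layout} {q c₁ c₂ : ℕ → ℕ} {S : Ledger} {v i A B : ℕ} {b : ℕ}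

theorem Layout.ElimCtx.slot_lt (hX : ℓ.ElimCtx q c₁ c₂ S v i A B) :
    A < 2 * ℓ.d ∧ B < 2 * ℓ.d := by
  have h1 := hX.lt
  have h2 := hX.slots
  omega

theorem slot_lt_of {γ d : ℕ} (h : γ / 2 < d) : γ < 2 * d := by omega

theorem run_elim_loop (hσ : σ.Bdd w) (hb : 2 ^ w = b) (hw : ℓ.Fits b)
    (hX : ℓ.ElimCtx q c₁ c₂ S v i A B) (hR : ℓ.ElimReady S i A B σ) (hA : S.mate A = B + 1) :
    Run w elimLoopProg σ ((ℓ.k + 1) * 50 + 50) fun τ => ℓ.Eliminated q c₁ c₂ S v i τ.arr := by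
  have hl := hw.lin
  have b0 : 0 < b := by omega
  have b1 : 1 < b := by omega
  have b3 : 3 < b := by omega
  have hslot := hX.slot_lt
  refine (Run.cons (T := 5) (T' := (σ.reg 4 * (30 + 8) + 6) + (25 + 1))
    (Q := fun υ => υ.arr 33 3 = 0) hσ
    (Run.of_wp hσ ?_) ?_).le (by rw [hR.r4]; omega)
  · simp [hb, b0, b3]
  intro σ₁ hσ₁ hF₁ h33
  have r4 := hF₁.1 4
  have hneed : ∀ arr : ℕ → ℕ → ℕ, arr 30 = σ.arr 30 → ∀ x, arr 30 (A * (ℓ.k + 1) + x) = S.need A x := by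
    intro arr h x
    rw [h, ← hR.need]
    rfl
  rw [← r4]
  refine Run.cons hσ₁ (Run.for (T := 30) (I := fun t arr => arr 33 3 ≠ 0 ↔
    ∃ x < t, x + S.need A x ≤ ℓ.k - S.used i) hσ₁ (by simp [h33]) ?_) ?_
  · intro t ht τ hτ hF r8 hI
    have s4 := (hF.1 4).trans (r4.trans hR.r4)
    have s12 := (hF.1 12).trans ((hF₁.1 12).trans hR.r12)
    have s14 := (hF.1 14).trans ((hF₁.1 14).trans hR.r14)
    rw [r4, hR.r4] at ht
    have hn := hneed τ.arr ((hF.2 30).trans (hF₁.2 30))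
    refine Run.of_wp hτ ?_
    have h1 := mul_add_lt hslot.1 ht hw.rows
    have h2 := hX.inv.need_le A (by omega) t (by omega)
    have h3 : A * (ℓ.k + 1) < b := by omega
    have h4 : A * (ℓ.k + 1) + t < b := by omega
    have h5 : t + S.need A t < b := by omega
    simp [hb, r8, s4, s12, s14, hn, h3, h4, h5, b1, b3]
    grind
  intro σ₂ hσ₂ hF₂ hE
  rw [r4, hR.r4] at hE
  have s12 := (hF₂.1 12).trans ((hF₁.1 12).trans hR.r12)
  have s13 := (hF₂.1 13).trans ((hF₁.1 13).trans hR.r13)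
  have a27 : σ₂.arr 27 = S.used := (hF₂.2 27).trans ((hF₁.2 27).trans hR.used)
  have a29 : σ₂.arr 29 = S.mate := (hF₂.2 29).trans ((hF₁.2 29).trans hR.mate)
  have a30 : σ₂.arr 30 = σ.arr 30 := (hF₂.2 30).trans (hF₁.2 30)
  have a31 := (hF₂.2 31).trans ((hF₁.2 31).trans hR.done)
  have a32 : σ₂.arr 32 0 = 0 := by
    rw [hF₂.2 32, hF₁.2 32]
    exact hR.flag
  refine Run.cons (Q := fun τ => ℓ.Eliminated q c₁ c₂ S v i τ.arr) hσ₂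
    (Run.of_wp hσ₂ ?_) fun τ _ _ h => Run.nil h
  have key : ∀ arr : ℕ → ℕ → ℕ, arr 27 = S.used → (arr 29 = fun γ => if γ = A ∨ γ = B then 0 else S.mate γ) →
      arr 30 = σ.arr 30 → arr 31 = Function.update S.done i 1 →
      (arr 32 0 = 0 ↔ σ₂.arr 33 3 ≠ 0) → ℓ.Eliminated q c₁ c₂ S v i arr := by
    intro arr e27 e29 e30 e31 e32
    obtain ⟨h1, h2⟩ := Layout.elim_loop hX.tame.par_zero hX.tame.par_lt hX.cross hX.inv hX.lt hX.done
      hX.below hX.slots (S' := ℓ.ledger arr) (by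
        intro j
        change arr 31 j = _
        rw [e31, update_apply]) hA
      (fun γ => congrFun e29 γ) (by
        rw [← hR.need]
        funext γ x
        exact congrFun e30 _) e27
    have h3 : σ₂.arr 33 3 ≠ 0 ↔ ∃ x ≤ ℓ.k - S.used i, x + S.need A x ≤ ℓ.k - S.used i := by
      rw [hE]
      grind
    rw [← h3, ← e32] at h2
    refine ⟨fun h4 => ⟨h1, ?_⟩, fun h4 h5 => h4 (h2.1 h5).1, e31⟩
    rw [h2]
    grind
  simp [hb, s12, s13, b0, b1, b3]
  refine ⟨fun h => ?_, fun h => ?_⟩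
  · refine key _ (by simpa using a27) ?_ (by simpa using a30) (by simpa using a31)
      (by simp [h, a32])
    funext γ
    simp [update_apply, a29]
    split_ifs <;> simp_all
  · refine key _ (by simpa using a27) ?_ (by simpa using a30) (by simpa using a31)
      (by simp [h])
    funext γ
    simp [update_apply, a29]
    split_ifs <;> simp_all

theorem run_elim_leaf (hσ : σ.Bdd w) (hb : 2 ^ w = b) (hw : ℓ.Fits b)
    (hX : ℓ.ElimCtx q c₁ c₂ S v i A B) (hR : ℓ.ElimReady S i A B σ) (hA0 : S.mate A ≠ 0)
    (hB0 : S.mate B = 0) :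
    Run w elimLeafProg σ 60 fun τ => ℓ.Eliminated q c₁ c₂ S v i τ.arr := by
  have hl := hw.lin
  have b0 : 0 < b := by omega
  have b1 : 1 < b := by omega
  have b2 : 2 < b := by omega
  have hslot := hX.slot_lt
  obtain ⟨δ, hA⟩ : ∃ δ, S.mate A = δ + 1 := ⟨S.mate A - 1, by omega⟩
  refine Run.of_wp hσ ?_
  have hneed : ∀ x, σ.arr 30 (A * (ℓ.k + 1) + x) = S.need A x := by
    intro x
    rw [← hR.need]
    rfl
  have hδ : S.mate δ ≠ 0 := by
    rw [hX.inv.symm _ _ hA]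
    omega
  have hδd := hX.inv.lt δ hδ
  have h1 := mul_add_lt hslot.1 (show ℓ.k - S.used i < ℓ.k + 1 by omega) hw.rows
  have h2 := hX.inv.need_le A hA0 (ℓ.k - S.used i) (by omega)
  have h3 := hX.inv.used_le _ hδd
  have h4 : A * (ℓ.k + 1) < b := by omega
  have h5 : A * (ℓ.k + 1) + (ℓ.k - S.used i) < b := by omega
  have h6 : S.used (δ / 2) + S.need A (ℓ.k - S.used i) < b := by omega
  have key : ∀ arr : ℕ → ℕ → ℕ, (arr 27 = fun j =>
        if j = δ / 2 then S.used j + S.need A (ℓ.k - S.used i) else S.used j) →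
      (arr 29 = fun γ => if γ = A ∨ γ = δ then 0 else S.mate γ) →
      arr 30 = σ.arr 30 → arr 31 = Function.update S.done i 1 →
      (arr 32 0 = 0 ↔ arr 27 (δ / 2) ≤ ℓ.k) → ℓ.Eliminated q c₁ c₂ S v i arr := by
    intro arr e27 e29 e30 e31 e32
    obtain ⟨h1, h2⟩ := Layout.elim_leaf hX.tame.par_zero hX.tame.par_lt hX.cross hX.inv hX.lt hX.done
      hX.below hX.slots (S' := ℓ.ledger arr) (by
        intro j
        change arr 31 j = _
        rw [e31, update_apply]) hA hB0
      (fun γ => congrFun e29 γ) (by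
        rw [← hR.need]
        funext γ x
        exact congrFun e30 _) (fun j => congrFun e27 j)
    change arr 27 (δ / 2) ≤ ℓ.k → _ at h1
    change _ ↔ arr 27 (δ / 2) ≤ ℓ.k ∧ _ at h2
    rw [← e32] at h1 h2
    refine ⟨fun h4 => ⟨h1 h4, ?_⟩, fun h4 h5 => h4 (h2.1 h5).1, e31⟩
    rw [h2]
    grind
  simp [elimLeafProg, hb, hR.r12, hR.r4, hR.r14, hR.mate, hA, hneed, hR.used, hR.loaded.k, b0, b1, b2, h4, h5, h6]
  refine ⟨fun h => ?_, fun h => ?_⟩ <;>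
  · refine key _ ?_ ?_ (by simp) (by simpa using hR.done) ?_
    · funext j
      simp [update_apply]
      split_ifs <;> simp_all
    · funext γ
      simp [update_apply]
      split_ifs <;> simp_all
    · simp [hR.flag]
      omega

theorem run_compose (hσ : σ.Bdd w) (hb : 2 ^ w = b) (hw : ℓ.Fits b)
    (hX : ℓ.ElimCtx q c₁ c₂ S v i A B) {γ δ : ℕ} (r4 : σ.reg 4 = ℓ.k + 1) (r12 : σ.reg 12 = A)
    (r13 : σ.reg 13 = B) (r14 : σ.reg 14 = ℓ.k - S.used i) (r15 : σ.reg 15 = γ)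
    (r16 : σ.reg 16 = δ) (hγ : γ < 2 * ℓ.d) (hδ : δ < 2 * ℓ.d) (hγδ : γ ≠ δ) (hγA : γ ≠ A)
    (hγB : γ ≠ B) (hδA : δ ≠ A) (hδB : δ ≠ B)
    (hneed : ∀ ε, ∀ x ≤ ℓ.k, σ.arr 30 (ε * (ℓ.k + 1) + x) = S.need ε x) :
    Run w (forLoop 8 4 composeStep) σ ((ℓ.k + 1) * 200 + 6) fun τ =>
      ∀ ε, ∀ x ≤ ℓ.k, τ.arr 30 (ε * (ℓ.k + 1) + x) =
        if ε = γ then (if S.need γ x ≤ ℓ.k - S.used i then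
          S.need B (ℓ.k - S.used i - S.need γ x) else ℓ.k + 1)
        else if ε = δ then (if S.need δ x ≤ ℓ.k - S.used i then
          S.need A (ℓ.k - S.used i - S.need δ x) else ℓ.k + 1)
        else S.need ε x := by
  have hl := hw.lin
  have hslot := hX.slot_lt
  let new : ℕ → ℕ → ℕ := fun ε x =>
        if ε = γ then (if S.need γ x ≤ ℓ.k - S.used i then
          S.need B (ℓ.k - S.used i - S.need γ x) else ℓ.k + 1)
        else if ε = δ then (if S.need δ x ≤ ℓ.k - S.used i then
          S.need A (ℓ.k - S.used i - S.need δ x) else ℓ.k + 1)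
        else S.need ε x
  rw [← r4]
  refine (Run.for (T := 192) (I := fun t arr => ∀ ε, ∀ x ≤ ℓ.k, arr 30 (ε * (ℓ.k + 1) + x) =
    if x < t then new ε x else S.need ε x) hσ
    (fun ε x hx => by simp [hneed ε x hx]) ?_).mono (by omega) fun τ h ε x hx => ?_
  swap
  · grind
  intro t ht τ hτ hF r8 hI
  rw [r4] at ht
  have s4 := (hF.1 4).trans r4
  have s12 := (hF.1 12).trans r12
  have s13 := (hF.1 13).trans r13
  have s14 := (hF.1 14).trans r14
  have s15 := (hF.1 15).trans r15
  have s16 := (hF.1 16).trans r16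
  refine Run.of_wp hτ ?_
  have hK : ∀ y, ℓ.k - S.used i - y < ℓ.k + 1 := fun y => by omega
  have m1 := mul_add_lt hγ ht hw.rows
  have m2 := mul_add_lt hδ ht hw.rows
  have m3 := fun y => mul_add_lt hslot.1 (hK y) hw.rows
  have m4 := fun y => mul_add_lt hslot.2 (hK y) hw.rows
  have k1 : γ * (ℓ.k + 1) < b := by omega
  have k2 : γ * (ℓ.k + 1) + t < b := by omega
  have k3 : δ * (ℓ.k + 1) < b := by omega
  have k4 : δ * (ℓ.k + 1) + t < b := by omega
  have k5 : A * (ℓ.k + 1) < b := by have := m3 0; omega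
  have k6 : ∀ y, A * (ℓ.k + 1) + (ℓ.k - S.used i - y) < b := fun y => by have := m3 y; omega
  have k7 : B * (ℓ.k + 1) < b := by have := m4 0; omega
  have k8 : ∀ y, B * (ℓ.k + 1) + (ℓ.k - S.used i - y) < b := fun y => by have := m4 y; omega
  have vγ : τ.arr 30 (γ * (ℓ.k + 1) + t) = S.need γ t := by
    grind
  have vδ : τ.arr 30 (δ * (ℓ.k + 1) + t) = S.need δ t := by
    grind
  have hnew : ∀ ε x, ε ≠ γ → ε ≠ δ → new ε x = S.need ε x := fun ε x h1 h2 => by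
    grind
  have vA : ∀ y, τ.arr 30 (A * (ℓ.k + 1) + (ℓ.k - S.used i - y)) =
      S.need A (ℓ.k - S.used i - y) := fun y => by
    grind
  have vB : ∀ y, τ.arr 30 (B * (ℓ.k + 1) + (ℓ.k - S.used i - y)) =
      S.need B (ℓ.k - S.used i - y) := fun y => by
    grind
  have d1 : δ * (ℓ.k + 1) + t ≠ γ * (ℓ.k + 1) + t := by
    rw [Ne, mul_add_inj ht ht]
    tauto
  have d2 : ∀ y, A * (ℓ.k + 1) + (ℓ.k - S.used i - y) ≠ γ * (ℓ.k + 1) + t := fun y => by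
    rw [Ne, mul_add_inj (hK y) ht]
    tauto
  have key : ∀ f : ℕ → ℕ, f = Function.update (Function.update (τ.arr 30)
      (γ * (ℓ.k + 1) + t) (new γ t)) (δ * (ℓ.k + 1) + t) (new δ t) →
      ∀ ε, ∀ x ≤ ℓ.k, f (ε * (ℓ.k + 1) + x) = if x ≤ t then new ε x else S.need ε x := by
    intro f h ε x hx
    rw [h, update_apply, update_apply]
    simp only [mul_add_inj (show x < ℓ.k + 1 by omega) ht, hI ε x hx]
    grind
  have nγ : new γ t = if S.need γ t ≤ ℓ.k - S.used i then
          S.need B (ℓ.k - S.used i - S.need γ t) else ℓ.k + 1 := if_pos rfl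
  have nδ : new δ t = if S.need δ t ≤ ℓ.k - S.used i then
          S.need A (ℓ.k - S.used i - S.need δ t) else ℓ.k + 1 := by
    grind
  obtain ⟨g, hg⟩ : ∃ g, g = γ * (ℓ.k + 1) + t := ⟨_, rfl⟩
  obtain ⟨h, hh⟩ : ∃ h, h = δ * (ℓ.k + 1) + t := ⟨_, rfl⟩
  rw [← hg] at k2 vγ d1 key
  rw [← hh] at k4 vδ d1 key
  simp only [← hg] at d2
  simp [composeStep, ← hg, ← hh, hb, r8, s4, s12, s13, s14, s15, s16, k1, k2, k3, k4, k5, k6, k7, k8, vγ, vδ,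
    vA, vB, d1, d2]
  grind

theorem run_elim_merge (hσ : σ.Bdd w) (hb : 2 ^ w = b) (hw : ℓ.Fits b)
    (hX : ℓ.ElimCtx q c₁ c₂ S v i A B) (hR : ℓ.ElimReady S i A B σ) (hA0 : S.mate A ≠ 0)
    (hB0 : S.mate B ≠ 0) (hAB : S.mate A ≠ B + 1) :
    Run w elimMergeProg σ ((ℓ.k + 1) * 200 + 60) fun τ => ℓ.Eliminated q c₁ c₂ S v i τ.arr := by
  have hl := hw.lin
  have b0 : 0 < b := by omega
  have b1 : 1 < b := by omega
  have hI := hX.inv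
  obtain ⟨γ, hA⟩ : ∃ γ, S.mate A = γ + 1 := ⟨S.mate A - 1, by omega⟩
  obtain ⟨δ, hB⟩ : ∃ δ, S.mate B = δ + 1 := ⟨S.mate B - 1, by omega⟩
  have hγA := hI.symm _ _ hA
  have hδB := hI.symm _ _ hB
  have n1 := hI.ne _ _ hA
  have n2 := hI.ne _ _ hB
  have hAneB : A ≠ B := by have := hX.slots; omega
  have n3 : γ ≠ B := by omega
  have n4 : δ ≠ A := by
    rintro rfl
    omega
  have n5 : γ ≠ δ := by
    grind
  have hγd := slot_lt_of (hI.lt γ (by omega))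
  have hδd := slot_lt_of (hI.lt δ (by omega))
  refine (Run.cons (T := 20) (T' := ((ℓ.k + 1) * 200 + 6) + (30 + 1))
    (Q := fun υ => υ.reg 15 = γ ∧ υ.reg 16 = δ) hσ
    (Run.of_wp hσ ?_) ?_).le (by omega)
  · simp [hb, hR.r12, hR.r13, hR.mate, hA, hB, b1]
  rintro σ₁ hσ₁ hF₁ ⟨r15, r16⟩
  refine Run.cons hσ₁ (run_compose hσ₁ hb hw hX ((hF₁.1 4).trans hR.r4)
    ((hF₁.1 12).trans hR.r12) ((hF₁.1 13).trans hR.r13)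
    ((hF₁.1 14).trans hR.r14) r15 r16 hγd hδd n5 n1.symm n3 n4 n2.symm
    fun ε x hx => ?_) ?_
  · rw [hF₁.2 30, ← hR.need]
    rfl
  intro σ₂ hσ₂ hF₂ hE
  have s12 := (hF₂.1 12).trans ((hF₁.1 12).trans hR.r12)
  have s13 := (hF₂.1 13).trans ((hF₁.1 13).trans hR.r13)
  have s15 := (hF₂.1 15).trans r15
  have s16 := (hF₂.1 16).trans r16
  have a27 : σ₂.arr 27 = S.used := (hF₂.2 27).trans ((hF₁.2 27).trans hR.used)
  have a29 : σ₂.arr 29 = S.mate := (hF₂.2 29).trans ((hF₁.2 29).trans hR.mate)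
  have a31 := (hF₂.2 31).trans ((hF₁.2 31).trans hR.done)
  have a32 : σ₂.arr 32 0 = 0 := by
    rw [hF₂.2 32, hF₁.2 32]
    exact hR.flag
  refine Run.cons (Q := fun τ => ℓ.Eliminated q c₁ c₂ S v i τ.arr) hσ₂
    (Run.of_wp hσ₂ ?_) fun τ _ _ h => Run.nil h
  have key : ∀ arr : ℕ → ℕ → ℕ, arr 27 = S.used →
      (arr 29 = fun ε => if ε = γ then δ + 1 else if ε = δ then γ + 1 else
        if ε = A ∨ ε = B then 0 else S.mate ε) →
      arr 30 = σ₂.arr 30 → arr 31 = Function.update S.done i 1 →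
      arr 32 0 = 0 → ℓ.Eliminated q c₁ c₂ S v i arr := by
    intro arr e27 e29 e30 e31 e32
    have hn : ∀ ε x, (ℓ.ledger arr).need ε x = σ₂.arr 30 (ε * (ℓ.k + 1) + x) :=
      fun ε x => congrFun e30 _
    obtain ⟨h1, h2⟩ := Layout.elim_merge hX.tame.par_zero hX.tame.par_lt hX.cross hX.inv hX.lt hX.done
      hX.below hX.slots (S' := ℓ.ledger arr) (by
        intro j
        change arr 31 j = _
        rw [e31, update_apply]) hA hB n3
      (fun γ => congrFun e29 γ) (fun x hx => by rw [hn, hE γ x hx, if_pos rfl])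
      (fun x hx => by rw [hn, hE δ x hx, if_neg n5.symm, if_pos rfl])
      (fun ε h1 h2 x hx => by rw [hn, hE ε x hx, if_neg h1, if_neg h2]) e27
    exact ⟨fun _ => ⟨h1, h2.symm⟩, fun h => absurd e32 h, e31⟩
  have hγb : γ + 1 < b := by omega
  have hδb : δ + 1 < b := by omega
  simp [hb, s12, s13, s15, s16, b0, b1, hγb, hδb]
  refine key _ (by simpa using a27) ?_ (by simp) (by simpa using a31) (by simpa using a32)
  funext ε
  simp [update_apply, a29]
  split_ifs <;> simp_all

end

end CactusRouting
namespace CactusRouting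

open Function Nat


open RamProg WordExpr

/-! ### The loop over the nodes -/

namespace Layout

variable (ℓ : Layout)

/-- The data used by the dynamic program: `q v` has to be shared between the slots `g v`
and `h v` at node `v`. -/
structure Planned (q g h : ℕ → ℕ) (arr : ℕ → ℕ → ℕ) : Prop where
  marked : ℓ.Marked ℓ.d arr
  weight : ∀ v, arr 28 v = q v
  first : arr 22 = g
  second : arr 23 = h

/-- The slots at the nodes where costs are shared. -/
structure Shares (q g h : ℕ → ℕ) : Prop where
  le : ∀ v, q v ≤ 4
  pos : ∀ v, q v ≠ 0 → 0 < v
  lt : ∀ v, q v ≠ 0 → v < ℓ.n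
  first : ∀ v, q v ≠ 0 → ℓ.CrossSlot ℓ.d v (g v)
  second : ∀ v, q v ≠ 0 → ℓ.CrossSlot ℓ.d v (h v)
  ne : ∀ v, q v ≠ 0 → g v ≠ h v
  only : ∀ v, q v ≠ 0 → ∀ i < ℓ.d, ℓ.Cross i v → i = g v / 2 ∨ i = h v / 2

/-- The state while the demands are eliminated at node `v`; the first `i` of them have been
considered. -/
def AtNode (q c₁ c₂ : ℕ → ℕ) (goal : Prop) (v i : ℕ) (arr : ℕ → ℕ → ℕ) : Prop :=
  (arr 32 0 = 0 → ℓ.Inv (ℓ.ledger arr) v ∧ (ℓ.Sat q c₁ c₂ (ℓ.ledger arr) (v + 1) ↔ goal) ∧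
    ∀ j < i, arr 31 j = 0 → ¬ ℓ.Below j v) ∧ (arr 32 0 ≠ 0 → ¬ goal)

/-- The state after processing the nodes from `v` on. -/
def After (q c₁ c₂ : ℕ → ℕ) (goal : Prop) (v : ℕ) (arr : ℕ → ℕ → ℕ) : Prop :=
  (arr 32 0 = 0 → ℓ.Inv (ℓ.ledger arr) v ∧ (ℓ.Sat q c₁ c₂ (ℓ.ledger arr) v ↔ goal) ∧
    (v = 0 → ∀ j < ℓ.d, arr 31 j ≠ 0)) ∧ (arr 32 0 ≠ 0 → ¬ goal)

variable {ℓ}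

theorem Planned.frame {q g h : ℕ → ℕ} {P : RamProg} {σ τ : RamState}
    (hP : ℓ.Planned q g h σ.arr) (hF : P.Frame σ τ)
    (ha : ∀ a ∈ [19, 20, 22, 23, 28], a ∉ P.arrs := by decide) : ℓ.Planned q g h τ.arr where
  marked := by
    unfold Marked
    rw [hF.2 19 (ha 19 (by decide)), hF.2 20 (ha 20 (by decide))]
    exact hP.marked
  weight := by
    rw [hF.2 28 (ha 28 (by decide))]
    exact hP.weight
  first := (hF.2 22 (ha 22 (by decide))).trans hP.first
  second := (hF.2 23 (ha 23 (by decide))).trans hP.second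

theorem Shares.cross {q g h : ℕ → ℕ} (hS : ℓ.Shares q g h) (v : ℕ) (hv : q v ≠ 0) :
    ℓ.Cross (g v / 2) v ∧ ℓ.Cross (h v / 2) v :=
  ⟨(hS.first v hv).2.1, (hS.second v hv).2.1⟩

end Layout

/-- The slots are ordered so that the first has a mate whenever either has one; this leaves four
cases for the elimination. -/
def elimPrepare : RamProg := block [
  .ite (.load 29 (.lit 2 * .reg 7))
    (block [.set 12 (.lit 2 * .reg 7), .set 13 (.lit 2 * .reg 7 + .lit 1)])
    (block [.set 12 (.lit 2 * .reg 7 + .lit 1), .set 13 (.lit 2 * .reg 7)]),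
  .set 14 (.reg 3 - .load 27 (.reg 7)), .store 31 (.reg 7) (.lit 1)]

def elimBranch : RamProg := .ite (.load 29 (.reg 12))
  (.ite (.equal (.load 29 (.reg 12)) (.reg 13 + .lit 1)) elimLoopProg
    (.ite (.load 29 (.reg 13)) elimMergeProg elimLeafProg)) .skip

/-- Eliminates a demand when both of its ends are below the node. -/
def elimStep : RamProg := .ite (.load 32 (.lit 0)) .skip <| .ite (.load 31 (.reg 7)) .skip <|
  .ite (.load 19 (.reg 7 * .reg 0 + .reg 11)) (.ite (.load 20 (.reg 7 * .reg 0 + .reg 11))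
    (block [elimPrepare, elimBranch]) .skip) .skip

/-- Adds a shared cost to the row of the slot in register `a`. -/
def shiftProg (a : ℕ) : RamProg := forLoop 8 4 <| block [.set 15 (.reg 3 - .reg 8),
  .set 16 (.load 30 (.reg a * .reg 4 + .reg 15) + .reg 14),
  .ite (.less (.reg 15) (.reg 14)) .skip
    (block [.set 17 (.load 30 (.reg a * .reg 4 + (.reg 15 - .reg 14))),
      .ite (.less (.reg 17) (.reg 16)) (.set 16 (.reg 17)) .skip]),
  .ite (.less (.reg 4) (.reg 16)) (.set 16 (.reg 4)) .skip,
  .store 30 (.reg a * .reg 4 + .reg 15) (.reg 16)]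

/-- By `link_cases`, a mate of the first slot can only be the second one. Otherwise they are joined
by rows of zeros, the void constraint. -/
def freshProg : RamProg := .ite (.load 29 (.reg 12)) .skip <| block [
  block [.store 29 (.reg 12) (.reg 13 + .lit 1), .store 29 (.reg 13) (.reg 12 + .lit 1)],
  forLoop 8 4 (block [.store 30 (.reg 12 * .reg 4 + .reg 8) (.lit 0),
    .store 30 (.reg 13 * .reg 4 + .reg 8) (.lit 0)])]

/-- Joins the two demands sharing a cost at the node. -/
def linkStep : RamProg := .ite (.load 32 (.lit 0)) .skip <| .ite (.load 28 (.reg 11)) (block [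
  block [.set 12 (.load 22 (.reg 11)), .set 13 (.load 23 (.reg 11)), .set 14 (.load 28 (.reg 11))],
  freshProg, shiftProg 12, shiftProg 13]) .skip

def nodesProg : RamProg := forLoop 6 0 <| block [.set 11 (.reg 0 - .reg 6 - .lit 1),
  forLoop 7 2 elimStep, linkStep]

section

variable {w : ℕ} {σ : RamState} {ℓ : Layout} {q g h : ℕ → ℕ} {goal : Prop} {v i : ℕ} {b : ℕ}

theorem run_elim_step (hσ : σ.Bdd w) (hℓ : ℓ.Loaded σ) (ht : ℓ.Tame) (hb : 2 ^ w = b)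
    (hw : ℓ.Fits b) (hS : ℓ.Shares q g h) (hP : ℓ.Planned q g h σ.arr) (hv : v < ℓ.n)
    (hi : i < ℓ.d) (r4 : σ.reg 4 = ℓ.k + 1) (r7 : σ.reg 7 = i) (r11 : σ.reg 11 = v)
    (hN : ℓ.AtNode q (fun v => g v / 2) (fun v => h v / 2) goal v i σ.arr) :
    Run w elimStep σ ((ℓ.k + 1) * 200 + 200) fun τ =>
      ℓ.AtNode q (fun v => g v / 2) (fun v => h v / 2) goal v (i + 1) τ.arr := by
  have hl := hw.lin
  have b0 : 0 < b := by omega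
  have b1 : 1 < b := by omega
  have b2 : 2 < b := by omega
  have hrow := mul_add_lt hi hv hw.marks
  obtain ⟨m1, m2⟩ := hP.marked i hi v hv
  have hskip : ∀ {T : ℕ} {σ : RamState}, 1 ≤ T →
      ℓ.AtNode q (fun v => g v / 2) (fun v => h v / 2) goal v (i + 1) σ.arr → Run w .skip σ T
      fun τ => ℓ.AtNode q (fun v => g v / 2) (fun v => h v / 2) goal v (i + 1) τ.arr :=
    fun hT h => ⟨1, _, .skip _, hT, h⟩
  have hok : ∀ a, (WordExpr.load a (.reg 7 * .reg 0 + .reg 11)).Ok w σ := by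
    intro a
    simp [r7, r11, hℓ.n, hb]
    omega
  have hval : (WordExpr.reg 7 * .reg 0 + .reg 11).val σ = i * ℓ.n + v := by
    simp [r7, r11, hℓ.n]
  have hsucc : σ.arr 32 0 = 0 → (σ.arr 31 i = 0 → ¬ ℓ.Below i v) →
      ℓ.AtNode q (fun v => g v / 2) (fun v => h v / 2) goal v (i + 1) σ.arr := by
    intro h0 h1
    obtain ⟨h2, h3, h4⟩ := hN.1 h0
    refine ⟨fun _ => ⟨h2, h3, fun j hj => ?_⟩, hN.2⟩
    grind
  refine (Run.ite (T := (ℓ.k + 1) * 200 + 190) hσ (by simp [hb, b0]) (fun h0 => ?_)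
    fun h0 => ?_).le (by simp only [cost]; omega)
  · refine hskip (by omega) ⟨fun h => absurd h h0, hN.2⟩
  obtain ⟨hI, hsat, hact⟩ := hN.1 h0
  refine (Run.ite (T := (ℓ.k + 1) * 200 + 180) hσ (by simp) (fun h1 => ?_)
    fun h1 => ?_).le (by simp only [cost]; omega)
  · simp only [val_load, val_reg, r7] at h1
    exact hskip (by omega) (hsucc h0 fun h => absurd h h1)
  simp only [val_load, val_reg, r7] at h1
  refine (Run.ite (T := (ℓ.k + 1) * 200 + 160) hσ (hok 19) (fun h2 => ?_)
    fun h2 => ?_).le (le_of_eq_of_le (show _ = 7 + ((ℓ.k + 1) * 200 + 160) from rfl) (by omega))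
  swap
  · rw [val_load, hval, m1] at h2
    refine hskip (by omega) (hsucc h0 fun _ hB => ?_)
    rw [if_pos ⟨hi, hB.1⟩] at h2
    exact one_ne_zero h2
  refine (Run.ite (T := (ℓ.k + 1) * 200 + 140) hσ (hok 20) (fun h3 => ?_)
    fun h3 => ?_).le (le_of_eq_of_le (show _ = 7 + ((ℓ.k + 1) * 200 + 140) from rfl) (by omega))
  swap
  · rw [val_load, hval, m2] at h3
    refine hskip (by omega) (hsucc h0 fun _ hB => ?_)
    rw [if_pos ⟨hi, hB.2⟩] at h3
    exact one_ne_zero h3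
  rw [val_load, hval, m1] at h2
  rw [val_load, hval, m2] at h3
  have hB : ℓ.Below i v := by
    constructor
    · grind
    · grind
  obtain ⟨S, hSe⟩ : ∃ S, S = ℓ.ledger σ.arr := ⟨_, rfl⟩
  rw [← hSe] at hI hsat
  have hfin : ∀ arr, ℓ.Eliminated q (fun v => g v / 2) (fun v => h v / 2) S v i arr →
      ℓ.AtNode q (fun v => g v / 2) (fun v => h v / 2) goal v (i + 1) arr := by
    rintro arr ⟨e1, e2, e3⟩
    refine ⟨fun e4 => ⟨(e1 e4).1, (e1 e4).2.trans hsat, fun j hj hd => ?_⟩, fun e4 e5 =>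
      e2 e4 (hsat.2 e5)⟩
    rw [e3, update_apply] at hd
    split_ifs at hd with hji
    refine hact j (by omega) ?_
    rw [hSe] at hd
    exact hd
  have hu := hI.used_le i hi
  refine (Run.cons (T := 40) (T' := ((ℓ.k + 1) * 200 + 95) + 1)
    (Q := fun υ => ∃ A B, ℓ.ElimCtx q (fun v => g v / 2) (fun v => h v / 2) S v i A B ∧
      ℓ.ElimReady S i A B υ ∧ (S.mate A = 0 → S.mate B = 0)) hσ
    (Run.of_wp hσ ?_) ?_).le (by omega)
  · have hd2 : 2 * i + 1 < b := by omega
    have hd1 : 2 * i < b := by omega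
    have hX : ∀ A B, A = 2 * i ∧ B = 2 * i + 1 ∨ A = 2 * i + 1 ∧ B = 2 * i →
        ℓ.ElimCtx q (fun v => g v / 2) (fun v => h v / 2) S v i A B := fun A B hAB =>
      ⟨ht, hS.cross, hI, hi, by rw [hSe]; exact h1, hB, hAB⟩
    simp [elimPrepare, hb, r7, hℓ.k, hd1, hd2, b1, b2]
    refine ⟨fun h4 => ⟨2 * i, 2 * i + 1, hX _ _ (Or.inl ⟨rfl, rfl⟩), ?_, ?_⟩,
      fun h4 => ⟨2 * i + 1, 2 * i, hX _ _ (Or.inr ⟨rfl, rfl⟩), ?_, ?_⟩⟩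
    · subst hSe
      exact ⟨⟨hℓ.n, hℓ.m, hℓ.d, hℓ.k, hℓ.par, hℓ.eu, hℓ.ev, hℓ.sp, hℓ.tp⟩, r4, r7, rfl, rfl, rfl, rfl, rfl, rfl, rfl, h0⟩
    · intro h5
      rw [hSe] at h5
      exact absurd h5 h4
    · subst hSe
      exact ⟨⟨hℓ.n, hℓ.m, hℓ.d, hℓ.k, hℓ.par, hℓ.eu, hℓ.ev, hℓ.sp, hℓ.tp⟩, r4, r7, rfl, rfl, rfl, rfl, rfl, rfl, rfl, h0⟩
    · intro _
      rw [hSe]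
      exact h4
  rintro τ hτ - ⟨A, B, hX, hR, hAB⟩
  refine Run.cons (Q := fun τ => ℓ.AtNode q (fun v => g v / 2) (fun v => h v / 2) goal v (i + 1) τ.arr)
    hτ ?_ fun υ _ _ h => Run.nil h
  have hslot := hX.slot_lt
  refine (Run.ite (T := (ℓ.k + 1) * 200 + 90) hτ (by simp) (fun h4 => ?_)
    fun h4 => ?_).le (by simp only [cost]; omega)
  swap
  · simp only [val_load, val_reg, hR.r12, hR.mate] at h4
    refine hskip (by omega) (hfin _ ?_)
    obtain ⟨e1, e2⟩ := Layout.elim_free ht.par_zero ht.par_lt hS.cross hI hi hX.done hB hX.slots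
      (S' := ℓ.ledger τ.arr) (fun j => by
        change τ.arr 31 j = _
        rw [hR.done, update_apply]) h4 (hAB h4) hR.mate hR.need hR.used
    exact ⟨fun _ => ⟨e1, e2⟩, fun h => absurd hR.flag h, hR.done⟩
  simp only [val_load, val_reg, hR.r12, hR.mate] at h4
  refine (Run.ite (T := (ℓ.k + 1) * 200 + 80) hτ (by simp [hR.r13, hb]; omega) (fun h5 => ?_)
    fun h5 => ?_).le (le_of_eq_of_le (show _ = 7 + ((ℓ.k + 1) * 200 + 80) from rfl) (by omega))
  · have h6 : S.mate A = B + 1 := by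
      by_contra h6
      refine h5 ?_
      rw [val_equal_eq_zero]
      simpa [hR.r12, hR.r13, hR.mate] using h6
    exact (run_elim_loop hτ hb hw hX hR h6).mono (by omega) fun υ h => hfin _ h
  have h6 : S.mate A ≠ B + 1 := by
    rw [val_equal_eq_zero] at h5
    simpa [hR.r12, hR.r13, hR.mate] using h5
  refine (Run.ite (T := (ℓ.k + 1) * 200 + 70) hτ (by simp) (fun h7 => ?_)
    fun h7 => ?_).le (by simp only [cost]; omega)
  · simp only [val_load, val_reg, hR.r13, hR.mate] at h7
    exact (run_elim_merge hτ hb hw hX hR h4 h7 h6).mono (by omega) fun υ h => hfin _ h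
  · simp only [val_load, val_reg, hR.r13, hR.mate] at h7
    exact (run_elim_leaf hτ hb hw hX hR h4 h7).mono (by omega) fun υ h => hfin _ h

theorem run_shift (a : ℕ) (ha : a = 12 ∨ a = 13) (hσ : σ.Bdd w) (hℓ : ℓ.Loaded σ) (hb : 2 ^ w = b)
    (hw : ℓ.Fits b) {γ x₀ : ℕ} (r4 : σ.reg 4 = ℓ.k + 1) (ra : σ.reg a = γ) (r14 : σ.reg 14 = x₀)
    (h0 : x₀ ≠ 0) (h4 : x₀ ≤ 4) (hγ : γ < 2 * ℓ.d)
    (hn : ∀ x ≤ ℓ.k, σ.arr 30 (γ * (ℓ.k + 1) + x) ≤ ℓ.k + 1) :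
    Run w (shiftProg a) σ ((ℓ.k + 1) * 100 + 6) fun τ => ∀ ε, ∀ x ≤ ℓ.k,
      τ.arr 30 (ε * (ℓ.k + 1) + x) = if ε = γ then min (ℓ.k + 1)
        (min (if x₀ ≤ x then σ.arr 30 (γ * (ℓ.k + 1) + (x - x₀)) else ℓ.k + 1)
          (σ.arr 30 (γ * (ℓ.k + 1) + x) + x₀)) else σ.arr 30 (ε * (ℓ.k + 1) + x) := by
  have hl := hw.lin
  let new : ℕ → ℕ := fun x => min (ℓ.k + 1)
        (min (if x₀ ≤ x then σ.arr 30 (γ * (ℓ.k + 1) + (x - x₀)) else ℓ.k + 1)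
          (σ.arr 30 (γ * (ℓ.k + 1) + x) + x₀))
  have ha8 : a ≠ 8 := by omega
  rw [← r4]
  refine (Run.for (T := 92) (I := fun t arr => ∀ ε, ∀ x ≤ ℓ.k, arr 30 (ε * (ℓ.k + 1) + x) =
    if ε = γ ∧ ℓ.k < x + t then new x else σ.arr 30 (ε * (ℓ.k + 1) + x)) hσ
    (fun ε x hx => ?_) ?_ (of_decide_eq_true rfl) (of_decide_eq_true rfl)).mono (by omega)
    fun τ h ε x hx => ?_
  · rw [if_neg (by omega)]
  swap
  · grind
  intro t ht τ hτ hF r8 hI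
  rw [r4] at ht
  have hL := hℓ.frame hF (of_decide_eq_true rfl) (of_decide_eq_true rfl)
  have s4 := (hF.1 4 (of_decide_eq_true rfl)).trans r4
  have s14 := (hF.1 14 (of_decide_eq_true rfl)).trans r14
  have sa : τ.reg a = γ := by
    rcases ha with rfl | rfl
    · exact (hF.1 12 (of_decide_eq_true rfl)).trans ra
    · exact (hF.1 13 (of_decide_eq_true rfl)).trans ra
  have a15 : a ≠ 15 := by omega
  have a16 : a ≠ 16 := by omega
  have a17 : a ≠ 17 := by omega
  refine Run.of_wp hτ ?_ (of_decide_eq_true rfl)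
  -- The row is traversed downwards, so the entry at `x - x₀` still has its old value when it is
  -- needed; this uses `x₀ ≠ 0`.
  obtain ⟨x, hx⟩ : ∃ x, x = ℓ.k - t := ⟨_, rfl⟩
  have m1 := fun y => mul_add_lt hγ (show x - y < ℓ.k + 1 by omega) hw.rows
  have k1 : γ * (ℓ.k + 1) < b := by have := m1 0; omega
  have k2 : ∀ y, γ * (ℓ.k + 1) + (x - y) < b := fun y => by have := m1 y; omega
  have k3 : γ * (ℓ.k + 1) + x < b := k2 0
  have v1 : τ.arr 30 (γ * (ℓ.k + 1) + x) = σ.arr 30 (γ * (ℓ.k + 1) + x) := by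
    grind
  have v2 : x₀ ≤ x → τ.arr 30 (γ * (ℓ.k + 1) + (x - x₀)) = σ.arr 30 (γ * (ℓ.k + 1) + (x - x₀)) := by
    intro h
    rw [hI γ (x - x₀) (by omega), if_neg (by omega)]
  have hn0 := hn x (by omega)
  have k4 : σ.arr 30 (γ * (ℓ.k + 1) + x) + x₀ < b := by omega
  have key : ∀ (f : ℕ → ℕ) (y : ℕ), y = new x →
      f = Function.update (τ.arr 30) (γ * (ℓ.k + 1) + x) y →
      ∀ ε, ∀ x ≤ ℓ.k, f (ε * (ℓ.k + 1) + x) =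
        if ε = γ ∧ ℓ.k < x + (t + 1) then new x else σ.arr 30 (ε * (ℓ.k + 1) + x) := by
    intro f y hy h ε z hz
    rw [h, update_apply]
    simp only [mul_add_inj (show z < ℓ.k + 1 by omega) (show x < ℓ.k + 1 by omega), hI ε z hz]
    grind
  have hnew : new x = min (ℓ.k + 1)
        (min (if x₀ ≤ x then σ.arr 30 (γ * (ℓ.k + 1) + (x - x₀)) else ℓ.k + 1)
          (σ.arr 30 (γ * (ℓ.k + 1) + x) + x₀)) := rfl
  simp only [wp, block, ok_sub, ok_reg, ok_add, ok_mul, ok_load, ok_less, val_add, val_mul,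
    val_reg, val_sub, val_load, val_less_eq_zero, ne_eq, not_not, update_self,
    update_of_ne, hb, r8, s4, s14, hL.k, sa, ← hx, k1, k2, k3, k4, v1, a15, a16, a17,
    update_of_ne (show (4 : ℕ) ≠ 15 by decide), update_of_ne (show (4 : ℕ) ≠ 16 by decide),
    update_of_ne (show (4 : ℕ) ≠ 17 by decide), update_of_ne (show (14 : ℕ) ≠ 15 by decide),
    update_of_ne (show (14 : ℕ) ≠ 16 by decide),
    update_of_ne (show (15 : ℕ) ≠ 16 by decide), update_of_ne (show (15 : ℕ) ≠ 17 by decide),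
    update_of_ne (show (16 : ℕ) ≠ 17 by decide), not_false_eq_true, and_self, true_and]
  refine ⟨fun h1 => ⟨fun h2 => ?_, fun h2 => ?_⟩, fun h1 => ⟨fun h2 => ⟨fun h3 => ?_, fun h3 => ?_⟩,
    fun h2 => ⟨fun h3 => ?_, fun h3 => ?_⟩⟩⟩
  · grind
  · grind
  all_goals
    grind

end

end CactusRouting
namespace CactusRouting

open Function Nat


open RamProg WordExpr

section

variable {w : ℕ} {σ : RamState} {ℓ : Layout} {q g h : ℕ → ℕ} {goal : Prop} {v : ℕ} {b : ℕ}

theorem run_fresh (hσ : σ.Bdd w) (hb : 2 ^ w = b) (hw : ℓ.Fits b) {γ δ : ℕ}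
    (r4 : σ.reg 4 = ℓ.k + 1) (r12 : σ.reg 12 = γ) (r13 : σ.reg 13 = δ) (hγ : γ < 2 * ℓ.d)
    (hδ : δ < 2 * ℓ.d) : Run w freshProg σ ((ℓ.k + 1) * 50 + 50) fun τ =>
      (σ.arr 29 γ ≠ 0 → τ.arr = σ.arr) ∧ (σ.arr 29 γ = 0 →
        τ.arr 29 = Function.update (Function.update (σ.arr 29) γ (δ + 1)) δ (γ + 1) ∧
        ∀ ε, ∀ x ≤ ℓ.k, τ.arr 30 (ε * (ℓ.k + 1) + x) =
          if ε = γ ∨ ε = δ then 0 else σ.arr 30 (ε * (ℓ.k + 1) + x)) := by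
  have hl := hw.lin
  have b0 : 0 < b := by omega
  have b1 : 1 < b := by omega
  refine (Run.ite (T := (ℓ.k + 1) * 50 + 40) hσ (by simp) (fun h1 => ?_) fun h1 => ?_).le
    (by simp only [cost]; omega)
  · simp only [val_load, val_reg, r12] at h1
    exact ⟨1, _, .skip _, by omega, fun _ => rfl, fun h => absurd h h1⟩
  simp only [val_load, val_reg, r12] at h1
  refine Run.mono (Q := fun τ => τ.arr 29 = Function.update (Function.update (σ.arr 29) γ (δ + 1))
      δ (γ + 1) ∧ ∀ ε, ∀ x ≤ ℓ.k, τ.arr 30 (ε * (ℓ.k + 1) + x) =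
          if ε = γ ∨ ε = δ then 0 else σ.arr 30 (ε * (ℓ.k + 1) + x)) ?_ le_rfl
    fun υ h => ⟨fun h2 => absurd h1 h2, fun _ => h⟩
  refine (Run.cons (T := 20) (T' := ((ℓ.k + 1) * (20 + 8) + 6) + 1)
    (Q := fun υ => υ.arr 29 = Function.update (Function.update (σ.arr 29) γ (δ + 1)) δ (γ + 1)) hσ
    (Run.of_wp hσ ?_) ?_).le (by omega)
  · have e1 : δ + 1 < b := by omega
    have e2 : γ + 1 < b := by omega
    simp [hb, r12, r13, e1, e2, b1]
  intro σ₁ hσ₁ hF₁ h29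
  have s4 := (hF₁.1 4).trans r4
  rw [← s4]
  refine Run.cons hσ₁ (Run.for (T := 20) (I := fun t arr => ∀ ε, ∀ x ≤ ℓ.k,
    arr 30 (ε * (ℓ.k + 1) + x) =
      if (ε = γ ∨ ε = δ) ∧ x < t then 0 else σ.arr 30 (ε * (ℓ.k + 1) + x)) hσ₁ (fun ε x hx => ?_) ?_) fun τ hτ hF h => Run.nil ?_
  · rw [if_neg (by omega), hF₁.2 30]
  swap
  · refine ⟨(hF.2 29).trans h29, fun ε x hx => ?_⟩
    grind
  intro t ht τ hτ hF r8 hI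
  rw [s4] at ht
  have u4 := (hF.1 4).trans s4
  have u12 := (hF.1 12).trans ((hF₁.1 12).trans r12)
  have u13 := (hF.1 13).trans ((hF₁.1 13).trans r13)
  have m1 := mul_add_lt hγ ht hw.rows
  have m2 := mul_add_lt hδ ht hw.rows
  have k1 : γ * (ℓ.k + 1) < b := by omega
  have k2 : γ * (ℓ.k + 1) + t < b := by omega
  have k3 : δ * (ℓ.k + 1) < b := by omega
  have k4 : δ * (ℓ.k + 1) + t < b := by omega
  refine Run.of_wp hτ ?_
  simp only [wp, block, ok_reg, ok_add, ok_mul, ok_lit, val_add, val_mul, val_reg, val_lit,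
    update_self, hb, r8, u4, u12, u13, k1, k2, k3, k4, b0, true_and, and_self]
  intro ε x hx
  simp only [update_apply, mul_add_inj (show x < ℓ.k + 1 by omega) ht, hI ε x hx]
  grind

theorem run_link (hσ : σ.Bdd w) (hℓ : ℓ.Loaded σ) (ht : ℓ.Tame) (hb : 2 ^ w = b)
    (hw : ℓ.Fits b) (hS : ℓ.Shares q g h) (hP : ℓ.Planned q g h σ.arr) (r4 : σ.reg 4 = ℓ.k + 1)
    (r11 : σ.reg 11 = v) (hN : ℓ.AtNode q (fun v => g v / 2) (fun v => h v / 2) goal v ℓ.d σ.arr) :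
    Run w linkStep σ ((ℓ.k + 1) * 250 + 100) fun τ =>
      ℓ.After q (fun v => g v / 2) (fun v => h v / 2) goal v τ.arr := by
  have hl := hw.lin
  have b0 : 0 < b := by omega
  refine (Run.ite (T := (ℓ.k + 1) * 250 + 90) hσ (by simp [hb, b0]) (fun f0 => ?_)
    fun f0 => ?_).le (by simp only [cost]; omega)
  · exact ⟨1, _, .skip _, by omega, fun h => absurd h f0, hN.2⟩
  obtain ⟨hI, hsat, hact⟩ := hN.1 f0
  refine (Run.ite (T := (ℓ.k + 1) * 250 + 80) hσ (by simp) (fun hq => ?_)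
    fun hq => ?_).le (by simp only [cost]; omega)
  swap
  · simp only [val_load, val_reg, r11, hP.weight] at hq
    refine ⟨1, _, .skip _, by omega, fun _ => ⟨hI, (Layout.sat_succ_of_eq_zero fun _ => hq).symm.trans hsat,
      ?_⟩, hN.2⟩
    -- Every end lies below the root, so no demand is left after the root has been processed.
    rintro rfl j hj hd
    exact hact j hj hd ⟨anc_zero ht.par_zero ht.par_lt _, anc_zero ht.par_zero ht.par_lt _⟩
  simp only [val_load, val_reg, r11, hP.weight] at hq
  obtain ⟨γ, hγ⟩ : ∃ γ, γ = g v := ⟨_, rfl⟩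
  obtain ⟨δ, hδ⟩ : ∃ δ, δ = h v := ⟨_, rfl⟩
  obtain ⟨γd, γc, γa⟩ := hS.first v hq
  obtain ⟨δd, δc, δa⟩ := hS.second v hq
  have hne := hS.ne v hq
  have hv := hS.pos v hq
  have honly := hS.only v hq
  have hle := hS.le v
  rw [← hγ] at γd γc γa hne honly
  rw [← hδ] at δd δc δa hne honly
  have hγl := slot_lt_of γd
  have hδl := slot_lt_of δd
  have hγ0 := hI.done_eq_zero ht.par_zero ht.par_lt γd γc
  have hδ0 := hI.done_eq_zero ht.par_zero ht.par_lt δd δc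
  have hcase := Layout.link_cases ht.par_zero ht.par_lt hI hact γa δa γc δc honly
  refine (Run.cons (T := 15) (T' := ((ℓ.k + 1) * 50 + 50) + (((ℓ.k + 1) * 100 + 6) +
    (((ℓ.k + 1) * 100 + 6) + 1)))
    (Q := fun υ => υ.reg 12 = γ ∧ υ.reg 13 = δ ∧ υ.reg 14 = q v) hσ
    (Run.of_wp hσ ?_) ?_).le (by omega)
  · simp [r11, hP.weight, hP.first, hP.second, hγ, hδ]
  rintro σ₁ hσ₁ hF₁ ⟨s12, s13, s14⟩
  have s4 := (hF₁.1 4).trans r4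
  have a1 : ∀ a, σ₁.arr a = σ.arr a := fun a => hF₁.2 a (by simp [arrs])
  refine Run.cons hσ₁ (run_fresh hσ₁ hb hw s4 s12 s13 hγl hδl) fun σ₂ hσ₂ hF₂ hE => ?_
  have t4 := (hF₂.1 4).trans s4
  have t12 := (hF₂.1 12).trans s12
  have t13 := (hF₂.1 13).trans s13
  have t14 := (hF₂.1 14).trans s14
  have a27 : σ₂.arr 27 = σ.arr 27 := (hF₂.2 27).trans (a1 27)
  have a31 : σ₂.arr 31 = σ.arr 31 := (hF₂.2 31).trans (a1 31)
  have a32 : σ₂.arr 32 = σ.arr 32 := (hF₂.2 32).trans (a1 32)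
  obtain ⟨hI₂, hsat₂, hm₂⟩ : ℓ.Inv (ℓ.ledger σ₂.arr) v ∧
      (ℓ.Sat q (fun v => g v / 2) (fun v => h v / 2) (ℓ.ledger σ₂.arr) (v + 1) ↔ goal) ∧
      σ₂.arr 29 γ = δ + 1 := by
    simp only [a1] at hE
    rcases hcase with ⟨m1, m2⟩ | m1
    · obtain ⟨e29, e30⟩ := hE.2 m1
      obtain ⟨h1, h2⟩ := Layout.link_fresh (S' := ℓ.ledger σ₂.arr) ht.par_zero ht.par_lt hI m1 m2
        hne γd δd hγ0 hδ0 γa δa (fun ε => by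
          change σ₂.arr 29 ε = _
          rw [e29, update_apply, update_apply]
          split_ifs with h3 h4
          · exact absurd (h4.symm.trans h3) hne
          · rfl
          · rfl
          · rfl) (fun x hx => ⟨(e30 γ x hx).trans (if_pos (Or.inl rfl)),
          (e30 δ x hx).trans (if_pos (Or.inr rfl))⟩)
        (fun ε h3 h4 x hx => (e30 ε x hx).trans (if_neg (by tauto))) a27 a31 (v + 1)
      refine ⟨h1, h2.symm.trans hsat, ?_⟩
      rw [e29, update_of_ne hne, update_self]
    · have h1 : σ₂.arr = σ.arr := (hE.1 (fun h => by
        change σ.arr 29 γ = δ + 1 at m1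
        omega)).trans (funext a1)
      rw [h1]
      exact ⟨hI, hsat, m1⟩
  have hm₂' := hI₂.symm _ _ hm₂
  refine Run.cons hσ₂ (run_shift 12 (Or.inl rfl) hσ₂ ((hℓ.frame hF₁).frame hF₂) hb hw t4 t12 t14 hq hle hγl (hI₂.need_le γ (by
      change σ₂.arr 29 γ ≠ 0
      omega))) fun σ₃ hσ₃ hF₃ hE₃ => ?_
  have n3 : ∀ x ≤ ℓ.k, σ₃.arr 30 (δ * (ℓ.k + 1) + x) = σ₂.arr 30 (δ * (ℓ.k + 1) + x) :=
    fun x hx => (hE₃ δ x hx).trans (if_neg hne.symm)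
  refine Run.cons hσ₃ (run_shift 13 (Or.inr rfl) hσ₃ (((hℓ.frame hF₁).frame hF₂).frame hF₃) hb hw ((hF₃.1 4).trans t4)
    ((hF₃.1 13).trans t13) ((hF₃.1 14).trans t14) hq hle hδl
    (fun x hx => (n3 x hx).trans_le (hI₂.need_le δ (by omega) x hx)))
    fun σ₄ hσ₄ hF₄ hE₄ => Run.nil ?_
  have hkeep : ∀ a, (_ : a ≠ 30 := by decide) → σ₄.arr a = σ₂.arr a := fun a ha =>
    (hF₄.2 a (by simpa [shiftProg, forLoop, arrs] using ha)).trans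
      (hF₃.2 a (by simpa [shiftProg, forLoop, arrs] using ha))
  obtain ⟨h1, h2⟩ := Layout.link_shift (S' := ℓ.ledger σ₄.arr) (q := q) (c₁ := fun v => g v / 2)
    (c₂ := fun v => h v / 2) hI₂ hv hm₂ (by rw [hγ]) (by rw [hδ])
    (hkeep 29) (fun x hx => ((hE₄ γ x hx).trans (if_neg hne)).trans
      ((hE₃ γ x hx).trans (if_pos rfl))) (fun x hx => by
      refine ((hE₄ δ x hx).trans (if_pos rfl)).trans ?_
      rw [n3 x hx]
      congr 2
      exact if_congr Iff.rfl (n3 _ (by omega)) rfl)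
    (fun ε h3 h4 x hx => ((hE₄ ε x hx).trans (if_neg h4)).trans ((hE₃ ε x hx).trans (if_neg h3)))
    (hkeep 27) (hkeep 31)
  refine ⟨fun _ => ⟨h1, h2.symm.trans hsat₂, fun h => absurd h hv.ne'⟩, fun h3 => absurd f0 ?_⟩
  rw [hkeep 32, a32] at h3
  exact h3

theorem run_nodes (hσ : σ.Bdd w) (hℓ : ℓ.Loaded σ) (ht : ℓ.Tame) (hb : 2 ^ w = b)
    (hw : ℓ.Fits b) (hS : ℓ.Shares q g h) (hP : ℓ.Planned q g h σ.arr) (r4 : σ.reg 4 = ℓ.k + 1)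
    (hN : ℓ.After q (fun v => g v / 2) (fun v => h v / 2) goal ℓ.n σ.arr) :
    Run w nodesProg σ (ℓ.n * (ℓ.d * ((ℓ.k + 1) * 200 + 208) + ((ℓ.k + 1) * 250 + 130)) + 6)
      fun τ => ℓ.After q (fun v => g v / 2) (fun v => h v / 2) goal 0 τ.arr := by
  have hl := hw.lin
  have b1 : 1 < b := by omega
  rw [← hℓ.n]
  refine (Run.for (T := ℓ.d * ((ℓ.k + 1) * 200 + 208) + ((ℓ.k + 1) * 250 + 122))
    (I := fun t arr => ℓ.After q (fun v => g v / 2) (fun v => h v / 2) goal (ℓ.n - t) arr) hσ hN ?_).mono (Nat.add_le_add_right (Nat.mul_le_mul_left _ (by omega)) _) fun τ h => ?_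
  swap
  · rwa [hℓ.n, Nat.sub_self] at h
  intro t htn τ hτ hF r6 hI
  rw [hℓ.n] at htn
  have hL := hℓ.frame hF
  have hP' := hP.frame hF
  have u4 := (hF.1 4).trans r4
  obtain ⟨v, hv⟩ : ∃ v, v = ℓ.n - t - 1 := ⟨_, rfl⟩
  have hv1 : ℓ.n - t = v + 1 := by omega
  have hv2 : ℓ.n - (t + 1) = v := by omega
  rw [hv1] at hI
  rw [hv2]
  refine (Run.cons (T := 8) (T' := (ℓ.d * (((ℓ.k + 1) * 200 + 200) + 8) + 6) +
    (((ℓ.k + 1) * 250 + 100) + 1)) (Q := fun υ => υ.reg 11 = v ∧ υ.arr = τ.arr) hτ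
    (Run.of_wp hτ ?_) ?_).le (by
      rw [add_assoc _ 200 8]
      omega)
  · simp [hb, b1, hL.n, r6, hv]
  rintro σ₁ hσ₁ hF₁ ⟨s11, e1⟩
  have hL₁ := hL.frame hF₁
  rw [← hL₁.d]
  refine Run.cons hσ₁ (Run.for (T := (ℓ.k + 1) * 200 + 200) (I := fun i arr =>
    ℓ.AtNode q (fun v => g v / 2) (fun v => h v / 2) goal v i arr) hσ₁ ?_ ?_)
    fun σ₂ hσ₂ hF₂ h₂ => ?_
  · rw [e1]
    exact ⟨fun h => ⟨(hI.1 h).1.mono, (hI.1 h).2.1, fun j hj => absurd hj (not_lt_zero _)⟩, hI.2⟩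
  · intro i hi υ hυ hF₂ r7 h₂
    rw [hL₁.d] at hi
    exact run_elim_step hυ (hL₁.frame hF₂) ht hb hw hS
      ((hP'.frame hF₁).frame hF₂) (by omega) hi
      ((hF₂.1 4).trans ((hF₁.1 4).trans u4)) r7
      ((hF₂.1 11).trans s11) h₂
  · rw [hL₁.d] at h₂
    exact Run.cons hσ₂ (run_link hσ₂ (hL₁.frame hF₂) ht hb hw hS
      ((hP'.frame hF₁).frame hF₂)
      ((hF₂.1 4).trans ((hF₁.1 4).trans u4))
      ((hF₂.1 11).trans s11) h₂) fun τ _ _ h => Run.nil h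

end

end CactusRouting
namespace CactusRouting


open RamProg WordExpr

/-! ### Solving the problem on a layout -/

namespace Layout

variable {ℓ : Layout} {f : ℕ} {s two : ℕ → ℕ} {arr : ℕ → ℕ → ℕ}

theorem two_of_weight_ne_zero {v : ℕ} (h : ℓ.weight two v ≠ 0) :
    two (ℓ.cyc v) = v ∧ v ≠ 0 := by
  unfold weight shared at h
  grind

theorem Checked.shares (h : ℓ.Checked ℓ.n f s two) (hX : ℓ.Crossed ℓ.d arr) :
    ℓ.Shares (ℓ.weight two) (arr 22) (arr 23) := by
  have hw := h.witness hX
  have key : ∀ v, ℓ.weight two v ≠ 0 → 0 < v ∧ v < ℓ.n ∧ ℓ.cnt v = 2 := by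
    intro v hv
    obtain ⟨h1, h2⟩ := two_of_weight_ne_zero hv
    obtain ⟨h3, h4, h5⟩ := h.2.2.2 (ℓ.cyc v) (by rwa [h1])
    grind
  have hcr : ∀ v, ℓ.weight two v ≠ 0 → ℓ.CrossSlot ℓ.d v (arr 22 v) ∧
      ℓ.CrossSlot ℓ.d v (arr 23 v) ∧ arr 22 v / 2 ≠ arr 23 v / 2 := by
    intro v hv
    obtain ⟨h1, h2, h3⟩ := key v hv
    obtain ⟨h4, h5, h6⟩ := hX.1 v h1 h2
    have h7 : arr 21 v = 2 := h4.trans h3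
    grind
  exact ⟨weight_le two, fun v hv => (key v hv).1, fun v hv => (key v hv).2.1,
    fun v hv => (hcr v hv).1, fun v hv => (hcr v hv).2.1,
    fun v hv he => (hcr v hv).2.2 (by rw [he]), fun v hv i hi hc =>
      hw.eq_or_eq (key v hv).1 (key v hv).2.1 (key v hv).2.2 hi hc⟩

/-- Without links the state of the dynamic program expresses precisely the criterion of
`solvable_iff`, the checks of which are recorded in the flag. -/
theorem after_init (hc : ℓ.Cactus) (hn : 0 < ℓ.n) (h : ℓ.Checked ℓ.n f s two)
    (hX : ℓ.Crossed ℓ.d arr) (hu : ∀ i < ℓ.d, arr 27 i = ∑ e ∈ Finset.range ℓ.m, ℓ.forced two (e + 1) i)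
    (hf : arr 32 0 = 0 ↔ (f = 0 ∧
      ∀ e < ℓ.m, ¬ ℓ.Free (e + 1) → two (e + 1) ≠ 0 → ℓ.numFull (e + 1) ≠ 0) ∧
      ∀ i < ℓ.d, arr 27 i ≤ ℓ.k) (h29 : ∀ x, arr 29 x = 0) (h31 : ∀ x, arr 31 x = 0) :
    ℓ.After (ℓ.weight two) (fun v => arr 22 v / 2) (fun v => arr 23 v / 2) ℓ.Solvable ℓ.n arr := by
  have hs := solvable_iff hc (h.witness hX)
  rw [h.1] at hf
  constructor
  · intro h0
    obtain ⟨⟨h1, h2⟩, h3⟩ := hf.1 h0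
    refine ⟨inv_init h29 (fun i _ => h31 i) h3, ?_, fun h => absurd h hn.ne'⟩
    rw [sat_init h29 (fun i _ => h31 i), hs]
    have h4 : ∀ o : ℕ → Prop, (∀ i < ℓ.d, (ℓ.ledger arr).used i + ∑ v ∈ Finset.Ioo 0 ℓ.n,
        pay (ℓ.weight two) (fun v => arr 22 v / 2) (fun v => arr 23 v / 2) o v i ≤ ℓ.k) ↔ _ :=
      fun o => forall₂_congr fun i hi => by
        rw [show (ℓ.ledger arr).used i = _ from hu i hi]
    simp only [h4]
    exact ⟨fun h => ⟨h1, h2, h⟩, fun h => h.2.2⟩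
  · grind

/-- At the root every demand is eliminated, so the remaining problem is satisfiable and the flag
alone decides. -/
theorem After.iff {q c₁ c₂ : ℕ → ℕ} {goal : Prop} (h : ℓ.After q c₁ c₂ goal 0 arr) :
    arr 32 0 = 0 ↔ goal := by
  refine ⟨fun h0 => ?_, fun hg => by_contra fun h0 => h.2 h0 hg⟩
  obtain ⟨h1, h2, h3⟩ := h.1 h0
  exact h2.1 (sat_of_done h1 (h3 rfl) 0)

end Layout

def prepareProg : RamProg := block [endSumProg, idSumProg, cycleProg, markProg, crossProg]

def decideProg : RamProg := block [checkProg, chargeProg, budgetProg, .set 4 (.reg 3 + .lit 1),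
  nodesProg, .set 0 (.equal (.load 32 (.lit 0)) (.lit 0))]

section

variable {w : ℕ} {σ : RamState} {ℓ : Layout} {b : ℕ}

theorem run_prepare (hσ : σ.Bdd w) (hℓ : ℓ.Loaded σ) (ht : ℓ.Tame) (hb : 2 ^ w = b)
    (hw : ℓ.Fits b) (h0 : ∀ a, (_ : 14 < a := by decide) → ∀ x, σ.arr a x = 0) :
    Run w prepareProg σ (ℓ.m * 100 + ℓ.n * 200 + ℓ.d * (ℓ.n * 200 + 100) + 40) fun τ =>
      ℓ.Cycles τ.arr ∧ ℓ.Marked ℓ.d τ.arr ∧ ℓ.Crossed ℓ.d τ.arr := by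
  refine Run.mono (T := (ℓ.m * 100 + 6) + ((ℓ.n * 100 + 6) + ((ℓ.n * 100 + 6) +
    ((ℓ.d * (ℓ.n * 100 + 50) + 6) + ((ℓ.d * (ℓ.n * 100 + 50) + 6) + 1))))) ?_ (by
      have : ℓ.d * (ℓ.n * 200 + 100) = ℓ.d * (ℓ.n * 100 + 50) + ℓ.d * (ℓ.n * 100 + 50) := by ring
      omega) fun τ h => h
  refine Run.cons hσ (run_endSum hσ hℓ hb hw (h0 15) (h0 16))
    fun σ₁ hσ₁ hF₁ h₁ => ?_
  have hℓ₁ := hℓ.frame hF₁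
  refine Run.cons hσ₁ (run_idSum hσ₁ hℓ₁ ht hb hw h₁.1 h₁.2) fun σ₂ hσ₂ hF₂ h₂ => ?_
  have hℓ₂ := hℓ₁.frame hF₂
  have e18 : σ₂.arr 18 = σ.arr 18 := (hF₂.2 18).trans (hF₁.2 18)
  refine Run.cons hσ₂ (run_cycle hσ₂ hℓ₂ hb hw h₂.1 h₂.2 (by rw [e18]; exact h0 18))
    fun σ₃ hσ₃ hF₃ h₃ => ?_
  have hℓ₃ := hℓ₂.frame hF₃
  have e3 : ∀ a, (_ : 18 < a := by decide) → σ₃.arr a = σ.arr a := by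
    intro a ha
    rw [hF₃.2 a ?_, hF₂.2 a ?_, hF₁.2 a ?_] <;>
      simp [endSumProg, idSumProg, cycleProg, forLoop, block, arrs] <;> omega
  refine Run.cons hσ₃ (run_mark hσ₃ hℓ₃ ht hb hw (by rw [e3 19]; exact h0 19)
    (by rw [e3 20]; exact h0 20)) fun σ₄ hσ₄ hF₄ h₄ => ?_
  have hℓ₄ := hℓ₃.frame hF₄
  have e4 : ∀ a, (_ : a ∈ [21, 24] := by decide) → ∀ x, σ₄.arr a x = 0 := by
    intro a ha
    have h5 : 20 < a := by
      grind
    rw [hF₄.2 a ?_, e3 a (by omega)]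
    · exact h0 a (by omega)
    · simp [markProg, climbProg, forLoop, block, arrs]
      omega
  have hC : ℓ.Cycles σ₄.arr := by
    unfold Layout.Cycles
    rw [hF₄.2 17, hF₄.2 18]
    exact h₃
  refine Run.cons hσ₄ (run_cross hσ₄ hℓ₄ ht hb hw hC h₄ (e4 21) (e4 24))
    fun σ₅ hσ₅ hF₅ h₅ => Run.nil ⟨?_, ?_, h₅⟩
  · unfold Layout.Cycles
    rw [hF₅.2 17, hF₅.2 18]
    exact hC
  · unfold Layout.Marked
    rw [hF₅.2 19, hF₅.2 20]
    exact h₄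

theorem run_decide (hσ : σ.Bdd w) (hℓ : ℓ.Loaded σ) (ht : ℓ.Tame) (hn : 0 < ℓ.n) (hb : 2 ^ w = b)
    (hw : ℓ.Fits b) (hC : ℓ.Cycles σ.arr) (hM : ℓ.Marked ℓ.d σ.arr) (hX : ℓ.Crossed ℓ.d σ.arr)
    (h0 : ∀ a, (_ : 24 < a := by decide) → ∀ x, σ.arr a x = 0) :
    Run w decideProg σ (ℓ.n * 100 + ℓ.m * (ℓ.d * 200 + 200) + ℓ.d * 50 +
      ℓ.n * (ℓ.d * ((ℓ.k + 1) * 200 + 208) + ((ℓ.k + 1) * 250 + 130)) + 40) fun τ =>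
      τ.reg 0 = 1 ∧ ℓ.Solvable ∨ τ.reg 0 = 0 ∧ ¬ ℓ.Solvable := by
  have hl := hw.lin
  have b0 : 0 < b := by omega
  have b1 : 1 < b := by omega
  refine Run.mono (T := (ℓ.n * 100 + 6) + ((ℓ.m * (ℓ.d * 200 + 200) + 6) + ((ℓ.d * 50 + 6) + (4 +
    ((ℓ.n * (ℓ.d * ((ℓ.k + 1) * 200 + 208) + ((ℓ.k + 1) * 250 + 130)) + 6) + (5 + 1)))))) ?_
    (by omega) fun τ h => h
  refine Run.cons hσ (run_check hσ hℓ hb hw hC hX (h0 25) (h0 26)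
    (h0 32)) fun σ₁ hσ₁ hF₁ h₁ => ?_
  have hℓ₁ := hℓ.frame hF₁
  have e1 : ∀ a, (_ : a ≠ 25 := by decide) → (_ : a ≠ 26 := by decide) → (_ : a ≠ 32 := by decide) →
      σ₁.arr a = σ.arr a := by
    intro a ha hb hc
    rw [hF₁.2 a ?_]
    simp [checkProg, forLoop, block, arrs, ha, hb, hc]
  have hD : Layout.CycleData (ℓ := ℓ) σ₁.arr := by
    refine ⟨fun i hi c hc => ?_, fun c => ?_, h₁.2.1⟩
    · rw [e1 24, hX.2 i hi c hc, if_pos hi]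
    · rw [e1 18]
      exact hC.2 c
  refine Run.cons hσ₁ (run_charge hσ₁ hℓ₁ hb hw hD (fun c hc => (h₁.2.2.2 c hc).2.1)
    (by rw [e1 27]; exact h0 27)
    (by rw [e1 28]; exact h0 28))
    fun σ₂ hσ₂ hF₂ h₂ => ?_
  have hℓ₂ := hℓ₁.frame hF₂
  refine Run.cons hσ₂ (run_budget hσ₂ hℓ₂) fun σ₃ hσ₃ hF₃ h₃ => ?_
  have hℓ₃ := hℓ₂.frame hF₃
  have e27 : σ₃.arr 27 = σ₂.arr 27 := hF₃.2 27
  have e28 : σ₃.arr 28 = σ₂.arr 28 := hF₃.2 28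
  have e3 : ∀ a, (_ : a ∈ [19, 20, 21, 22, 23, 24, 29, 31] := by decide) → σ₃.arr a = σ.arr a := by
    intro a ha
    rw [hF₃.2 a ?_, hF₂.2 a ?_, hF₁.2 a ?_] <;> clear * - ha <;> revert a <;> decide
  have hX₃ : ℓ.Crossed ℓ.d σ₃.arr := by
    unfold Layout.Crossed
    simp only [e3 21, e3 22, e3 23, e3 24]
    exact hX
  have hA := Layout.after_init ht.cactus hn h₁ hX₃ (by rw [e27]; exact h₂.used)
    (by rw [h₃, h₂.fail, e27]) (by rw [e3 29]; exact h0 29)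
    (by rw [e3 31]; exact h0 31)
  refine Run.cons (Q := fun υ => υ.reg 4 = ℓ.k + 1 ∧ υ.arr = σ₃.arr) hσ₃
    (Run.of_wp hσ₃ ?_) ?_
  · have : ℓ.k + 1 < b := by omega
    simp [hb, hℓ₃.k, b1, this]
  rintro σ₄ hσ₄ hF₄ ⟨r4, e4⟩
  have hℓ₄ := hℓ₃.frame hF₄
  rw [← e4] at hA hX₃
  have hP : ℓ.Planned (ℓ.weight (σ₁.arr 26)) (σ₄.arr 22) (σ₄.arr 23) σ₄.arr := by
    refine ⟨?_, fun v => ?_, rfl, rfl⟩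
    · unfold Layout.Marked
      rw [e4, e3 19, e3 20]
      exact hM
    · rw [e4, e28]
      exact h₂.weight_eq ht.cactus (fun c hc => (h₁.2.2.2 c hc).1) v
  refine Run.cons hσ₄ (run_nodes hσ₄ hℓ₄ ht hb hw (h₁.shares hX₃) hP r4 hA) fun σ₅ hσ₅ _ h₅ => ?_
  refine Run.cons (Q := fun τ => τ.reg 0 = 1 ∧ ℓ.Solvable ∨ τ.reg 0 = 0 ∧ ¬ ℓ.Solvable) hσ₅
    (Run.of_wp hσ₅ ?_) fun _ _ _ h => Run.nil h
  have h6 := h₅.iff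
  by_cases h7 : ℓ.Solvable
  · simp [h7, hb, b0, val_equal, h6.2 h7]
  · simp [h7, hb, b0, val_equal, mt h6.1 h7]

end

end CactusRouting
namespace CactusRouting

open Function Nat


open RamProg WordExpr

/-! ### The whole algorithm -/

section

variable {n : ℕ} {G : SimpleGraph (Fin n)} {es D : List (Fin n × Fin n)} {k : ℕ}

/-- A cactus has fewer than two edges per vertex. -/
theorem length_le_of_isCactus (T : RootedTree G) (hG : IsCactus G) (hes : IsEdgeList G es) :
    es.length ≤ 2 * T.n := by
  classical
  obtain ⟨ℓ, hℓ⟩ : ∃ ℓ, ℓ = layoutOf T es [] 0 := ⟨_, rfl⟩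
  have hc : ℓ.Cactus := hℓ ▸ layoutOf_cactus T hG hes
  have hpos : ∀ e (he : e < es.length), ℓ.eu e = T.pos es[e].1 ∧ ℓ.ev e = T.pos es[e].2 := by
    intro e he
    simp [hℓ, layoutOf, he]
  have hne : ∀ e < es.length, ℓ.eu e ≠ ℓ.ev e := fun e he h => by
    rw [(hpos e he).1, (hpos e he).2] at h
    exact G.ne_of_adj (hes.adj he) (pos_injective T h)
  have hlt : ∀ e < es.length, ℓ.eu e < T.n ∧ ℓ.ev e < T.n := fun e he => by
    rw [(hpos e he).1, (hpos e he).2]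
    exact ⟨T.pos_lt _, T.pos_lt _⟩
  have hp : ℓ.par 0 = 0 ∧ ∀ j, 0 < j → ℓ.par j < j := hℓ ▸ ⟨T.par_zero, T.par_lt⟩
  -- Each edge is assigned to the larger of its end nodes, from whose parent it is separated by the
  -- subtree cut. Two non-tree edges at one node would cover the same tree edge, and a tree edge is
  -- determined by its lower node; so each kind has at most `T.n` edges.
  let top : ℕ → ℕ := fun e => max (ℓ.eu e) (ℓ.ev e)
  have hsep : ∀ e < es.length, ℓ.Sep (ℓ.eu e) (ℓ.ev e) (top e) := by
    intro e he h
    have h1 := hne e he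
    rcases lt_or_gt_of_ne h1 with h2 | h2
    · have h3 : top e = ℓ.ev e := max_eq_right h2.le
      rw [h3] at h
      exact absurd (Anc.le hp.1 hp.2 (h.2 (Anc.refl _))) (by omega)
    · have h3 : top e = ℓ.eu e := max_eq_left h2.le
      rw [h3] at h
      exact absurd (Anc.le hp.1 hp.2 (h.1 (Anc.refl _))) (by omega)
  have htop : ∀ e < es.length, 0 < top e ∧ top e < T.n := fun e he => by
    grind
  have htree : ∀ e (he : e < es.length), ¬ ℓ.NT e → s(es[e].1, es[e].2) = T.edge (top e) := by
    intro e he h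
    rw [hℓ, layoutOf_NT T hes he] at h
    unfold RootedTree.NonTree at h
    push Not at h
    obtain ⟨i, hi, hin, h1⟩ := h (hes.adj he)
    have h2 := T.par_lt i hi
    have h3 := T.pos_ord i hin
    have h4 := T.pos_ord _ (T.par_lt_n hi hin)
    have h5 : top e = i := by
      change max (ℓ.eu e) (ℓ.ev e) = i
      rw [(hpos e he).1, (hpos e he).2]
      have h6 := h1
      rw [RootedTree.edge, Sym2.eq_iff] at h6
      grind
    rw [h5]
    exact h1
  have h1 : ((Finset.range es.length).filter fun e => ℓ.NT e).card ≤ T.n := by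
    rw [← Finset.card_range T.n]
    refine Finset.card_le_card_of_injOn top (fun e he => ?_) fun e he e' he' h => ?_
    · grind
    · simp only [Finset.coe_filter, Finset.mem_range, Set.mem_ofPred_eq] at he he'
      have h2 := hsep e' he'.1
      rw [← show top e = top e' from h] at h2
      exact hc (top e) (htop e he.1).1 (hℓ ▸ (htop e he.1).2) e (hℓ ▸ he.1) e' (hℓ ▸ he'.1) he.2 he'.2
        (hsep e he.1) h2
  have h2 : ((Finset.range es.length).filter fun e => ¬ ℓ.NT e).card ≤ T.n := by
    rw [← Finset.card_range T.n]
    refine Finset.card_le_card_of_injOn top (fun e he => ?_) fun e he e' he' h => ?_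
    · grind
    · simp only [Finset.coe_filter, Finset.mem_range, Set.mem_ofPred_eq] at he he'
      refine hes.inj he.1 he'.1 ?_
      grind
  have h3 := Finset.card_filter_add_card_filter_not (s := Finset.range es.length) fun e => ℓ.NT e
  grind

theorem getD_map_val {α : Type*} (l : List α) (f : α → Fin n) (i : ℕ) :
    (l.map fun e => (f e : ℕ)).getD i 0 = if h : i < l.length then (f l[i] : ℕ) else 0 := by
  grind

theorem inputState_arr_zero (a : ℕ) (ha : 3 < a) (x : ℕ) : (inputState n es D k).arr a x = 0 := by
  simp only [inputState]
  grind

theorem inputState_arr (x : ℕ) :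
    (inputState n es D k).arr 0 x = (if h : x < es.length then (es[x].1 : ℕ) else 0) ∧
    (inputState n es D k).arr 1 x = (if h : x < es.length then (es[x].2 : ℕ) else 0) ∧
    (inputState n es D k).arr 2 x = (if h : x < D.length then (D[x].1 : ℕ) else 0) ∧
    (inputState n es D k).arr 3 x = (if h : x < D.length then (D[x].2 : ℕ) else 0) :=
  ⟨getD_map_val es Prod.fst x, getD_map_val es Prod.snd x, getD_map_val D Prod.fst x,
    getD_map_val D Prod.snd x⟩

theorem inputState_bdd {w : ℕ} (h1 : 1 < 2 ^ w) (hn : n < 2 ^ w) (hm : es.length < 2 ^ w)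
    (hd : D.length < 2 ^ w) (hk : k < 2 ^ w) : (inputState n es D k).Bdd w where
  one_lt := h1
  reg r := by
    match r with
    | 0 => exact hn
    | 1 => exact hm
    | 2 => exact hd
    | 3 => exact hk
    | r + 4 => exact zero_lt_one.trans h1
  arr a i := by
    obtain ⟨a0, a1, a2, a3⟩ := inputState_arr (es := es) (D := D) (k := k) i
    have h : ∀ x : Fin n, (x : ℕ) < 2 ^ w := fun x => x.2.trans hn
    have h0 : 0 < 2 ^ w := zero_lt_one.trans h1
    match a with
    | 0 => grind
    | 1 => grind
    | 2 => grind
    | 3 => grind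
    | a + 4 => rw [inputState_arr_zero _ (by omega)]; exact h0

variable {eu ev : ℕ → ℕ}

theorem arcSrc_cases {m b : ℕ} (hb : 0 < b) (hm : b ≤ 2 * m) : ∃ e < m,
    arcSrc eu ev b = eu e ∧ arcSrc ev eu b = ev e ∨ arcSrc eu ev b = ev e ∧ arcSrc ev eu b = eu e := by
  refine ⟨(b - 1) / 2, by omega, ?_⟩
  unfold arcSrc
  grind

/-- The arcs of the input reach all vertices. -/
theorem arcs_connected (hG : G.Connected) (hes : IsEdgeList G es)
    (heu : ∀ e (he : e < es.length), eu e = es[e].1) (hev : ∀ e (he : e < es.length), ev e = es[e].2)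
    (P : ℕ → Prop) (h0 : P 0) (hP : ∀ b, 0 < b → b ≤ 2 * es.length → P (arcSrc eu ev b) →
      P (arcSrc ev eu b)) : ∀ y < n, P y := by
  intro y hy
  have hn : 0 < n := by omega
  have hstep : ∀ x y : Fin n, G.Adj x y → P x → P y := by
    intro x y hxy hx
    obtain ⟨e, he, h⟩ := hes.exists_index (f := s(x, y)) hxy
    rw [Sym2.eq_iff] at h
    rcases h with ⟨h1, h2⟩ | ⟨h1, h2⟩
    · have := hP (2 * e + 1) (by omega) (by omega)
      rw [arcSrc_odd, arcSrc_odd, heu e he, hev e he, h1, h2] at this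
      exact this hx
    · have := hP (2 * e + 2) (by omega) (by omega)
      rw [arcSrc_even, arcSrc_even, heu e he, hev e he, h1, h2] at this
      exact this hx
  have hwalk : ∀ (x y : Fin n) (_ : G.Walk x y), P x → P y := by
    intro x y p
    induction p with
    | nil => exact id
    | cons h _ ih => exact fun hx => ih (hstep _ _ h hx)
  obtain ⟨p⟩ := hG.preconnected ⟨0, hn⟩ ⟨y, hy⟩
  exact hwalk _ _ p h0

/-- The spanning tree found by breadth-first search. -/
theorem Searched.exists_tree (hn : 0 < n) (hes : IsEdgeList G es)
    (heu : ∀ e (he : e < es.length), eu e = es[e].1) (hev : ∀ e (he : e < es.length), ev e = es[e].2)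
    {arr : ℕ → ℕ → ℕ} (h : Searched eu ev n es.length arr) :
    ∃ T : RootedTree G, T.n = n ∧ T.par = arr 9 ∧ ∀ x : Fin n, T.pos x = arr 8 x - 1 := by
  obtain ⟨J, A, i, hI, hpos⟩ := h
  -- Reduction modulo `n` only makes the function total; it does nothing to entries in range.
  let ord : ℕ → Fin n := fun j => ⟨arr 7 j % n, mod_lt _ hn⟩
  have hord : ∀ j < n, (ord j : ℕ) = arr 7 j := fun j hj => mod_eq_of_lt (hI.ord_lt j hj)
  have hle := hI.pos_le
  refine ⟨⟨n, arr 9, fun x => arr 8 x - 1, ord, hI.par_zero, hI.par_lt, fun x => ?_, fun j hj => ?_,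
    fun x => ?_, fun j hj hjn => ?_⟩, rfl, rfl, fun _ => rfl⟩
  · grind
  · rw [hord j hj, hI.pos_ord j hj, Nat.add_sub_cancel]
  · have h1 := hpos x x.2
    have h2 := hle x
    refine Fin.ext ?_
    rw [hord _ (by omega), hI.ord_pos x h1]
  · obtain ⟨b, hb, hbm, h1, h2⟩ := hI.arc j hj hjn
    rw [← hord _ hjn] at h2
    rw [← hord _ ((hI.par_lt j hj).trans hjn)] at h1
    obtain ⟨e, he, ⟨h3, h4⟩ | ⟨h3, h4⟩⟩ := arcSrc_cases (eu := eu) (ev := ev) hb hbm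
    all_goals
      rw [h3] at h1
      rw [h4] at h2
      have h5 := hes.adj he
    · rw [heu e he] at h1
      rw [hev e he] at h2
      rw [← Fin.ext h1, ← Fin.ext h2]
      exact h5.symm
    · rw [hev e he] at h1
      rw [heu e he] at h2
      grind

theorem layoutOf_tame (T : RootedTree G) (hG : IsCactus G) (hes : IsEdgeList G es) :
    (layoutOf T es D k).Tame where
  par_zero := T.par_zero
  par_lt := T.par_lt
  eu_lt e he := by
    have he : e < es.length := he
    simpa [layoutOf, he] using T.pos_lt _
  ev_lt e he := by
    have he : e < es.length := he
    simpa [layoutOf, he] using T.pos_lt _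
  sp_lt i hi := by
    have hi : i < D.length := hi
    simpa [layoutOf, hi] using T.pos_lt _
  tp_lt i hi := by
    have hi : i < D.length := hi
    simpa [layoutOf, hi] using T.pos_lt _
  cactus := layoutOf_cactus T hG hes

/-- Put `N = n + D.length + k + 2`. The bounds are linear or are products of two factors at most `2
* N`, while `N ≥ 3` gives `81 * N ^ 2 ≤ N ^ 6`. This is the origin of the exponent `6`. -/
theorem layoutOf_fits (T : RootedTree G) (hn : 0 < n) (hT : T.n = n) (hm : es.length ≤ 2 * n) {B : ℕ}
    (hB : (n + D.length + k + 2) ^ 6 ≤ B) : (layoutOf T es D k).Fits B := by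
  obtain ⟨N, hN⟩ : ∃ N, N = n + D.length + k + 2 := ⟨_, rfl⟩
  rw [← hN] at hB
  have h3 : 3 ≤ N := by omega
  have h4 : 81 * (N * N) ≤ N ^ 6 := by
    have := Nat.mul_le_mul_right (N * N) (Nat.pow_le_pow_left h3 4)
    calc 81 * (N * N) ≤ N ^ 4 * (N * N) := this
      _ = N ^ 6 := by ring
  have h5 : 3 * N ≤ N * N := mul_le_mul_right N h3
  have key : ∀ a b, a ≤ 2 * N → b ≤ 2 * N → a * b < B := fun a b ha hb => by
    have := mul_le_mul ha hb
    grind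
  constructor <;> simp only [layoutOf, hT]
  · omega
  · exact key _ _ (by omega) (by omega)
  · exact key _ _ (by omega) (by omega)
  · exact key _ _ (by omega) (by omega)
  · exact key _ _ (by omega) (by omega)
  · omega

end

/-- Constructs a spanning tree of the input. -/
def searchProg : RamProg := block [adjacencyProg, bfsProg]

/-- The program solving Unit Segment Routing on cacti. -/
def routingProg : RamProg := block [searchProg, loadProg, prepareProg, decideProg]

section

variable {n : ℕ} {G : SimpleGraph (Fin n)} {es D : List (Fin n × Fin n)} {k w : ℕ}

theorem run_search (hG : G.Connected) (hes : IsEdgeList G es) (hn : 0 < n)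
    (hm : n + 2 * es.length + 2 < 2 ^ w) (hd : D.length < 2 ^ w) (hk : k < 2 ^ w) :
    Run w searchProg (inputState n es D k) (n * 200 + es.length * 500 + 210) fun τ =>
      ∃ T : RootedTree G, T.n = n ∧ T.par = τ.arr 9 ∧ ∀ x : Fin n, T.pos x = τ.arr 8 x - 1 := by
  have hσ : (inputState n es D k).Bdd w :=
    inputState_bdd (by omega) (by omega) (by omega) hd hk
  have heu : ∀ e (he : e < es.length), (inputState n es D k).arr 0 e = es[e].1 := fun e he =>
    (inputState_arr e).1.trans (dif_pos he)
  have hev : ∀ e (he : e < es.length), (inputState n es D k).arr 1 e = es[e].2 := fun e he =>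
    (inputState_arr e).2.1.trans (dif_pos he)
  have r1 : (inputState n es D k).reg 1 = es.length := rfl
  refine Run.mono (T := (es.length * 100 + 6) + (((n + 2 * es.length) * 200 + 200) + 1)) ?_
    (by omega) fun τ h => h
  refine Run.cons hσ (run_adjacency hσ rfl (by rw [r1]; omega)
    (inputState_arr_zero 4 (by decide))) fun σ₁ hσ₁ hF₁ h₁ => ?_
  have h0 : ∀ a, (_ : 6 < a := by decide) → ∀ x, σ₁.arr a x = 0 := by
    intro a ha x
    rw [hF₁.2 a ?_]
    · exact inputState_arr_zero a (by omega) x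
    · simp [adjacencyProg, forLoop, block, arrs]
      omega
  exact Run.cons hσ₁ (run_bfs hσ₁ (hF₁.1 0) (hF₁.1 1) hn rfl (by omega)
    (fun e he => by rw [heu e he]; exact es[e].1.2) (fun e he => by rw [hev e he]; exact es[e].2.2)
    (arcs_connected hG hes heu hev) h₁ (h0 7) (h0 8) (h0 9)
    (h0 10)) fun σ₂ _ _ h₂ => Run.nil (h₂.exists_tree hn hes heu hev)

/-- The spanning tree needed for counting edges comes from a run of the search itself, on words long
enough for any number of edges. The bound does not mention the word length, so it may be used before
overflow has been excluded for the actual words. -/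
theorem length_le (hG : IsCactus G) (hes : IsEdgeList G es) (hn : 0 < n) :
    es.length ≤ 2 * n := by
  obtain ⟨_, _, _, _, T, hT, -⟩ := run_search (D := []) (k := 0) hG.1 hes hn
    (w := n + 2 * es.length + 2) Nat.lt_two_pow_self (by simp) (by simp)
  have := length_le_of_isCactus T hG hes
  omega

/-- After `m ≤ 2 * n`, each monomial is at most twice the product of `max k 1`, `max d 1` and `n`;
the maxima absorb the terms lacking `k` or `d`. -/
theorem time_le (n m d k : ℕ) (hn : 0 < n) (hm : m ≤ 2 * n) :
    (n * 200 + m * 500 + 210) + ((m * 50 + d * 50 + 20) +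
      ((m * 100 + n * 200 + d * (n * 200 + 100) + 40) + ((n * 100 + m * (d * 200 + 200) + d * 50 +
      n * (d * ((k + 1) * 200 + 208) + ((k + 1) * 250 + 130)) + 40) + 1))) ≤
      10000 * (max k 1 * max d 1 * n) := by
  obtain ⟨K, hK⟩ : ∃ K, K = max k 1 := ⟨_, rfl⟩
  obtain ⟨E, hE⟩ : ∃ E, E = max d 1 := ⟨_, rfl⟩
  have hk1 : k ≤ K := by omega
  have hd1 : d ≤ E := by omega
  have hK1 : 1 ≤ K := by omega
  have hE1 : 1 ≤ E := by omega
  rw [← hK, ← hE]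
  have key : ∀ a b c, a ≤ K → b ≤ E → c ≤ 2 * n → a * b * c ≤ 2 * (K * E * n) := by
    intro a b c ha hb hc
    calc a * b * c ≤ K * E * (2 * n) := Nat.mul_le_mul (Nat.mul_le_mul ha hb) hc
      _ = 2 * (K * E * n) := by ring
  have h1 := key 1 1 n hK1 hE1 (by omega)
  have h2 := key 1 1 m hK1 hE1 hm
  have h3 := key 1 d 1 hK1 hd1 (by omega)
  have h4 := key 1 d n hK1 hd1 (by omega)
  have h5 := key 1 d m hK1 hd1 hm
  have h6 := key k d n hk1 hd1 (by omega)
  have h7 := key k 1 n hk1 hE1 (by omega)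
  grind

theorem run_routing (hG : IsCactus G) (hes : IsEdgeList G es)
    (hw : (n + D.length + k + 2) ^ 6 ≤ 2 ^ w) :
    Run w routingProg (inputState n es D k) (10000 * (max k 1 * max D.length 1 * n)) fun τ =>
      UnitSegmentRouting G D k ∧ τ.reg 0 = 1 ∨ ¬ UnitSegmentRouting G D k ∧ τ.reg 0 = 0 := by
  have hn : 0 < n := by
    obtain ⟨x⟩ := hG.1.nonempty
    exact x.pos
  have hm := length_le hG hes hn
  have hfit : ∀ T : RootedTree G, T.n = n → (layoutOf T es D k).Fits (2 ^ w) := fun T hT =>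
    layoutOf_fits T hn hT hm hw
  -- An auxiliary tree is needed only to turn the assumption on the word length into linear bounds;
  -- the algorithm later finds its own tree.
  obtain ⟨-, -, -, -, T₀, hT₀, -⟩ := run_search (D := []) (k := 0) hG.1 hes hn
    (w := n + 2 * es.length + 2) Nat.lt_two_pow_self (by simp) (by simp)
  have hl := (hfit T₀ hT₀).lin
  simp only [layoutOf, hT₀] at hl
  have hσ : (inputState n es D k).Bdd w :=
    inputState_bdd (by omega) (by omega) (by omega) (by omega) (by omega)
  refine Run.mono ?_ (time_le n es.length D.length k hn hm) fun τ h => h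
  refine Run.cons hσ (run_search hG.1 hes hn (by omega) (by omega) (by omega)) ?_
  rintro σ₁ hσ₁ hF₁ ⟨T, hT, hpar, hpos⟩
  have r0 : σ₁.reg 0 = n := hF₁.1 0
  have r1 : σ₁.reg 1 = es.length := hF₁.1 1
  have r2 : σ₁.reg 2 = D.length := hF₁.1 2
  have r3 : σ₁.reg 3 = k := hF₁.1 3
  have h0 : ∀ a, (_ : 10 < a := by decide) → ∀ x, σ₁.arr a x = 0 := by
    intro a ha x
    rw [hF₁.2 a ?_]
    · exact inputState_arr_zero a (by omega) x
    · simp [searchProg, bfsProg, bfsStep, adjacencyProg, forLoop, block, arrs]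
      omega
  rw [← r1, ← r2]
  refine Run.cons hσ₁ (run_load hσ₁ rfl (h0 11) (h0 12) (h0 13)
    (h0 14)) ?_
  rintro σ₂ hσ₂ hF₂ ⟨e11, e12, e13, e14⟩
  rw [r1, r2]
  obtain ⟨ℓ, hℓ⟩ : ∃ ℓ, ℓ = layoutOf T es D k := ⟨_, rfl⟩
  have a03 : ∀ a, (_ : a < 4 := by decide) → σ₁.arr a = (inputState n es D k).arr a := by
    intro a ha
    refine hF₁.2 a ?_
    simp [searchProg, bfsProg, bfsStep, adjacencyProg, forLoop, block, arrs]
    omega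
  have hL : ℓ.Loaded σ₂ := by
    subst hℓ
    refine ⟨(hF₂.1 0).trans (r0.trans hT.symm), (hF₂.1 1).trans r1,
      (hF₂.1 2).trans r2, (hF₂.1 3).trans r3,
      (hF₂.2 9).trans hpar.symm, funext fun e => ?_, funext fun e => ?_,
      funext fun e => ?_, funext fun e => ?_⟩
    · rw [e11, r1, a03 0]
      simp only [layoutOf, hpos]
      split_ifs with h
      · rw [(inputState_arr e).1, dif_pos h]
      · rfl
    · rw [e12, r1, a03 1]
      simp only [layoutOf, hpos]
      split_ifs with h
      · rw [(inputState_arr e).2.1, dif_pos h]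
      · rfl
    · rw [e13, r2, a03 2]
      simp only [layoutOf, hpos]
      split_ifs with h
      · rw [(inputState_arr e).2.2.1, dif_pos h]
      · rfl
    · rw [e14, r2, a03 3]
      simp only [layoutOf, hpos]
      split_ifs with h
      · rw [(inputState_arr e).2.2.2, dif_pos h]
      · rfl
  have ht : ℓ.Tame := hℓ ▸ layoutOf_tame T hG hes
  have hw' : ℓ.Fits (2 ^ w) := hℓ ▸ hfit T hT
  have h0' : ∀ a, 14 < a → ∀ x, σ₂.arr a x = 0 := by
    intro a ha x
    rw [hF₂.2 a ?_]
    · exact h0 a (by omega) x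
    · simp [loadProg, forLoop, block, arrs]
      omega
  have q1 : ℓ.n = n := hℓ ▸ hT
  have q2 : ℓ.m = es.length := hℓ ▸ rfl
  have q3 : ℓ.d = D.length := hℓ ▸ rfl
  have q4 : ℓ.k = k := hℓ ▸ rfl
  have hiff : UnitSegmentRouting G D k ↔ ℓ.Solvable := hℓ ▸ unitSegmentRouting_iff T hG hes
  have p₁ := run_prepare hσ₂ hL ht rfl hw' h0'
  refine Run.cons hσ₂ (p₁.le (le_of_eq (by rw [q1, q2, q3]))) fun σ₃ hσ₃ hF₃ ⟨h1, h2, h3⟩ => ?_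
  have h0'' : ∀ a, 24 < a → ∀ x, σ₃.arr a x = 0 := by
    intro a ha x
    rw [hF₃.2 a ?_]
    · exact h0' a (by omega) x
    · simp [prepareProg, endSumProg, idSumProg, cycleProg, markProg, climbProg, crossProg, crossStep,
        forLoop, block, arrs]
      omega
  have p₂ := run_decide hσ₃ (hL.frame hF₃) ht (by omega) rfl hw' h1 h2 h3 h0''
  refine Run.cons hσ₃ (p₂.le (le_of_eq (by rw [q1, q2, q3, q4]))) fun τ _ _ h => Run.nil ?_
  rw [hiff]
  tauto

end

end CactusRouting
/-- One program decides Unit Segment Routing on undirected cacti with `n` vertices, `d` demands and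
budget `k` in `O(kdn)` steps, on words of `O(log (n + d + k))` bits. -/
theorem mainTheorem3 :
    ∃ (P : RamProg) (c C : ℕ),
      ∀ (n : ℕ) (G : SimpleGraph (Fin n)) (es D : List (Fin n × Fin n)) (k w : ℕ),
        IsCactus G → IsEdgeList G es → (n + D.length + k + 2) ^ c ≤ 2 ^ w →
          ∃ (t : ℕ) (τ : RamState),
            RamProg.Exec w P (inputState n es D k) t τ ∧
            t ≤ C * (max k 1 * max D.length 1 * n) ∧
            (UnitSegmentRouting G D k ∧ τ.reg 0 = 1 ∨
              ¬ UnitSegmentRouting G D k ∧ τ.reg 0 = 0) := by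
  refine ⟨CactusRouting.routingProg, 6, 10000, fun n G es D k w hG hes hw => ?_⟩
  obtain ⟨t, τ, h1, h2, h3⟩ := CactusRouting.run_routing hG hes hw
  exact ⟨t, τ, h1, h2, h3⟩
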